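/- **Setting.** Let $\mathbb T=\mathbb R/\mathbb Z$, let $\mathcal D'$ be the space of (complex-valued) distributions on $\mathbb T$, and $\hat u(k)=\langle u,e^{-2\pi i k\cdot}\rangle$. Fix smooth, nonnegative, even functions $\chi,\rho$ on $\mathbb R$ with $\operatorname{supp}\chi\subset\{|x|\le 4/3\}$, $\operatorname{supp}\rho\subset\{3/4\le|x|\le 8/3\}$ and $\chi+\sum_{j\ge0}\rho(2^{-j}\cdot)\equiv1$; put $\rho_{-1}=\chi$, $\rho_j=\rho(2^{-j}\cdot)$ for $j\ge 0$, and $\Delta_ju=\sum_{k\in\mathbb Z}\rho_j(k)\hat u(k)e^{2\pi ik\cdot}$ for $j\ge-1$. Let $\mathcal C^a$ ($a\in\mathbb R$) be the space of $u\in\mathcal D'$ with $2^{ja}\|\Delta_ju\|_{L^\infty}\to0$ as $j\to\infty$, with norm $\|u\|_a=\sup_{j\ge-1}2^{ja}\|\Delta_ju\|_{L^\infty}$. Let $$u\prec v=\sum_{i\le j-2}\Delta_iu\,\Delta_jv,\qquad u\circ v=\sum_{|i-j|\le1}\Delta_iu\,\Delta_jv,\qquad u\succ v=v\prec u,\qquad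 uv=u\prec v+u\circ v+u\succ v$$ (the series converging in $\mathcal D'$), and let $R$ denote the continuous extension of $(u,v,w)\mapsto(u\prec v)\circ w-u(v\circ w)$ from smooth functions to $\mathcal C^\beta\times\mathcal C^\alpha\times\mathcal C^{\alpha-1}\to\mathcal C^{2\alpha+\beta-1}$, where $\alpha,\beta$ are as below. Write $\mathcal L=\partial_t-\frac12\partial_x^2$; equations $\mathcal Lf=F$ are understood in the sense of distributions. For $\tau>0$, $C_\tau\mathcal C^a=C([0,\tau],\mathcal C^a)$ carries the supremum norm, and $\mathcal L^{a,\delta}_\tau$ is the set of $u\in C_\tau\mathcal C^a$ that are $\delta$-Hölder from $[0,\tau]$ to $\mathcal C^{a-2\delta}$, with norm $$\|u\|_{\mathcal L^{a,\delta}_\tau}=\sup_{0\le t\le \tau}\|u_t\|_a+\sup_{0\le s<t\le \tau}\frac{\|u_t-u_s\|_{a-2\delta}}{|t-s|^\delta}.$$ For $\eta\ge0$, $\mathcal L^{\eta,a,\delta}_\tau$ is the set of $u\in C([0,\tau],\mathcal C^{a-2\eta})$ that are continuous from $(0,\tau]$ to $\mathcal C^a$ and to $\mathcal C^{a-2\delta}$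 and have finite norm $$\|u\|_{\mathcal L^{\eta,a,\delta}_\tau}=\sup_{0<t\le \tau}t^\eta\|u_t\|_a+\sup_{0\le t\le \tau}\|u_t\|_{a-2\eta}+\sup_{0<s<t\le \tau}s^\eta\frac{\|u_t-u_s\|_{a-2\delta}}{|t-s|^\delta}.$$ Let $\frac13<\beta<\alpha<\frac12$, $-\beta<\gamma\le\beta$ and $T>0$. A *driving term* is a tuple $$\mathbb X=(X^I,X^Y,X^W,X^B,X^D,X^K,X^C)\in C_T\mathcal C^\alpha\times C_T\mathcal C^{2\alpha}\times\mathcal L_T^{\alpha+1,1/4}\times C_T\mathcal C^{2\alpha-1}\times C_T\mathcal C^{2\alpha-1}\times C_T\mathcal C^{\alpha+1}\times C_T\mathcal C^{2\alpha-1}$$ with $\mathcal LX^K=\partial_xX^I$; $|||\mathbb X|||_T$ is the sum of the norms of its components. For $0<\tau\le T$ let $\mathcal D_\tau=\mathcal L_\tau^{\frac{\beta-\gamma}2,\beta+1,\frac14}\times\mathcal L_\tau^{\beta-\gamma,2\beta+1,\frac14}$, with the sum of the norms. A pair $(f,g)\in\mathcal D_\tau$ is a *solution of the para-KPZ equation on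 $[0,\tau]$* with initial value $(f_0,g_0)$ if $(f,g)(0)=(f_0,g_0)$ and, with $u=\partial_x(X^W+f+g)$, on $(0,\tau]$ (all products on the right being well defined) $$\mathcal Lf=u\prec\partial_xX^I,$$ $$\mathcal Lg=X^D+uX^C+R(u,\partial_xX^K,\partial_xX^I)+(\partial_xf-u\prec\partial_xX^K)\circ\partial_xX^I+\partial_xg\circ\partial_xX^I+u\succ\partial_xX^I+X^B+u\,\partial_xX^Y+\tfrac12u^2 .$$ **Theorem.** There exist constants $C_1,C_2>0$, depending only on $\alpha,\beta,\gamma,T$ (and on the fixed functions $\chi,\rho$), such that for every $(f_0,g_0)\in\mathcal C^{\gamma+1}\times\mathcal C^{2\gamma+1}$ and every driving term $\mathbb X$ there is a unique solution $(f,g)\in\mathcal D_{T_*}$ of the para-KPZ equation on $[0,T_*]$ with initial value $(f_0,g_0)$, where $$T_*=C_2\bigl(1+\|f_0\|_{\gamma+1}+\|g_0\|_{2\gamma+1}+|||\mathbb X|||_T^3\bigr)^{-\frac2{\alpha-\beta}}\wedge T,$$ and this solution satisfies $$\|(f,g)\|_{\mathcal D_{T_*}}\le C_1\bigl(1+\|f_0\|_{\gamma+1}+\|g_0\|_{2\gamma+1}+|||\mathbb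 X|||_T^3\bigr).$$ Furthermore, let $(f_0^\epsilon,g_0^\epsilon)\in\mathcal C^{\gamma+1}\times\mathcal C^{2\gamma+1}$ and driving terms $\mathbb X^\epsilon$ ($\epsilon>0$) satisfy $$\lim_{\epsilon\downarrow0}\|f_0^\epsilon-f_0\|_{\gamma+1}=\lim_{\epsilon\downarrow0}\|g_0^\epsilon-g_0\|_{2\gamma+1}=\lim_{\epsilon\downarrow0}|||\mathbb X^\epsilon-\mathbb X|||_T=0,$$ and let $(f^\epsilon,g^\epsilon)\in\mathcal D_{T_*^\epsilon}$ be the corresponding solutions, with $T_*^\epsilon$ given by the formula for $T_*$ with $(f_0^\epsilon,g_0^\epsilon,\mathbb X^\epsilon)$ in place of $(f_0,g_0,\mathbb X)$. Then $$\lim_{\epsilon\downarrow0}\|(f^\epsilon,g^\epsilon)-(f,g)\|_{\mathcal D_{T_*^\epsilon\wedge T_*}}=0.$$ -/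

import Mathlib

open Filter Topology Set
open scoped ENNReal ContDiff

noncomputable section

namespace ParaKPZ

/-! ### Periodic test functions and distributions on the torus `ℝ / ℤ` -/

/-- Smooth functions on the torus: smooth `1`-periodic functions `ℝ → ℂ`. -/
def testSubmodule : Submodule ℂ (ℝ → ℂ) where
  carrier := {φ | ContDiff ℝ ∞ φ ∧ Function.Periodic φ 1}
  add_mem' := fun ha hb => ⟨ha.1.add hb.1, ha.2.add hb.2⟩
  zero_mem' := ⟨contDiff_const, fun _ => rfl⟩
  smul_mem' := fun c _ hf => ⟨contDiff_const.smul hf.1, hf.2.smul c⟩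

abbrev TestFn : Type := testSubmodule

lemma deriv_mem_testSubmodule {φ : ℝ → ℂ} (h : φ ∈ testSubmodule) :
    deriv φ ∈ testSubmodule := by
  refine ⟨(contDiff_infty_iff_deriv.1 h.1).2, fun x => ?_⟩
  have h2 : (fun y => φ (y + 1)) = φ := funext h.2
  rw [← deriv_comp_add_const, h2]

/-- The derivative `φ ↦ φ'` on test functions. -/
def testDeriv : TestFn →ₗ[ℂ] TestFn where
  toFun φ := ⟨deriv φ.1, deriv_mem_testSubmodule φ.2⟩
  map_add' φ ψ := by
    ext x
    exact deriv_add ((φ.2.1.differentiable (by simp)) x) ((ψ.2.1.differentiable (by simp)) x)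
  map_smul' c φ := by
    ext x
    exact deriv_const_smul c ((φ.2.1.differentiable (by simp)) x)

/-- The character `x ↦ exp (2 π i k x)`. -/
def character (k : ℤ) : TestFn :=
  ⟨fun x => Complex.exp (2 * Real.pi * Complex.I * k * x), by
    refine ⟨?_, fun x => ?_⟩
    · exact Complex.contDiff_exp.comp (contDiff_const.mul Complex.ofRealCLM.contDiff)
    · show Complex.exp _ = Complex.exp _
      rw [Complex.exp_eq_exp_iff_exists_int]
      exact ⟨k, by push_cast; ring⟩⟩

/-- Distributions on the torus: the linear functionals on smooth periodic functions that are
continuous, i.e. bounded by finitely many of the seminorms `sup |φ⁽ᵐ⁾|`. -/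
def distSubmodule : Submodule ℂ (TestFn →ₗ[ℂ] ℂ) where
  carrier := {u | ∃ (N : ℕ) (C : ℝ), ∀ (φ : TestFn) (B : ℝ),
    (∀ m ≤ N, ∀ x : ℝ, ‖iteratedDeriv m φ.1 x‖ ≤ B) → ‖u φ‖ ≤ C * B}
  add_mem' := by
    rintro u v ⟨N, C, h⟩ ⟨N', C', h'⟩
    refine ⟨max N N', C + C', fun φ B hB => ?_⟩
    have h1 := h φ B fun m hm => hB m (le_max_of_le_left hm)
    have h2 := h' φ B fun m hm => hB m (le_max_of_le_right hm)
    calc ‖(u + v) φ‖ ≤ ‖u φ‖ + ‖v φ‖ := norm_add_le _ _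
      _ ≤ (C + C') * B := by linarith
  zero_mem' := ⟨0, 0, fun φ B _ => by simp⟩
  smul_mem' := by
    rintro c u ⟨N, C, h⟩
    refine ⟨N, ‖c‖ * C, fun φ B hB => ?_⟩
    calc ‖(c • u) φ‖ = ‖c‖ * ‖u φ‖ := norm_mul c (u φ)
      _ ≤ ‖c‖ * (C * B) := mul_le_mul_of_nonneg_left (h φ B hB) (norm_nonneg c)
      _ = ‖c‖ * C * B := by ring

abbrev TDist : Type := distSubmodule

/-- The distributional derivative `⟨∂ₓ u, φ⟩ = - ⟨u, φ'⟩`. -/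
def dx (u : TDist) : TDist :=
  ⟨-(u.1.comp testDeriv), by
    obtain ⟨N, C, h⟩ := u.2
    refine ⟨N + 1, C, fun φ B hB => ?_⟩
    have := h (testDeriv φ) B fun m hm x => by
      have := hB (m + 1) (by omega) x
      rwa [iteratedDeriv_succ'] at this
    simpa using this⟩

/-- The Fourier coefficient `∫ exp (- 2 π i k x) u(x) dx`. -/
def fourier (u : TDist) (k : ℤ) : ℂ := u.1 (character (-k))

/-- `u` is (given by) a smooth function. -/
def IsSmooth (u : TDist) : Prop :=
  ∃ a : TestFn, ∀ φ : TestFn, u.1 φ = ∫ x in (0 : ℝ)..1, a.1 x * φ.1 x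

/-- The functions `a n` converge to `w` in the sense of distributions on the torus. -/
def IsDistLimit (a : ℕ → ℝ → ℂ) (w : TDist) : Prop :=
  ∀ φ : TestFn, Tendsto (fun n => ∫ x in (0 : ℝ)..1, a n x * φ.1 x) atTop (𝓝 (w.1 φ))

open Classical in
/-- The limit in the sense of distributions (`0` if there is none). -/
def distLimit (a : ℕ → ℝ → ℂ) : TDist :=
  if h : ∃ w, IsDistLimit a w then h.choose else 0

/-! ### Littlewood--Paley blocks and Besov spaces -/

/-- A dyadic partition of unity `(χ, ρ)`. -/
structure DyadicPartition where
  χ : ℝ → ℝ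
  ρ : ℝ → ℝ
  χ_smooth : ContDiff ℝ ∞ χ
  ρ_smooth : ContDiff ℝ ∞ ρ
  χ_nonneg : ∀ x, 0 ≤ χ x
  ρ_nonneg : ∀ x, 0 ≤ ρ x
  χ_even : ∀ x, χ (-x) = χ x
  ρ_even : ∀ x, ρ (-x) = ρ x
  χ_supp : tsupport χ ⊆ {x | |x| ≤ 4 / 3}
  ρ_supp : tsupport ρ ⊆ {x | 3 / 4 ≤ |x| ∧ |x| ≤ 8 / 3}
  sum_eq_one : ∀ x, HasSum (fun j : ℕ => ρ (((2 : ℝ) ^ j)⁻¹ * x)) (1 - χ x)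

namespace DyadicPartition

variable (P : DyadicPartition)

/-- The symbols, with the index shifted by one: `symbol 0 = χ = ρ₋₁` and
`symbol (j + 1) = ρ (2⁻ʲ ·) = ρⱼ`. -/
def symbol : ℕ → ℝ → ℝ
  | 0 => P.χ
  | j + 1 => fun x => P.ρ (((2 : ℝ) ^ j)⁻¹ * x)

/-- The block `Δ_{j-1} u`, as a trigonometric polynomial. -/
def block (j : ℕ) (u : TDist) (x : ℝ) : ℂ :=
  ∑' k : ℤ, (P.symbol j k : ℂ) * fourier u k * (character k).1 x

/-- `2^{(j-1) a} ‖Δ_{j-1} u‖_{L^∞}`. -/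
def besovTerm (a : ℝ) (u : TDist) (j : ℕ) : ℝ≥0∞ :=
  ENNReal.ofReal ((2 : ℝ) ^ (((j : ℝ) - 1) * a)) * ⨆ x : ℝ, ‖P.block j u x‖ₑ

/-- The norm `‖u‖_a` of `𝒞^a = B^a_{∞,∞}`, with value `∞` allowed. -/
def cnorm (a : ℝ) (u : TDist) : ℝ≥0∞ := ⨆ j : ℕ, P.besovTerm a u j

/-- Membership in `𝒞^a`: the sequence `2^{ja} ‖Δ_j u‖_{L^∞}` tends to `0`
(in particular it is bounded). -/
def MemC (a : ℝ) (u : TDist) : Prop := Tendsto (P.besovTerm a u) atTop (𝓝 0)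

/-! ### Paraproducts, resonant product, product, commutator -/

/-- Partial sums of `∑_{i ≤ j - 2} Δᵢ u Δⱼ v`. -/
def paraSum (u v : TDist) (n : ℕ) (x : ℝ) : ℂ :=
  ∑ j ∈ Finset.range n, ∑ i ∈ Finset.range n,
    if i + 2 ≤ j then P.block i u x * P.block j v x else 0

/-- Partial sums of `∑_{|i - j| ≤ 1} Δᵢ u Δⱼ v`. -/
def resSum (u v : TDist) (n : ℕ) (x : ℝ) : ℂ :=
  ∑ j ∈ Finset.range n, ∑ i ∈ Finset.range n,
    if i ≤ j + 1 ∧ j ≤ i + 1 then P.block i u x * P.block j v x else 0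

/-- The paraproduct of `u` (low frequencies) and `v` (high frequencies). -/
def para (u v : TDist) : TDist := distLimit (P.paraSum u v)

/-- The resonant product. -/
def res (u v : TDist) : TDist := distLimit (P.resSum u v)

/-- The series defining the resonant product of `u` and `v` converges. -/
def ResConverges (u v : TDist) : Prop := ∃ w, IsDistLimit (P.resSum u v) w

/-- The product, by Bony's decomposition. -/
def mul (u v : TDist) : TDist := P.para u v + P.res u v + P.para v u

/-- The commutator `(u ≺ v) ∘ w - u (v ∘ w)` (to be used for smooth `u`, `v`, `w`). -/
def smoothCommutator (u v w : TDist) : TDist :=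
  P.res (P.para u v) w - P.mul u (P.res v w)

/-- `r` is the value at `(u, v, w)` of the extension by continuity of the commutator, from triples
of smooth functions to `𝒞^a × 𝒞^b × 𝒞^c`, with values in `𝒞^{a+b+c}`. -/
def IsCommutator (a b c : ℝ) (u v w r : TDist) : Prop :=
  P.MemC (a + b + c) r ∧
  ∀ ε : ℝ≥0∞, 0 < ε → ∃ δ : ℝ≥0∞, 0 < δ ∧ ∀ u' v' w' : TDist,
    IsSmooth u' → IsSmooth v' → IsSmooth w' →
    P.cnorm a (u' - u) < δ → P.cnorm b (v' - v) < δ → P.cnorm c (w' - w) < δ →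
    P.cnorm (a + b + c) (P.smoothCommutator u' v' w' - r) < ε

open Classical in
/-- The extended commutator `R` on `𝒞^a × 𝒞^b × 𝒞^c` (`0` if there is no extension). -/
def commutator (a b c : ℝ) (u v w : TDist) : TDist :=
  if h : ∃ r, P.IsCommutator a b c u v w r then h.choose else 0

/-! ### Spaces of functions of time -/

/-- `u` is a continuous function from `J` to `𝒞^a`. -/
def ContC (J : Set ℝ) (a : ℝ) (u : ℝ → TDist) : Prop :=
  (∀ t ∈ J, P.MemC a (u t)) ∧
  ∀ t ∈ J, Tendsto (fun s => P.cnorm a (u s - u t)) (𝓝[J] t) (𝓝 0)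

/-- The norm of `C_T 𝒞^a`. -/
def supNorm (T a : ℝ) (u : ℝ → TDist) : ℝ≥0∞ := ⨆ t ∈ Icc 0 T, P.cnorm a (u t)

/-- The seminorm of `C_T^δ 𝒞^a`. -/
def holderNorm (T δ a : ℝ) (u : ℝ → TDist) : ℝ≥0∞ :=
  ⨆ (s : ℝ) (t : ℝ) (_ : 0 ≤ s ∧ s < t ∧ t ≤ T),
    P.cnorm a (u t - u s) / ENNReal.ofReal ((t - s) ^ δ)

/-- The norm of `ℰ_T^η 𝒞^a`. -/
def wSupNorm (T η a : ℝ) (u : ℝ → TDist) : ℝ≥0∞ :=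
  ⨆ t ∈ Ioc 0 T, ENNReal.ofReal (t ^ η) * P.cnorm a (u t)

/-- The seminorm of `ℰ_T^{η,δ} 𝒞^a`. -/
def wHolderNorm (T η δ a : ℝ) (u : ℝ → TDist) : ℝ≥0∞ :=
  ⨆ (s : ℝ) (t : ℝ) (_ : 0 < s ∧ s < t ∧ t ≤ T),
    ENNReal.ofReal (s ^ η) * (P.cnorm a (u t - u s) / ENNReal.ofReal ((t - s) ^ δ))

/-- Membership in `ℒ_T^{a,δ} = C_T 𝒞^a ∩ C_T^δ 𝒞^{a-2δ}`. -/
def MemL (T a δ : ℝ) (u : ℝ → TDist) : Prop :=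
  P.ContC (Icc 0 T) a u ∧ P.ContC (Icc 0 T) (a - 2 * δ) u ∧ P.holderNorm T δ (a - 2 * δ) u < ⊤

/-- The norm of `ℒ_T^{a,δ}`. -/
def lNorm (T a δ : ℝ) (u : ℝ → TDist) : ℝ≥0∞ :=
  P.supNorm T a u + P.holderNorm T δ (a - 2 * δ) u

/-- Membership in `ℒ_T^{η,a,δ} = ℰ_T^η 𝒞^a ∩ C_T 𝒞^{a-2η} ∩ ℰ_T^{η,δ} 𝒞^{a-2δ}`. -/
def MemWL (T η a δ : ℝ) (u : ℝ → TDist) : Prop :=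
  (P.ContC (Ioc 0 T) a u ∧ P.wSupNorm T η a u < ⊤) ∧
  P.ContC (Icc 0 T) (a - 2 * η) u ∧
  (P.ContC (Ioc 0 T) (a - 2 * δ) u ∧ P.wHolderNorm T η δ (a - 2 * δ) u < ⊤)

/-- The norm of `ℒ_T^{η,a,δ}`. -/
def wlNorm (T η a δ : ℝ) (u : ℝ → TDist) : ℝ≥0∞ :=
  P.wSupNorm T η a u + P.supNorm T (a - 2 * η) u + P.wHolderNorm T η δ (a - 2 * δ) u

end DyadicPartition

/-- `(∂ₜ - ½ ∂ₓ²) f = F` on `(0, T] × 𝕋`, in the sense of distributions (tested in space,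
integrated in time). -/
def SolvesHeat (T : ℝ) (f F : ℝ → TDist) : Prop :=
  ∀ φ : TestFn, ∀ s t : ℝ, 0 < s → s ≤ t → t ≤ T →
    IntervalIntegrable (fun r => (1 / 2 : ℂ) * (dx (dx (f r))).1 φ + (F r).1 φ)
      MeasureTheory.volume s t ∧
    (f t).1 φ - (f s).1 φ = ∫ r in s..t, ((1 / 2 : ℂ) * (dx (dx (f r))).1 φ + (F r).1 φ)

/-! ### The para-KPZ equation -/

/-- The seven components of a driving term, named after the letters that label them. -/
structure DrivingTerm where
  XI : ℝ → TDist
  XY : ℝ → TDist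
  XW : ℝ → TDist
  XB : ℝ → TDist
  XD : ℝ → TDist
  XK : ℝ → TDist
  XC : ℝ → TDist

/-- The componentwise difference. -/
def DrivingTerm.diff (X Y : DrivingTerm) : DrivingTerm where
  XI := X.XI - Y.XI
  XY := X.XY - Y.XY
  XW := X.XW - Y.XW
  XB := X.XB - Y.XB
  XD := X.XD - Y.XD
  XK := X.XK - Y.XK
  XC := X.XC - Y.XC

namespace DyadicPartition

variable (P : DyadicPartition)

/-- `X` is a driving term of the para-KPZ equation on `[0, T]`. -/
def IsDriving (α T : ℝ) (X : DrivingTerm) : Prop :=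
  P.ContC (Icc 0 T) α X.XI ∧
  P.ContC (Icc 0 T) (2 * α) X.XY ∧
  P.MemL T (α + 1) (1 / 4) X.XW ∧
  P.ContC (Icc 0 T) (2 * α - 1) X.XB ∧
  P.ContC (Icc 0 T) (2 * α - 1) X.XD ∧
  P.ContC (Icc 0 T) (α + 1) X.XK ∧
  P.ContC (Icc 0 T) (2 * α - 1) X.XC ∧
  SolvesHeat T X.XK (fun t => dx (X.XI t))

/-- The size of a driving term on `[0, T]`. -/
def drivingNorm (α T : ℝ) (X : DrivingTerm) : ℝ≥0∞ :=
  P.supNorm T α X.XI + P.supNorm T (2 * α) X.XY + P.lNorm T (α + 1) (1 / 4) X.XW +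
  P.supNorm T (2 * α - 1) X.XB + P.supNorm T (2 * α - 1) X.XD +
  P.supNorm T (α + 1) X.XK + P.supNorm T (2 * α - 1) X.XC

/-- Membership of `(f, g)` in the solution space `𝒟_T`. -/
def MemD (β γ T : ℝ) (f g : ℝ → TDist) : Prop :=
  P.MemWL T ((β - γ) / 2) (β + 1) (1 / 4) f ∧ P.MemWL T (β - γ) (2 * β + 1) (1 / 4) g

/-- The norm of `𝒟_T`. -/
def dNorm (β γ T : ℝ) (f g : ℝ → TDist) : ℝ≥0∞ :=
  P.wlNorm T ((β - γ) / 2) (β + 1) (1 / 4) f + P.wlNorm T (β - γ) (2 * β + 1) (1 / 4) g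

/-- `u = ∂ₓ (X^W + f + g)`. -/
def uTerm (X : DrivingTerm) (f g : ℝ → TDist) (t : ℝ) : TDist := dx (X.XW t + f t + g t)

/-- The right-hand side of the equation for `f`. -/
def rhsF (X : DrivingTerm) (f g : ℝ → TDist) (t : ℝ) : TDist :=
  P.para (uTerm X f g t) (dx (X.XI t))

/-- The remainder `∂ₓ f - u ≺ ∂ₓ X^K`. -/
def remainder (X : DrivingTerm) (f g : ℝ → TDist) (t : ℝ) : TDist :=
  dx (f t) - P.para (uTerm X f g t) (dx (X.XK t))

/-- The right-hand side of the equation for `g`. The commutator is taken on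
`𝒞^β × 𝒞^α × 𝒞^{α-1}`. -/
def rhsG (α β : ℝ) (X : DrivingTerm) (f g : ℝ → TDist) (t : ℝ) : TDist :=
  X.XD t + P.mul (uTerm X f g t) (X.XC t)
    + P.commutator β α (α - 1) (uTerm X f g t) (dx (X.XK t)) (dx (X.XI t))
    + P.res (P.remainder X f g t) (dx (X.XI t))
    + P.res (dx (g t)) (dx (X.XI t))
    + P.para (dx (X.XI t)) (uTerm X f g t)
    + X.XB t + P.mul (uTerm X f g t) (dx (X.XY t))
    + (1 / 2 : ℂ) • P.mul (uTerm X f g t) (uTerm X f g t)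

/-- `(f, g) ∈ 𝒟_T` solves the para-KPZ equation on `[0, T]` with initial value `(f₀, g₀)`.
The regularity of `(f, g)` and `X` makes all products in the right-hand sides convergent, except
for one resonant product, whose convergence is therefore demanded explicitly. -/
def IsSolution (α β γ T : ℝ) (X : DrivingTerm) (f₀ g₀ : TDist) (f g : ℝ → TDist) : Prop :=
  P.MemD β γ T f g ∧ f 0 = f₀ ∧ g 0 = g₀ ∧
  (∀ t ∈ Ioc 0 T, P.ResConverges (P.remainder X f g t) (dx (X.XI t))) ∧
  SolvesHeat T f (P.rhsF X f g) ∧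
  SolvesHeat T g (P.rhsG α β X f g)

/-- `1 + ‖f₀‖_{γ+1} + ‖g₀‖_{2γ+1} + |||X|||_T³` (all norms are finite for the data considered). -/
def dataSize (α γ T : ℝ) (X : DrivingTerm) (f₀ g₀ : TDist) : ℝ :=
  1 + (P.cnorm (γ + 1) f₀).toReal + (P.cnorm (2 * γ + 1) g₀).toReal
    + (P.drivingNorm α T X).toReal ^ 3

/-- The time `T_* = C₂ (1 + ‖f₀‖_{γ+1} + ‖g₀‖_{2γ+1} + |||X|||_T³)^{-2/(α-β)} ∧ T`. -/
def localTime (C₂ α β γ T : ℝ) (X : DrivingTerm) (f₀ g₀ : TDist) : ℝ :=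
  min (C₂ * P.dataSize α γ T X f₀ g₀ ^ (-(2 / (α - β)))) T

end DyadicPartition

end ParaKPZ

end

open ParaKPZ

noncomputable section

namespace ParaKPZ

open MeasureTheory AddCircle

/-- The Haar probability measure of the unit circle. -/
notation "𝔥" => haarAddCircle (T := (1 : ℝ))

/-! ### Trigonometric polynomials and Fourier multipliers on the circle -/

/-- Families of Fourier coefficients. -/
abbrev FD : Type := ℤ → ℂ

/-- Continuous functions on the circle. -/
def CT : Type := C(UnitAddCircle, ℂ)

namespace CT

instance : NormedCommRing CT := inferInstanceAs (NormedCommRing C(UnitAddCircle, ℂ))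
instance : NormedAlgebra ℂ CT := inferInstanceAs (NormedAlgebra ℂ C(UnitAddCircle, ℂ))
instance : CompleteSpace CT := inferInstanceAs (CompleteSpace C(UnitAddCircle, ℂ))
instance : FunLike CT UnitAddCircle ℂ := inferInstanceAs (FunLike C(UnitAddCircle, ℂ) _ _)
instance : ContinuousMapClass CT UnitAddCircle ℂ :=
  inferInstanceAs (ContinuousMapClass C(UnitAddCircle, ℂ) _ _)

variable (f g : CT) (x : UnitAddCircle)

@[simp] lemma add_apply : (f + g) x = f x + g x := rfl
@[simp] lemma sub_apply : (f - g) x = f x - g x := rfl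
@[simp] lemma mul_apply : (f * g) x = f x * g x := rfl
@[simp] lemma one_apply : (1 : CT) x = 1 := rfl
@[simp] lemma zero_apply : (0 : CT) x = 0 := rfl
@[simp] lemma smul_apply (c : ℂ) : (c • f) x = c * f x := rfl

@[fun_prop] protected lemma continuous : Continuous f := map_continuous f

variable {f g} in
@[ext] lemma ext (h : ∀ x, f x = g x) : f = g := DFunLike.ext _ _ h

/-- Evaluation at a point. -/
def eval : CT →ₗ[ℂ] ℂ where
  toFun f := f x
  map_add' _ _ := rfl
  map_smul' _ _ := rfl

@[simp] lemma sum_apply {ι : Type*} (s : Finset ι) (F : ι → CT) :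
    (∑ i ∈ s, F i) x = ∑ i ∈ s, F i x := map_sum (eval x) F s

lemma norm_coe_le_norm : ‖f x‖ ≤ ‖f‖ := ContinuousMap.norm_coe_le_norm (f : C(UnitAddCircle, ℂ)) x

lemma norm_le {C : ℝ} (hC : 0 ≤ C) : ‖f‖ ≤ C ↔ ∀ x, ‖f x‖ ≤ C :=
  ContinuousMap.norm_le (f : C(UnitAddCircle, ℂ)) hC

end CT

/-- The character `x ↦ exp (2 π i k x)` on the circle. -/
def chr (k : ℤ) : CT := (_root_.fourier k : C(AddCircle (1 : ℝ), ℂ))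

lemma chr_apply (k : ℤ) (x : UnitAddCircle) : chr k x = _root_.fourier k x := rfl

lemma chr_mul (m n : ℤ) : chr m * chr n = chr (m + n) := by ext x; exact fourier_add.symm

lemma norm_chr_apply (k : ℤ) (x : UnitAddCircle) : ‖chr k x‖ = 1 := by
  simp only [chr_apply, fourier_apply]; exact Circle.norm_coe _

lemma chr_sub_apply (k : ℤ) (x y : UnitAddCircle) : chr k (x - y) = chr k x * chr (-k) y := by
  simp only [chr_apply]
  rw [fourier_apply, fourier_apply, fourier_apply, smul_sub, sub_eq_add_neg, toCircle_add,
    neg_smul, Circle.coe_mul]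

lemma integrable_CT (f : CT) : Integrable f 𝔥 :=
  f.continuous.integrable_of_hasCompactSupport (HasCompactSupport.of_compactSpace f)

/-- The `k`-th Fourier coefficient as a continuous functional. -/
def coefL (k : ℤ) : CT →L[ℂ] ℂ :=
  LinearMap.mkContinuous
    { toFun := fun f => fourierCoeff f k
      map_add' := fun f g => congrFun (fourierCoeff.add (integrable_CT f) (integrable_CT g)) k
      map_smul' := fun c f => fourierCoeff.const_smul f c k } 1 (by
      intro f
      show ‖fourierCoeff f k‖ ≤ 1 * ‖f‖
      rw [one_mul, fourierCoeff]
      refine (norm_integral_le_of_norm_le_const (C := ‖f‖) ?_).trans (by simp)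
      refine Eventually.of_forall fun x => ?_
      rw [norm_smul]
      have := norm_chr_apply (-k) x
      simp only [chr_apply] at this
      rw [this, one_mul]
      exact f.norm_coe_le_norm x)

/-- The Fourier coefficients of a continuous function. -/
def coef : CT →ₗ[ℂ] FD where
  toFun f k := coefL k f
  map_add' f g := by ext k; simp
  map_smul' c f := by ext k; simp

lemma coef_apply (f : CT) (k : ℤ) : coef f k = coefL k f := rfl

lemma coef_eq_integral (f : CT) (k : ℤ) :
    coef f k = ∫ x, chr (-k) x * f x ∂𝔥 := rfl

lemma norm_coef_le (f : CT) (k : ℤ) : ‖coef f k‖ ≤ ‖f‖ := by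
  have := (coefL k).le_opNorm f
  refine this.trans ?_
  have : ‖coefL k‖ ≤ 1 := LinearMap.mkContinuous_norm_le _ zero_le_one _
  nlinarith [norm_nonneg f]

lemma coef_chr (m k : ℤ) : coef (chr m) k = if k = m then 1 else 0 := by
  show fourierCoeff (_root_.fourier m) k = _
  rw [fourierCoeff_fourier]
  simp [Pi.single_apply]

/-- The trigonometric polynomial with coefficients `c k`, `k ∈ s`. -/
def poly (s : Finset ℤ) : FD →ₗ[ℂ] CT where
  toFun c := ∑ k ∈ s, c k • chr k
  map_add' c d := by simp only [Pi.add_apply, add_smul, Finset.sum_add_distrib]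
  map_smul' a c := by simp [mul_smul, Finset.smul_sum]

lemma poly_def (s : Finset ℤ) (c : FD) : poly s c = ∑ k ∈ s, c k • chr k := rfl

lemma poly_apply (s : Finset ℤ) (c : FD) (x : UnitAddCircle) :
    poly s c x = ∑ k ∈ s, c k * chr k x := by simp [poly_def, CT.sum_apply]

lemma coef_poly (s : Finset ℤ) (c : FD) (k : ℤ) :
    coef (poly s c) k = if k ∈ s then c k else 0 := by
  rw [poly_def, map_sum, Finset.sum_apply]
  simp only [map_smul, Pi.smul_apply, coef_chr, smul_eq_mul, mul_ite, mul_one, mul_zero]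
  rw [Finset.sum_ite_eq]

lemma poly_congr {s : Finset ℤ} {c d : FD} (h : ∀ k ∈ s, c k = d k) : poly s c = poly s d :=
  Finset.sum_congr rfl fun k hk => by rw [h k hk]

lemma poly_subset {s t : Finset ℤ} (hst : s ⊆ t) {c : FD} (h : ∀ k ∈ t, k ∉ s → c k = 0) :
    poly s c = poly t c :=
  Finset.sum_subset hst fun k hk hk' => by rw [h k hk hk', zero_smul]

/-- Parseval for trigonometric polynomials. -/
lemma integral_norm_sq_poly (s : Finset ℤ) (c : FD) :
    ∫ x, ‖poly s c x‖ ^ 2 ∂𝔥 = ∑ k ∈ s, ‖c k‖ ^ 2 := by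
  have h1 : ∀ x, ((‖poly s c x‖ ^ 2 : ℝ) : ℂ)
      = ∑ k ∈ s, (starRingEnd ℂ (c k)) * (chr (-k) x * poly s c x) := by
    intro x
    have : ((‖poly s c x‖ ^ 2 : ℝ) : ℂ) = starRingEnd ℂ (poly s c x) * poly s c x := by
      rw [Complex.conj_mul']; push_cast; rfl
    rw [this]
    conv_lhs => rw [poly_apply s c x, map_sum, Finset.sum_mul]
    rw [← poly_apply]
    refine Finset.sum_congr rfl fun k _ => ?_
    simp only [map_mul, chr_apply, fourier_neg]
    ring
  have h2 : ((∫ x, ‖poly s c x‖ ^ 2 ∂𝔥 : ℝ) : ℂ)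
      = ((∑ k ∈ s, ‖c k‖ ^ 2 : ℝ) : ℂ) := by
    rw [← integral_complex_ofReal]
    simp_rw [h1]
    rw [integral_finsetSum]
    · push_cast
      refine Finset.sum_congr rfl fun k hk => ?_
      rw [integral_const_mul, ← coef_eq_integral, coef_poly, if_pos hk, Complex.conj_mul']
    · intro k _
      exact ((integrable_CT (chr (-k) * poly s c)).const_mul _)
  exact_mod_cast h2

lemma mul_sum_conv (s : Finset ℤ) (a : FD) (f : CT) (x : UnitAddCircle) :
    poly s (a * coef f) x
      = ∫ y, poly s a (x - y) * f y ∂𝔥 := by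
  simp only [poly_apply, Finset.sum_mul]
  rw [integral_finsetSum]
  · refine Finset.sum_congr rfl fun k _ => ?_
    simp only [chr_sub_apply, Pi.mul_apply, coef_eq_integral]
    rw [mul_assoc, mul_comm (∫ _, _ ∂_), ← mul_assoc, ← integral_const_mul]
    refine integral_congr_ae (Eventually.of_forall fun y => ?_)
    simp only
    ring
  · intro k _
    have : Continuous fun y => a k * chr k (x - y) * f y := by fun_prop
    exact integrable_CT (show C(UnitAddCircle, ℂ) from ⟨_, this⟩)

lemma integral_circle (f : UnitAddCircle → ℝ) :
    ∫ x, f x ∂𝔥 = ∫ x in (-(1/2) : ℝ)..(1/2), f x := by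
  have h := AddCircle.intervalIntegral_preimage (1 : ℝ) (-(1/2)) f
  have h' := integral_haarAddCircle (T := (1:ℝ)) (f := f)
  rw [h']
  norm_num at h ⊢
  exact h.symm

lemma norm_chr_one_sub (z : ℝ) (hz : |z| ≤ 1 / 2) :
    4 * |z| ≤ ‖chr 1 (z : UnitAddCircle) - 1‖ := by
  have h1 : chr 1 (z : UnitAddCircle) = Complex.exp (Complex.I * ((2 * Real.pi * z : ℝ) : ℂ)) := by
    simp only [chr_apply, fourier_coe_apply]
    congr 1; push_cast; ring
  rw [h1, Complex.norm_exp_I_mul_ofReal_sub_one]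
  have h2 : (2 * Real.pi * z) / 2 = Real.pi * z := by ring
  rw [h2, norm_mul, Real.norm_eq_abs, Real.norm_eq_abs, abs_two]
  have h3 : |Real.sin (Real.pi * z)| = Real.sin (Real.pi * |z|) := by
    rcases abs_cases z with ⟨h, hz'⟩ | ⟨h, hz'⟩
    · rw [h, abs_of_nonneg]
      exact Real.sin_nonneg_of_nonneg_of_le_pi (by positivity)
        (by nlinarith [Real.pi_pos])
    · rw [h, mul_neg, Real.sin_neg, abs_of_nonpos]
      have := Real.sin_nonneg_of_nonneg_of_le_pi (x := Real.pi * (-z))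
        (mul_nonneg Real.pi_pos.le (by linarith)) (by nlinarith [Real.pi_pos])
      rw [mul_neg, Real.sin_neg] at this
      linarith
  have h4 := Real.mul_le_sin (x := Real.pi * |z|) (by positivity) (by nlinarith [Real.pi_pos])
  rw [h3]
  have h5 : 2 / Real.pi * (Real.pi * |z|) = 2 * |z| := by field_simp
  linarith

lemma integral_weight_inv (N : ℝ) (hN : 0 < N) :
    ∫ x, (1 + N ^ 2 * ‖chr 1 x - 1‖ ^ 2)⁻¹ ∂𝔥 ≤ 1 / N := by
  rw [integral_circle]
  have h1 : ∫ x in (-(1/2) : ℝ)..(1/2), (1 + N ^ 2 * ‖chr 1 (x : UnitAddCircle) - 1‖ ^ 2)⁻¹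
      ≤ ∫ x in (-(1/2) : ℝ)..(1/2), (1 + (4 * N * x) ^ 2)⁻¹ := by
    apply intervalIntegral.integral_mono_on (by norm_num)
    · apply Continuous.intervalIntegrable
      have : Continuous fun x : ℝ => chr 1 (x : UnitAddCircle) :=
        (chr 1).continuous.comp (AddCircle.continuous_mk' 1)
      refine Continuous.inv₀ (by fun_prop) fun x => by positivity
    · apply Continuous.intervalIntegrable
      exact Continuous.inv₀ (by fun_prop) fun x => by positivity
    · intro x hx
      apply inv_anti₀ (by positivity)
      have := norm_chr_one_sub x (abs_le.2 ⟨by linarith [hx.1], by linarith [hx.2]⟩)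
      have h' : (4 * |x|) ^ 2 ≤ ‖chr 1 (x : UnitAddCircle) - 1‖ ^ 2 := by gcongr
      have h'' : (4 * |x|) ^ 2 = 16 * x ^ 2 := by rw [mul_pow, sq_abs]; norm_num
      nlinarith [sq_nonneg N, mul_le_mul_of_nonneg_left h' (sq_nonneg N)]
  refine h1.trans ?_
  rw [intervalIntegral.integral_comp_mul_left (fun y => (1 + y ^ 2)⁻¹) (by positivity),
    integral_inv_one_add_sq]
  have ha := Real.arctan_lt_pi_div_two (4 * N * (1/2))
  have hb := Real.neg_pi_div_two_lt_arctan (4 * N * (-(1/2)))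
  have hpi := Real.pi_le_four
  rw [smul_eq_mul, ← div_eq_inv_mul, div_le_div_iff₀ (by positivity) hN]
  nlinarith

/-- The box of frequencies of modulus at most `2 N`. -/
def box (N : ℕ) : Finset ℤ := Finset.Icc (-(2 * N)) (2 * N)

lemma mem_box {N : ℕ} {k : ℤ} : k ∈ box N ↔ |k| ≤ 2 * N := by rw [box, Finset.mem_Icc, abs_le]

lemma box_mono {N M : ℕ} (h : N ≤ M) : box N ⊆ box M := fun k hk => by
  rw [mem_box] at *; have : (N : ℤ) ≤ M := by exact_mod_cast h
  linarith

lemma card_box (N : ℕ) : (box N).card = 4 * N + 1 := by rw [box, Int.card_Icc]; omega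

lemma chr_one_sub_mul_poly (N : ℕ) (hN : 1 ≤ N) (a : FD) (h0 : ∀ k, k ∉ box N → a k = 0) :
    (chr 1 - 1) * poly (box N) a = poly (box (2 * N)) fun k => a (k - 1) - a k := by
  have hs : poly (box N) a = poly (box (2 * N)) a :=
    poly_subset (box_mono (by omega)) fun k _ hk => h0 k hk
  have h1 : chr 1 * poly (box N) a = poly (box (2 * N)) fun k => a (k - 1) := by
    rw [poly_def, poly_def, Finset.mul_sum]
    have : ∀ k ∈ box N, chr 1 * a k • chr k = a (k + 1 - 1) • chr (k + 1) := by
      intro k _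
      rw [mul_smul_comm, chr_mul, add_comm 1 k, add_sub_cancel_right]
    rw [Finset.sum_congr rfl this]
    rw [← Finset.sum_image (g := fun k => k + 1) (f := fun k => a (k - 1) • chr k)
      (fun x _ y _ h => by simpa using h)]
    refine Finset.sum_subset ?_ ?_
    · intro k hk
      obtain ⟨l, hl, rfl⟩ := Finset.mem_image.1 hk
      rw [mem_box, abs_le] at *
      push_cast
      omega
    · intro k _ hk
      rw [h0, zero_smul]
      intro h
      exact hk (Finset.mem_image.2 ⟨k - 1, h, by ring⟩)
  rw [sub_mul, one_mul, h1]
  conv_lhs => rw [hs]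
  rw [← map_sub]
  rfl

/-- `L¹` bound of a kernel, from bounds of its coefficients and of their first differences. -/
lemma integral_norm_poly_le (N : ℕ) (hN : 1 ≤ N) (a : FD) (A : ℝ)
    (h0 : ∀ k, k ∉ box N → a k = 0) (h1 : ∀ k, ‖a k‖ ≤ A) (h2 : ∀ k, ‖a (k - 1) - a k‖ ≤ A / N) :
    ∫ x, ‖poly (box N) a x‖ ∂𝔥 ≤ 8 * A := by
  have hN' : (1 : ℝ) ≤ N := by exact_mod_cast hN
  have hNpos : (0 : ℝ) < N := by linarith
  have hA : 0 ≤ A := (norm_nonneg _).trans (h1 0)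
  rcases hA.eq_or_lt with rfl | hA
  · have : a = 0 := by ext k; simpa using h1 k
    simp [this]
  obtain ⟨K, hK⟩ : ∃ K, K = poly (box N) a := ⟨_, rfl⟩
  obtain ⟨w₀, hw⟩ : ∃ w₀ : UnitAddCircle → ℝ, w₀ = fun x => 1 + (N : ℝ) ^ 2 * ‖chr 1 x - 1‖ ^ 2 :=
    ⟨_, rfl⟩
  have hw1 : ∀ x, 0 < w₀ x := fun x => by rw [hw]; positivity
  have hwc : Continuous w₀ := by rw [hw]; fun_prop
  rw [← hK]
  have e1 : ∫ x, ‖K x‖ ^ 2 ∂𝔥 ≤ 5 * N * A ^ 2 := by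
    rw [hK, integral_norm_sq_poly]
    calc ∑ k ∈ box N, ‖a k‖ ^ 2 ≤ ∑ k ∈ box N, A ^ 2 := by gcongr with k _; exact h1 k
      _ = (4 * N + 1) * A ^ 2 := by rw [Finset.sum_const, card_box]; simp
      _ ≤ 5 * N * A ^ 2 := by gcongr; linarith
  have e2 : ∫ x, ((N : ℝ) ^ 2 * ‖chr 1 x - 1‖ ^ 2) * ‖K x‖ ^ 2 ∂𝔥
      ≤ 9 * N * A ^ 2 := by
    have : ∀ x, ((N : ℝ) ^ 2 * ‖chr 1 x - 1‖ ^ 2) * ‖K x‖ ^ 2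
        = (N : ℝ) ^ 2 * ‖poly (box (2 * N)) (fun k => a (k - 1) - a k) x‖ ^ 2 := by
      intro x
      rw [← chr_one_sub_mul_poly N hN a h0, CT.mul_apply, norm_mul, mul_pow]
      simp [hK, mul_assoc]
    simp_rw [this]
    rw [integral_const_mul, integral_norm_sq_poly]
    calc (N : ℝ) ^ 2 * ∑ k ∈ box (2 * N), ‖a (k - 1) - a k‖ ^ 2
        ≤ (N : ℝ) ^ 2 * ∑ k ∈ box (2 * N), (A / N) ^ 2 := by gcongr with k _; exact h2 k
      _ = (8 * N + 1) * A ^ 2 := by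
          rw [Finset.sum_const, card_box]; simp only [nsmul_eq_mul]; push_cast; field_simp; ring
      _ ≤ 9 * N * A ^ 2 := by gcongr; linarith
  have i1 : Integrable (fun x => ‖K x‖ ^ 2) 𝔥 :=
    Continuous.integrable_of_hasCompactSupport (by fun_prop) (HasCompactSupport.of_compactSpace _)
  have i2 : Integrable (fun x => ((N : ℝ) ^ 2 * ‖chr 1 x - 1‖ ^ 2) * ‖K x‖ ^ 2)
      𝔥 :=
    Continuous.integrable_of_hasCompactSupport (by fun_prop) (HasCompactSupport.of_compactSpace _)
  have i3 : Integrable (fun x => (w₀ x)⁻¹) 𝔥 :=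
    Continuous.integrable_of_hasCompactSupport (hwc.inv₀ fun x => (hw1 x).ne')
      (HasCompactSupport.of_compactSpace _)
  have key : ∀ x, ‖K x‖ ≤ (1 / (2 * N * A)) * (‖K x‖ ^ 2
      + ((N : ℝ) ^ 2 * ‖chr 1 x - 1‖ ^ 2) * ‖K x‖ ^ 2) + (N * A / 2) * (w₀ x)⁻¹ := by
    intro x
    have hx := hw1 x
    have : (1 / (2 * N * A)) * (‖K x‖ ^ 2
      + ((N : ℝ) ^ 2 * ‖chr 1 x - 1‖ ^ 2) * ‖K x‖ ^ 2) + (N * A / 2) * (w₀ x)⁻¹ - ‖K x‖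
      = (‖K x‖ * w₀ x - N * A) ^ 2 / (2 * N * A * w₀ x) := by
      have : ‖K x‖ ^ 2 + ((N : ℝ) ^ 2 * ‖chr 1 x - 1‖ ^ 2) * ‖K x‖ ^ 2 = ‖K x‖ ^ 2 * w₀ x := by
        simp only [hw]; ring
      rw [this]
      field_simp
      ring
    have h' : 0 ≤ (‖K x‖ * w₀ x - N * A) ^ 2 / (2 * N * A * w₀ x) := by positivity
    linarith
  have j1 : Integrable (fun x => (1 / (2 * N * A)) * (‖K x‖ ^ 2
      + ((N : ℝ) ^ 2 * ‖chr 1 x - 1‖ ^ 2) * ‖K x‖ ^ 2)) 𝔥 :=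
    (i1.add i2).const_mul _
  have j2 : Integrable (fun x => (N * A / 2) * (w₀ x)⁻¹) 𝔥 :=
    i3.const_mul _
  have m1 := integral_mono_of_nonneg (Eventually.of_forall fun x => norm_nonneg (K x))
    (j1.add j2) (Eventually.of_forall key)
  have m2 := integral_add j1 j2
  have m3 := integral_add i1 i2
  rw [integral_const_mul, integral_const_mul, m3] at m2
  have m4 := integral_weight_inv N hNpos
  have m5 : ∫ x, (w₀ x)⁻¹ ∂𝔥 ≤ 1 / N := by rw [hw]; exact m4
  have m6 : (1 / (2 * N * A)) * (∫ x, ‖K x‖ ^ 2 ∂𝔥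
        + ∫ x, ((N : ℝ) ^ 2 * ‖chr 1 x - 1‖ ^ 2) * ‖K x‖ ^ 2 ∂𝔥)
      ≤ (1 / (2 * N * A)) * (5 * N * A ^ 2 + 9 * N * A ^ 2) :=
    mul_le_mul_of_nonneg_left (add_le_add e1 e2) (by positivity)
  have m7 : (N * A / 2) * ∫ x, (w₀ x)⁻¹ ∂𝔥 ≤ (N * A / 2) * (1 / N) :=
    mul_le_mul_of_nonneg_left m5 (by positivity)
  have m8 : (1 / (2 * N * A)) * (5 * N * A ^ 2 + 9 * N * A ^ 2) + (N * A / 2) * (1 / N)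
      = (7 + 1 / 2) * A := by field_simp; ring
  refine m1.trans (m2.le.trans ?_)
  linarith

lemma integral_norm_translate (K : CT) (x : UnitAddCircle) :
    ∫ y, ‖K (x - y)‖ ∂𝔥
      = ∫ y, ‖K y‖ ∂𝔥 :=
  integral_sub_left_eq_self (fun y => ‖K y‖) _ x

/-- Fourier multipliers are bounded on continuous functions. -/
lemma norm_multiplier_le (N : ℕ) (hN : 1 ≤ N) (a : FD) (A : ℝ)
    (h0 : ∀ k, k ∉ box N → a k = 0) (h1 : ∀ k, ‖a k‖ ≤ A) (h2 : ∀ k, ‖a (k - 1) - a k‖ ≤ A / N)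
    (f : CT) : ‖poly (box N) (a * coef f)‖ ≤ 8 * A * ‖f‖ := by
  have hA : 0 ≤ A := (norm_nonneg _).trans (h1 0)
  rw [CT.norm_le _ (by positivity)]
  intro x
  rw [mul_sum_conv]
  calc ‖∫ y, poly (box N) a (x - y) * f y ∂𝔥‖
      ≤ ∫ y, ‖poly (box N) a (x - y)‖ * ‖f‖ ∂𝔥 := by
        refine norm_integral_le_of_norm_le ?_ (Eventually.of_forall fun y => ?_)
        · exact Continuous.integrable_of_hasCompactSupport (by fun_prop)
            (HasCompactSupport.of_compactSpace _)
        · rw [norm_mul]; gcongr; exact f.norm_coe_le_norm y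
    _ ≤ 8 * A * ‖f‖ := by
        rw [integral_mul_const, integral_norm_translate]
        gcongr
        exact integral_norm_poly_le N hN a A h0 h1 h2

/-- Commutator of a Fourier multiplier and the multiplication with a Lipschitz function. -/
lemma norm_commutator_le (N : ℕ) (hN : 1 ≤ N) (a : FD) (A : ℝ)
    (h0 : ∀ k, k ∉ box N → a k = 0) (h2 : ∀ k, ‖a (k - 1) - a k‖ ≤ A / N)
    (h3 : ∀ k, ‖(a (k - 1 - 1) - a (k - 1)) - (a (k - 1) - a k)‖ ≤ A / N ^ 2)
    (g : CT) (L : ℝ) (hL : 0 ≤ L) (hg : ∀ x y, ‖g x - g y‖ ≤ L * ‖chr 1 x - chr 1 y‖) (f : CT) :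
    ‖poly (box N) (a * coef (g * f)) - g * poly (box N) (a * coef f)‖
      ≤ 16 * (A / N) * L * ‖f‖ := by
  have hA : 0 ≤ A / N := (norm_nonneg _).trans (h2 0)
  have hN' : (1 : ℝ) ≤ N := by exact_mod_cast hN
  rw [CT.norm_le _ (by positivity)]
  intro x
  set K := poly (box N) a
  have hker : ∫ y, ‖((chr 1 - 1) * K) y‖ ∂𝔥 ≤ 16 * (A / N) := by
    rw [chr_one_sub_mul_poly N hN a h0]
    have := integral_norm_poly_le (2 * N) (by omega) (fun k => a (k - 1) - a k) (2 * (A / N)) ?_ ?_ ?_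
    · linarith
    · intro k hk
      rw [h0, h0, sub_zero]
      · exact fun h => hk (box_mono (by omega) h)
      · intro h
        apply hk
        rw [mem_box, abs_le] at *
        push_cast
        omega
    · intro k; linarith [h2 k]
    · intro k
      refine (h3 k).trans (le_of_eq ?_)
      push_cast
      field_simp
  rw [CT.sub_apply, CT.mul_apply, mul_sum_conv, mul_sum_conv,
    ← integral_const_mul, ← integral_sub]
  · calc ‖∫ y, (K (x - y) * (g * f) y - g x * (K (x - y) * f y)) ∂𝔥‖
        ≤ ∫ y, ‖((chr 1 - 1) * K) (x - y)‖ * (L * ‖f‖) ∂𝔥 := by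
          refine norm_integral_le_of_norm_le ?_ (Eventually.of_forall fun y => ?_)
          · exact Continuous.integrable_of_hasCompactSupport (by fun_prop)
              (HasCompactSupport.of_compactSpace _)
          · have e1 : K (x - y) * (g * f) y - g x * (K (x - y) * f y)
                = K (x - y) * (g y - g x) * f y := by simp only [CT.mul_apply]; ring
            have e2 : ‖chr 1 y - chr 1 x‖ = ‖chr 1 (x - y) - 1‖ := by
              have : chr 1 x = chr 1 (x - y) * chr 1 y := by
                conv_lhs => rw [← sub_add_cancel x y]
                simp only [chr_apply, fourier_apply, one_smul, toCircle_add]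
                simp
              rw [this, ← norm_neg, neg_sub, ← sub_one_mul, norm_mul, norm_chr_apply, mul_one]
            rw [e1, norm_mul, norm_mul, CT.mul_apply, norm_mul]
            have := hg y x
            rw [e2] at this
            calc ‖K (x - y)‖ * ‖g y - g x‖ * ‖f y‖
                ≤ ‖K (x - y)‖ * (L * ‖chr 1 (x - y) - 1‖) * ‖f‖ := by
                  gcongr; exact f.norm_coe_le_norm y
              _ = _ := by simp; ring
      _ ≤ 16 * (A / N) * L * ‖f‖ := by
          rw [integral_mul_const, integral_norm_translate]
          calc _ ≤ 16 * (A / N) * (L * ‖f‖) := by gcongr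
            _ = _ := by ring
  · exact Continuous.integrable_of_hasCompactSupport (by fun_prop)
      (HasCompactSupport.of_compactSpace _)
  · exact Continuous.integrable_of_hasCompactSupport (by fun_prop)
      (HasCompactSupport.of_compactSpace _)

/-- The symbol `2 π i k` of the derivative. -/
def dsym : FD := fun k => 2 * Real.pi * Complex.I * k

/-- Trigonometric polynomials are Lipschitz, with constant given by the derivative. -/
lemma poly_lipschitz (s : Finset ℤ) (c : FD) (x y : UnitAddCircle) :
    ‖poly s c x - poly s c y‖ ≤ ‖poly s (dsym * c)‖ * ‖chr 1 x - chr 1 y‖ := by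
  obtain ⟨y', rfl⟩ := QuotientAddGroup.mk_surjective y
  obtain ⟨z, hz⟩ := QuotientAddGroup.mk_surjective (x - (y' : UnitAddCircle))
  set n := round z
  set z' : ℝ := z - n with hz'
  have hzz : ((z' : ℝ) : UnitAddCircle) = x - (y' : UnitAddCircle) := by
    rw [← hz]
    have : (z' : UnitAddCircle) = (z : UnitAddCircle) - ((n : ℝ) : UnitAddCircle) := by
      rw [hz']; rfl
    rw [this]
    have h0 : ((n : ℝ) : UnitAddCircle) = 0 := by rw [AddCircle.coe_eq_zero_iff]; exact ⟨n, by simp⟩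
    rw [h0, sub_zero]
  have hx : x = ((y' + z' : ℝ) : UnitAddCircle) := by rw [AddCircle.coe_add, hzz]; abel
  have hz2 : |z'| ≤ 1 / 2 := abs_sub_round z
  have hd : ∀ t : ℝ, HasDerivAt (fun t : ℝ => poly s c (t : UnitAddCircle))
      (poly s (dsym * c) (t : UnitAddCircle)) t := by
    intro t
    rw [funext fun t : ℝ => poly_apply s c (t : UnitAddCircle), poly_apply]
    refine HasDerivAt.fun_sum fun k _ => ?_
    have := (hasDerivAt_fourier (1 : ℝ) k t).const_mul (c k)
    have e : (dsym * c) k * chr k (t : UnitAddCircle)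
        = c k * (2 * Real.pi * Complex.I * k / (1 : ℝ) * _root_.fourier k (t : UnitAddCircle)) := by
      simp only [dsym, Pi.mul_apply, chr_apply, Complex.ofReal_one, div_one]
      ring
    rw [e]
    exact this
  have hm := Convex.norm_image_sub_le_of_norm_hasDerivWithin_le (s := Set.univ)
    (f := fun t : ℝ => poly s c (t : UnitAddCircle)) (C := ‖poly s (dsym * c)‖)
    (fun t _ => (hd t).hasDerivWithinAt) (fun t _ => CT.norm_coe_le_norm _ _)
    convex_univ (Set.mem_univ y') (Set.mem_univ (y' + z'))
  have he : ‖chr 1 x - chr 1 (y' : UnitAddCircle)‖ = ‖chr 1 (z' : UnitAddCircle) - 1‖ := by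
    have : chr 1 x = chr 1 (z' : UnitAddCircle) * chr 1 (y' : UnitAddCircle) := by
      rw [hx, add_comm, AddCircle.coe_add]
      simp only [chr_apply, fourier_apply, one_smul, toCircle_add]
      simp
    rw [this, ← sub_one_mul, norm_mul, norm_chr_apply, mul_one]
  have h4 := norm_chr_one_sub z' hz2
  show ‖poly s c x - poly s c (y' : UnitAddCircle)‖
    ≤ ‖poly s (dsym * c)‖ * ‖chr 1 x - chr 1 (y' : UnitAddCircle)‖
  rw [he, hx]
  refine hm.trans ?_
  rw [add_sub_cancel_left, Real.norm_eq_abs]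
  gcongr
  linarith [abs_nonneg z']

/-- Continuous functions whose frequencies lie in `box N`. -/
def SpecIn (N : ℕ) (f : CT) : Prop := ∃ c : FD, f = poly (box N) c

lemma SpecIn.coef_eq_zero {N : ℕ} {f : CT} (h : SpecIn N f) {k : ℤ} (hk : k ∉ box N) :
    coef f k = 0 := by
  obtain ⟨c, rfl⟩ := h
  rw [coef_poly, if_neg hk]

lemma specIn_poly {s : Finset ℤ} {N : ℕ} (hs : s ⊆ box N) (c : FD) : SpecIn N (poly s c) := by
  refine ⟨coef (poly s c), ?_⟩
  rw [← poly_subset hs]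
  · exact poly_congr fun k hk => by rw [coef_poly, if_pos hk]
  · intro k _ hk; rw [coef_poly, if_neg hk]

lemma SpecIn.mono {N M : ℕ} (h : N ≤ M) {f : CT} (hf : SpecIn N f) : SpecIn M f := by
  obtain ⟨c, rfl⟩ := hf
  exact specIn_poly (box_mono h) c

lemma SpecIn.add {N : ℕ} {f g : CT} (hf : SpecIn N f) (hg : SpecIn N g) : SpecIn N (f + g) := by
  obtain ⟨c, rfl⟩ := hf
  obtain ⟨d, rfl⟩ := hg
  exact ⟨c + d, (map_add _ _ _).symm⟩

lemma SpecIn.sub {N : ℕ} {f g : CT} (hf : SpecIn N f) (hg : SpecIn N g) : SpecIn N (f - g) := by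
  obtain ⟨c, rfl⟩ := hf
  obtain ⟨d, rfl⟩ := hg
  exact ⟨c - d, (map_sub _ _ _).symm⟩

lemma SpecIn.zero (N : ℕ) : SpecIn N 0 := ⟨0, (map_zero _).symm⟩

lemma SpecIn.sum {ι : Type*} {N : ℕ} (s : Finset ι) {f : ι → CT} (h : ∀ i ∈ s, SpecIn N (f i)) :
    SpecIn N (∑ i ∈ s, f i) :=
  Finset.sum_induction _ _ (fun _ _ => SpecIn.add) (SpecIn.zero N) h

/-- The frequencies of a product. -/
lemma coef_mul_poly (s t : Finset ℤ) (c d : FD) (k : ℤ) :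
    coef (poly s c * poly t d) k = ∑ p ∈ s ×ˢ t, if p.1 + p.2 = k then c p.1 * d p.2 else 0 := by
  rw [poly_def, poly_def, Finset.sum_mul_sum, ← Finset.sum_product', map_sum, Finset.sum_apply]
  refine Finset.sum_congr rfl fun p _ => ?_
  rw [smul_mul_smul_comm, chr_mul, map_smul, Pi.smul_apply, coef_chr]
  by_cases h : p.1 + p.2 = k
  · simp [h]
  · rw [if_neg h, if_neg (fun h' => h h'.symm)]; simp

lemma SpecIn.mul {N M : ℕ} {f g : CT} (hf : SpecIn N f) (hg : SpecIn M g) :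
    SpecIn (N + M) (f * g) := by
  obtain ⟨c, rfl⟩ := hf
  obtain ⟨d, rfl⟩ := hg
  rw [poly_def, poly_def, Finset.sum_mul_sum]
  refine SpecIn.sum _ fun i hi => SpecIn.sum _ fun j hj => ?_
  rw [smul_mul_smul_comm, chr_mul]
  have : (c i * d j) • chr (i + j) = poly {i + j} fun _ => c i * d j := by simp [poly_def]
  rw [this]
  refine specIn_poly ?_ _
  intro k hk
  rw [Finset.mem_singleton] at hk
  rw [mem_box, abs_le] at *
  push_cast
  omega

end ParaKPZ

namespace ParaKPZ

/-! ### Littlewood--Paley symbols -/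

/-- Symbols living at scale `N`, of size `A`. -/
structure SymbolBound (N : ℕ) (a : FD) (A : ℝ) : Prop where
  supp : ∀ k, k ∉ box N → a k = 0
  norm_le : ∀ k, ‖a k‖ ≤ A
  diff_le : ∀ k, ‖a (k - 1) - a k‖ ≤ A / N
  diff_diff_le : ∀ k, ‖(a (k - 1 - 1) - a (k - 1)) - (a (k - 1) - a k)‖ ≤ A / N ^ 2

lemma SymbolBound.norm_poly_le {N : ℕ} (hN : 1 ≤ N) {a : FD} {A : ℝ} (h : SymbolBound N a A)
    (f : CT) : ‖poly (box N) (a * coef f)‖ ≤ 8 * A * ‖f‖ :=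
  norm_multiplier_le N hN a A h.supp h.norm_le h.diff_le f

lemma SymbolBound.smul {N : ℕ} {a : FD} {A : ℝ} (h : SymbolBound N a A) (c : ℂ) :
    SymbolBound N (c • a) (‖c‖ * A) where
  supp k hk := by simp [h.supp k hk]
  norm_le k := by
    rw [Pi.smul_apply, smul_eq_mul, norm_mul]
    exact mul_le_mul_of_nonneg_left (h.norm_le k) (norm_nonneg c)
  diff_le k := by
    simp only [Pi.smul_apply, smul_eq_mul]
    rw [← mul_sub, norm_mul, mul_div_assoc]
    exact mul_le_mul_of_nonneg_left (h.diff_le k) (norm_nonneg c)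
  diff_diff_le k := by
    simp only [Pi.smul_apply, smul_eq_mul]
    rw [← mul_sub, ← mul_sub, ← mul_sub, norm_mul, mul_div_assoc]
    exact mul_le_mul_of_nonneg_left (h.diff_diff_le k) (norm_nonneg c)

lemma SymbolBound.mono {N : ℕ} {a : FD} {A B : ℝ} (h : SymbolBound N a A) (hAB : A ≤ B) :
    SymbolBound N a B where
  supp := h.supp
  norm_le k := (h.norm_le k).trans hAB
  diff_le k := (h.diff_le k).trans (by gcongr)
  diff_diff_le k := (h.diff_diff_le k).trans (by gcongr)

lemma abs_sub_le_of_deriv {m m' : ℝ → ℝ} {A : ℝ} (h1 : ∀ x, HasDerivAt m (m' x) x)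
    (h2 : ∀ x, |m' x| ≤ A) (x y : ℝ) : |m x - m y| ≤ A * |x - y| := by
  have := Convex.norm_image_sub_le_of_norm_hasDerivWithin_le (s := Set.univ) (f := m) (C := A)
    (fun t _ => (h1 t).hasDerivWithinAt) (fun t _ => h2 t) convex_univ (Set.mem_univ y)
    (Set.mem_univ x)
  exact this

lemma symbolBound_of_deriv {m m' m'' : ℝ → ℝ} {A : ℝ} (N : ℕ) (hN : 1 ≤ N)
    (h1 : ∀ x, HasDerivAt m (m' x) x) (h2 : ∀ x, HasDerivAt m' (m'' x) x)
    (b0 : ∀ x, |m x| ≤ A) (b1 : ∀ x, |m' x| ≤ A) (b2 : ∀ x, |m'' x| ≤ A)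
    (h0 : ∀ x, 2 < |x| → m x = 0) :
    SymbolBound N (fun k => ((m (k / N) : ℝ) : ℂ)) A := by
  have hN' : (0 : ℝ) < N := by exact_mod_cast hN
  refine ⟨fun k hk => ?_, fun k => ?_, fun k => ?_, fun k => ?_⟩
  · rw [h0, Complex.ofReal_zero]
    rw [mem_box, not_le] at hk
    rw [abs_div, abs_of_pos hN', lt_div_iff₀ hN']
    exact_mod_cast hk
  · rw [Complex.norm_real]; exact b0 _
  · rw [← Complex.ofReal_sub, Complex.norm_real]
    refine (abs_sub_le_of_deriv h1 b1 _ _).trans (le_of_eq ?_)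
    push_cast
    rw [← sub_div, sub_sub_cancel_left, abs_div, abs_of_pos hN', abs_neg, abs_one]
    ring
  · simp only [← Complex.ofReal_sub]
    rw [Complex.norm_real]
    set h : ℝ → ℝ := fun x => m (x - 1 / N) - m x with hh
    have d1 : ∀ x, HasDerivAt h (m' (x - 1 / N) - m' x) x := fun x =>
      (HasDerivAt.comp_sub_const x (1 / N : ℝ) (h1 _)).sub (h1 x)
    have d2 : ∀ x, |m' (x - 1 / N) - m' x| ≤ A / N := by
      intro x
      refine (abs_sub_le_of_deriv h2 b2 _ _).trans (le_of_eq ?_)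
      rw [sub_sub_cancel_left, abs_neg, abs_of_pos (by positivity)]; ring
    have := abs_sub_le_of_deriv d1 d2 ((k - 1 : ℤ) / N) (k / N)
    have e : ∀ l : ℤ, ((l - 1 : ℤ) : ℝ) / N = (l : ℝ) / N - 1 / N := by intro l; push_cast; ring
    rw [Real.norm_eq_abs, e (k - 1)]
    conv_lhs => rw [show m (((k - 1 : ℤ) : ℝ) / N) - m ((k : ℝ) / N) = h (k / N) by
      rw [hh]; simp only [e]]
    refine this.trans (le_of_eq ?_)
    rw [e, sub_sub_cancel_left, abs_neg, abs_of_pos (by positivity)]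
    field_simp

lemma pow_four_mul_exp_neg_le (x : ℝ) (hx : 0 ≤ x) : (1 + x) ^ 4 * Real.exp (-x) ≤ 72 := by
  have h1 := Real.pow_div_factorial_le_exp (1 + x) (by linarith) 4
  have h2 : Real.exp (1 + x) * Real.exp (-x) = Real.exp 1 := by rw [← Real.exp_add]; ring_nf
  have h3 : Real.exp 1 ≤ 3 := by have := Real.exp_one_lt_d9; linarith
  have h4 := Real.exp_pos (-x)
  norm_num [Nat.factorial] at h1
  calc (1 + x) ^ 4 * Real.exp (-x) ≤ 24 * Real.exp (1 + x) * Real.exp (-x) := by gcongr; linarith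
    _ = 24 * Real.exp 1 := by rw [mul_assoc, h2]
    _ ≤ 72 := by linarith

/-- Symbols localised in an annulus, damped by the heat flow. -/
lemma exists_heat_symbolBound {r : ℝ → ℝ} (hr : ContDiff ℝ ∞ r)
    (hs : tsupport r ⊆ {x | 3 / 4 ≤ |x| ∧ |x| ≤ 8 / 3}) :
    ∃ A : ℝ, 0 ≤ A ∧ ∀ N : ℕ, 1 ≤ N → ∀ x : ℝ, 0 ≤ x →
      SymbolBound N (fun k => ((r (2 * (k / N)) * Real.exp (-(2 * Real.pi ^ 2 * (k / N) ^ 2 * x)) : ℝ) : ℂ))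
        (A * ((1 + x) ^ 2)⁻¹) := by
  set r' := deriv r with hr'
  set r'' := deriv r' with hr''
  have c1 : ContDiff ℝ ∞ r' := (contDiff_infty_iff_deriv.1 hr).2
  have c2 : ContDiff ℝ ∞ r'' := (contDiff_infty_iff_deriv.1 c1).2
  have hK : IsCompact {x : ℝ | 3 / 4 ≤ |x| ∧ |x| ≤ 8 / 3} := by
    refine (isCompact_Icc (a := -(8/3 : ℝ)) (b := 8/3)).of_isClosed_subset ?_ ?_
    · exact (isClosed_le continuous_const continuous_abs).inter
        (isClosed_le continuous_abs continuous_const)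
    · intro x hx; exact abs_le.1 hx.2
  have s1 : tsupport r' ⊆ tsupport r := closure_minimal support_deriv_subset (isClosed_tsupport r)
  have s2 : tsupport r'' ⊆ tsupport r :=
    (closure_minimal support_deriv_subset (isClosed_tsupport r')).trans s1
  have z : ∀ q : ℝ → ℝ, tsupport q ⊆ tsupport r → ∀ y, ¬ (3 / 4 ≤ |y| ∧ |y| ≤ 8 / 3) → q y = 0 := by
    intro q hq y hy
    by_contra h
    exact hy (hs (hq (subset_tsupport q h)))
  have bd : ∀ q : ℝ → ℝ, Continuous q → tsupport q ⊆ tsupport r → ∃ B, 0 ≤ B ∧ ∀ y, |q y| ≤ B := by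
    intro q hq hqs
    obtain ⟨B, hB⟩ := hK.exists_bound_of_continuousOn hq.continuousOn
    refine ⟨max B 0, le_max_right _ _, fun y => ?_⟩
    by_cases hy : 3 / 4 ≤ |y| ∧ |y| ≤ 8 / 3
    · exact (hB y hy).trans (le_max_left _ _)
    · rw [z q hqs y hy, abs_zero]; exact le_max_right _ _
  obtain ⟨B0, hB0, b0⟩ := bd r hr.continuous le_rfl
  obtain ⟨B1, hB1, b1⟩ := bd r' c1.continuous s1
  obtain ⟨B2, hB2, b2⟩ := bd r'' c2.continuous s2
  set B := B0 + B1 + B2 with hB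
  refine ⟨B * 1000000, by positivity, fun N hN x hx => ?_⟩
  set c : ℝ := 2 * Real.pi ^ 2 with hc
  have hc1 : 18 ≤ c := by rw [hc]; nlinarith [Real.pi_gt_three]
  have hc2 : c ≤ 20 := by rw [hc]; nlinarith [Real.pi_lt_d2, Real.pi_pos]
  set G : ℝ → ℝ := fun y => Real.exp (-(c * y ^ 2 * x)) with hG
  have dG : ∀ y, HasDerivAt G (-(2 * c * y * x) * G y) y := by
    intro y
    have : HasDerivAt (fun y : ℝ => -(c * y ^ 2 * x)) (-(2 * c * y * x)) y := by
      have := (((hasDerivAt_pow 2 y).const_mul c).mul_const x).neg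
      refine this.congr_deriv ?_
      push_cast; ring
    have := this.exp
    refine this.congr_deriv ?_
    rw [hG]; ring
  have dG2 : ∀ y, HasDerivAt (fun y => -(2 * c * y * x) * G y)
      ((4 * c ^ 2 * y ^ 2 * x ^ 2 - 2 * c * x) * G y) y := by
    intro y
    have h1 : HasDerivAt (fun y : ℝ => -(2 * c * y * x)) (-(2 * c * x)) y := by
      have := (((hasDerivAt_id y).const_mul (2 * c)).mul_const x).neg
      refine this.congr_deriv ?_
      ring
    refine (h1.mul (dG y)).congr_deriv ?_
    ring
  have dr : ∀ y, HasDerivAt (fun y => r (2 * y)) (2 * r' (2 * y)) y := by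
    intro y
    have h := ((hr.differentiable (by simp)) (2 * y)).hasDerivAt
    have := h.comp y ((hasDerivAt_id y).const_mul 2)
    refine this.congr_deriv ?_
    rw [hr']; ring
  have dr' : ∀ y, HasDerivAt (fun y => 2 * r' (2 * y)) (4 * r'' (2 * y)) y := by
    intro y
    have h := ((c1.differentiable (by simp)) (2 * y)).hasDerivAt
    have := (h.comp y ((hasDerivAt_id y).const_mul 2)).const_mul 2
    refine this.congr_deriv ?_
    rw [hr'']; ring
  have gb : ∀ y, 3 / 4 ≤ |2 * y| ∧ |2 * y| ≤ 8 / 3 →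
      G y ≤ 72 * ((1 + x) ^ 2)⁻¹ ∧ |(2 * c * y * x) * G y| ≤ 60 * 72 * ((1 + x) ^ 2)⁻¹ ∧
      |(4 * c ^ 2 * y ^ 2 * x ^ 2 - 2 * c * x) * G y| ≤ 4000 * 72 * ((1 + x) ^ 2)⁻¹ := by
    intro y hy
    rw [abs_mul, abs_two] at hy
    have hy1 : 9 / 64 ≤ y ^ 2 := by rw [← sq_abs]; nlinarith [hy.1]
    have hy2 : |y| ≤ 4 / 3 := by linarith [hy.2]
    have hy3 : y ^ 2 ≤ 16 / 9 := by rw [← sq_abs]; nlinarith [abs_nonneg y]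
    have g1 : G y ≤ Real.exp (-x) := by
      apply Real.exp_le_exp.2
      have : 1 ≤ c * y ^ 2 := by nlinarith
      nlinarith
    have g0 : 0 < G y := Real.exp_pos _
    have hx1 : 0 < 1 + x := by linarith
    have g2 : (1 + x) ^ 2 * G y ≤ 72 * ((1 + x) ^ 2)⁻¹ := by
      rw [← div_eq_mul_inv, le_div_iff₀ (by positivity)]
      calc (1 + x) ^ 2 * G y * (1 + x) ^ 2 = (1 + x) ^ 4 * G y := by ring
        _ ≤ (1 + x) ^ 4 * Real.exp (-x) := by gcongr
        _ ≤ 72 := pow_four_mul_exp_neg_le x hx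
    have q1 : 1 ≤ (1 + x) ^ 2 := by nlinarith
    have q2 : x ≤ (1 + x) ^ 2 := by nlinarith
    have q3 : x ^ 2 ≤ (1 + x) ^ 2 := by nlinarith
    refine ⟨?_, ?_, ?_⟩
    · nlinarith
    · rw [abs_mul, abs_of_pos g0]
      have : |2 * c * y * x| ≤ 60 * (1 + x) ^ 2 := by
        rw [abs_mul, abs_mul, abs_of_nonneg hx, abs_of_pos (by linarith : 0 < 2 * c)]
        have : 2 * c * |y| ≤ 60 := by nlinarith [abs_nonneg y]
        nlinarith
      calc |2 * c * y * x| * G y ≤ 60 * (1 + x) ^ 2 * G y := by gcongr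
        _ ≤ _ := by linarith
    · rw [abs_mul, abs_of_pos g0]
      have : |4 * c ^ 2 * y ^ 2 * x ^ 2 - 2 * c * x| ≤ 4000 * (1 + x) ^ 2 := by
        have e1 : c ^ 2 ≤ 400 := by nlinarith
        have e2 : c ^ 2 * y ^ 2 ≤ 400 * (16 / 9) := by gcongr
        have e3 : c ^ 2 * y ^ 2 * x ^ 2 ≤ 400 * (16 / 9) * (1 + x) ^ 2 := by gcongr
        have e4 : c * x ≤ 20 * (1 + x) ^ 2 := by gcongr
        have e5 : 0 ≤ c ^ 2 * y ^ 2 * x ^ 2 := by positivity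
        have e6 : 0 ≤ c * x := by positivity
        rw [abs_le]; constructor <;> nlinarith
      calc _ ≤ 4000 * (1 + x) ^ 2 * G y := by gcongr
        _ ≤ _ := by linarith
  set d := ((1 + x) ^ 2)⁻¹ with hd
  have hd0 : 0 ≤ d := by positivity
  have zz : ∀ q : ℝ → ℝ, tsupport q ⊆ tsupport r → ∀ (Bq : ℝ), (∀ y, |q y| ≤ Bq) → ∀ y v M,
      0 ≤ M → (3 / 4 ≤ |2 * y| ∧ |2 * y| ≤ 8 / 3 → |v| ≤ M * d) →
      |q (2 * y) * v| ≤ Bq * (M * d) := by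
    intro q hq Bq hBq y v M hM h
    by_cases hy : 3 / 4 ≤ |2 * y| ∧ |2 * y| ≤ 8 / 3
    · rw [abs_mul]; exact mul_le_mul (hBq _) (h hy) (abs_nonneg _) ((abs_nonneg _).trans (hBq 0))
    · rw [z q hq _ hy, zero_mul, abs_zero]
      have := (abs_nonneg _).trans (hBq 0)
      positivity
  have absG : ∀ y, |G y| = G y := fun y => abs_of_pos (Real.exp_pos _)
  have f0 := fun y => zz r le_rfl B0 b0 y (G y) 72 (by norm_num) fun h => by
    rw [absG]; exact (gb y h).1
  have f1 := fun y => zz r le_rfl B0 b0 y (-(2 * c * y * x) * G y) (60 * 72) (by norm_num) fun h => by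
    rw [neg_mul, abs_neg]; exact (gb y h).2.1
  have f2 := fun y => zz r le_rfl B0 b0 y _ (4000 * 72) (by norm_num) fun h => (gb y h).2.2
  have f3 := fun y => zz r' s1 B1 b1 y (G y) 72 (by norm_num) fun h => by
    rw [absG]; exact (gb y h).1
  have f4 := fun y => zz r' s1 B1 b1 y (-(2 * c * y * x) * G y) (60 * 72) (by norm_num) fun h => by
    rw [neg_mul, abs_neg]; exact (gb y h).2.1
  have f5 := fun y => zz r'' s2 B2 b2 y (G y) 72 (by norm_num) fun h => by
    rw [absG]; exact (gb y h).1
  have l0 : B0 * d ≤ B * d := by gcongr; linarith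
  have l1 : B1 * d ≤ B * d := by gcongr; linarith
  have l2 : B2 * d ≤ B * d := by gcongr; linarith
  have lB : 0 ≤ B * d := by positivity
  refine symbolBound_of_deriv (m := fun y => r (2 * y) * G y)
    (m' := fun y => 2 * r' (2 * y) * G y + r (2 * y) * (-(2 * c * y * x) * G y))
    (m'' := fun y => (4 * r'' (2 * y) * G y + 2 * r' (2 * y) * (-(2 * c * y * x) * G y))
      + (2 * r' (2 * y) * (-(2 * c * y * x) * G y)
        + r (2 * y) * ((4 * c ^ 2 * y ^ 2 * x ^ 2 - 2 * c * x) * G y))) N hN ?_ ?_ ?_ ?_ ?_ ?_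
  · intro y; exact (dr y).mul (dG y)
  · intro y; exact ((dr' y).mul (dG y)).add ((dr y).mul (dG2 y))
  · intro y
    have := f0 y
    linarith
  · intro y
    have h1 := f1 y
    have h3 := f3 y
    have e : 2 * r' (2 * y) * G y = 2 * (r' (2 * y) * G y) := by ring
    rw [e]
    refine (abs_add_le _ _).trans ?_
    rw [abs_mul, abs_two]
    linarith
  · intro y
    have h2 := f2 y
    have h4 := f4 y
    have h5 := f5 y
    have e : (4 * r'' (2 * y) * G y + 2 * r' (2 * y) * (-(2 * c * y * x) * G y))
      + (2 * r' (2 * y) * (-(2 * c * y * x) * G y)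
        + r (2 * y) * ((4 * c ^ 2 * y ^ 2 * x ^ 2 - 2 * c * x) * G y))
      = 4 * (r'' (2 * y) * G y) + 4 * (r' (2 * y) * (-(2 * c * y * x) * G y))
        + r (2 * y) * ((4 * c ^ 2 * y ^ 2 * x ^ 2 - 2 * c * x) * G y) := by ring
    rw [e]
    refine (abs_add_three _ _ _).trans ?_
    rw [abs_mul, abs_mul 4 (r' (2 * y) * _), abs_of_pos (by norm_num : (0 : ℝ) < 4)]
    linarith
  · intro y hy
    show r (2 * y) * G y = 0
    rw [z r le_rfl _ (fun h => by rw [abs_mul, abs_two] at h; linarith [h.2]), zero_mul]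

/-- The symbol of the heat semigroup. -/
def heat (t : ℝ) : FD := fun k => ((Real.exp (-(2 * Real.pi ^ 2 * k ^ 2 * t)) : ℝ) : ℂ)

lemma heat_zero : heat 0 = 1 := by ext k; simp [heat]

lemma heat_add (s t : ℝ) : heat (s + t) = heat s * heat t := by
  ext k
  simp only [heat, Pi.mul_apply, ← Complex.ofReal_mul, ← Real.exp_add]
  congr 2; ring

lemma norm_heat_le {t : ℝ} (ht : 0 ≤ t) (k : ℤ) : ‖heat t k‖ ≤ 1 := by
  rw [heat, Complex.norm_real, Real.norm_eq_abs, abs_of_pos (Real.exp_pos _)]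
  exact Real.exp_le_one_iff.2 (by have : 0 ≤ 2 * Real.pi ^ 2 * (k : ℝ) ^ 2 * t := by positivity
                                  linarith)

namespace DyadicPartition

variable (P : DyadicPartition)

/-- The dyadic symbols on the integers. -/
def sym (j : ℕ) : FD := fun k => ((P.symbol j k : ℝ) : ℂ)

lemma χ_eq_zero {x : ℝ} (h : 4 / 3 < |x|) : P.χ x = 0 := by
  by_contra h'
  exact absurd (P.χ_supp (subset_tsupport _ h')) (not_le.2 h)

lemma ρ_eq_zero {x : ℝ} (h : |x| < 3 / 4 ∨ 8 / 3 < |x|) : P.ρ x = 0 := by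
  by_contra h'
  have := P.ρ_supp (subset_tsupport _ h')
  rcases h with h | h
  · exact absurd this.1 (not_le.2 h)
  · exact absurd this.2 (not_le.2 h)

lemma symbol_eq_zero_of_lt {j : ℕ} {x : ℝ} (h : 4 / 3 * 2 ^ j < |x|) : P.symbol j x = 0 := by
  cases j with
  | zero => exact P.χ_eq_zero (by simpa using h)
  | succ j =>
    refine P.ρ_eq_zero (Or.inr ?_)
    rw [abs_mul, abs_of_pos (by positivity), lt_inv_mul_iff₀ (by positivity)]
    rw [pow_succ] at h; linarith

lemma symbol_eq_zero_of_gt {j : ℕ} {x : ℝ} (h : |x| < 3 / 8 * 2 ^ (j + 1)) :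
    P.symbol (j + 1) x = 0 := by
  refine P.ρ_eq_zero (Or.inl ?_)
  rw [abs_mul, abs_of_pos (by positivity), inv_mul_lt_iff₀ (by positivity)]
  rw [pow_succ] at h; linarith

lemma symbol_nonneg (j : ℕ) (x : ℝ) : 0 ≤ P.symbol j x := by
  cases j with
  | zero => exact P.χ_nonneg x
  | succ j => exact P.ρ_nonneg _

lemma hasSum_symbol (x : ℝ) : HasSum (fun j => P.symbol j x) 1 := by
  have := (hasSum_nat_add_iff' (f := fun j => P.symbol j x) (g := 1) 1).1 (by
    simpa [symbol] using P.sum_eq_one x)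
  exact this

lemma symbol_le_one (j : ℕ) (x : ℝ) : P.symbol j x ≤ 1 :=
  le_hasSum (P.hasSum_symbol x) j fun i _ => P.symbol_nonneg i x

lemma sym_support {j : ℕ} {k : ℤ} (h : P.sym j k ≠ 0) :
    (|k| : ℝ) ≤ 4 / 3 * 2 ^ j ∧ (j ≠ 0 → 3 / 8 * 2 ^ j ≤ (|k| : ℝ)) := by
  have h' : P.symbol j k ≠ 0 := fun h0 => h (by simp [sym, h0])
  refine ⟨not_lt.1 fun h0 => h' (P.symbol_eq_zero_of_lt h0), fun hj => ?_⟩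
  obtain ⟨i, rfl⟩ := Nat.exists_eq_succ_of_ne_zero hj
  exact not_lt.1 fun h0 => h' (P.symbol_eq_zero_of_gt h0)

lemma sym_eq_zero_of_not_mem {j : ℕ} {k : ℤ} (h : k ∉ box (2 ^ j)) : P.sym j k = 0 := by
  by_contra h'
  have := (P.sym_support h').1
  rw [mem_box, not_le] at h
  have h2 : ((2 * (2 ^ j : ℕ) : ℤ) : ℝ) < ((|k| : ℤ) : ℝ) := by exact_mod_cast h
  push_cast at h2
  have : (0 : ℝ) < 2 ^ j := by positivity
  linarith

lemma sym_mul_sym_eq_zero {i j : ℕ} (h : i + 2 ≤ j) (k : ℤ) : P.sym i k * P.sym j k = 0 := by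
  by_contra h'
  have h1 := (P.sym_support (left_ne_zero_of_mul h')).1
  have h2 := (P.sym_support (right_ne_zero_of_mul h')).2 (by omega)
  have : (2 : ℝ) ^ i * 4 ≤ 2 ^ j := by
    calc (2 : ℝ) ^ i * 4 = 2 ^ (i + 2) := by ring
      _ ≤ 2 ^ j := pow_le_pow_right₀ (by norm_num) h
  have : (0 : ℝ) < 2 ^ i := by positivity
  linarith

/-- The neighbours of an index. -/
def nb (j : ℕ) : Finset ℕ := Finset.Icc (j - 1) (j + 1)

lemma mem_nb {i j : ℕ} : i ∈ nb j ↔ i ≤ j + 1 ∧ j ≤ i + 1 := by rw [nb, Finset.mem_Icc]; omega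

lemma card_nb_le (j : ℕ) : (nb j).card ≤ 3 := by rw [nb, Nat.card_Icc]; omega

lemma sym_mul_sym_of_not_mem_nb {i j : ℕ} (h : i ∉ nb j) : P.sym i * P.sym j = 0 := by
  ext k
  rw [mem_nb, not_and_or, not_le, not_le] at h
  rcases h with h | h
  · rw [Pi.mul_apply, mul_comm, P.sym_mul_sym_eq_zero (by omega)]; rfl
  · rw [Pi.mul_apply, P.sym_mul_sym_eq_zero (by omega)]; rfl

lemma sum_nb_sym_mul (j : ℕ) : (∑ i ∈ nb j, P.sym i) * P.sym j = P.sym j := by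
  ext k
  by_cases hk : P.sym j k = 0
  · simp [hk]
  have h1 : ∀ i ∉ nb j, P.symbol i k = 0 := by
    intro i hi
    have := congrFun (P.sym_mul_sym_of_not_mem_nb hi) k
    rw [Pi.mul_apply] at this
    have := (mul_eq_zero.1 this).resolve_right hk
    simpa [sym] using this
  have h2 : ∑ i ∈ nb j, P.symbol i k = 1 :=
    (hasSum_sum_of_ne_finset_zero h1).unique (P.hasSum_symbol k)
  rw [Pi.mul_apply, Finset.sum_apply]
  have : ∑ i ∈ nb j, P.sym i k = 1 := by
    simp only [sym]; rw [← Complex.ofReal_sum, h2, Complex.ofReal_one]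
  rw [this, one_mul]

/-- The damping factor of the heat flow at scale `2 ^ j`. -/
def _root_.ParaKPZ.damp (t : ℝ) (j : ℕ) : ℝ := ((1 + t * 4 ^ j) ^ 2)⁻¹

lemma _root_.ParaKPZ.damp_nonneg (t : ℝ) (j : ℕ) : 0 ≤ damp t j := by unfold damp; positivity

lemma _root_.ParaKPZ.symbolBound_one_of_norm_le {a : FD} {A : ℝ} (h0 : ∀ k, k ∉ box 1 → a k = 0)
    (h : ∀ k, ‖a k‖ ≤ A) : SymbolBound 1 a (4 * A) where
  supp := h0
  norm_le k := by linarith [h k, (norm_nonneg _).trans (h k)]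
  diff_le k := by
    simp only [Nat.cast_one, div_one]
    linarith [norm_sub_le (a (k - 1)) (a k), h k, h (k - 1), (norm_nonneg _).trans (h k)]
  diff_diff_le k := by
    simp only [Nat.cast_one, one_pow, div_one]
    linarith [norm_sub_le (a (k - 1 - 1) - a (k - 1)) (a (k - 1) - a k),
      norm_sub_le (a (k - 1)) (a k), norm_sub_le (a (k - 1 - 1)) (a (k - 1)),
      h k, h (k - 1), h (k - 1 - 1)]

/-- Uniform bounds of the dyadic symbols multiplied by the symbols of the heat flow and of its
derivative. -/
lemma exists_symbolBound (T : ℝ) (hT : 0 ≤ T) : ∃ A : ℝ, 0 ≤ A ∧ ∀ (j : ℕ) (t : ℝ), 0 ≤ t → t ≤ T →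
    SymbolBound (2 ^ j) (P.sym j * heat t) (A * damp t j) ∧
    SymbolBound (2 ^ j) (P.sym j * (dsym * heat t)) (A * 2 ^ j * damp t j) := by
  obtain ⟨A0, hA0, h0⟩ := exists_heat_symbolBound P.ρ_smooth P.ρ_supp
  obtain ⟨A1, hA1, h1⟩ := exists_heat_symbolBound (r := fun x => x * P.ρ x)
    (contDiff_id.mul P.ρ_smooth) ((tsupport_mul_subset_right).trans P.ρ_supp)
  have hd0 : ∀ t, 0 ≤ t → t ≤ T → 1 ≤ (1 + T) ^ 2 * damp t 0 := by
    intro t ht htT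
    rw [damp, pow_zero, mul_one, ← div_eq_mul_inv, one_le_div (by positivity)]
    gcongr
  have hsym1 : ∀ k, ‖P.sym 0 k‖ ≤ 1 := by
    intro k
    rw [sym, Complex.norm_real, Real.norm_eq_abs, abs_of_nonneg (P.symbol_nonneg _ _)]
    exact P.symbol_le_one _ _
  refine ⟨A0 + 4 * A1 + 4 * 14 * (1 + T) ^ 2, by positivity, fun j t ht htT => ?_⟩
  have hdj := damp_nonneg t j
  cases j with
  | zero =>
    have hd := hd0 t ht htT
    have e1 : ∀ k, ‖(P.sym 0 * heat t) k‖ ≤ 1 := by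
      intro k
      rw [Pi.mul_apply, norm_mul]
      exact mul_le_one₀ (hsym1 k) (norm_nonneg _) (norm_heat_le ht k)
    have e2 : ∀ k, ‖(P.sym 0 * (dsym * heat t)) k‖ ≤ 14 := by
      intro k
      by_cases hk : P.sym 0 k = 0
      · simp [hk]
      have hk1 := (P.sym_support hk).1
      rw [Pi.mul_apply, Pi.mul_apply, norm_mul, norm_mul]
      have hk2 : ‖dsym k‖ ≤ 14 := by
        simp only [dsym, norm_mul, Complex.norm_I, mul_one, Complex.norm_real, Complex.norm_intCast,
          Complex.norm_ofNat, Real.norm_eq_abs, abs_of_pos Real.pi_pos]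
        rw [pow_zero, mul_one] at hk1
        have := Real.pi_lt_d2
        nlinarith [abs_nonneg (k : ℝ), Real.pi_pos]
      calc ‖P.sym 0 k‖ * (‖dsym k‖ * ‖heat t k‖) ≤ 1 * (14 * 1) := by
            gcongr
            · exact hsym1 k
            · exact norm_heat_le ht k
        _ = 14 := by norm_num
    have aux : 4 * 14 ≤ (A0 + 4 * A1 + 4 * 14 * (1 + T) ^ 2) * damp t 0 := by
      have : 0 ≤ (A0 + 4 * A1) * damp t 0 := by positivity
      nlinarith
    refine ⟨(symbolBound_one_of_norm_le (fun k hk => ?_) e1).mono (by linarith),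
      (symbolBound_one_of_norm_le (fun k hk => ?_) e2).mono (by rw [pow_zero, mul_one]; exact aux)⟩
    · rw [Pi.mul_apply, P.sym_eq_zero_of_not_mem (by simpa using hk), zero_mul]
    · rw [Pi.mul_apply, P.sym_eq_zero_of_not_mem (by simpa using hk), zero_mul]
  | succ l =>
    have hx : 0 ≤ t * 4 ^ (l + 1) := by positivity
    have hN : 1 ≤ 2 ^ (l + 1) := Nat.one_le_two_pow
    have hb0 := h0 (2 ^ (l + 1)) hN _ hx
    have hb1 := (h1 (2 ^ (l + 1)) hN _ hx).smul (Real.pi * Complex.I * 2 ^ (l + 1))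
    have hexp : ∀ k : ℤ, -(2 * Real.pi ^ 2 * ((k : ℝ) / (2 ^ (l + 1) : ℕ)) ^ 2 * (t * 4 ^ (l + 1)))
        = -(2 * Real.pi ^ 2 * k ^ 2 * t) := by
      intro k
      have : ((2 : ℝ) ^ (l + 1)) ^ 2 = 4 ^ (l + 1) := by rw [← pow_mul, mul_comm, pow_mul]; norm_num
      push_cast
      rw [div_pow, this]
      field_simp
    have harg : ∀ k : ℤ, 2 * ((k : ℝ) / (2 ^ (l + 1) : ℕ)) = ((2 : ℝ) ^ l)⁻¹ * k := by
      intro k; push_cast; rw [pow_succ]; field_simp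
    constructor
    · have e : P.sym (l + 1) * heat t = fun k : ℤ => ((P.ρ (2 * (k / (2 ^ (l + 1) : ℕ)))
          * Real.exp (-(2 * Real.pi ^ 2 * (k / (2 ^ (l + 1) : ℕ)) ^ 2 * (t * 4 ^ (l + 1)))) : ℝ) : ℂ) := by
        ext k
        rw [hexp, harg, Pi.mul_apply, sym, heat, Complex.ofReal_mul]
        rfl
      rw [e]
      refine hb0.mono ?_
      rw [← damp]
      gcongr
      have : 0 ≤ 4 * A1 + 4 * 14 * (1 + T) ^ 2 := by positivity
      linarith
    · have e : P.sym (l + 1) * (dsym * heat t) = (Real.pi * Complex.I * 2 ^ (l + 1) : ℂ) •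
          fun k : ℤ => (((2 * (k / (2 ^ (l + 1) : ℕ))) * P.ρ (2 * (k / (2 ^ (l + 1) : ℕ)))
          * Real.exp (-(2 * Real.pi ^ 2 * (k / (2 ^ (l + 1) : ℕ)) ^ 2 * (t * 4 ^ (l + 1)))) : ℝ) : ℂ) := by
        ext k
        rw [Pi.smul_apply, hexp, Pi.mul_apply, Pi.mul_apply, sym, heat, Complex.ofReal_mul,
          Complex.ofReal_mul, dsym]
        have : P.symbol (l + 1) k = P.ρ (2 * (k / (2 ^ (l + 1) : ℕ))) := by rw [harg]; rfl
        rw [this]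
        push_cast
        rw [smul_eq_mul]
        field_simp
      rw [e]
      refine hb1.mono ?_
      rw [← damp]
      simp only [norm_mul, Complex.norm_I, mul_one, Complex.norm_real, norm_pow,
          Complex.norm_ofNat, Real.norm_eq_abs, abs_of_pos Real.pi_pos]
      have h4 := Real.pi_le_four
      calc Real.pi * 2 ^ (l + 1) * (A1 * damp t (l + 1))
          ≤ 4 * 2 ^ (l + 1) * (A1 * damp t (l + 1)) := by gcongr
        _ = 4 * A1 * 2 ^ (l + 1) * damp t (l + 1) := by ring
        _ ≤ _ := by
          gcongr
          have : 0 ≤ A0 + 4 * 14 * (1 + T) ^ 2 := by positivity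
          linarith

end DyadicPartition

/-! ### Dyadic weights -/

/-- The dyadic weight `2 ^ (- a j)`. -/
def dy (a : ℝ) (j : ℕ) : ℝ := ((2 : ℝ) ^ (-a)) ^ j

lemma dy_pos (a : ℝ) (j : ℕ) : 0 < dy a j := by unfold dy; positivity

lemma dy_nonneg (a : ℝ) (j : ℕ) : 0 ≤ dy a j := (dy_pos a j).le

lemma dy_eq (a : ℝ) (j : ℕ) : dy a j = (2 : ℝ) ^ (-a * j) := by
  rw [dy, Real.rpow_mul (by norm_num), Real.rpow_natCast]

lemma dy_add (a b : ℝ) (j : ℕ) : dy (a + b) j = dy a j * dy b j := by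
  rw [dy, dy, dy, ← mul_pow, ← Real.rpow_add (by norm_num), neg_add]

lemma dy_zero (j : ℕ) : dy 0 j = 1 := by simp [dy]

lemma dy_neg (a : ℝ) (j : ℕ) : dy (-a) j = (dy a j)⁻¹ := by
  refine eq_inv_of_mul_eq_one_left ?_
  rw [← dy_add, neg_add_cancel, dy_zero]

lemma dy_mono {a b : ℝ} (h : a ≤ b) (j : ℕ) : dy b j ≤ dy a j := by unfold dy; gcongr; norm_num

lemma dy_add_index (a : ℝ) (i j : ℕ) : dy a (i + j) = dy a i * dy a j := pow_add _ _ _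

lemma dy_neg_one (j : ℕ) : dy (-1) j = 2 ^ j := by simp [dy]

lemma dy_one (j : ℕ) : dy 1 j = ((2 : ℝ) ^ j)⁻¹ := by rw [← dy_neg_one, ← dy_neg, neg_neg]

lemma dy_rpow (a θ : ℝ) (j : ℕ) : dy a j ^ θ = dy (a * θ) j := by
  rw [dy_eq, dy_eq, ← Real.rpow_mul (by norm_num)]; congr 1; ring

lemma four_pow_eq_dy (j : ℕ) : (4 : ℝ) ^ j = dy (-2) j := by rw [dy, neg_neg]; norm_num

/-- The constant needed to shift a dyadic weight by at most `p`. -/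
def shiftC (a : ℝ) (p : ℕ) : ℝ := ((2 : ℝ) ^ |a|) ^ p

lemma shiftC_pos (a : ℝ) (p : ℕ) : 0 < shiftC a p := by unfold shiftC; positivity

lemma one_le_shiftC (a : ℝ) (p : ℕ) : 1 ≤ shiftC a p :=
  one_le_pow₀ (Real.one_le_rpow (by norm_num) (abs_nonneg a))

lemma dy_le_shift (a : ℝ) {i j p : ℕ} (h1 : i ≤ j + p) (h2 : j ≤ i + p) :
    dy a i ≤ shiftC a p * dy a j := by
  have h2' : (0 : ℝ) < 2 := by norm_num
  rw [dy_eq, dy_eq, shiftC, ← Real.rpow_natCast, ← Real.rpow_mul h2'.le, ← Real.rpow_add h2']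
  apply Real.rpow_le_rpow_of_exponent_le (by norm_num)
  have h1' : (i : ℝ) ≤ j + p := by exact_mod_cast h1
  have h3' : (j : ℝ) ≤ i + p := by exact_mod_cast h2
  rcases abs_cases a with ⟨h, h'⟩ | ⟨h, h'⟩ <;> rw [h] <;> nlinarith

lemma summable_dy {a : ℝ} (ha : 0 < a) : Summable (dy a) :=
  summable_geometric_of_lt_one (by positivity)
    (Real.rpow_lt_one_of_one_lt_of_neg (by norm_num) (by linarith))

/-- The sum of the dyadic weights. -/
def dyS (a : ℝ) : ℝ := ∑' j, dy a j

lemma dyS_nonneg (a : ℝ) : 0 ≤ dyS a := tsum_nonneg fun j => dy_nonneg a j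

lemma sum_dy_le {a : ℝ} (ha : 0 < a) (s : Finset ℕ) : ∑ j ∈ s, dy a j ≤ dyS a :=
  (summable_dy ha).sum_le_tsum s fun j _ => dy_nonneg a j

lemma sum_range_dy_le_of_neg {a : ℝ} (ha : a < 0) (n : ℕ) :
    ∑ j ∈ Finset.range (n + 1), dy a j ≤ dyS (-a) * dy a n := by
  rw [← Finset.sum_range_reflect]
  have : ∀ j ∈ Finset.range (n + 1), dy a (n + 1 - 1 - j) = dy (-a) j * dy a n := by
    intro j hj
    rw [Finset.mem_range] at hj
    rw [dy_neg, eq_inv_mul_iff_mul_eq₀ (dy_pos a j).ne', ← dy_add_index]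
    congr 1; omega
  rw [Finset.sum_congr rfl this, ← Finset.sum_mul]
  exact mul_le_mul_of_nonneg_right (sum_dy_le (by linarith) _) (dy_nonneg _ _)

namespace DyadicPartition

variable (P : DyadicPartition)

/-! ### Blocks of families of Fourier coefficients -/

/-- The Littlewood--Paley blocks. -/
def blk (j : ℕ) : FD →ₗ[ℂ] CT where
  toFun c := poly (box (2 ^ j)) (P.sym j * c)
  map_add' c d := by rw [mul_add, map_add]
  map_smul' a c := by rw [mul_smul_comm, map_smul]; rfl

lemma blk_def (j : ℕ) (c : FD) : P.blk j c = poly (box (2 ^ j)) (P.sym j * c) := rfl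

lemma coef_blk (j : ℕ) (c : FD) : coef (P.blk j c) = P.sym j * c := by
  ext k
  rw [blk_def, coef_poly]
  split_ifs with h
  · rfl
  · rw [Pi.mul_apply, P.sym_eq_zero_of_not_mem h, zero_mul]

lemma poly_box_sym {j M : ℕ} (h : 2 ^ j ≤ M) (c : FD) :
    poly (box M) (P.sym j * c) = poly (box (2 ^ j)) (P.sym j * c) := by
  refine (poly_subset (box_mono h) fun k _ hk => ?_).symm
  rw [Pi.mul_apply, P.sym_eq_zero_of_not_mem hk, zero_mul]

lemma specIn_blk (j : ℕ) (c : FD) : SpecIn (2 ^ j) (P.blk j c) := ⟨_, rfl⟩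

lemma blk_multiplier (j : ℕ) (h c : FD) : P.blk j (h * c)
    = ∑ i ∈ nb j, poly (box (2 ^ i)) ((P.sym i * h) * coef (P.blk j c)) := by
  have : ∀ i ∈ nb j, poly (box (2 ^ i)) ((P.sym i * h) * coef (P.blk j c))
      = poly (box (2 ^ (j + 1))) (P.sym i * (P.sym j * (h * c))) := by
    intro i hi
    rw [coef_blk, P.poly_box_sym (Nat.pow_le_pow_right (by norm_num) (mem_nb.1 hi).1)]
    congr 1; ring
  rw [Finset.sum_congr rfl this, ← map_sum, ← Finset.sum_mul, ← mul_assoc, sum_nb_sym_mul,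
    P.poly_box_sym (Nat.pow_le_pow_right (by norm_num) (by omega))]
  rfl

lemma norm_sym_mul_le (j : ℕ) (c : FD) (k : ℤ) : ‖P.sym j k * c k‖ ≤ ‖P.blk j c‖ := by
  have := norm_coef_le (P.blk j c) k
  rwa [coef_blk] at this

lemma hasSum_sym_mul (c : FD) (k : ℤ) : HasSum (fun j => P.sym j k * c k) (c k) := by
  have h : HasSum (fun j => P.sym j k) 1 := by
    have := P.hasSum_symbol k
    have h2 := Complex.hasSum_ofReal.2 this
    rwa [Complex.ofReal_one] at h2
  simpa using h.mul_right (c k)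

lemma damp_le_of_nb {t : ℝ} (ht : 0 ≤ t) {i j : ℕ} (h : j ≤ i + 1) : damp t i ≤ 16 * damp t j := by
  have h1 : (4 : ℝ) ^ j ≤ 4 * 4 ^ i := by
    calc (4 : ℝ) ^ j ≤ 4 ^ (i + 1) := pow_le_pow_right₀ (by norm_num) h
      _ = _ := by ring
  have h2 : 1 + t * 4 ^ j ≤ 4 * (1 + t * 4 ^ i) := by nlinarith
  have h3 : (1 + t * 4 ^ j) ^ 2 ≤ 16 * (1 + t * 4 ^ i) ^ 2 := by
    calc (1 + t * 4 ^ j) ^ 2 ≤ (4 * (1 + t * 4 ^ i)) ^ 2 := by gcongr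
      _ = _ := by ring
  unfold damp
  rw [← div_eq_mul_inv, inv_le_comm₀ (by positivity) (by positivity), inv_div,
    div_le_iff₀ (by norm_num)]
  linarith

lemma damp_zero (j : ℕ) : damp 0 j = 1 := by simp [damp]

lemma damp_le_one {t : ℝ} (ht : 0 ≤ t) (j : ℕ) : damp t j ≤ 1 := by
  unfold damp
  apply inv_le_one_of_one_le₀
  have : 0 ≤ t * 4 ^ j := by positivity
  nlinarith

lemma damp_le {t θ : ℝ} (ht : 0 < t) (hθ : 0 ≤ θ) (hθ2 : θ ≤ 2) (j : ℕ) :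
    damp t j ≤ t ^ (-θ) * dy (2 * θ) j := by
  have hx : 0 < t * 4 ^ j := by positivity
  have h1 : (t * 4 ^ j) ^ θ ≤ (1 + t * 4 ^ j) ^ 2 := by
    calc (t * 4 ^ j) ^ θ ≤ (1 + t * 4 ^ j) ^ θ := by gcongr; linarith
      _ ≤ (1 + t * 4 ^ j) ^ (2 : ℝ) := Real.rpow_le_rpow_of_exponent_le (by linarith) hθ2
      _ = _ := by norm_cast
  have h2 : t ^ (-θ) * dy (2 * θ) j = ((t * 4 ^ j) ^ θ)⁻¹ := by
    rw [Real.mul_rpow ht.le (by positivity), mul_inv, Real.rpow_neg ht.le, four_pow_eq_dy,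
      dy_rpow, ← dy_neg]
    congr 2; ring
  rw [h2, damp]
  exact inv_anti₀ (by positivity) h1

/-- Bounds of the heat semigroup and of its derivative on blocks. -/
lemma exists_norm_blk_heat_le (T : ℝ) (hT : 0 ≤ T) : ∃ C : ℝ, 0 ≤ C ∧
    ∀ (j : ℕ) (t : ℝ) (c : FD), 0 ≤ t → t ≤ T →
      ‖P.blk j (heat t * c)‖ ≤ C * damp t j * ‖P.blk j c‖ ∧
      ‖P.blk j (dsym * heat t * c)‖ ≤ C * 2 ^ j * damp t j * ‖P.blk j c‖ := by
  obtain ⟨A, hA, h⟩ := P.exists_symbolBound T hT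
  refine ⟨3 * (8 * A * 2 * 16), by positivity, fun j t c ht htT => ?_⟩
  have hd := damp_nonneg t j
  constructor
  · rw [blk_multiplier]
    refine (norm_sum_le_of_le _ fun i hi => ((h i t ht htT).1).norm_poly_le Nat.one_le_two_pow _).trans ?_
    refine (Finset.sum_le_card_nsmul _ _ (8 * A * 16 * damp t j * ‖P.blk j c‖) ?_).trans ?_
    · intro i hi
      have := damp_le_of_nb ht (mem_nb.1 hi).2
      calc 8 * (A * damp t i) * ‖P.blk j c‖ ≤ 8 * (A * (16 * damp t j)) * ‖P.blk j c‖ := by gcongr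
        _ = _ := by ring
    · rw [nsmul_eq_mul]
      have h3 : ((nb j).card : ℝ) ≤ 3 := by exact_mod_cast card_nb_le j
      calc _ ≤ 3 * (8 * A * 16 * damp t j * ‖P.blk j c‖) := by gcongr
        _ ≤ 3 * (8 * A * 16 * damp t j * ‖P.blk j c‖) * 2 := le_mul_of_one_le_right (by positivity) (by norm_num)
        _ = _ := by ring
  · rw [blk_multiplier]
    refine (norm_sum_le_of_le _ fun i hi => ((h i t ht htT).2).norm_poly_le Nat.one_le_two_pow _).trans ?_
    refine (Finset.sum_le_card_nsmul _ _ (8 * A * 2 * 16 * 2 ^ j * damp t j * ‖P.blk j c‖) ?_).trans ?_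
    · intro i hi
      have h1 := damp_le_of_nb ht (mem_nb.1 hi).2
      have h2 : (2 : ℝ) ^ i ≤ 2 * 2 ^ j := by
        calc (2 : ℝ) ^ i ≤ 2 ^ (j + 1) := pow_le_pow_right₀ (by norm_num) (mem_nb.1 hi).1
          _ = _ := by ring
      have h3 := damp_nonneg t i
      calc 8 * (A * 2 ^ i * damp t i) * ‖P.blk j c‖
          ≤ 8 * (A * (2 * 2 ^ j) * (16 * damp t j)) * ‖P.blk j c‖ := by gcongr
        _ = _ := by ring
    · rw [nsmul_eq_mul]
      have h3 : ((nb j).card : ℝ) ≤ 3 := by exact_mod_cast card_nb_le j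
      calc _ ≤ 3 * (8 * A * 2 * 16 * 2 ^ j * damp t j * ‖P.blk j c‖) := by gcongr
        _ = _ := by ring

lemma hasDerivAt_heat (k : ℤ) (t : ℝ) :
    HasDerivAt (fun t => heat t k) (1 / 2 * (dsym k * dsym k) * heat t k) t := by
  have h1 : HasDerivAt (fun t : ℝ => Real.exp (-(2 * Real.pi ^ 2 * k ^ 2 * t)))
      (-(2 * Real.pi ^ 2 * k ^ 2) * Real.exp (-(2 * Real.pi ^ 2 * k ^ 2 * t))) t := by
    have := (((hasDerivAt_id t).const_mul (2 * Real.pi ^ 2 * (k : ℝ) ^ 2)).neg).exp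
    refine this.congr_deriv ?_
    simp; ring
  refine h1.ofReal_comp.congr_deriv ?_
  simp only [heat, dsym]
  push_cast
  linear_combination (-2 * Real.pi ^ 2 * k ^ 2 *
    Complex.exp (-(2 * Real.pi ^ 2 * k ^ 2 * t))) * Complex.I_sq

/-- Time regularity of the heat semigroup on blocks. -/
lemma exists_norm_blk_heat_sub_le (T : ℝ) (hT : 0 ≤ T) : ∃ C : ℝ, 0 ≤ C ∧
    ∀ (j : ℕ) (t : ℝ) (c : FD), 0 ≤ t → t ≤ T →
      ‖P.blk j ((heat t - 1) * c)‖ ≤ C * ‖P.blk j c‖ ∧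
      ‖P.blk j ((heat t - 1) * c)‖ ≤ C * (t * 4 ^ j) * ‖P.blk j c‖ := by
  obtain ⟨C, hC, h⟩ := P.exists_norm_blk_heat_le T hT
  refine ⟨C + 1 + C * C, by positivity, fun j t c ht htT => ⟨?_, ?_⟩⟩
  · rw [sub_mul, one_mul, map_sub]
    have h1 := (h j t c ht htT).1
    have h2 := damp_le_one ht j
    calc _ ≤ ‖P.blk j (heat t * c)‖ + ‖P.blk j c‖ := norm_sub_le _ _
      _ ≤ C * 1 * ‖P.blk j c‖ + ‖P.blk j c‖ := by gcongr; exact h1.trans (by gcongr)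
      _ ≤ _ := by nlinarith [norm_nonneg (P.blk j c), mul_nonneg (mul_nonneg hC hC) (norm_nonneg (P.blk j c))]
  · have hd : ∀ s, HasDerivAt (fun s => P.blk j (heat s * c))
        (P.blk j ((1 / 2 : ℂ) • (dsym * heat s * (dsym * c)))) s := by
      intro s
      simp only [blk_def, poly_def]
      refine HasDerivAt.fun_sum fun k _ => ?_
      have := (((hasDerivAt_heat k s).mul_const (c k)).const_mul (P.sym j k)).smul_const (chr k)
      refine this.congr_deriv ?_
      congr 1
      simp only [Pi.mul_apply, Pi.smul_apply, smul_eq_mul]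
      ring
    have hb : ∀ s, 0 ≤ s → s ≤ T → ‖P.blk j ((1 / 2 : ℂ) • (dsym * heat s * (dsym * c)))‖
        ≤ C * C * 4 ^ j * ‖P.blk j c‖ := by
      intro s hs hsT
      have h1 := (h j s (dsym * c) hs hsT).2
      have h2 := (h j 0 c le_rfl hT).2
      rw [heat_zero, mul_one, damp_zero, mul_one] at h2
      have h3 := damp_le_one hs j
      have h0 := damp_nonneg s j
      rw [map_smul, norm_smul]
      have e : ‖(1 / 2 : ℂ)‖ ≤ 1 := by norm_num
      have e4 : (2 : ℝ) ^ j * 2 ^ j = 4 ^ j := by rw [← mul_pow]; norm_num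
      calc _ ≤ 1 * (C * 2 ^ j * 1 * (C * 2 ^ j * ‖P.blk j c‖)) := by
            gcongr; exact h1.trans (by gcongr)
        _ = C * C * (2 ^ j * 2 ^ j) * ‖P.blk j c‖ := by ring
        _ = _ := by rw [e4]
    have := (convex_Icc 0 T).norm_image_sub_le_of_norm_hasDerivWithin_le
      (fun s _ => (hd s).hasDerivWithinAt) (fun s hs => hb s hs.1 hs.2) ⟨le_rfl, hT⟩ ⟨ht, htT⟩
    rw [heat_zero, one_mul, ← map_sub, sub_zero, Real.norm_eq_abs, abs_of_nonneg ht] at this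
    rw [sub_mul, one_mul]
    refine this.trans ?_
    have hz : 0 ≤ t * 4 ^ j * ‖P.blk j c‖ := by positivity
    nlinarith

/-- Blocks of continuous functions are bounded. -/
lemma exists_norm_blk_coef_le : ∃ C : ℝ, 0 ≤ C ∧ ∀ (j : ℕ) (f : CT),
    ‖P.blk j (coef f)‖ ≤ C * ‖f‖ := by
  obtain ⟨A, hA, h⟩ := P.exists_symbolBound 0 le_rfl
  refine ⟨8 * A, by positivity, fun j f => ?_⟩
  have := ((h j 0 le_rfl le_rfl).1).norm_poly_le Nat.one_le_two_pow f
  rw [heat_zero, mul_one, damp_zero, mul_one] at this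
  exact this

/-! ### Bounds in Besov spaces -/

/-- `‖c‖_a ≤ K`, up to the normalisation of the blocks. -/
def Bd (a : ℝ) (c : FD) (K : ℝ) : Prop := ∀ j, ‖P.blk j c‖ ≤ K * dy a j

/-- The little Besov space. -/
def Lit (a : ℝ) (c : FD) : Prop := ∀ ε : ℝ, 0 < ε → ∃ n, ∀ j ≥ n, ‖P.blk j c‖ ≤ ε * dy a j

variable {P} {a b : ℝ} {c d : FD} {K L : ℝ}

lemma Bd.nonneg (h : P.Bd a c K) : 0 ≤ K := by
  have := (norm_nonneg _).trans (h 0)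
  simpa [dy] using this

lemma Bd.zero (a : ℝ) : P.Bd a 0 0 := fun j => by simp

lemma Bd.add (h : P.Bd a c K) (h' : P.Bd a d L) : P.Bd a (c + d) (K + L) := fun j => by
  rw [map_add, add_mul]; exact (norm_add_le _ _).trans (add_le_add (h j) (h' j))

lemma Bd.neg (h : P.Bd a c K) : P.Bd a (-c) K := fun j => by rw [map_neg, norm_neg]; exact h j

lemma Bd.sub (h : P.Bd a c K) (h' : P.Bd a d L) : P.Bd a (c - d) (K + L) := by
  rw [sub_eq_add_neg]; exact h.add h'.neg

lemma Bd.smul (h : P.Bd a c K) (z : ℂ) : P.Bd a (z • c) (‖z‖ * K) := fun j => by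
  rw [map_smul, norm_smul, mul_assoc]; exact mul_le_mul_of_nonneg_left (h j) (norm_nonneg z)

lemma Bd.mono (h : P.Bd a c K) (hK : K ≤ L) : P.Bd a c L := fun j =>
  (h j).trans (mul_le_mul_of_nonneg_right hK (dy_nonneg _ _))

lemma Bd.exp_mono (h : P.Bd a c K) (hab : b ≤ a) : P.Bd b c K := fun j =>
  (h j).trans (mul_le_mul_of_nonneg_left (dy_mono hab j) h.nonneg)

lemma Bd.interp (h : P.Bd a c K) (h' : P.Bd b c L) {θ : ℝ} (h0 : 0 ≤ θ) (h1 : θ ≤ 1) :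
    P.Bd ((1 - θ) * a + θ * b) c (K ^ (1 - θ) * L ^ θ) := fun j => by
  have hK := h.nonneg
  have hL := h'.nonneg
  have e : ‖P.blk j c‖ = ‖P.blk j c‖ ^ (1 - θ) * ‖P.blk j c‖ ^ θ := by
    rcases (norm_nonneg (P.blk j c)).eq_or_lt with h2 | h2
    · rw [← h2]
      rcases h0.eq_or_lt with rfl | h3
      · simp
      · rw [Real.zero_rpow h3.ne', mul_zero]
    · rw [← Real.rpow_add h2]; simp
  rw [e, dy_add, show (1 - θ) * a = a * (1 - θ) by ring, show θ * b = b * θ by ring, ← dy_rpow,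
    ← dy_rpow]
  calc _ ≤ (K * dy a j) ^ (1 - θ) * (L * dy b j) ^ θ := by
        have hx := dy_nonneg a j
        have hy := dy_nonneg b j
        have := h j
        have := h' j
        have : 0 ≤ 1 - θ := by linarith
        gcongr
    _ = _ := by rw [Real.mul_rpow hK (dy_nonneg _ _), Real.mul_rpow hL (dy_nonneg _ _)]; ring

lemma Bd.lit (h : P.Bd a c K) (hab : b < a) : P.Lit b c := by
  intro ε hε
  have hs : Tendsto (fun j => K * dy (a - b) j) atTop (𝓝 0) := by
    have := (summable_dy (a := a - b) (by linarith)).tendsto_atTop_zero.const_mul K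
    simpa using this
  obtain ⟨n, hn⟩ := eventually_atTop.1 (hs.eventually_le_const hε)
  refine ⟨n, fun j hj => (h j).trans ?_⟩
  have : dy a j = dy (a - b) j * dy b j := by rw [← dy_add, sub_add_cancel]
  rw [this, ← mul_assoc]
  exact mul_le_mul_of_nonneg_right (hn j hj) (dy_nonneg _ _)

lemma Lit.exists_bd (h : P.Lit a c) : ∃ K, P.Bd a c K := by
  obtain ⟨n, hn⟩ := h 1 one_pos
  refine ⟨1 + ∑ j ∈ Finset.range n, ‖P.blk j c‖ / dy a j, fun j => ?_⟩
  have hS : ∀ i ∈ Finset.range n, 0 ≤ ‖P.blk i c‖ / dy a i := fun i _ =>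
    div_nonneg (norm_nonneg _) (dy_nonneg _ _)
  rcases le_or_gt n j with hj | hj
  · refine (hn j hj).trans (mul_le_mul_of_nonneg_right ?_ (dy_nonneg _ _))
    linarith [Finset.sum_nonneg hS]
  · have := Finset.single_le_sum hS (Finset.mem_range.2 hj)
    calc ‖P.blk j c‖ = ‖P.blk j c‖ / dy a j * dy a j := by rw [div_mul_cancel₀ _ (dy_pos a j).ne']
      _ ≤ _ := mul_le_mul_of_nonneg_right (by linarith) (dy_nonneg _ _)

lemma Lit.add (h : P.Lit a c) (h' : P.Lit a d) : P.Lit a (c + d) := by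
  intro ε hε
  obtain ⟨n, hn⟩ := h (ε / 2) (by positivity)
  obtain ⟨m, hm⟩ := h' (ε / 2) (by positivity)
  refine ⟨max n m, fun j hj => ?_⟩
  rw [map_add]
  refine (norm_add_le _ _).trans ?_
  linarith [hn j (le_of_max_le_left hj), hm j (le_of_max_le_right hj)]

lemma Lit.exp_mono (h : P.Lit a c) (hab : b ≤ a) : P.Lit b c := fun ε hε => by
  obtain ⟨n, hn⟩ := h ε hε
  exact ⟨n, fun j hj => (hn j hj).trans (mul_le_mul_of_nonneg_left (dy_mono hab j) hε.le)⟩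

/-- Limits in norm of elements of the little Besov space belong to it. -/
lemma Lit.of_approx (h : ∀ ε : ℝ, 0 < ε → ∃ d, P.Lit a d ∧ P.Bd a (c - d) ε) : P.Lit a c := by
  intro ε hε
  obtain ⟨d, hd, hcd⟩ := h (ε / 2) (by positivity)
  obtain ⟨n, hn⟩ := hd (ε / 2) (by positivity)
  refine ⟨n, fun j hj => ?_⟩
  have : c = (c - d) + d := by abel
  rw [this, map_add]
  refine (norm_add_le _ _).trans ?_
  linarith [hcd j, hn j hj]

/-- Polynomial growth of the coefficients. -/
lemma Bd.norm_coef_le (h : P.Bd a c K) (k : ℤ) :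
    ‖c k‖ ≤ dyS 1 * K * (3 * (1 + |(k : ℝ)|)) ^ ⌈1 + |a|⌉₊ := by
  have hK := h.nonneg
  set p := ⌈1 + |a|⌉₊
  set B : ℝ := 3 * (1 + |(k : ℝ)|)
  have hB : 1 ≤ B := by have := abs_nonneg (k : ℝ); simp only [B]; linarith
  have key : ∀ j, ‖P.sym j k * c k‖ ≤ dy 1 j * (K * B ^ p) := by
    intro j
    by_cases hk : P.sym j k = 0
    · rw [hk, zero_mul, norm_zero]
      have := dy_nonneg 1 j
      positivity
    refine (P.norm_sym_mul_le j c k).trans ((h j).trans ?_)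
    have h2 : (2 : ℝ) ^ j ≤ B := by
      rcases eq_or_ne j 0 with rfl | hj
      · simpa using hB
      · have := (P.sym_support hk).2 hj
        simp only [B]; linarith [abs_nonneg (k : ℝ)]
    have h3 : dy a j ≤ dy 1 j * B ^ p := by
      have e : dy a j = dy 1 j * dy (a - 1) j := by rw [← dy_add]; congr 1; ring
      rw [e]
      refine mul_le_mul_of_nonneg_left ?_ (dy_nonneg _ _)
      have : -(p : ℝ) ≤ a - 1 := by
        have h5 := Nat.le_ceil (1 + |a|)
        have h6 := neg_abs_le a
        simp only [p]; linarith
      calc dy (a - 1) j ≤ dy (-p) j := dy_mono this j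
        _ = (2 ^ j) ^ p := by
          rw [← dy_neg_one, dy, dy, ← pow_mul, neg_neg, neg_neg, Real.rpow_one, Real.rpow_natCast,
            ← pow_mul, mul_comm]
        _ ≤ B ^ p := by gcongr
    calc K * dy a j ≤ K * (dy 1 j * B ^ p) := by gcongr
      _ = _ := by ring
  have hs := (summable_dy one_pos).mul_right (K * B ^ p)
  rw [← (P.hasSum_sym_mul c k).tsum_eq]
  refine (tsum_of_norm_bounded hs.hasSum key).trans (le_of_eq ?_)
  rw [tsum_mul_right, dyS]; ring

lemma eq_zero_of_bd (h : ∀ ε : ℝ, 0 < ε → P.Bd a c ε) : c = 0 := by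
  ext k
  rw [← (P.hasSum_sym_mul c k).tsum_eq]
  have : ∀ j, P.sym j k * c k = 0 := by
    intro j
    have h0 : P.blk j c = 0 := by
      rw [← norm_le_zero_iff]
      refine le_of_forall_pos_le_add fun ε hε => ?_
      have := h (ε / dy a j) (div_pos hε (dy_pos _ _)) j
      rwa [div_mul_cancel₀ _ (dy_pos a j).ne', ← zero_add ε] at this
    have := P.norm_sym_mul_le j c k
    rw [h0, norm_zero] at this
    exact norm_le_zero_iff.1 this
  simp [this]

/-- Bounds are closed under convergence of the coefficients. -/
lemma Bd.of_tendsto {ι : Type*} {l : Filter ι} [l.NeBot] {u : ι → FD}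
    (hu : ∀ k, Tendsto (fun i => u i k) l (𝓝 (c k))) (h : ∀ᶠ i in l, P.Bd a (u i) K) :
    P.Bd a c K := by
  intro j
  have : Tendsto (fun i => P.blk j (u i)) l (𝓝 (P.blk j c)) := by
    simp only [blk_def, poly_def]
    refine tendsto_finsetSum _ fun k _ => ?_
    exact ((hu k).const_mul (P.sym j k)).smul_const (chr k)
  exact le_of_tendsto this.norm (h.mono fun i hi => hi j)

variable (P)

lemma exists_bd_deriv (a : ℝ) : ∃ C : ℝ, 0 ≤ C ∧ ∀ (c : FD) (K : ℝ), P.Bd a c K →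
    P.Bd (a - 1) (dsym * c) (C * K) := by
  obtain ⟨C, hC, h⟩ := P.exists_norm_blk_heat_le 0 le_rfl
  refine ⟨C, hC, fun c K hc j => ?_⟩
  have h2 := (h j 0 c le_rfl le_rfl).2
  rw [heat_zero, mul_one, damp_zero, mul_one] at h2
  refine h2.trans ?_
  rw [sub_eq_add_neg, dy_add, dy_neg_one]
  calc C * 2 ^ j * ‖P.blk j c‖ ≤ C * 2 ^ j * (K * dy a j) := by gcongr; exact hc j
    _ = _ := by ring

lemma lit_deriv {a : ℝ} {c : FD} (h : P.Lit a c) : P.Lit (a - 1) (dsym * c) := by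
  obtain ⟨C, hC, hd⟩ := P.exists_norm_blk_heat_le 0 le_rfl
  intro ε hε
  obtain ⟨n, hn⟩ := h (ε / (C + 1)) (by positivity)
  refine ⟨n, fun j hj => ?_⟩
  have h2 := (hd j 0 c le_rfl le_rfl).2
  rw [heat_zero, mul_one, damp_zero, mul_one] at h2
  refine h2.trans ?_
  rw [sub_eq_add_neg, dy_add, dy_neg_one]
  have := dy_nonneg a j
  calc C * 2 ^ j * ‖P.blk j c‖ ≤ (C + 1) * 2 ^ j * (ε / (C + 1) * dy a j) := by
        gcongr
        · linarith
        · exact hn j hj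
    _ = _ := by field_simp

/-- Smoothing by the heat semigroup. -/
lemma exists_bd_heat (T : ℝ) (hT : 0 ≤ T) : ∃ C : ℝ, 0 ≤ C ∧
    ∀ (a θ t : ℝ) (c : FD) (K : ℝ), 0 ≤ θ → θ ≤ 2 → 0 < t → t ≤ T → P.Bd a c K →
      P.Bd (a + 2 * θ) (heat t * c) (C * t ^ (-θ) * K) := by
  obtain ⟨C, hC, h⟩ := P.exists_norm_blk_heat_le T hT
  refine ⟨C, hC, fun a θ t c K hθ hθ2 ht htT hc j => ?_⟩
  refine (h j t c ht.le htT).1.trans ?_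
  have h1 := damp_le ht hθ hθ2 j
  have h2 := damp_nonneg t j
  have := hc.nonneg
  have h3 := h2.trans h1
  rw [dy_add]
  calc C * damp t j * ‖P.blk j c‖ ≤ C * (t ^ (-θ) * dy (2 * θ) j) * (K * dy a j) := by
        gcongr; exact hc j
    _ = _ := by ring

lemma exists_bd_heat_zero (T : ℝ) (hT : 0 ≤ T) : ∃ C : ℝ, 0 ≤ C ∧
    ∀ (a t : ℝ) (c : FD) (K : ℝ), 0 ≤ t → t ≤ T → P.Bd a c K → P.Bd a (heat t * c) (C * K) := by
  obtain ⟨C, hC, h⟩ := P.exists_norm_blk_heat_le T hT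
  refine ⟨C, hC, fun a t c K ht htT hc j => ?_⟩
  refine (h j t c ht htT).1.trans ?_
  have := hc.nonneg
  calc C * damp t j * ‖P.blk j c‖ ≤ C * 1 * (K * dy a j) := by
        gcongr
        · exact damp_le_one ht j
        · exact hc j
    _ = _ := by ring

/-- Time regularity of the heat semigroup. -/
lemma exists_bd_heat_sub (T : ℝ) (hT : 0 ≤ T) : ∃ C : ℝ, 0 ≤ C ∧
    ∀ (a δ t : ℝ) (c : FD) (K : ℝ), 0 ≤ δ → δ ≤ 1 → 0 ≤ t → t ≤ T → P.Bd a c K →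
      P.Bd (a - 2 * δ) ((heat t - 1) * c) (C * t ^ δ * K) := by
  obtain ⟨C, hC, h⟩ := P.exists_norm_blk_heat_sub_le T hT
  refine ⟨C, hC, fun a δ t c K hδ hδ1 ht htT hc j => ?_⟩
  have h1 : ‖P.blk j ((heat t - 1) * c)‖ ≤ C * (t * 4 ^ j) ^ δ * ‖P.blk j c‖ := by
    have hx : 0 ≤ t * 4 ^ j := by positivity
    rcases le_or_gt 1 (t * 4 ^ j) with h1 | h1
    · refine (h j t c ht htT).1.trans ?_
      have := Real.one_le_rpow h1 hδ
      gcongr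
      nlinarith
    · refine (h j t c ht htT).2.trans ?_
      gcongr
      rcases hx.eq_or_lt with h0 | h0
      · rw [← h0]; exact Real.rpow_nonneg le_rfl _
      · calc t * 4 ^ j = (t * 4 ^ j) ^ (1 : ℝ) := (Real.rpow_one _).symm
          _ ≤ _ := Real.rpow_le_rpow_of_exponent_ge h0 h1.le hδ1
  refine h1.trans ?_
  rw [Real.mul_rpow ht (by positivity), four_pow_eq_dy, dy_rpow, sub_eq_add_neg, dy_add]
  have e : dy (-2 * δ) j = dy (-(2 * δ)) j := by congr 1; ring
  rw [e]
  have := dy_nonneg (-(2 * δ)) j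
  have := Real.rpow_nonneg ht δ
  calc C * (t ^ δ * dy (-(2 * δ)) j) * ‖P.blk j c‖
      ≤ C * (t ^ δ * dy (-(2 * δ)) j) * (K * dy a j) := by gcongr; exact hc j
    _ = _ := by ring

end DyadicPartition

/-! ### Series of continuous functions, by their Fourier coefficients -/

/-- The sum of a series of continuous functions, on the level of Fourier coefficients. -/
def ser (g : ℕ → CT) : FD := fun k => ∑' m, coef (g m) k

/-- The series of the coefficients converge. -/
def SerSummable (g : ℕ → CT) : Prop := ∀ k, Summable fun m => coef (g m) k

lemma ser_add {g h : ℕ → CT} (hg : SerSummable g) (hh : SerSummable h) :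
    ser (fun m => g m + h m) = ser g + ser h := by
  ext k
  simp only [ser, map_add, Pi.add_apply]
  exact (hg k).tsum_add (hh k)

lemma ser_sub {g h : ℕ → CT} (hg : SerSummable g) (hh : SerSummable h) :
    ser (fun m => g m - h m) = ser g - ser h := by
  ext k
  simp only [ser, map_sub, Pi.sub_apply]
  exact (hg k).tsum_sub (hh k)

lemma ser_smul (z : ℂ) (g : ℕ → CT) : ser (fun m => z • g m) = z • ser g := by
  ext k
  simp only [ser, map_smul, Pi.smul_apply, smul_eq_mul, tsum_mul_left]

namespace DyadicPartition

variable (P : DyadicPartition)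

lemma sym_mul_eq_zero_of_blk {j : ℕ} {c : FD} (h : P.blk j c = 0) : P.sym j * c = 0 := by
  rw [← coef_blk, h, map_zero]

lemma blk_eq_zero_of_sym_mul {j : ℕ} {c : FD} (h : ∀ k, P.sym j k ≠ 0 → c k = 0) :
    P.blk j c = 0 := by
  rw [blk_def]
  have : P.sym j * c = 0 := by
    ext k
    by_cases hk : P.sym j k = 0
    · simp [hk]
    · simp [h k hk]
  rw [this, map_zero]

lemma exists_sym_ne_zero (k : ℤ) : ∃ j, P.sym j k ≠ 0 := by
  by_contra! h
  have := P.hasSum_sym_mul 1 k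
  simp only [h, zero_mul, Pi.one_apply] at this
  exact zero_ne_one (hasSum_zero.unique this)

lemma blk_mul_ser {g : ℕ → CT} {j : ℕ} (h : FD) (s : Finset ℕ)
    (hs : ∀ m ∉ s, P.blk j (coef (g m)) = 0) :
    P.blk j (h * ser g) = ∑ m ∈ s, P.blk j (h * coef (g m)) := by
  have key : P.sym j * (h * ser g) = ∑ m ∈ s, P.sym j * (h * coef (g m)) := by
    ext k
    rw [Finset.sum_apply]
    simp only [Pi.mul_apply, ser]
    rw [← tsum_mul_left, ← tsum_mul_left]
    refine tsum_eq_sum fun m hm => ?_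
    have := congrFun (P.sym_mul_eq_zero_of_blk (hs m hm)) k
    simp only [Pi.mul_apply, Pi.zero_apply] at this
    rw [mul_left_comm, this, mul_zero]
  rw [blk_def, key, map_sum]
  rfl

lemma blk_ser {g : ℕ → CT} {j : ℕ} (s : Finset ℕ) (hs : ∀ m ∉ s, P.blk j (coef (g m)) = 0) :
    P.blk j (ser g) = ∑ m ∈ s, P.blk j (coef (g m)) := by simpa using P.blk_mul_ser 1 s hs

/-- The `m`-th term of a series lives in an annulus of size `2 ^ m`. -/
def Annular (g : ℕ → CT) : Prop := ∀ j m, ¬ (j ≤ m + 5 ∧ m ≤ j + 5) → P.blk j (coef (g m)) = 0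

/-- The indices of an annulus. -/
def ann (j : ℕ) : Finset ℕ := Finset.Icc (j - 5) (j + 5)

lemma mem_ann {i j : ℕ} : i ∈ ann j ↔ j ≤ i + 5 ∧ i ≤ j + 5 := by rw [ann, Finset.mem_Icc]; omega

lemma card_ann_le (j : ℕ) : (ann j).card ≤ 11 := by rw [ann, Nat.card_Icc]; omega

variable {P}

lemma Annular.serSummable {g : ℕ → CT} (h : P.Annular g) : SerSummable g := by
  intro k
  obtain ⟨j, hj⟩ := P.exists_sym_ne_zero k
  refine summable_of_ne_finset_zero (s := ann j) fun m hm => ?_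
  have := congrFun (P.sym_mul_eq_zero_of_blk (h j m (by rwa [mem_ann] at hm))) k
  exact (mul_eq_zero.1 this).resolve_left hj

lemma Annular.blk_ser {g : ℕ → CT} (h : P.Annular g) (j : ℕ) :
    P.blk j (ser g) = ∑ m ∈ ann j, P.blk j (coef (g m)) :=
  P.blk_ser _ fun m hm => h j m (by rwa [mem_ann] at hm)

variable (P)

lemma sum_ann_le {f : ℕ → ℝ} {j : ℕ} {B : ℝ} (hB : 0 ≤ B) (h : ∀ m ∈ ann j, f m ≤ B) :
    ∑ m ∈ ann j, f m ≤ 11 * B := by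
  refine (Finset.sum_le_card_nsmul _ _ B h).trans ?_
  rw [nsmul_eq_mul]
  have : ((ann j).card : ℝ) ≤ 11 := by exact_mod_cast card_ann_le j
  gcongr

lemma sum_nb_le {f : ℕ → ℝ} {j : ℕ} {B : ℝ} (hB : 0 ≤ B) (h : ∀ m ∈ nb j, f m ≤ B) :
    ∑ m ∈ nb j, f m ≤ 3 * B := by
  refine (Finset.sum_le_card_nsmul _ _ B h).trans ?_
  rw [nsmul_eq_mul]
  have : ((nb j).card : ℝ) ≤ 3 := by exact_mod_cast card_nb_le j
  gcongr

lemma exists_bd_ser_annular (s : ℝ) : ∃ C : ℝ, 0 ≤ C ∧ ∀ (g : ℕ → CT) (K : ℝ), P.Annular g →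
    (∀ m, ‖g m‖ ≤ K * dy s m) → P.Bd s (ser g) (C * K) := by
  obtain ⟨C, hC, h⟩ := P.exists_norm_blk_coef_le
  have hs := shiftC_pos s 5
  refine ⟨11 * (C * shiftC s 5), by positivity, fun g K hg hK j => ?_⟩
  have hK0 : 0 ≤ K := by simpa [dy] using (norm_nonneg _).trans (hK 0)
  have hd := dy_nonneg s j
  rw [hg.blk_ser]
  refine (norm_sum_le _ _).trans ((sum_ann_le (B := C * (K * (shiftC s 5 * dy s j))) (by positivity)
    fun m hm => ?_).trans (le_of_eq (by ring)))
  refine (h j (g m)).trans ?_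
  have := dy_le_shift s (mem_ann.1 hm).2 (mem_ann.1 hm).1
  have h2 := hK m
  gcongr
  exact h2.trans (by gcongr)

/-- The `m`-th term of a series lives in a ball of size `2 ^ (m + p)`. -/
def BallLike (p : ℕ) (g : ℕ → CT) : Prop := ∀ j m, m + p < j → P.blk j (coef (g m)) = 0

lemma blk_coef_of_specIn {N j : ℕ} {f : CT} (hf : SpecIn N f) (h : (2 * N : ℝ) < 3 / 8 * 2 ^ j)
    (hj : j ≠ 0) : P.blk j (coef f) = 0 := by
  refine P.blk_eq_zero_of_sym_mul fun k hk => hf.coef_eq_zero fun hb => ?_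
  have h1 := (P.sym_support hk).2 hj
  rw [mem_box] at hb
  have h2 : ((|k| : ℤ) : ℝ) ≤ ((2 * N : ℤ) : ℝ) := by exact_mod_cast hb
  push_cast at h2
  linarith

lemma ballLike_of_specIn {g : ℕ → CT} (q : ℕ) (h : ∀ m, SpecIn (2 ^ (m + q)) (g m)) :
    P.BallLike (q + 2) g := by
  intro j m hj
  refine P.blk_coef_of_specIn (h m) ?_ (by omega)
  push_cast
  have : (2 : ℝ) ^ (m + q) * 8 ≤ 2 ^ j := by
    calc (2 : ℝ) ^ (m + q) * 8 = 2 ^ (m + q + 3) := by ring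
      _ ≤ 2 ^ j := pow_le_pow_right₀ (by norm_num) (by omega)
  have : (0 : ℝ) < 2 ^ (m + q) := by positivity
  linarith

lemma _root_.ParaKPZ.summable_norm_of_le_dy {s : ℝ} (hs : 0 < s) {g : ℕ → CT} {K : ℝ}
    (hK : ∀ m, ‖g m‖ ≤ K * dy s m) : Summable fun m => ‖g m‖ :=
  Summable.of_nonneg_of_le (fun m => norm_nonneg _) hK ((summable_dy hs).mul_left K)

lemma _root_.ParaKPZ.hasSum_coef {g : ℕ → CT} (h : Summable g) (k : ℤ) :
    HasSum (fun m => coef (g m) k) (coef (∑' m, g m) k) :=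
  (coefL k).hasSum h.hasSum

lemma _root_.ParaKPZ.serSummable_of_summable {g : ℕ → CT} (h : Summable g) : SerSummable g :=
  fun k => (hasSum_coef h k).summable

lemma _root_.ParaKPZ.ser_eq_coef {g : ℕ → CT} (h : Summable g) : ser g = coef (∑' m, g m) := by
  ext k; exact (hasSum_coef h k).tsum_eq

lemma hasSum_blk_coef {g : ℕ → CT} (h : Summable g) (j : ℕ) :
    HasSum (fun m => P.blk j (coef (g m))) (P.blk j (ser g)) := by
  obtain ⟨C, hC, hb⟩ := P.exists_norm_blk_coef_le
  have := ((P.blk j ∘ₗ coef).mkContinuous C (hb j)).hasSum h.hasSum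
  rw [ser_eq_coef h]
  exact this

lemma exists_bd_ser_ball {s : ℝ} (hs : 0 < s) (p : ℕ) : ∃ C : ℝ, 0 ≤ C ∧ ∀ (g : ℕ → CT) (K : ℝ),
    P.BallLike p g → (∀ m, ‖g m‖ ≤ K * dy s m) → P.Bd s (ser g) (C * K) := by
  obtain ⟨C, hC, h⟩ := P.exists_norm_blk_coef_le
  have hsh := shiftC_pos s p
  have hS := dyS_nonneg s
  refine ⟨C * dyS s * shiftC s p, by positivity, fun g K hg hK j => ?_⟩
  have hK0 : 0 ≤ K := by simpa [dy] using (norm_nonneg _).trans (hK 0)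
  have hsum := P.hasSum_blk_coef (summable_norm_of_le_dy hs hK).of_norm j
  have h1 := (hasSum_nat_add_iff' (j - p)).2 hsum
  have h2 : ∑ i ∈ Finset.range (j - p), P.blk j (coef (g i)) = 0 :=
    Finset.sum_eq_zero fun i hi => hg j i (by rw [Finset.mem_range] at hi; omega)
  rw [h2, sub_zero] at h1
  have hd := dy_nonneg s (j - p)
  have h3 : ∀ m, ‖P.blk j (coef (g (m + (j - p))))‖ ≤ dy s m * (C * K * dy s (j - p)) := by
    intro m
    refine (h j _).trans ?_
    have := hK (m + (j - p))
    rw [dy_add_index] at this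
    calc C * ‖g (m + (j - p))‖ ≤ C * (K * (dy s m * dy s (j - p))) := by gcongr
      _ = _ := by ring
  rw [← h1.tsum_eq]
  refine (tsum_of_norm_bounded ((summable_dy hs).hasSum.mul_right _) h3).trans ?_
  have h4 := dy_le_shift s (i := j - p) (j := j) (p := p) (by omega) (by omega)
  calc dyS s * (C * K * dy s (j - p)) ≤ dyS s * (C * K * (shiftC s p * dy s j)) := by gcongr
    _ = _ := by ring

/-! ### Paraproduct -/

/-- The low frequencies. -/
def low (m : ℕ) : FD →ₗ[ℂ] CT := ∑ i ∈ Finset.range (m - 1), P.blk i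

lemma low_apply (m : ℕ) (u : FD) : P.low m u = ∑ i ∈ Finset.range (m - 1), P.blk i u := by
  simp [low]

variable {P} in
lemma norm_low_le_pos {a : ℝ} (ha : 0 < a) {u : FD} {K : ℝ} (h : P.Bd a u K) (m : ℕ) :
    ‖P.low m u‖ ≤ K * dyS a := by
  rw [low_apply]
  refine (norm_sum_le_of_le _ fun i _ => h i).trans ?_
  rw [← Finset.mul_sum]
  exact mul_le_mul_of_nonneg_left (sum_dy_le ha _) h.nonneg

lemma _root_.ParaKPZ.sum_range_sub_one_dy_le {a : ℝ} (ha : a < 0) (m : ℕ) :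
    ∑ i ∈ Finset.range (m - 1), dy a i ≤ dyS (-a) * dy a m :=
  (Finset.sum_le_sum_of_subset_of_nonneg (Finset.range_mono (by omega))
    fun i _ _ => dy_nonneg a i).trans (sum_range_dy_le_of_neg ha m)

variable {P} in
lemma norm_low_le_neg {a : ℝ} (ha : a < 0) {u : FD} {K : ℝ} (h : P.Bd a u K) (m : ℕ) :
    ‖P.low m u‖ ≤ K * (dyS (-a) * dy a m) := by
  rw [low_apply]
  refine (norm_sum_le_of_le _ fun i _ => h i).trans ?_
  rw [← Finset.mul_sum]
  exact mul_le_mul_of_nonneg_left (sum_range_sub_one_dy_le ha m) h.nonneg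

lemma annular_low_mul (u : ℕ → FD) (f : ℕ → CT) (hf : ∀ m, ∃ v, f m = P.blk m v) :
    P.Annular fun m => P.low m (u m) * f m := by
  intro j m hjm
  refine P.blk_eq_zero_of_sym_mul fun k hk => ?_
  obtain ⟨v, hv⟩ := hf m
  simp only [hv]
  rw [low_apply, Finset.sum_mul, map_sum, Finset.sum_apply]
  refine Finset.sum_eq_zero fun i hi => ?_
  rw [Finset.mem_range] at hi
  by_contra h
  rw [blk_def, blk_def, coef_mul_poly] at h
  obtain ⟨⟨p, q⟩, -, hpq⟩ := Finset.exists_ne_zero_of_sum_ne_zero h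
  simp only [ne_eq, ite_eq_right_iff, Classical.not_imp, Pi.mul_apply] at hpq
  obtain ⟨rfl, h2⟩ := hpq
  have hp := (P.sym_support (left_ne_zero_of_mul (left_ne_zero_of_mul h2))).1
  have hq := P.sym_support (left_ne_zero_of_mul (right_ne_zero_of_mul h2))
  have hq1 := hq.1
  have hq2 := hq.2 (by omega)
  obtain ⟨hk1, hk2⟩ := P.sym_support hk
  push_cast at hk1 hk2
  have e1 : (2 : ℝ) ^ i * 4 ≤ 2 ^ m := by
    calc (2 : ℝ) ^ i * 4 = 2 ^ (i + 2) := by ring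
      _ ≤ 2 ^ m := pow_le_pow_right₀ (by norm_num) (by omega)
  have t1 := abs_add_le (p : ℝ) q
  have t2 : |(q : ℝ)| ≤ |(p : ℝ) + q| + |(p : ℝ)| := by
    calc |(q : ℝ)| = |((p : ℝ) + q) - p| := by congr 1; ring
      _ ≤ _ := abs_sub _ _
  have pm : (0 : ℝ) < 2 ^ m := by positivity
  have pj : (0 : ℝ) < 2 ^ j := by positivity
  rw [not_and_or, not_le, not_le] at hjm
  rcases hjm with hjm | hjm
  · have e2 : (2 : ℝ) ^ m * 64 ≤ 2 ^ j := by
      calc (2 : ℝ) ^ m * 64 = 2 ^ (m + 6) := by ring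
        _ ≤ 2 ^ j := pow_le_pow_right₀ (by norm_num) (by omega)
    have := hk2 (by omega)
    linarith
  · have e2 : (2 : ℝ) ^ j * 64 ≤ 2 ^ m := by
      calc (2 : ℝ) ^ j * 64 = 2 ^ (j + 6) := by ring
        _ ≤ 2 ^ m := pow_le_pow_right₀ (by norm_num) (by omega)
    linarith

/-- The terms of the paraproduct. -/
def paraT (u v : FD) (m : ℕ) : CT := P.low m u * P.blk m v

lemma annular_paraT (u v : FD) : P.Annular (P.paraT u v) :=
  P.annular_low_mul (fun _ => u) (fun m => P.blk m v) fun m => ⟨v, rfl⟩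

/-- The paraproduct of families of Fourier coefficients. -/
def fpara : FD →ₗ[ℂ] FD →ₗ[ℂ] FD :=
  LinearMap.mk₂ ℂ (fun u v => ser (P.paraT u v))
    (fun u u' v => by
      rw [← ser_add (P.annular_paraT u v).serSummable (P.annular_paraT u' v).serSummable]
      congr 1; ext1 m; simp only [paraT, map_add, add_mul])
    (fun z u v => by rw [← ser_smul]; congr 1; ext1 m; simp only [paraT, map_smul, smul_mul_assoc])
    (fun u v v' => by
      rw [← ser_add (P.annular_paraT u v).serSummable (P.annular_paraT u v').serSummable]
      congr 1; ext1 m; simp only [paraT, map_add, mul_add])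
    (fun z u v => by rw [← ser_smul]; congr 1; ext1 m; simp only [paraT, map_smul, mul_smul_comm])

lemma fpara_apply (u v : FD) : P.fpara u v = ser (P.paraT u v) := rfl

lemma exists_bd_fpara_pos {a : ℝ} (ha : 0 < a) (b : ℝ) : ∃ C : ℝ, 0 ≤ C ∧ ∀ (u v : FD) (K L : ℝ),
    P.Bd a u K → P.Bd b v L → P.Bd b (P.fpara u v) (C * (K * L)) := by
  obtain ⟨C, hC, h⟩ := P.exists_bd_ser_annular b
  have := dyS_nonneg a
  refine ⟨C * dyS a, by positivity, fun u v K L hu hv => ?_⟩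
  refine (h _ (dyS a * (K * L)) (P.annular_paraT u v) fun m => ?_).mono (by rw [mul_assoc])
  refine (norm_mul_le _ _).trans ?_
  have h1 := norm_low_le_pos ha hu m
  have h2 := hv m
  have := hu.nonneg
  calc _ ≤ (K * dyS a) * (L * dy b m) := by gcongr
    _ = _ := by ring

lemma exists_bd_fpara_neg {a : ℝ} (ha : a < 0) (b : ℝ) : ∃ C : ℝ, 0 ≤ C ∧ ∀ (u v : FD) (K L : ℝ),
    P.Bd a u K → P.Bd b v L → P.Bd (a + b) (P.fpara u v) (C * (K * L)) := by
  obtain ⟨C, hC, h⟩ := P.exists_bd_ser_annular (a + b)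
  have hS := dyS_nonneg (-a)
  refine ⟨C * dyS (-a), by positivity, fun u v K L hu hv => ?_⟩
  refine (h _ (dyS (-a) * (K * L)) (P.annular_paraT u v) fun m => ?_).mono (by rw [mul_assoc])
  refine (norm_mul_le _ _).trans ?_
  have h1 := norm_low_le_neg ha hu m
  have h2 := hv m
  have := hu.nonneg
  have := dy_nonneg a m
  calc _ ≤ (K * (dyS (-a) * dy a m)) * (L * dy b m) := by gcongr
    _ = _ := by rw [dy_add]; ring

lemma specIn_low (m : ℕ) (u : FD) : SpecIn (2 ^ m) (P.low m u) := by
  rw [low_apply]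
  refine SpecIn.sum _ fun i hi => (P.specIn_blk i u).mono (Nat.pow_le_pow_right (by norm_num) ?_)
  rw [Finset.mem_range] at hi; omega

/-! ### Resonant product -/

/-- The sum of the neighbouring blocks. -/
def nbw (m : ℕ) : FD →ₗ[ℂ] CT := ∑ l ∈ nb m, P.blk l

lemma nbw_apply (m : ℕ) (w : FD) : P.nbw m w = ∑ l ∈ nb m, P.blk l w := by simp [nbw]

lemma specIn_nbw (m : ℕ) (w : FD) : SpecIn (2 ^ (m + 1)) (P.nbw m w) := by
  rw [nbw_apply]
  exact SpecIn.sum _ fun i hi => (P.specIn_blk i w).mono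
    (Nat.pow_le_pow_right (by norm_num) (mem_nb.1 hi).1)

variable {P} in
lemma norm_nbw_le {c : ℝ} {w : FD} {M : ℝ} (h : P.Bd c w M) (m : ℕ) :
    ‖P.nbw m w‖ ≤ 3 * shiftC c 1 * M * dy c m := by
  have hM := h.nonneg
  have hd := dy_nonneg c m
  have hs := shiftC_pos c 1
  rw [nbw_apply]
  refine (norm_sum_le _ _).trans ((sum_nb_le (B := M * (shiftC c 1 * dy c m)) (by positivity)
    fun i hi => ?_).trans (le_of_eq (by ring)))
  exact (h i).trans (mul_le_mul_of_nonneg_left (dy_le_shift c (mem_nb.1 hi).1 (mem_nb.1 hi).2) hM)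

/-- The terms of the resonant product, ordered by the larger frequency. -/
def resT (u v : FD) : ℕ → CT
  | 0 => P.blk 0 u * P.blk 0 v
  | m + 1 => P.blk (m + 1) u * P.blk (m + 1) v
      + (P.blk (m + 1) u * P.blk m v + P.blk m u * P.blk (m + 1) v)

/-- The resonant product of families of Fourier coefficients. -/
def fres (u v : FD) : FD := ser (P.resT u v)

lemma specIn_resT (u v : FD) (m : ℕ) : SpecIn (2 ^ (m + 1)) (P.resT u v m) := by
  have e : ∀ m, 2 ^ m + 2 ^ m = 2 ^ (m + 1) := fun m => by ring
  cases m with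
  | zero => exact ((P.specIn_blk 0 u).mul (P.specIn_blk 0 v)).mono (by norm_num)
  | succ m =>
    have hu := P.specIn_blk (m + 1) u
    have hv := P.specIn_blk (m + 1) v
    have hu' := (P.specIn_blk m u).mono (Nat.pow_le_pow_right (by norm_num) (Nat.le_succ m))
    have hv' := (P.specIn_blk m v).mono (Nat.pow_le_pow_right (by norm_num) (Nat.le_succ m))
    rw [← e (m + 1)]
    exact (hu.mul hv).add ((hu.mul hv').add (hu'.mul hv))

variable {P} in
lemma norm_resT_le {a b : ℝ} {u v : FD} {K L : ℝ} (hu : P.Bd a u K) (hv : P.Bd b v L) (m : ℕ) :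
    ‖P.resT u v m‖ ≤ (3 * (shiftC a 1 * shiftC b 1)) * (K * L) * dy (a + b) m := by
  have hK := hu.nonneg
  have hL := hv.nonneg
  have h1a := one_le_shiftC a 1
  have h1b := one_le_shiftC b 1
  have hda := fun m => dy_nonneg a m
  have hdb := fun m => dy_nonneg b m
  have key : ∀ i j m, i ≤ m → m ≤ i + 1 → j ≤ m → m ≤ j + 1 → ‖P.blk i u * P.blk j v‖
      ≤ (shiftC a 1 * shiftC b 1) * (K * L) * dy (a + b) m := by
    intro i j m h1 h2 h3 h4
    refine (norm_mul_le _ _).trans ?_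
    have e1 := dy_le_shift a (i := i) (j := m) (p := 1) (by omega) h2
    have e2 := dy_le_shift b (i := j) (j := m) (p := 1) (by omega) h4
    have hu' := hu i
    have hv' := hv j
    have := hda m
    have := hdb m
    have := hda i
    have := hdb j
    calc ‖P.blk i u‖ * ‖P.blk j v‖ ≤ (K * dy a i) * (L * dy b j) := by gcongr
      _ ≤ (K * (shiftC a 1 * dy a m)) * (L * (shiftC b 1 * dy b m)) := by gcongr
      _ = _ := by rw [dy_add]; ring
  have hpos : 0 ≤ (shiftC a 1 * shiftC b 1) * (K * L) * dy (a + b) m := by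
    have := dy_nonneg (a + b) m
    positivity
  cases m with
  | zero => exact (key 0 0 0 le_rfl (by omega) le_rfl (by omega)).trans (by linarith)
  | succ m =>
    have k1 := key (m + 1) (m + 1) (m + 1) le_rfl (by omega) le_rfl (by omega)
    have k2 := key (m + 1) m (m + 1) le_rfl (by omega) (by omega) le_rfl
    have k3 := key m (m + 1) (m + 1) (by omega) le_rfl le_rfl (by omega)
    refine (norm_add_le _ _).trans ?_
    have := norm_add_le (P.blk (m + 1) u * P.blk m v) (P.blk m u * P.blk (m + 1) v)
    linarith

lemma exists_bd_fres {a b : ℝ} (hab : 0 < a + b) : ∃ C : ℝ, 0 ≤ C ∧ ∀ (u v : FD) (K L : ℝ),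
    P.Bd a u K → P.Bd b v L → P.Bd (a + b) (P.fres u v) (C * (K * L)) := by
  obtain ⟨C, hC, h⟩ := P.exists_bd_ser_ball hab 3
  have h1 := shiftC_pos a 1
  have h2 := shiftC_pos b 1
  refine ⟨C * (3 * (shiftC a 1 * shiftC b 1)), by positivity, fun u v K L hu hv => ?_⟩
  exact (h _ _ (P.ballLike_of_specIn 1 (P.specIn_resT u v)) (norm_resT_le hu hv)).mono
    (le_of_eq (by ring))

variable {P} in
lemma summable_resT {a b : ℝ} (hab : 0 < a + b) {u v : FD} {K L : ℝ} (hu : P.Bd a u K)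
    (hv : P.Bd b v L) : Summable (P.resT u v) :=
  (summable_norm_of_le_dy hab (norm_resT_le hu hv)).of_norm

variable {P} in
lemma fres_sub {a b : ℝ} (hab : 0 < a + b) {u u' v v' : FD} {K K' L L' : ℝ} (hu : P.Bd a u K)
    (hu' : P.Bd a u' K') (hv : P.Bd b v L) (hv' : P.Bd b v' L') :
    P.fres u v - P.fres u' v' = P.fres (u - u') v + P.fres u' (v - v') := by
  have s := fun {u v K L} (hu : P.Bd a u K) (hv : P.Bd b v L) =>
    serSummable_of_summable (summable_resT hab hu hv)
  simp only [fres]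
  rw [← ser_sub (s hu hv) (s hu' hv'), ← ser_add (s (hu.sub hu') hv) (s hu' (hv.sub hv'))]
  congr 1
  ext1 m
  cases m <;> simp only [resT, map_sub] <;> ring

/-! ### Commutators -/

lemma exists_norm_comm_blk_le (T : ℝ) (hT : 0 ≤ T) : ∃ C : ℝ, 0 ≤ C ∧
    ∀ (m : ℕ) (t : ℝ) (g f : CT) (L : ℝ), 0 ≤ t → t ≤ T → 0 ≤ L →
      (∀ x y, ‖g x - g y‖ ≤ L * ‖chr 1 x - chr 1 y‖) →
      ‖P.blk m (coef (g * f)) - g * P.blk m (coef f)‖ ≤ C * dy 1 m * L * ‖f‖ ∧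
      ‖P.blk m (dsym * heat t * coef (g * f)) - g * P.blk m (dsym * heat t * coef f)‖
        ≤ C * damp t m * L * ‖f‖ := by
  obtain ⟨A, hA, h⟩ := P.exists_symbolBound T hT
  refine ⟨16 * A, by positivity, fun m t g f L ht htT hL hg => ⟨?_, ?_⟩⟩
  · have hb := (h m 0 le_rfl hT).1
    rw [heat_zero, mul_one, damp_zero, mul_one] at hb
    refine (norm_commutator_le _ Nat.one_le_two_pow _ _ hb.supp hb.diff_le hb.diff_diff_le g L hL hg
      f).trans (le_of_eq ?_)
    rw [dy_one]; push_cast; field_simp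
  · have hb := (h m t ht htT).2
    have := norm_commutator_le _ Nat.one_le_two_pow _ _ hb.supp hb.diff_le hb.diff_diff_le g L hL hg f
    have e : ∀ c : FD, P.blk m (dsym * heat t * c)
        = poly (box (2 ^ m)) (P.sym m * (dsym * heat t) * c) := fun c => by
      rw [blk_def]; congr 1; ring
    rw [e, e]
    refine this.trans (le_of_eq ?_)
    push_cast
    field_simp

lemma exists_low_lipschitz {a : ℝ} (ha : a < 1) : ∃ C : ℝ, 0 ≤ C ∧ ∀ (u : FD) (K : ℝ), P.Bd a u K →
    ∀ m x y, ‖P.low m u x - P.low m u y‖ ≤ C * K * dy (a - 1) m * ‖chr 1 x - chr 1 y‖ := by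
  obtain ⟨C, hC, h⟩ := P.exists_norm_blk_heat_le 0 le_rfl
  have hS := dyS_nonneg (-(a - 1))
  refine ⟨C * dyS (-(a - 1)), by positivity, fun u K hu m x y => ?_⟩
  have hK := hu.nonneg
  have h1 : ∀ i, ‖P.blk i u x - P.blk i u y‖ ≤ C * K * dy (a - 1) i * ‖chr 1 x - chr 1 y‖ := by
    intro i
    refine (poly_lipschitz _ _ x y).trans (mul_le_mul_of_nonneg_right ?_ (norm_nonneg _))
    have e : poly (box (2 ^ i)) (dsym * (P.sym i * u)) = P.blk i (dsym * u) := by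
      rw [blk_def]; congr 1; ring
    have h2 := (h i 0 u le_rfl le_rfl).2
    rw [heat_zero, mul_one, damp_zero, mul_one] at h2
    rw [e, sub_eq_add_neg, dy_add, dy_neg_one]
    have := hu i
    calc _ ≤ C * 2 ^ i * (K * dy a i) := h2.trans (by gcongr)
      _ = _ := by ring
  rw [low_apply, CT.sum_apply, CT.sum_apply, ← Finset.sum_sub_distrib]
  refine (norm_sum_le_of_le _ fun i _ => h1 i).trans ?_
  rw [← Finset.sum_mul, ← Finset.mul_sum]
  have := sum_range_sub_one_dy_le (a := a - 1) (by linarith) m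
  calc _ ≤ C * K * (dyS (-(a - 1)) * dy (a - 1) m) * ‖chr 1 x - chr 1 y‖ := by gcongr
    _ = _ := by ring

/-- Commutator of the differentiated heat semigroup and the paraproduct. -/
lemma exists_bd_heat_comm (T : ℝ) (hT : 0 ≤ T) {a : ℝ} (ha : a < 1) (b θ : ℝ) (hθ : 0 ≤ θ)
    (hθ2 : θ ≤ 2) : ∃ C : ℝ, 0 ≤ C ∧ ∀ (t : ℝ) (u v : FD) (K L : ℝ), 0 < t → t ≤ T → P.Bd a u K →
      P.Bd b v L → P.Bd (a + b - 1 + 2 * θ)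
        (dsym * heat t * P.fpara u v - P.fpara u (dsym * heat t * v)) (C * t ^ (-θ) * (K * L)) := by
  obtain ⟨C1, hC1, h1⟩ := P.exists_norm_comm_blk_le T hT
  obtain ⟨C2, hC2, h2⟩ := P.exists_low_lipschitz ha
  obtain ⟨C3, hC3, h3⟩ := P.exists_norm_blk_heat_le T hT
  set e := a + b - 1 + 2 * θ with he
  have s1 := shiftC_pos (2 * θ) 5
  have s2 := shiftC_pos 1 5
  have s3 := shiftC_pos e 5
  refine ⟨11 * ((C1 * C2 * shiftC (2 * θ) 5 + C1 * C2 * C3 * shiftC 1 5) * shiftC e 5),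
    by positivity, fun t u v K L ht htT hu hv l => ?_⟩
  have hK := hu.nonneg
  have hL := hv.nonneg
  have htθ : 0 < t ^ (-θ) := by positivity
  have b1 : P.blk l (dsym * heat t * P.fpara u v)
      = ∑ m ∈ ann l, P.blk l (dsym * heat t * coef (P.low m u * P.blk m v)) :=
    P.blk_mul_ser _ _ fun m hm => P.annular_paraT u v l m (by rwa [mem_ann] at hm)
  have b2 : P.blk l (P.fpara u (dsym * heat t * v))
      = ∑ m ∈ ann l, P.blk l (coef (P.low m u * P.blk m (dsym * heat t * v))) :=
    (P.annular_paraT _ _).blk_ser l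
  rw [map_sub, b1, b2, ← Finset.sum_sub_distrib]
  have hdl := dy_nonneg e l
  refine (norm_sum_le _ _).trans ((sum_ann_le (B := (C1 * C2 * shiftC (2 * θ) 5
    + C1 * C2 * C3 * shiftC 1 5) * shiftC e 5 * t ^ (-θ) * (K * L) * dy e l)
    (by positivity) fun m hm => ?_).trans (le_of_eq (by ring)))
  obtain ⟨hm1, hm2⟩ := mem_ann.1 hm
  have hlip := h2 u K hu m
  have hd1 := dy_nonneg (a - 1) m
  have hLip : 0 ≤ C2 * K * dy (a - 1) m := by positivity
  have q1 := (h1 l t (P.low m u) (P.blk m v) _ ht.le htT hLip hlip).2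
  have q2 := (h1 l t (P.low m u) (P.blk m (dsym * heat t * v)) _ ht.le htT hLip hlip).1
  have hc : P.blk l (coef (P.blk m (dsym * heat t * v)))
      = P.blk l (dsym * heat t * coef (P.blk m v)) := by rw [coef_blk, coef_blk]; congr 1; ring
  rw [hc] at q2
  have q3 := (h3 m t v ht.le htT).2
  have d1 := damp_le ht hθ hθ2 l
  have d2 := damp_le ht hθ hθ2 m
  have d3 := dy_le_shift (2 * θ) hm1 hm2
  have d4 := dy_le_shift 1 hm1 hm2
  have d5 := dy_le_shift e hm2 hm1
  have n1 := dy_nonneg b m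
  have n2 := dy_nonneg (2 * θ) m
  have n3 := dy_nonneg 1 l
  have n4 := dy_nonneg 1 m
  have n5 := damp_nonneg t l
  have n6 := damp_nonneg t m
  have hvm := hv m
  have e1 : dy e m = dy (2 * θ) m * (dy (a - 1) m * dy b m) := by
    rw [← dy_add, ← dy_add]; congr 1; rw [he]; ring
  have e2 : dy 1 m * 2 ^ m = 1 := by rw [dy_one, inv_mul_cancel₀ (by positivity)]
  have t1 : C1 * damp t l * (C2 * K * dy (a - 1) m) * ‖P.blk m v‖
      ≤ C1 * C2 * shiftC (2 * θ) 5 * t ^ (-θ) * (K * L) * dy e m := by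
    calc C1 * damp t l * (C2 * K * dy (a - 1) m) * ‖P.blk m v‖
        ≤ C1 * (t ^ (-θ) * (shiftC (2 * θ) 5 * dy (2 * θ) m)) * (C2 * K * dy (a - 1) m)
          * (L * dy b m) := by
          have : damp t l ≤ t ^ (-θ) * (shiftC (2 * θ) 5 * dy (2 * θ) m) := d1.trans (by gcongr)
          gcongr
      _ = _ := by rw [e1]; ring
  have t2 : C1 * dy 1 l * (C2 * K * dy (a - 1) m) * ‖P.blk m (dsym * heat t * v)‖
      ≤ C1 * C2 * C3 * shiftC 1 5 * t ^ (-θ) * (K * L) * dy e m := by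
    calc C1 * dy 1 l * (C2 * K * dy (a - 1) m) * ‖P.blk m (dsym * heat t * v)‖
        ≤ C1 * (shiftC 1 5 * dy 1 m) * (C2 * K * dy (a - 1) m)
          * (C3 * 2 ^ m * (t ^ (-θ) * dy (2 * θ) m) * (L * dy b m)) := by
          have : ‖P.blk m (dsym * heat t * v)‖
              ≤ C3 * 2 ^ m * (t ^ (-θ) * dy (2 * θ) m) * (L * dy b m) := q3.trans (by gcongr)
          gcongr
      _ = C1 * C2 * C3 * shiftC 1 5 * t ^ (-θ) * (K * L)
          * (dy (2 * θ) m * (dy (a - 1) m * dy b m)) * (dy 1 m * 2 ^ m) := by ring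
      _ = _ := by rw [e2, e1, mul_one]
  have tri : ∀ x y z : CT, ‖x - z‖ ≤ ‖x - y‖ + ‖z - y‖ := fun x y z => by
    have := norm_sub_le (x - y) (z - y)
    rwa [sub_sub_sub_cancel_right] at this
  refine (tri _ (P.low m u * P.blk l (dsym * heat t * coef (P.blk m v))) _).trans ?_
  calc _ ≤ C1 * C2 * shiftC (2 * θ) 5 * t ^ (-θ) * (K * L) * dy e m
        + C1 * C2 * C3 * shiftC 1 5 * t ^ (-θ) * (K * L) * dy e m :=
        add_le_add (q1.trans t1) (q2.trans t2)
    _ = (C1 * C2 * shiftC (2 * θ) 5 + C1 * C2 * C3 * shiftC 1 5) * t ^ (-θ) * (K * L) * dy e m := by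
        ring
    _ ≤ (C1 * C2 * shiftC (2 * θ) 5 + C1 * C2 * C3 * shiftC 1 5) * t ^ (-θ) * (K * L)
        * (shiftC e 5 * dy e l) := by gcongr
    _ = _ := by ring

/-- Commutator of a block and the paraproduct. -/
def comT (u v : FD) (m : ℕ) : CT :=
  ∑ j ∈ ann m, (P.blk m (coef (P.low j u * P.blk j v)) - P.low j u * P.blk m (coef (P.blk j v)))

/-- The resonant terms below a frequency. -/
def resQ (v w : FD) (i : ℕ) : CT :=
  ∑ j ∈ Finset.range (i + 2), ∑ m ∈ nb j, P.blk m (coef (P.blk j v)) * P.nbw m w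

/-- The terms of the commutator. -/
def commT (u v w : FD) (m : ℕ) : CT := P.comT u v m * P.nbw m w - P.blk m u * P.resQ v w m

/-- The extended commutator `R (u, v, w)`. -/
def fcomm (u v w : FD) : FD := ser (P.commT u v w)

lemma specIn_blk_coef {N : ℕ} (m : ℕ) (f : CT) (h : 2 ^ m ≤ N) : SpecIn N (P.blk m (coef f)) :=
  (P.specIn_blk m _).mono h

lemma specIn_commT (u v w : FD) (m : ℕ) : SpecIn (2 ^ (m + 7)) (P.commT u v w m) := by
  have p : ∀ {a b : ℕ}, a ≤ b → 2 ^ a ≤ 2 ^ b := fun h => Nat.pow_le_pow_right (by norm_num) h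
  have h1 : SpecIn (2 ^ (m + 6)) (P.comT u v m) := by
    refine SpecIn.sum _ fun j hj => ?_
    have hj2 := (mem_ann.1 hj).2
    refine SpecIn.sub (P.specIn_blk_coef _ _ (p (by omega))) ?_
    refine (((P.specIn_low j u).mono (p hj2)).mul
      (P.specIn_blk_coef m _ (p (by omega : m ≤ m + 5)))).mono (le_of_eq ?_)
    ring
  have h2 : SpecIn (2 ^ (m + 5)) (P.resQ v w m) := by
    refine SpecIn.sum _ fun j hj => SpecIn.sum _ fun l hl => ?_
    rw [Finset.mem_range] at hj
    have hl := (mem_nb.1 hl).1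
    refine ((P.specIn_blk_coef l _ (p (by omega : l ≤ m + 4))).mul
      ((P.specIn_nbw l w).mono (p (by omega : l + 1 ≤ m + 4)))).mono (le_of_eq ?_)
    ring
  have h3 : SpecIn (2 ^ (m + 7)) (P.comT u v m * P.nbw m w) := by
    refine (h1.mul ((P.specIn_nbw m w).mono (p (by omega : m + 1 ≤ m + 6)))).mono (le_of_eq ?_)
    ring
  have h4 : SpecIn (2 ^ (m + 7)) (P.blk m u * P.resQ v w m) := by
    refine (((P.specIn_blk m u).mono (p (by omega : m ≤ m + 5))).mul h2).mono ?_
    calc 2 ^ (m + 5) + 2 ^ (m + 5) = 2 ^ (m + 6) := by ring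
      _ ≤ _ := p (by omega)
  exact h3.sub h4

lemma exists_norm_commT_le {a b c : ℝ} (ha : a < 1) (hbc : b + c < 0) : ∃ C : ℝ, 0 ≤ C ∧
    ∀ (u v w : FD) (K L M : ℝ), P.Bd a u K → P.Bd b v L → P.Bd c w M →
      ∀ m, ‖P.commT u v w m‖ ≤ C * (K * L * M) * dy (a + b + c) m := by
  obtain ⟨C1, hC1, h1⟩ := P.exists_norm_comm_blk_le 0 le_rfl
  obtain ⟨C2, hC2, h2⟩ := P.exists_low_lipschitz ha
  obtain ⟨C3, hC3, h3⟩ := P.exists_norm_blk_coef_le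
  have s1 := shiftC_pos (a - 1) 5
  have s2 := shiftC_pos b 5
  have s3 := shiftC_pos c 1
  have s4 := dyS_nonneg (-(b + c))
  have s5 := shiftC_pos (b + c) 1
  refine ⟨11 * (C1 * C2 * shiftC (a - 1) 5 * shiftC b 5) * (3 * shiftC c 1)
    + 3 * (C3 * (3 * shiftC c 1 * shiftC c 1)) * dyS (-(b + c)) * shiftC (b + c) 1,
    by positivity, fun u v w K L M hu hv hw m => ?_⟩
  have hK := hu.nonneg
  have hL := hv.nonneg
  have hM := hw.nonneg
  have na := fun m => dy_nonneg a m
  have nb' := fun m => dy_nonneg b m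
  have nc := fun m => dy_nonneg c m
  have nbc := fun m => dy_nonneg (b + c) m
  have e0 : dy (a + b + c) m = dy a m * dy b m * dy c m := by rw [dy_add, dy_add]
  have hcom : ‖P.comT u v m‖ ≤ 11 * (C1 * C2 * shiftC (a - 1) 5 * shiftC b 5 * (K * L)
      * (dy a m * dy b m)) := by
    have := na m
    have := nb' m
    refine (norm_sum_le _ _).trans (sum_ann_le (by positivity) fun j hj => ?_)
    obtain ⟨hj1, hj2⟩ := mem_ann.1 hj
    have hd1 := dy_nonneg (a - 1) j
    have hLip : 0 ≤ C2 * K * dy (a - 1) j := by positivity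
    refine ((h1 m 0 (P.low j u) (P.blk j v) _ le_rfl le_rfl hLip (h2 u K hu j)).1).trans ?_
    have d1 := dy_le_shift (a - 1) hj2 hj1
    have d2 := dy_le_shift b hj2 hj1
    have n1 := dy_nonneg 1 m
    have n2 := dy_nonneg (a - 1) m
    have n3 := nb' j
    have e1 : dy a m = dy 1 m * dy (a - 1) m := by rw [← dy_add]; congr 1; ring
    calc C1 * dy 1 m * (C2 * K * dy (a - 1) j) * ‖P.blk j v‖
        ≤ C1 * dy 1 m * (C2 * K * (shiftC (a - 1) 5 * dy (a - 1) m)) * (L * (shiftC b 5 * dy b m)) := by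
          have : ‖P.blk j v‖ ≤ L * (shiftC b 5 * dy b m) := (hv j).trans (by gcongr)
          gcongr
      _ = _ := by rw [e1]; ring
  have hQ : ‖P.resQ v w m‖ ≤ 3 * (C3 * (3 * shiftC c 1 * shiftC c 1) * (L * M))
      * (dyS (-(b + c)) * (shiftC (b + c) 1 * dy (b + c) m)) := by
    have q : ∀ j ∈ Finset.range (m + 2), ‖∑ l ∈ nb j, P.blk l (coef (P.blk j v)) * P.nbw l w‖
        ≤ 3 * (C3 * (3 * shiftC c 1 * shiftC c 1) * (L * M)) * dy (b + c) j := by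
      intro j _
      have := nb' j
      have := nc j
      refine (norm_sum_le _ _).trans ((sum_nb_le (B := C3 * (3 * shiftC c 1 * shiftC c 1) * (L * M)
        * (dy b j * dy c j)) (by positivity) fun l hl => ?_).trans
        (le_of_eq (by rw [dy_add]; ring)))
      refine (norm_mul_le _ _).trans ?_
      have r1 := h3 l (P.blk j v)
      have r2 := norm_nbw_le hw l
      have r3 := dy_le_shift c (mem_nb.1 hl).1 (mem_nb.1 hl).2
      have r4 := hv j
      have := nc l
      calc _ ≤ (C3 * (L * dy b j)) * (3 * shiftC c 1 * M * (shiftC c 1 * dy c j)) := by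
            have e1 : ‖P.blk l (coef (P.blk j v))‖ ≤ C3 * (L * dy b j) := r1.trans (by gcongr)
            have e2 : ‖P.nbw l w‖ ≤ 3 * shiftC c 1 * M * (shiftC c 1 * dy c j) :=
              r2.trans (by gcongr)
            gcongr
        _ = _ := by ring
    refine (norm_sum_le_of_le _ q).trans ?_
    rw [← Finset.mul_sum]
    have r1 := sum_range_dy_le_of_neg hbc (m + 1)
    have r2 := dy_le_shift (b + c) (i := m + 1) (j := m) (p := 1) (by omega) (by omega)
    have := nbc m
    refine mul_le_mul_of_nonneg_left (r1.trans (by gcongr)) (by positivity)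
  have hw' := norm_nbw_le hw m
  have hu' := hu m
  have := na m
  have := nb' m
  have := nc m
  have := nbc m
  refine (norm_sub_le _ _).trans ?_
  calc _ ≤ (11 * (C1 * C2 * shiftC (a - 1) 5 * shiftC b 5 * (K * L)
      * (dy a m * dy b m))) * (3 * shiftC c 1 * M * dy c m)
      + (K * dy a m) * (3 * (C3 * (3 * shiftC c 1 * shiftC c 1) * (L * M))
      * (dyS (-(b + c)) * (shiftC (b + c) 1 * dy (b + c) m))) := by
        refine add_le_add ((norm_mul_le _ _).trans ?_) ((norm_mul_le _ _).trans ?_) <;> gcongr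
    _ = _ := by rw [e0, dy_add b c]; ring

lemma exists_bd_fcomm {a b c : ℝ} (ha : a < 1) (hbc : b + c < 0) (habc : 0 < a + b + c) :
    ∃ C : ℝ, 0 ≤ C ∧ ∀ (u v w : FD) (K L M : ℝ), P.Bd a u K → P.Bd b v L → P.Bd c w M →
      P.Bd (a + b + c) (P.fcomm u v w) (C * (K * L * M)) := by
  obtain ⟨C1, hC1, h1⟩ := P.exists_bd_ser_ball habc 9
  obtain ⟨C2, hC2, h2⟩ := P.exists_norm_commT_le ha hbc
  refine ⟨C1 * C2, by positivity, fun u v w K L M hu hv hw => ?_⟩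
  exact (h1 _ _ (P.ballLike_of_specIn 7 (P.specIn_commT u v w)) (h2 u v w K L M hu hv hw)).mono
    (le_of_eq (by ring))

variable {P} in
lemma summable_commT {a b c : ℝ} (ha : a < 1) (hbc : b + c < 0) (habc : 0 < a + b + c)
    {u v w : FD} {K L M : ℝ} (hu : P.Bd a u K) (hv : P.Bd b v L) (hw : P.Bd c w M) :
    Summable (P.commT u v w) := by
  obtain ⟨C2, hC2, h2⟩ := P.exists_norm_commT_le ha hbc
  exact (summable_norm_of_le_dy habc (h2 u v w K L M hu hv hw)).of_norm

lemma comT_sub_left (u u' v : FD) (m : ℕ) :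
    P.comT (u - u') v m = P.comT u v m - P.comT u' v m := by
  simp only [comT, ← Finset.sum_sub_distrib]
  refine Finset.sum_congr rfl fun j _ => ?_
  simp only [map_sub, sub_mul]
  abel

lemma comT_sub_right (u v v' : FD) (m : ℕ) :
    P.comT u (v - v') m = P.comT u v m - P.comT u v' m := by
  simp only [comT, ← Finset.sum_sub_distrib]
  refine Finset.sum_congr rfl fun j _ => ?_
  simp only [map_sub, mul_sub]
  abel

lemma resQ_sub_left (v v' w : FD) (m : ℕ) :
    P.resQ (v - v') w m = P.resQ v w m - P.resQ v' w m := by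
  simp only [resQ, ← Finset.sum_sub_distrib]
  refine Finset.sum_congr rfl fun j _ => Finset.sum_congr rfl fun l _ => ?_
  simp only [map_sub, sub_mul]

lemma resQ_sub_right (v w w' : FD) (m : ℕ) :
    P.resQ v (w - w') m = P.resQ v w m - P.resQ v w' m := by
  simp only [resQ, ← Finset.sum_sub_distrib]
  refine Finset.sum_congr rfl fun j _ => Finset.sum_congr rfl fun l _ => ?_
  simp only [map_sub, mul_sub]

variable {P} in
lemma fcomm_sub {a b c : ℝ} (ha : a < 1) (hbc : b + c < 0) (habc : 0 < a + b + c)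
    {u u' v v' w w' : FD} {K K' L L' M M' : ℝ} (hu : P.Bd a u K) (hu' : P.Bd a u' K')
    (hv : P.Bd b v L) (hv' : P.Bd b v' L') (hw : P.Bd c w M) (hw' : P.Bd c w' M') :
    P.fcomm u v w - P.fcomm u' v' w'
      = P.fcomm (u - u') v w + P.fcomm u' (v - v') w + P.fcomm u' v' (w - w') := by
  have s := fun {u v w K L M} (hu : P.Bd a u K) (hv : P.Bd b v L) (hw : P.Bd c w M) =>
    serSummable_of_summable (summable_commT ha hbc habc hu hv hw)
  have s1 := s (hu.sub hu') hv hw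
  have s2 := s hu' (hv.sub hv') hw
  have s3 := s hu' hv' (hw.sub hw')
  simp only [fcomm]
  rw [← ser_sub (s hu hv hw) (s hu' hv' hw'), ← ser_add s1 s2,
    ← ser_add (g := fun m => _ + _) (fun k => by
      simpa only [map_add, Pi.add_apply] using (s1 k).add (s2 k)) s3]
  congr 1
  ext1 m
  simp only [commT, comT_sub_left, comT_sub_right, resQ_sub_left, resQ_sub_right, map_sub]
  ring

end DyadicPartition

/-! ### The commutator of regular functions -/

lemma coef_injective : Function.Injective coef := by
  rw [injective_iff_map_eq_zero]
  intro f hf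
  have h0 : fourierCoeff f = 0 := hf
  have hs : Summable (fourierCoeff f) := by rw [h0]; exact summable_zero
  have := hasSum_fourier_series_of_summable (f := (f : C(AddCircle (1 : ℝ), ℂ))) hs
  have h1 : ∀ i : ℤ, fourierCoeff f i • (_root_.fourier i : C(AddCircle (1 : ℝ), ℂ)) = 0 := by
    intro i
    have h2 : fourierCoeff f i = 0 := congrFun h0 i
    rw [h2]
    exact zero_smul ℂ (_root_.fourier i : C(AddCircle (1 : ℝ), ℂ))
  have h3 : HasSum (fun _ : ℤ => (0 : C(AddCircle (1 : ℝ), ℂ))) f := this.congr_fun fun i => (h1 i).symm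
  exact h3.unique hasSum_zero

namespace DyadicPartition

variable (P : DyadicPartition)

/-- The product, by Bony's decomposition. -/
def fmul (u v : FD) : FD := P.fpara u v + P.fres u v + P.fpara v u

/-- The continuous function with given coefficients. -/
def toFn (u : FD) : CT := ∑' i, P.blk i u

variable {P} {a : ℝ} {u v w : FD} {K L M : ℝ}

lemma Bd.summable_norm (ha : 0 < a) (h : P.Bd a u K) : Summable fun i => ‖P.blk i u‖ :=
  summable_norm_of_le_dy ha h

lemma Bd.hasSum_toFn (ha : 0 < a) (h : P.Bd a u K) : HasSum (fun i => P.blk i u) (P.toFn u) :=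
  (h.summable_norm ha).of_norm.hasSum

lemma coef_toFn (ha : 0 < a) (h : P.Bd a u K) : coef (P.toFn u) = u := by
  ext k
  have h1 := hasSum_coef (h.summable_norm ha).of_norm k
  simp only [coef_blk] at h1
  exact h1.unique (P.hasSum_sym_mul u k)

lemma summable_paraT (ha : 0 < a) (hu : P.Bd a u K) (hv : P.Bd a v L) :
    Summable (P.paraT u v) := by
  have hK := hu.nonneg
  have hS := dyS_nonneg a
  refine (summable_norm_of_le_dy (K := K * dyS a * L) ha fun m => ?_).of_norm
  refine (norm_mul_le _ _).trans ?_
  have h1 := norm_low_le_pos ha hu m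
  have h2 := hv m
  calc _ ≤ K * dyS a * (L * dy a m) := by gcongr
    _ = _ := by ring

lemma sum_range_bony (u v : FD) (n : ℕ) :
    ∑ m ∈ Finset.range n, (P.paraT u v m + P.resT u v m + P.paraT v u m)
      = (∑ i ∈ Finset.range n, P.blk i u) * ∑ i ∈ Finset.range n, P.blk i v := by
  induction n with
  | zero => simp
  | succ n ih =>
    rw [Finset.sum_range_succ, ih]
    cases n with
    | zero => simp [paraT, resT, low_apply]
    | succ n =>
      simp only [paraT, resT, low_apply, Nat.add_sub_cancel]
      rw [Finset.sum_range_succ _ (n + 1), Finset.sum_range_succ _ (n + 1),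
        Finset.sum_range_succ _ n, Finset.sum_range_succ _ n]
      ring

lemma fmul_eq_coef (ha : 0 < a) (hu : P.Bd a u K) (hv : P.Bd a v L) :
    P.fmul u v = coef (P.toFn u * P.toFn v) := by
  have s1 := summable_paraT ha hu hv
  have s2 := summable_resT (by linarith : 0 < a + a) hu hv
  have s3 := summable_paraT ha hv hu
  have h1 := ((s1.hasSum.add s2.hasSum).add s3.hasSum).tendsto_sum_nat
  simp only [sum_range_bony] at h1
  have h2 := (hu.hasSum_toFn ha).tendsto_sum_nat.mul (hv.hasSum_toFn ha).tendsto_sum_nat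
  rw [← tendsto_nhds_unique h1 h2, map_add, map_add, ← ser_eq_coef s1, ← ser_eq_coef s2,
    ← ser_eq_coef s3]
  rfl

lemma sum_range_resT (u w : FD) (n : ℕ) :
    ∑ m ∈ Finset.range (n + 1), P.blk m u * P.nbw m w
      = ∑ m ∈ Finset.range (n + 1), P.resT u w m + P.blk n u * P.blk (n + 1) w := by
  induction n with
  | zero => simp [resT, nbw_apply, nb, Finset.sum_Icc_succ_top]; ring
  | succ n ih =>
    rw [Finset.sum_range_succ, ih, Finset.sum_range_succ _ (n + 1)]
    have : P.nbw (n + 1) w = P.blk n w + P.blk (n + 1) w + P.blk (n + 2) w := by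
      rw [nbw_apply, nb, Nat.add_sub_cancel, Finset.sum_Icc_succ_top (by omega),
        Finset.sum_Icc_succ_top (by omega), Finset.Icc_self, Finset.sum_singleton]
    rw [this]
    simp only [resT]
    ring

lemma summable_norm_mul_nbw (ha : 0 < a) (hu : P.Bd a u K) (hw : P.Bd a w M) :
    Summable fun m => ‖P.blk m u * P.nbw m w‖ := by
  have hK := hu.nonneg
  refine summable_norm_of_le_dy (s := a + a) (K := K * (3 * shiftC a 1 * M)) (by linarith) fun m => ?_
  refine (norm_mul_le _ _).trans ?_
  have h1 := hu m
  have h2 := norm_nbw_le hw m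
  have := dy_nonneg a m
  calc _ ≤ K * dy a m * (3 * shiftC a 1 * M * dy a m) := by gcongr
    _ = _ := by rw [dy_add]; ring

lemma fres_eq_coef (ha : 0 < a) (hu : P.Bd a u K) (hw : P.Bd a w M) :
    P.fres u w = coef (∑' m, P.blk m u * P.nbw m w) := by
  have s := summable_resT (by linarith : 0 < a + a) hu hw
  have h1 := ((tendsto_add_atTop_iff_nat 1).2 s.hasSum.tendsto_sum_nat)
  have h2 := (tendsto_add_atTop_iff_nat 1).2
    (summable_norm_mul_nbw ha hu hw).of_norm.hasSum.tendsto_sum_nat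
  have h3 : Tendsto (fun n => P.blk n u * P.blk (n + 1) w) atTop (𝓝 0) := by
    have e1 := (hu.summable_norm ha).of_norm.tendsto_atTop_zero
    have e2 := (tendsto_add_atTop_iff_nat 1).2 (hw.summable_norm ha).of_norm.tendsto_atTop_zero
    simpa using e1.mul e2
  simp only [sum_range_resT] at h2
  have h4 := h1.add h3
  rw [add_zero] at h4
  rw [← tendsto_nhds_unique h4 h2, ← ser_eq_coef s]
  rfl

lemma sum_ann_blk_coef_blk (m : ℕ) (v : FD) :
    ∑ j ∈ ann m, P.blk m (coef (P.blk j v)) = P.blk m v := by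
  rw [← map_sum, ← map_sum, blk_def, blk_def]
  congr 1
  rw [map_sum]
  simp only [coef_blk]
  rw [← Finset.sum_mul]
  have : (∑ j ∈ ann m, P.sym j) * P.sym m = P.sym m := by
    conv_rhs => rw [← P.sum_nb_sym_mul m]
    rw [Finset.sum_mul, Finset.sum_mul]
    symm
    refine Finset.sum_subset (fun j hj => ?_) fun j _ hj => P.sym_mul_sym_of_not_mem_nb hj
    rw [mem_nb] at hj
    rw [mem_ann]; omega
  rw [← mul_assoc, mul_comm (P.sym m), this]

lemma blk_coef_blk_eq_zero {m j : ℕ} (h : m ∉ nb j) (v : FD) : P.blk m (coef (P.blk j v)) = 0 := by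
  rw [coef_blk, blk_def, ← mul_assoc, P.sym_mul_sym_of_not_mem_nb h, zero_mul, map_zero]

variable (P) in
/-- The interaction of the blocks `j` of `v` and `m` of `v` and `w`. -/
def resX (v w : FD) (j m : ℕ) : CT := P.blk m (coef (P.blk j v)) * P.nbw m w

lemma resX_eq_zero {m j : ℕ} (h : m ∉ nb j) (v w : FD) : P.resX v w j m = 0 := by
  rw [resX, blk_coef_blk_eq_zero h, zero_mul]

variable (P) in
/-- The terms of the double series used to compute the commutator. -/
def dblT (u v w : FD) (p : ℕ × ℕ) : CT :=
  ∑ j ∈ ann p.2, if j < p.1 + 2 then P.blk p.1 u * P.resX v w j p.2 else 0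

lemma hasSum_ite_blk (ha : 0 < a) (hu : P.Bd a u K) (j : ℕ) :
    HasSum (fun i => if j < i + 2 then P.blk i u else 0) (P.toFn u - P.low j u) := by
  have h1 := hu.hasSum_toFn ha
  have h2 : HasSum (fun i => if i ∈ Finset.range (j - 1) then P.blk i u else 0) (P.low j u) := by
    rw [low_apply]
    have h3 : ∀ i ∉ Finset.range (j - 1), (if i ∈ Finset.range (j - 1) then P.blk i u else 0) = 0 :=
      fun i hi => if_neg hi
    have h4 : HasSum (fun i => if i ∈ Finset.range (j - 1) then P.blk i u else 0)
      (∑ i ∈ Finset.range (j - 1), if i ∈ Finset.range (j - 1) then P.blk i u else 0) :=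
      hasSum_sum_of_ne_finset_zero h3
    rwa [Finset.sum_congr rfl fun i hi => if_pos hi] at h4
  refine (h1.sub h2).congr_fun ?_
  intro i
  simp only [Finset.mem_range]
  by_cases h : j < i + 2
  · rw [if_pos h, if_neg (by omega), sub_zero]
  · rw [if_neg h, if_pos (by omega), sub_self]

lemma summable_norm_dblT (ha : 0 < a) (hu : P.Bd a u K) (hv : P.Bd a v L) (hw : P.Bd a w M) :
    Summable fun p => ‖P.dblT u v w p‖ := by
  obtain ⟨C, hC, hb⟩ := P.exists_norm_blk_coef_le
  have hL := hv.nonneg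
  have hM := hw.nonneg
  have hs := shiftC_pos a 1
  have hs5 := shiftC_pos a 5
  have s1 := hu.summable_norm ha
  have s2 : Summable fun m => 11 * (C * (L * shiftC a 5) * (3 * shiftC a 1 * M)) * dy (a + a) m :=
    (summable_dy (by linarith)).mul_left _
  refine Summable.of_nonneg_of_le (fun _ => norm_nonneg _) (fun p => ?_)
    (s1.mul_of_nonneg s2 (fun _ => norm_nonneg _) fun m => by
      have := dy_nonneg (a + a) m
      positivity)
  obtain ⟨i, m⟩ := p
  have hd := dy_nonneg a m
  refine (norm_sum_le _ _).trans ((sum_ann_le (B := ‖P.blk i u‖ * ((C * (L * (shiftC a 5 * dy a m)))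
    * (3 * shiftC a 1 * M * dy a m))) (by positivity) fun j hj => ?_).trans
      (le_of_eq (by simp only [dy_add]; ring)))
  obtain ⟨hj1, hj2⟩ := mem_ann.1 hj
  split_ifs
  · refine (norm_mul_le _ _).trans (mul_le_mul_of_nonneg_left ?_ (norm_nonneg _))
    refine (norm_mul_le _ _).trans ?_
    have e1 : ‖P.blk m (coef (P.blk j v))‖ ≤ C * (L * (shiftC a 5 * dy a m)) := by
      refine (hb m _).trans ?_
      have := dy_le_shift a hj2 hj1
      have h2 := hv j
      gcongr
      exact h2.trans (by gcongr)
    have e2 := norm_nbw_le hw m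
    gcongr
  · rw [norm_zero]; positivity

lemma dblT_inner_left (ha : 0 < a) (hu : P.Bd a u K) (m : ℕ) :
    HasSum (fun i => P.dblT u v w (i, m))
      (∑ j ∈ ann m, (P.toFn u - P.low j u) * P.resX v w j m) := by
  refine hasSum_sum fun j _ => ?_
  refine ((hasSum_ite_blk ha hu j).mul_right (P.resX v w j m)).congr_fun fun i => ?_
  simp only
  split_ifs <;> simp

lemma dblT_inner_right (i : ℕ) :
    HasSum (fun m => P.dblT u v w (i, m)) (P.blk i u * P.resQ v w i) := by
  have h0 : ∀ m ∉ Finset.range (i + 7), P.dblT u v w (i, m) = 0 := by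
    intro m hm
    rw [Finset.mem_range] at hm
    refine Finset.sum_eq_zero fun j hj => ?_
    simp only at hj
    rw [mem_ann] at hj
    rw [if_neg]; simp only; omega
  have h1 : HasSum (fun m => P.dblT u v w (i, m)) (∑ m ∈ Finset.range (i + 7), P.dblT u v w (i, m)) :=
    hasSum_sum_of_ne_finset_zero h0
  convert h1 using 1
  have h2 : ∀ m ∈ Finset.range (i + 7), P.dblT u v w (i, m)
      = P.blk i u * ∑ j ∈ Finset.range (i + 2), P.resX v w j m := by
    intro m _
    have e1 : ∑ j ∈ Finset.range (i + 2), P.resX v w j m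
        = ∑ j ∈ Finset.range (i + 2) ∩ ann m, P.resX v w j m := by
      refine (Finset.sum_subset Finset.inter_subset_left fun j hj hj' => ?_).symm
      refine resX_eq_zero (fun hn => hj' ?_) v w
      rw [mem_nb] at hn
      rw [Finset.mem_inter, mem_ann]
      exact ⟨hj, by omega⟩
    rw [e1, Finset.mul_sum, dblT, ← Finset.sum_filter]
    refine Finset.sum_congr ?_ fun _ _ => rfl
    ext j
    simp only [Finset.mem_filter, Finset.mem_inter, Finset.mem_range]
    tauto
  rw [Finset.sum_congr rfl h2, ← Finset.mul_sum, Finset.sum_comm, resQ]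
  congr 1
  refine Finset.sum_congr rfl fun j hj => ?_
  rw [Finset.mem_range] at hj
  refine Finset.sum_subset (fun m hm => ?_) fun m _ hm => resX_eq_zero hm v w
  rw [mem_nb] at hm
  rw [Finset.mem_range]; omega

lemma hasSum_swap {f : ℕ × ℕ → CT} {x : CT} (h : HasSum f x) :
    HasSum (fun p : ℕ × ℕ => f p.swap) x :=
  (Equiv.hasSum_iff (f := f) (Equiv.prodComm ℕ ℕ)).2 h

/-- For regular arguments the commutator is the difference of two products. -/
lemma fcomm_eq_of_regular (hu : P.Bd 2 u K) (hv : P.Bd 2 v L) (hw : P.Bd 2 w M) :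
    P.fres (P.fpara u v) w - P.fmul u (P.fres v w) = P.fcomm u v w := by
  have h2 : (0 : ℝ) < 2 := by norm_num
  obtain ⟨C1, -, hp⟩ := P.exists_bd_fpara_pos h2 2
  obtain ⟨C2, -, hr⟩ := P.exists_bd_fres (a := 2) (b := 2) (by norm_num)
  have hp := hp u v K L hu hv
  have hr := (hr v w L M hv hw).exp_mono (by norm_num : (2 : ℝ) ≤ 2 + 2)
  have hcs : Summable (P.commT u v w) :=
    summable_commT (a := 1 / 2) (b := 0) (c := -(1 / 4)) (by norm_num) (by norm_num) (by norm_num)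
      (hu.exp_mono (by norm_num)) (hv.exp_mono (by norm_num)) (hw.exp_mono (by norm_num))
  have hθ : P.toFn (P.fres v w) = ∑' m, P.blk m v * P.nbw m w := by
    apply coef_injective
    rw [coef_toFn h2 hr, fres_eq_coef h2 hv hw]
  rw [fres_eq_coef h2 hp hw, fmul_eq_coef h2 hu hr, hθ, fcomm, ser_eq_coef hcs, ← map_sub]
  congr 1
  have sD := (summable_norm_dblT h2 hu hv hw).of_norm
  have hR2 : HasSum (fun i => P.blk i u * P.resQ v w i) (∑' p, P.dblT u v w p) :=
    sD.hasSum.prod_fiberwise fun i => dblT_inner_right i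
  have hR2' : HasSum (fun m => ∑ j ∈ ann m, (P.toFn u - P.low j u) * P.resX v w j m)
      (∑' p, P.dblT u v w p) := by
    exact (hasSum_swap sD.hasSum).prod_fiberwise fun m => dblT_inner_left h2 hu m
  have hR1 := hcs.hasSum.add hR2
  have hL1 := (summable_norm_mul_nbw h2 hp hw).of_norm.hasSum
  have hL2 := ((summable_norm_mul_nbw h2 hv hw).of_norm.hasSum).mul_left (P.toFn u)
  have hL := (hL1.sub hL2).add hR2'
  have key : ∀ m, P.blk m (P.fpara u v) * P.nbw m w - P.toFn u * (P.blk m v * P.nbw m w)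
      + ∑ j ∈ ann m, (P.toFn u - P.low j u) * P.resX v w j m
      = P.commT u v w m + P.blk m u * P.resQ v w m := by
    intro m
    have e1 : P.blk m (P.fpara u v) = ∑ j ∈ ann m, P.blk m (coef (P.low j u * P.blk j v)) :=
      (P.annular_paraT u v).blk_ser m
    rw [commT, sub_add_cancel, e1, comT, ← sum_ann_blk_coef_blk m v]
    simp only [resX]
    rw [Finset.sum_mul, Finset.sum_mul, Finset.sum_mul, Finset.mul_sum, ← Finset.sum_sub_distrib,
      ← Finset.sum_add_distrib]
    refine Finset.sum_congr rfl fun j _ => ?_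
    ring
  simp only [key] at hL
  exact add_right_cancel (hL.unique hR1)

/-! ### Truncation -/

variable (P) in
/-- The sum of the first `n` blocks. -/
def trunc (n : ℕ) (u : FD) : FD := coef (P.low (n + 1) u)

lemma trunc_eq (n : ℕ) (u : FD) : P.trunc n u = ∑ i ∈ Finset.range n, P.sym i * u := by
  rw [trunc, low_apply, map_sum, Nat.add_sub_cancel]
  simp only [coef_blk]

lemma lit_coef_of_specIn {N : ℕ} {f : CT} (hf : SpecIn N f) (b : ℝ) : P.Lit b (coef f) := by
  intro ε hε
  refine ⟨2 * N + 3, fun j hj => ?_⟩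
  rw [P.blk_coef_of_specIn hf _ (by omega), norm_zero]
  · exact mul_nonneg hε.le (dy_nonneg _ _)
  · have h1 : (2 * N + 3 : ℝ) < 2 ^ (2 * N + 3) := by exact_mod_cast Nat.lt_two_pow_self
    have h2 : (2 : ℝ) ^ (2 * N + 3) ≤ 2 ^ j := pow_le_pow_right₀ (by norm_num) hj
    have h4 : (N + 1 : ℝ) ≤ 2 ^ N := by exact_mod_cast Nat.lt_two_pow_self
    have h5 : (2 : ℝ) ^ (2 * N + 3) = 2 ^ N * 2 ^ N * 8 := by ring
    have h6 : (0 : ℝ) ≤ N := Nat.cast_nonneg _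
    nlinarith

lemma lit_trunc (n : ℕ) (u : FD) (b : ℝ) : P.Lit b (P.trunc n u) :=
  lit_coef_of_specIn (P.specIn_low (n + 1) u) b

lemma Lit.exists_trunc (h : P.Lit a u) {ε : ℝ} (hε : 0 < ε) :
    ∃ n, P.Bd a (u - P.trunc n u) ε := by
  obtain ⟨C, hC, hb⟩ := P.exists_norm_blk_coef_le
  obtain ⟨n, hn⟩ := h (ε / (1 + 3 * C)) (by positivity)
  refine ⟨n + 1, fun j => ?_⟩
  have hd := dy_nonneg a j
  have hblk : P.blk j (P.trunc (n + 1) u)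
      = ∑ i ∈ Finset.range (n + 1) ∩ nb j, P.blk i (coef (P.blk j u)) := by
    rw [trunc_eq, map_sum]
    have e : ∀ i ∈ Finset.range (n + 1), P.blk j (P.sym i * u) = P.blk i (coef (P.blk j u)) := by
      intro i _
      apply coef_injective
      rw [coef_blk, coef_blk, coef_blk]; ring
    rw [Finset.sum_congr rfl e]
    refine (Finset.sum_subset Finset.inter_subset_left fun i hi hi' => ?_).symm
    exact blk_coef_blk_eq_zero (fun hn => hi' (Finset.mem_inter.2 ⟨hi, hn⟩)) u
  by_cases hj : j < n
  · have : P.blk j (u - P.trunc (n + 1) u) = 0 := by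
      rw [map_sub, hblk, sub_eq_zero]
      have e1 : Finset.range (n + 1) ∩ nb j = nb j := by
        refine Finset.inter_eq_right.2 fun i hi => ?_
        rw [mem_nb] at hi
        rw [Finset.mem_range]; omega
      rw [e1]
      apply coef_injective
      rw [map_sum]
      simp only [coef_blk]
      rw [← Finset.sum_mul, ← mul_assoc, P.sum_nb_sym_mul]
    rw [this, norm_zero]
    positivity
  · rw [map_sub, hblk]
    have h1 := hn j (by omega)
    have h2 : ‖∑ i ∈ Finset.range (n + 1) ∩ nb j, P.blk i (coef (P.blk j u))‖
        ≤ 3 * (C * ‖P.blk j u‖) := by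
      refine (norm_sum_le _ _).trans ?_
      refine (Finset.sum_le_sum_of_subset_of_nonneg Finset.inter_subset_right
        fun _ _ _ => norm_nonneg _).trans (sum_nb_le (by positivity) fun i _ => hb i _)
    calc _ ≤ ‖P.blk j u‖ + 3 * (C * ‖P.blk j u‖) := (norm_sub_le _ _).trans (by gcongr)
      _ = (1 + 3 * C) * ‖P.blk j u‖ := by ring
      _ ≤ (1 + 3 * C) * (ε / (1 + 3 * C) * dy a j) := by gcongr
      _ = ε * dy a j := by field_simp

/-- The commutator of elements of little Besov spaces belongs to a little Besov space. -/
lemma lit_fcomm {a b c : ℝ} (ha : a < 1) (hbc : b + c < 0) (habc : 0 < a + b + c)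
    (hu : P.Bd a u K) (hv : P.Lit b v) (hw : P.Bd c w M) : P.Lit (a + b + c) (P.fcomm u v w) := by
  obtain ⟨C, hC, hb⟩ := P.exists_bd_fcomm ha hbc habc
  have hK := hu.nonneg
  have hM := hw.nonneg
  obtain ⟨L, hL⟩ := hv.exists_bd
  refine Lit.of_approx fun ε hε => ?_
  obtain ⟨n, hn⟩ := hv.exists_trunc (ε := ε / (C * (K * M) + 1)) (by positivity)
  refine ⟨P.fcomm u (P.trunc n v) w, ?_, ?_⟩
  · set b' := b - (b + c) / 2 with hb'
    obtain ⟨L', hL'⟩ := (P.lit_trunc n v b').exists_bd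
    obtain ⟨C', -, hb2⟩ := P.exists_bd_fcomm (b := b') (c := c) ha (by linarith) (by linarith)
    exact (hb2 u _ w K L' M hu hL' hw).lit (by linarith)
  · obtain ⟨L', hL'⟩ := (P.lit_trunc n v b).exists_bd
    have hz := Bd.zero (P := P) c
    have e := fcomm_sub ha hbc habc hu hu hL hL' hw hw
    rw [sub_self, sub_self] at e
    have z1 : P.fcomm 0 v w = 0 := eq_zero_of_bd (P := P) (a := a + b + c) fun ε hε =>
      (hb 0 v w 0 L M (Bd.zero _) hL hw).mono (by simp [hε.le])
    have z2 : P.fcomm u (P.trunc n v) 0 = 0 := eq_zero_of_bd (P := P) (a := a + b + c) fun ε hε =>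
      (hb u _ 0 K L' 0 hu hL' (Bd.zero _)).mono (by simp [hε.le])
    rw [z1, z2, zero_add, add_zero] at e
    rw [e]
    refine (hb u _ w K _ M hu hn hw).mono ?_
    calc C * (K * (ε / (C * (K * M) + 1)) * M) = (C * (K * M)) * ε / (C * (K * M) + 1) := by ring
      _ ≤ ε := by rw [div_le_iff₀ (by positivity)]; nlinarith

end DyadicPartition

end ParaKPZ

namespace ParaKPZ

open MeasureTheory

/-! ### A singular kernel -/

lemma intervalIntegrable_sub_rpow {q : ℝ} (hq : q < 1) (s t : ℝ) :
    IntervalIntegrable (fun r => (r - s) ^ (-q)) volume s t := by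
  have := (intervalIntegral.intervalIntegrable_rpow' (a := 0) (b := t - s) (r := -q)
    (by linarith)).comp_sub_right s
  simpa using this

lemma intervalIntegrable_rpow_sub {p : ℝ} (hp : p < 1) (s t : ℝ) :
    IntervalIntegrable (fun r => (t - r) ^ (-p)) volume s t := by
  have := (intervalIntegral.intervalIntegrable_rpow' (a := t - s) (b := 0) (r := -p)
    (by linarith)).comp_sub_left t
  simpa using this

lemma integral_sub_rpow {q : ℝ} (hq : q < 1) (s t : ℝ) :
    ∫ r in s..t, (r - s) ^ (-q) = (t - s) ^ (1 - q) / (1 - q) := by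
  rw [intervalIntegral.integral_comp_sub_right (fun x => x ^ (-q)) s, sub_self,
    integral_rpow (Or.inl (by linarith)), Real.zero_rpow (by linarith), sub_zero]
  ring_nf

lemma integral_rpow_sub {p : ℝ} (hp : p < 1) (s t : ℝ) :
    ∫ r in s..t, (t - r) ^ (-p) = (t - s) ^ (1 - p) / (1 - p) := by
  rw [intervalIntegral.integral_comp_sub_left (fun x => x ^ (-p)) t, sub_self,
    integral_rpow (Or.inl (by linarith)), Real.zero_rpow (by linarith), sub_zero]
  ring_nf

lemma exists_kernel_bound {p q : ℝ} (hp : 0 ≤ p) (hp1 : p < 1) (hq : 0 ≤ q) (hq1 : q < 1) :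
    ∃ C : ℝ, 0 ≤ C ∧ ∀ s t : ℝ, s ≤ t →
      IntervalIntegrable (fun r => (t - r) ^ (-p) * (r - s) ^ (-q)) volume s t ∧
      ∫ r in s..t, (t - r) ^ (-p) * (r - s) ^ (-q) ≤ C * (t - s) ^ (1 - p - q) := by
  refine ⟨2 ^ p / (1 - q) + 2 ^ q / (1 - p), ?_, fun s t hst => ?_⟩
  · have : 0 < 1 - q := by linarith
    have : 0 < 1 - p := by linarith
    positivity
  rcases hst.eq_or_lt with rfl | hst'
  · simp only [intervalIntegral.integral_same, sub_self]
    refine ⟨IntervalIntegrable.refl, ?_⟩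
    have : 0 < 1 - q := by linarith
    have : 0 < 1 - p := by linarith
    positivity
  have hd : 0 < (t - s) / 2 := by linarith
  have hts : 0 < t - s := by linarith
  have i1 : IntervalIntegrable (fun r => ((t - s) / 2) ^ (-p) * (r - s) ^ (-q)) volume s t :=
    (intervalIntegrable_sub_rpow hq1 s t).const_mul _
  have i2 : IntervalIntegrable (fun r => ((t - s) / 2) ^ (-q) * (t - r) ^ (-p)) volume s t :=
    (intervalIntegrable_rpow_sub hp1 s t).const_mul _
  have hle : ∀ r ∈ Ioo s t, (t - r) ^ (-p) * (r - s) ^ (-q)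
      ≤ ((t - s) / 2) ^ (-p) * (r - s) ^ (-q) + ((t - s) / 2) ^ (-q) * (t - r) ^ (-p) := by
    intro r hr
    have h1 : 0 < t - r := by linarith [hr.2]
    have h2 : 0 < r - s := by linarith [hr.1]
    have h3 : 0 ≤ (t - r) ^ (-p) := by positivity
    have h4 : 0 ≤ (r - s) ^ (-q) := by positivity
    have h5 : 0 ≤ ((t - s) / 2) ^ (-p) := by positivity
    have h6 : 0 ≤ ((t - s) / 2) ^ (-q) := by positivity
    rcases le_total ((t - s) / 2) (t - r) with h | h
    · have := Real.rpow_le_rpow_of_nonpos hd h (by linarith : -p ≤ 0)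
      nlinarith [mul_nonneg h6 h3]
    · have := Real.rpow_le_rpow_of_nonpos hd (by linarith : (t - s) / 2 ≤ r - s)
        (by linarith : -q ≤ 0)
      nlinarith [mul_nonneg h5 h4]
  have hmeas : Measurable fun r : ℝ => (t - r) ^ (-p) * (r - s) ^ (-q) := by fun_prop
  have i3 : IntervalIntegrable (fun r => (t - r) ^ (-p) * (r - s) ^ (-q)) volume s t := by
    rw [intervalIntegrable_iff_integrableOn_Ioo_of_le hst]
    have i4 := (intervalIntegrable_iff_integrableOn_Ioo_of_le hst).1 (i1.add i2)
    refine Integrable.mono' i4 hmeas.aestronglyMeasurable ?_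
    refine (ae_restrict_iff' measurableSet_Ioo).2 (Eventually.of_forall fun r hr => ?_)
    have h1 : 0 < t - r := by linarith [hr.2]
    have h2 : 0 < r - s := by linarith [hr.1]
    rw [Real.norm_of_nonneg (by positivity)]
    exact hle r hr
  refine ⟨i3, ?_⟩
  have := intervalIntegral.integral_mono_on_of_le_Ioo hst i3 (i1.add i2) hle
  refine this.trans ?_
  rw [intervalIntegral.integral_add i1 i2, intervalIntegral.integral_const_mul,
    intervalIntegral.integral_const_mul, integral_sub_rpow hq1, integral_rpow_sub hp1]
  have e1 : ((t - s) / 2) ^ (-p) = 2 ^ p * (t - s) ^ (-p) := by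
    rw [Real.div_rpow hts.le (by norm_num), Real.rpow_neg (by norm_num : (0:ℝ) ≤ 2)]
    field_simp
  have e2 : ((t - s) / 2) ^ (-q) = 2 ^ q * (t - s) ^ (-q) := by
    rw [Real.div_rpow hts.le (by norm_num), Real.rpow_neg (by norm_num : (0:ℝ) ≤ 2)]
    field_simp
  have e3 : (t - s) ^ (-p) * (t - s) ^ (1 - q) = (t - s) ^ (1 - p - q) := by
    rw [← Real.rpow_add hts]; ring_nf
  have e4 : (t - s) ^ (-q) * (t - s) ^ (1 - p) = (t - s) ^ (1 - p - q) := by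
    rw [← Real.rpow_add hts]; ring_nf
  rw [e1, e2]
  apply le_of_eq
  calc _ = 2 ^ p / (1 - q) * ((t - s) ^ (-p) * (t - s) ^ (1 - q))
        + 2 ^ q / (1 - p) * ((t - s) ^ (-q) * (t - s) ^ (1 - p)) := by ring
    _ = _ := by rw [e3, e4]; ring

lemma continuous_heat (k : ℤ) : Continuous fun t => heat t k := by unfold heat; fun_prop

/-- The Duhamel integral of `F`. -/
def duh (F : ℝ → FD) (t : ℝ) : FD := fun k => ∫ r in (0 : ℝ)..t, heat (t - r) k * F r k

lemma duh_zero (F : ℝ → FD) : duh F 0 = 0 := by ext k; simp [duh]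

namespace DyadicPartition

variable (P : DyadicPartition)

lemma blk_integral_apply {G : ℝ → FD} {s t : ℝ}
    (hG : ∀ k, IntervalIntegrable (fun r => G r k) volume s t) (j : ℕ) (x : UnitAddCircle) :
    P.blk j (fun k => ∫ r in s..t, G r k) x = ∫ r in s..t, P.blk j (G r) x := by
  simp only [blk_def, poly_apply, Pi.mul_apply]
  rw [intervalIntegral.integral_finsetSum]
  · refine Finset.sum_congr rfl fun k _ => ?_
    rw [intervalIntegral.integral_mul_const, intervalIntegral.integral_const_mul]
  · intro k _
    exact ((hG k).const_mul _).mul_const _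

variable {P}

lemma intervalIntegrable_coef {G : ℝ → FD} {s t a : ℝ} {b : ℝ → ℝ} (hst : s ≤ t)
    (hb : IntervalIntegrable b volume s t) (hc : ∀ k, ContinuousOn (fun r => G r k) (Ioo s t))
    (h : ∀ r ∈ Ioo s t, P.Bd a (G r) (b r)) (k : ℤ) :
    IntervalIntegrable (fun r => G r k) volume s t := by
  rw [intervalIntegrable_iff_integrableOn_Ioo_of_le hst] at hb ⊢
  refine Integrable.mono' (hb.const_mul (dyS 1 * (3 * (1 + |(k : ℝ)|)) ^ ⌈1 + |a|⌉₊))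
    ((hc k).aestronglyMeasurable measurableSet_Ioo) ?_
  refine (ae_restrict_iff' measurableSet_Ioo).2 (Eventually.of_forall fun r hr => ?_)
  exact ((h r hr).norm_coef_le k).trans (le_of_eq (by ring))

lemma bd_integral {G : ℝ → FD} {s t a : ℝ} {b : ℝ → ℝ} (hst : s ≤ t)
    (hb : IntervalIntegrable b volume s t) (hc : ∀ k, ContinuousOn (fun r => G r k) (Ioo s t))
    (h : ∀ r ∈ Ioo s t, P.Bd a (G r) (b r)) :
    P.Bd a (fun k => ∫ r in s..t, G r k) (∫ r in s..t, b r) := by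
  have hb0 : 0 ≤ ∫ r in s..t, b r := by
    have := intervalIntegral.integral_mono_on_of_le_Ioo hst
      (intervalIntegrable_const (c := (0 : ℝ)) (μ := volume)) hb fun r hr => (h r hr).nonneg
    simpa using this
  intro j
  refine (CT.norm_le _ (mul_nonneg hb0 (dy_nonneg a j))).2 fun x => ?_
  rw [blk_integral_apply P (intervalIntegrable_coef hst hb hc h),
    ← intervalIntegral.integral_mul_const]
  refine intervalIntegral.norm_integral_le_of_norm_le hst ?_ (hb.mul_const _)
  have h0 : ∀ᵐ r : ℝ, r ≠ t := compl_mem_ae_iff.2 (measure_singleton t)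
  filter_upwards [h0] with r hr hr'
  exact (CT.norm_coe_le_norm _ x).trans (h r ⟨hr'.1, lt_of_le_of_ne hr'.2 hr⟩ j)

/-- The integral of the heat flow of a source with singularity of order `w` at the time `0`. -/
lemma exists_bd_heat_integral (P : DyadicPartition) {T : ℝ} (hT : 0 ≤ T) (σ : ℝ) {θ w η : ℝ}
    (hη : 0 ≤ η) (hηθ : η ≤ θ) (hηw : η ≤ w) (hθ : θ < 1) (hw : w < 1) : ∃ C : ℝ, 0 ≤ C ∧
    ∀ (F : ℝ → FD) (K s t : ℝ), 0 ≤ K → 0 ≤ s → s ≤ t → 0 < t → t ≤ T →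
      (∀ k, ContinuousOn (fun r => F r k) (Ioo s t)) →
      (∀ r ∈ Ioo s t, P.Bd σ (F r) (K * r ^ (-w))) →
      (∀ k, IntervalIntegrable (fun r => heat (t - r) k * F r k) volume s t) ∧
      P.Bd (σ + 2 * θ) (fun k => ∫ r in s..t, heat (t - r) k * F r k)
        (C * K * t ^ (-η) * (t - s) ^ (1 - θ - w + η)) := by
  obtain ⟨C, hC, hh⟩ := P.exists_bd_heat T hT
  obtain ⟨C1, hC1, hk1⟩ := exists_kernel_bound (p := θ - η) (q := w) (by linarith) (by linarith)
    (by linarith) hw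
  obtain ⟨C2, hC2, hk2⟩ := exists_kernel_bound (p := θ) (q := w - η) (by linarith) hθ
    (by linarith) (by linarith)
  refine ⟨C * (C1 + C2), by positivity, fun F K s t hK hs hst ht htT hF hB => ?_⟩
  obtain ⟨i1, b1⟩ := hk1 s t hst
  obtain ⟨i2, b2⟩ := hk2 s t hst
  set b : ℝ → ℝ := fun r => C * K * t ^ (-η) *
    ((t - r) ^ (-(θ - η)) * (r - s) ^ (-w) + (t - r) ^ (-θ) * (r - s) ^ (-(w - η))) with hb
  have ib : IntervalIntegrable b volume s t := (i1.add i2).const_mul _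
  have hc : ∀ k, ContinuousOn (fun r => (heat (t - r) * F r) k) (Ioo s t) := fun k =>
    ((continuous_heat k).comp (continuous_const.sub continuous_id)).continuousOn.mul (hF k)
  have hbd : ∀ r ∈ Ioo s t, P.Bd (σ + 2 * θ) (heat (t - r) * F r) (b r) := by
    intro r hr
    have h1 : 0 < t - r := by linarith [hr.2]
    have h2 : 0 < r - s := by linarith [hr.1]
    have h3 : 0 < r := by linarith
    refine (hh σ θ (t - r) (F r) _ (by linarith) (by linarith) h1 (by linarith)
      (hB r hr)).mono ?_
    have e0 : 1 ≤ t ^ (-η) * ((t - r) ^ η + r ^ η) := by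
      have := Real.rpow_add_le_add_rpow h1.le h3.le hη (by linarith)
      rw [sub_add_cancel] at this
      calc (1 : ℝ) = t ^ (-η) * t ^ η := by rw [← Real.rpow_add ht]; simp
        _ ≤ _ := by gcongr
    have e1 : (t - r) ^ (-θ) * (t - r) ^ η = (t - r) ^ (-(θ - η)) := by
      rw [← Real.rpow_add h1]; ring_nf
    have e2 : r ^ (-w) * r ^ η = r ^ (-(w - η)) := by rw [← Real.rpow_add h3]; ring_nf
    have e3 : r ^ (-w) ≤ (r - s) ^ (-w) :=
      Real.rpow_le_rpow_of_nonpos h2 (by linarith) (by linarith)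
    have e4 : r ^ (-(w - η)) ≤ (r - s) ^ (-(w - η)) :=
      Real.rpow_le_rpow_of_nonpos h2 (by linarith) (by linarith)
    have p1 : 0 ≤ (t - r) ^ (-θ) := by positivity
    have p2 : 0 ≤ (t - r) ^ (-(θ - η)) := by positivity
    have p3 : 0 ≤ r ^ (-w) := by positivity
    have p4 : 0 ≤ t ^ (-η) := by positivity
    calc C * (t - r) ^ (-θ) * (K * r ^ (-w)) = C * K * ((t - r) ^ (-θ) * r ^ (-w)) * 1 := by ring
      _ ≤ C * K * ((t - r) ^ (-θ) * r ^ (-w)) * (t ^ (-η) * ((t - r) ^ η + r ^ η)) := by gcongr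
      _ = C * K * t ^ (-η) * (((t - r) ^ (-θ) * (t - r) ^ η) * r ^ (-w)
          + (t - r) ^ (-θ) * (r ^ (-w) * r ^ η)) := by ring
      _ ≤ C * K * t ^ (-η) * ((t - r) ^ (-(θ - η)) * (r - s) ^ (-w)
          + (t - r) ^ (-θ) * (r - s) ^ (-(w - η))) := by rw [e1, e2]; gcongr
  refine ⟨intervalIntegrable_coef hst ib hc hbd, (bd_integral hst ib hc hbd).mono ?_⟩
  rw [hb, intervalIntegral.integral_const_mul, intervalIntegral.integral_add i1 i2]
  have q1 : (t - s) ^ (1 - (θ - η) - w) = (t - s) ^ (1 - θ - w + η) := by ring_nf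
  have q2 : (t - s) ^ (1 - θ - (w - η)) = (t - s) ^ (1 - θ - w + η) := by ring_nf
  rw [q1] at b1
  rw [q2] at b2
  calc _ ≤ C * K * t ^ (-η) * (C1 * (t - s) ^ (1 - θ - w + η) + C2 * (t - s) ^ (1 - θ - w + η)) := by
        gcongr
    _ = _ := by ring

variable (P) in
/-- The bounds defining the norm of `ℒ^{η,a,1/4}_τ`. -/
structure WL (τ η a K : ℝ) (f : ℝ → FD) : Prop where
  sup : ∀ t, 0 < t → t ≤ τ → P.Bd a (f t) (K * t ^ (-η))
  low : ∀ t, 0 ≤ t → t ≤ τ → P.Bd (a - 2 * η) (f t) K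
  hol : ∀ s t, 0 < s → s < t → t ≤ τ →
    P.Bd (a - 1 / 2) (f t - f s) (K * s ^ (-η) * (t - s) ^ (1 / 4 : ℝ))

lemma WL.mono {τ η a K L : ℝ} {f : ℝ → FD} (h : P.WL τ η a K f) (hKL : K ≤ L) :
    P.WL τ η a L f where
  sup t h0 ht := (h.sup t h0 ht).mono (by gcongr)
  low t h0 ht := (h.low t h0 ht).mono hKL
  hol s t h0 hst ht := (h.hol s t h0 hst ht).mono (by
    have : 0 < t - s := by linarith
    gcongr)

lemma WL.add {τ η a K L : ℝ} {f g : ℝ → FD} (h : P.WL τ η a K f) (h' : P.WL τ η a L g) :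
    P.WL τ η a (K + L) (fun t => f t + g t) where
  sup t h0 ht := ((h.sup t h0 ht).add (h'.sup t h0 ht)).mono (le_of_eq (by ring))
  low t h0 ht := (h.low t h0 ht).add (h'.low t h0 ht)
  hol s t h0 hst ht := by
    have := ((h.hol s t h0 hst ht).add (h'.hol s t h0 hst ht)).mono
      (le_of_eq (by ring) : _ ≤ (K + L) * s ^ (-η) * (t - s) ^ (1 / 4 : ℝ))
    rwa [show f t + g t - (f s + g s) = f t - f s + (g t - g s) by abel]

lemma WL.time_mono {τ τ' η a K : ℝ} {f : ℝ → FD} (h : P.WL τ η a K f) (hτ : τ' ≤ τ) :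
    P.WL τ' η a K f where
  sup t h0 ht := h.sup t h0 (ht.trans hτ)
  low t h0 ht := h.low t h0 (ht.trans hτ)
  hol s t h0 hst ht := h.hol s t h0 hst (ht.trans hτ)

lemma WL.congr {τ η a K : ℝ} {f g : ℝ → FD} (h : P.WL τ η a K f)
    (hfg : ∀ t, 0 ≤ t → t ≤ τ → g t = f t) : P.WL τ η a K g where
  sup t h0 ht := by rw [hfg t h0.le ht]; exact h.sup t h0 ht
  low t h0 ht := by rw [hfg t h0 ht]; exact h.low t h0 ht
  hol s t h0 hst ht := by
    rw [hfg t (h0.trans hst).le ht, hfg s h0.le (hst.le.trans ht)]; exact h.hol s t h0 hst ht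

lemma duh_eq_zero {F : ℝ → FD} {t₀ : ℝ} (hz : ∀ r, 0 < r → r ≤ t₀ → F r = 0) {t : ℝ} (ht0 : 0 ≤ t)
    (ht : t ≤ t₀) : duh F t = 0 := by
  ext k
  rw [duh]
  have : ∀ r ∈ Ioc 0 t, heat (t - r) k * F r k = 0 := fun r hr => by
    rw [hz r hr.1 (hr.2.trans ht), Pi.zero_apply, mul_zero]
  rw [intervalIntegral.integral_of_le ht0, setIntegral_congr_fun measurableSet_Ioc this,
    integral_zero, Pi.zero_apply]

lemma duh_eq_heat_mul_add {F : ℝ → FD} {s t : ℝ}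
    (h : ∀ k, IntervalIntegrable (fun r => heat (t - r) k * F r k) volume 0 s)
    (h' : ∀ k, IntervalIntegrable (fun r => heat (t - r) k * F r k) volume s t) :
    duh F t = heat (t - s) * duh F s + fun k => ∫ r in s..t, heat (t - r) k * F r k := by
  ext k
  rw [Pi.add_apply, Pi.mul_apply, duh, duh, ← intervalIntegral.integral_add_adjacent_intervals
    (h k) (h' k), ← intervalIntegral.integral_const_mul]
  congr 1
  refine intervalIntegral.integral_congr fun r _ => ?_
  have e : heat (t - r) = heat (t - s) * heat (s - r) := by rw [← heat_add, sub_add_sub_cancel]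
  rw [e, Pi.mul_apply, mul_assoc]

/-- The Schauder estimate, for a source that vanishes up to the time `t₀`. -/
lemma exists_wl_duh (P : DyadicPartition) {T : ℝ} (hT : 0 ≤ T) (σ : ℝ) {θ w η : ℝ}
    (h14 : 1 / 4 ≤ θ) (hθ : θ < 1) (hη : 0 ≤ η) (hηθ : η ≤ θ) (hηw : η ≤ w) (hw : w < 1)
    (hκ : 0 ≤ 1 - θ - w + η) : ∃ C : ℝ, 0 ≤ C ∧ ∀ (F : ℝ → FD) (K τ t₀ : ℝ), 0 ≤ K → 0 ≤ t₀ →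
      t₀ ≤ τ → τ ≤ T → (∀ k, ContinuousOn (fun r => F r k) (Ioc 0 τ)) →
      (∀ r, 0 < r → r ≤ τ → P.Bd σ (F r) (K * r ^ (-w))) →
      (∀ r, 0 < r → r ≤ t₀ → F r = 0) →
      P.WL τ η (σ + 2 * θ) (C * K * (τ - t₀) ^ (1 - θ - w + η)) (duh F) := by
  obtain ⟨C1, hC1, h1⟩ := P.exists_bd_heat_integral hT σ hη hηθ hηw hθ hw
  obtain ⟨C2, hC2, h2⟩ := P.exists_bd_heat_integral hT σ (θ := θ - η) (w := w) le_rfl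
    (by linarith) (by linarith) (by linarith) hw
  obtain ⟨C3, hC3, h3⟩ := P.exists_bd_heat_integral hT σ (θ := θ - 1 / 4) (w := w - η) le_rfl
    (by linarith) (by linarith) (by linarith) (by linarith)
  obtain ⟨C4, hC4, h4⟩ := P.exists_bd_heat_sub T hT
  refine ⟨C1 + C2 + C4 * C1 + C3, by positivity, fun F K τ t₀ hK ht0 htτ hτ hc hB hz => ?_⟩
  have hpos : 0 ≤ (τ - t₀) ^ (1 - θ - w + η) := Real.rpow_nonneg (by linarith) _
  have hI : ∀ s t, 0 ≤ s → s ≤ t → 0 < t → t ≤ τ → ∀ k,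
      IntervalIntegrable (fun r => heat (t - r) k * F r k) volume s t := fun s t hs hst ht htτ =>
    (h1 F K s t hK hs hst ht (htτ.trans hτ)
      (fun k => (hc k).mono fun r hr => ⟨hs.trans_lt hr.1, hr.2.le.trans htτ⟩)
      fun r hr => hB r (hs.trans_lt hr.1) (hr.2.le.trans htτ)).1
  have hI' : ∀ s t, 0 ≤ s → s ≤ t → 0 < t → t ≤ τ → ∀ k,
      IntervalIntegrable (fun r => heat (t - r) k * F r k) volume 0 s :=
    fun s t hs hst ht htτ k => (hI 0 t le_rfl (hs.trans hst) ht htτ k).mono_set (by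
      rw [uIcc_of_le hs, uIcc_of_le (hs.trans hst)]; exact Icc_subset_Icc le_rfl hst)
  have hsplit : ∀ s t, 0 ≤ s → s ≤ t → 0 < t → t ≤ τ → duh F t
      = heat (t - s) * duh F s + fun k => ∫ r in s..t, heat (t - r) k * F r k :=
    fun s t hs hst ht htτ => duh_eq_heat_mul_add (hI' s t hs hst ht htτ) (hI s t hs hst ht htτ)
  have hz0 : ∀ t, 0 ≤ t → t ≤ t₀ → duh F t = 0 := fun t h0 h => duh_eq_zero hz h0 h
  have hrep : ∀ t, t₀ < t → t ≤ τ → duh F t = fun k => ∫ r in t₀..t, heat (t - r) k * F r k := by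
    intro t h htτ
    rw [hsplit t₀ t ht0 h.le (ht0.trans_lt h) htτ, hz0 t₀ ht0 le_rfl, mul_zero, zero_add]
  have hsup : ∀ t, 0 < t → t ≤ τ →
      P.Bd (σ + 2 * θ) (duh F t) (C1 * K * (τ - t₀) ^ (1 - θ - w + η) * t ^ (-η)) := by
    intro t h0 ht
    rcases le_or_gt t t₀ with h | h
    · rw [hz0 t h0.le h]
      exact (Bd.zero _).mono (by positivity)
    · rw [hrep t h ht]
      have := (h1 F K t₀ t hK ht0 h.le h0 (ht.trans hτ)
        (fun k => (hc k).mono fun r hr => ⟨ht0.trans_lt hr.1, hr.2.le.trans ht⟩)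
        fun r hr => hB r (ht0.trans_lt hr.1) (hr.2.le.trans ht)).2
      refine this.mono ?_
      have e : (t - t₀) ^ (1 - θ - w + η) ≤ (τ - t₀) ^ (1 - θ - w + η) :=
        Real.rpow_le_rpow (by linarith) (by linarith) hκ
      calc C1 * K * t ^ (-η) * (t - t₀) ^ (1 - θ - w + η)
          ≤ C1 * K * t ^ (-η) * (τ - t₀) ^ (1 - θ - w + η) := by gcongr
        _ = _ := by ring
  refine ⟨fun t h0 ht => (hsup t h0 ht).mono ?_, fun t h0 ht => ?_, fun s t hs hst ht => ?_⟩
  · gcongr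
    linarith [mul_nonneg hC4 hC1]
  · rcases le_or_gt t t₀ with h | h
    · rw [hz0 t h0 h]
      exact (Bd.zero _).mono (by positivity)
    · rw [hrep t h ht]
      have := (h2 F K t₀ t hK ht0 h.le (ht0.trans_lt h) (ht.trans hτ)
        (fun k => (hc k).mono fun r hr => ⟨ht0.trans_lt hr.1, hr.2.le.trans ht⟩)
        fun r hr => hB r (ht0.trans_lt hr.1) (hr.2.le.trans ht)).2
      rw [show σ + 2 * (θ - η) = σ + 2 * θ - 2 * η by ring, neg_zero, Real.rpow_zero, mul_one,
        show 1 - (θ - η) - w + 0 = 1 - θ - w + η by ring] at this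
      refine this.mono ?_
      have e : (t - t₀) ^ (1 - θ - w + η) ≤ (τ - t₀) ^ (1 - θ - w + η) :=
        Real.rpow_le_rpow (by linarith) (by linarith) hκ
      have : 0 ≤ C1 + C4 * C1 + C3 := by positivity
      calc C2 * K * (t - t₀) ^ (1 - θ - w + η) ≤ C2 * K * (τ - t₀) ^ (1 - θ - w + η) := by gcongr
        _ ≤ _ := by gcongr; linarith
  · have hts : 0 < t - s := by linarith
    rcases le_or_gt t t₀ with h | h
    · rw [hz0 t (by linarith) h, hz0 s hs.le (by linarith), sub_zero]
      exact (Bd.zero _).mono (by positivity)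
    rw [hsplit s t hs.le hst.le (hs.trans hst) ht]
    have e1 : heat (t - s) * duh F s + (fun k => ∫ r in s..t, heat (t - r) k * F r k) - duh F s
        = (heat (t - s) - 1) * duh F s + fun k => ∫ r in s..t, heat (t - r) k * F r k := by ring
    rw [e1]
    have b1 := h4 (σ + 2 * θ) (1 / 4) (t - s) _ _ (by norm_num) (by norm_num) hts.le
      (by linarith) (hsup s hs (by linarith))
    set s' := max s t₀ with hs'
    have hs's : s ≤ s' := le_max_left _ _
    have hs't : t₀ ≤ s' := le_max_right _ _
    have hs'lt : s' < t := max_lt hst h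
    have e2 : (fun k => ∫ r in s..t, heat (t - r) k * F r k)
        = fun k => ∫ r in s'..t, heat (t - r) k * F r k := by
      ext k
      rcases le_total t₀ s with h5 | h5
      · rw [hs', max_eq_left h5]
      · rw [hs', max_eq_right h5, ← intervalIntegral.integral_add_adjacent_intervals
          ((hI s t hs.le hst.le (by linarith) ht k).mono_set (by
            rw [uIcc_of_le h5, uIcc_of_le hst.le]; exact Icc_subset_Icc le_rfl h.le))
          (hI t₀ t ht0 h.le (by linarith) ht k)]
        have : ∀ r ∈ Ioc s t₀, heat (t - r) k * F r k = 0 := fun r hr => by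
          rw [hz r (hs.trans hr.1) hr.2, Pi.zero_apply, mul_zero]
        rw [intervalIntegral.integral_of_le h5, setIntegral_congr_fun measurableSet_Ioc this]
        simp
    rw [e2]
    have b2 := (h3 F (K * s ^ (-η)) s' t (by positivity) (hs.le.trans hs's) hs'lt.le
      (hs.trans hst) (ht.trans hτ)
      (fun k => (hc k).mono fun r hr => ⟨hs.trans (hs's.trans_lt hr.1), hr.2.le.trans ht⟩)
      fun r hr => (hB r (hs.trans (hs's.trans_lt hr.1)) (hr.2.le.trans ht)).mono (by
        have hr0 : 0 < r := hs.trans (hs's.trans_lt hr.1)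
        have e3 : r ^ (-w) = r ^ (-η) * r ^ (-(w - η)) := by rw [← Real.rpow_add hr0]; ring_nf
        have e4 : r ^ (-η) ≤ s ^ (-η) :=
          Real.rpow_le_rpow_of_nonpos hs (hs's.trans hr.1.le) (by linarith)
        rw [e3, mul_assoc]
        gcongr)).2
    rw [show σ + 2 * (θ - 1 / 4) = σ + 2 * θ - 1 / 2 by ring, neg_zero, Real.rpow_zero, mul_one,
      show 1 - (θ - 1 / 4) - (w - η) + 0 = 1 - θ - w + η + 1 / 4 by ring] at b2
    rw [show σ + 2 * θ - 2 * (1 / 4) = σ + 2 * θ - 1 / 2 by ring] at b1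
    refine (b1.add b2).mono ?_
    have ht' : 0 < t - s' := by linarith
    have e5 : (t - s') ^ (1 - θ - w + η + 1 / 4)
        ≤ (τ - t₀) ^ (1 - θ - w + η) * (t - s) ^ (1 / 4 : ℝ) := by
      rw [Real.rpow_add ht']
      gcongr
    calc _ ≤ C4 * (t - s) ^ (1 / 4 : ℝ) * (C1 * K * (τ - t₀) ^ (1 - θ - w + η) * s ^ (-η))
          + C3 * (K * s ^ (-η)) * ((τ - t₀) ^ (1 - θ - w + η) * (t - s) ^ (1 / 4 : ℝ)) := by gcongr
      _ = (C4 * C1 + C3) * (K * (τ - t₀) ^ (1 - θ - w + η) * s ^ (-η) * (t - s) ^ (1 / 4 : ℝ)) := by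
          ring
      _ ≤ (C1 + C2 + C4 * C1 + C3)
          * (K * (τ - t₀) ^ (1 - θ - w + η) * s ^ (-η) * (t - s) ^ (1 / 4 : ℝ)) := by
          gcongr; linarith
      _ = _ := by ring

/-- The heat flow of an initial value. -/
lemma exists_wl_heat (P : DyadicPartition) {T : ℝ} (hT : 0 ≤ T) (a : ℝ) {η : ℝ} (hη : 0 ≤ η)
    (hη2 : η ≤ 2) : ∃ C : ℝ, 0 ≤ C ∧ ∀ (c : FD) (K : ℝ), P.Bd (a - 2 * η) c K →
      P.WL T η a (C * K) (fun t => heat t * c) := by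
  obtain ⟨C1, hC1, h1⟩ := P.exists_bd_heat T hT
  obtain ⟨C2, hC2, h2⟩ := P.exists_bd_heat_zero T hT
  obtain ⟨C4, hC4, h4⟩ := P.exists_bd_heat_sub T hT
  refine ⟨C1 + C2 + C4 * C1, by positivity, fun c K hc => ?_⟩
  have hK := hc.nonneg
  have hsup : ∀ t, 0 < t → t ≤ T → P.Bd a (heat t * c) (C1 * t ^ (-η) * K) := fun t h0 ht => by
    have := h1 _ η t c K hη hη2 h0 ht hc
    rwa [sub_add_cancel] at this
  refine ⟨fun t h0 ht => (hsup t h0 ht).mono ?_, fun t h0 ht => (h2 _ t c K h0 ht hc).mono ?_,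
    fun s t hs hst ht => ?_⟩
  · have : 0 ≤ C4 * C1 := by positivity
    calc C1 * t ^ (-η) * K = C1 * K * t ^ (-η) := by ring
      _ ≤ _ := by gcongr; linarith
  · have : 0 ≤ C4 * C1 := by positivity
    gcongr; linarith
  · have hts : 0 < t - s := by linarith
    have b1 := h4 a (1 / 4) (t - s) _ _ (by norm_num) (by norm_num) hts.le (by linarith)
      (hsup s hs (by linarith))
    have e : heat t * c - heat s * c = (heat (t - s) - 1) * (heat s * c) := by
      have e0 : heat t = heat (t - s) * heat s := by rw [← heat_add, sub_add_cancel]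
      rw [e0]
      ring
    rw [e]
    rw [show a - 2 * (1 / 4) = a - 1 / 2 by ring] at b1
    refine b1.mono ?_
    calc _ = C4 * C1 * (K * s ^ (-η) * (t - s) ^ (1 / 4 : ℝ)) := by ring
      _ ≤ (C1 + C2 + C4 * C1) * (K * s ^ (-η) * (t - s) ^ (1 / 4 : ℝ)) := by gcongr; linarith
      _ = _ := by ring

end DyadicPartition

namespace DyadicPartition

variable {P : DyadicPartition} {a b c : ℝ}

/-! ### Bilinear operators -/

variable (P) in
/-- `B` is a bounded bilinear operator from `𝒞^a × 𝒞^b` to `𝒞^c`. -/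
structure Bil (a b c C : ℝ) (B : FD → FD → FD) : Prop where
  nonneg : 0 ≤ C
  bd : ∀ (u v : FD) (K L : ℝ), P.Bd a u K → P.Bd b v L → P.Bd c (B u v) (C * (K * L))
  sub : ∀ (u u' v v' : FD) (K K' L L' : ℝ), P.Bd a u K → P.Bd a u' K' → P.Bd b v L →
    P.Bd b v' L' → B u v - B u' v' = B (u - u') v + B u' (v - v')

lemma Bil.exp_mono {C : ℝ} {B : FD → FD → FD} {c' : ℝ} (h : P.Bil a b c C B) (hc : c' ≤ c) :
    P.Bil a b c' C B :=
  ⟨h.nonneg, fun u v K L hu hv => (h.bd u v K L hu hv).exp_mono hc, h.sub⟩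

lemma Bil.add {C C' : ℝ} {B B' : FD → FD → FD} (h : P.Bil a b c C B) (h' : P.Bil a b c C' B') :
    P.Bil a b c (C + C') (fun u v => B u v + B' u v) :=
  ⟨add_nonneg h.nonneg h'.nonneg, fun u v K L hu hv =>
    ((h.bd u v K L hu hv).add (h'.bd u v K L hu hv)).mono (le_of_eq (by ring)),
    fun u u' v v' K K' L L' hu hu' hv hv' => by
      have e1 := h.sub u u' v v' K K' L L' hu hu' hv hv'
      have e2 := h'.sub u u' v v' K K' L L' hu hu' hv hv'
      rw [add_sub_add_comm, e1, e2]; abel⟩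

lemma fpara_sub_sub (u u' v v' : FD) :
    P.fpara u v - P.fpara u' v' = P.fpara (u - u') v + P.fpara u' (v - v') := by
  simp only [map_sub, LinearMap.sub_apply]; abel

lemma exists_bil_fpara_pos (P : DyadicPartition) (ha : 0 < a) (b : ℝ) :
    ∃ C, P.Bil a b b C (fun u v => P.fpara u v) := by
  obtain ⟨C, hC, h⟩ := P.exists_bd_fpara_pos ha b
  exact ⟨C, hC, h, fun u u' v v' _ _ _ _ _ _ _ _ => fpara_sub_sub u u' v v'⟩

lemma exists_bil_fpara_neg (P : DyadicPartition) (ha : a < 0) (b : ℝ) :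
    ∃ C, P.Bil a b (a + b) C (fun u v => P.fpara u v) := by
  obtain ⟨C, hC, h⟩ := P.exists_bd_fpara_neg ha b
  exact ⟨C, hC, h, fun u u' v v' _ _ _ _ _ _ _ _ => fpara_sub_sub u u' v v'⟩

lemma Bil.swap {C : ℝ} {B : FD → FD → FD} (h : P.Bil a b c C B) :
    P.Bil b a c C (fun u v => B v u) :=
  ⟨h.nonneg, fun u v K L hu hv => (h.bd v u L K hv hu).mono (le_of_eq (by ring)),
    fun u u' v v' K K' L L' hu hu' hv hv' => by
      have e1 := h.sub v v' u' u' L L' K' K' hv hv' hu' hu'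
      have e2 := h.sub v v u u' L L K K' hv hv hu hu'
      rw [sub_self] at e1 e2
      have q1 : B v u - B v' u' = (B v u - B v u') + (B v u' - B v' u') := by abel
      have q2 : B 0 u = 0 := by
        have := h.bd 0 u 0 K (Bd.zero _) hu
        exact eq_zero_of_bd (P := P) (a := c) fun ε hε => this.mono (by simp [hε.le])
      have q3 : B v' 0 = 0 := by
        have := h.bd v' 0 L' 0 hv' (Bd.zero _)
        exact eq_zero_of_bd (P := P) (a := c) fun ε hε => this.mono (by simp [hε.le])
      rw [q1, e2, e1, q2, q3]; abel⟩

lemma exists_bil_fres (P : DyadicPartition) (hab : 0 < a + b) :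
    ∃ C, P.Bil a b (a + b) C P.fres := by
  obtain ⟨C, hC, h⟩ := P.exists_bd_fres hab
  exact ⟨C, hC, h, fun _ _ _ _ _ _ _ _ hu hu' hv hv' => fres_sub hab hu hu' hv hv'⟩

lemma exists_bil_fmul_pos (P : DyadicPartition) (ha : 0 < a) : ∃ C, P.Bil a a a C P.fmul := by
  obtain ⟨C1, h1⟩ := P.exists_bil_fpara_pos ha a
  obtain ⟨C2, h2⟩ := P.exists_bil_fres (by linarith : 0 < a + a)
  exact ⟨_, (h1.add (h2.exp_mono (by linarith))).add h1.swap⟩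

lemma exists_bil_fmul_neg (P : DyadicPartition) (ha : 0 < a) (hb : b < 0) (hab : 0 < a + b) :
    ∃ C, P.Bil a b b C P.fmul := by
  obtain ⟨C1, h1⟩ := P.exists_bil_fpara_pos ha b
  obtain ⟨C2, h2⟩ := P.exists_bil_fres hab
  obtain ⟨C3, h3⟩ := P.exists_bil_fpara_neg hb a
  exact ⟨_, (h1.add (h2.exp_mono (by linarith))).add (h3.swap.exp_mono (by linarith))⟩

/-! ### Pairs -/

variable (P) in
/-- Bounds on two elements of a Besov space and on their difference. -/
structure PB (a : ℝ) (u u' : FD) (K d : ℝ) : Prop where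
  left : P.Bd a u K
  right : P.Bd a u' K
  diff : P.Bd a (u - u') d

lemma PB.mono {u u' : FD} {K d L e : ℝ} (h : P.PB a u u' K d) (hK : K ≤ L) (hd : d ≤ e) :
    P.PB a u u' L e := ⟨h.left.mono hK, h.right.mono hK, h.diff.mono hd⟩

lemma PB.exp_mono {u u' : FD} {K d : ℝ} (h : P.PB a u u' K d) (hb : b ≤ a) :
    P.PB b u u' K d := ⟨h.left.exp_mono hb, h.right.exp_mono hb, h.diff.exp_mono hb⟩

lemma PB.add {u u' v v' : FD} {K d L e : ℝ} (h : P.PB a u u' K d) (h' : P.PB a v v' L e) :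
    P.PB a (u + v) (u' + v') (K + L) (d + e) :=
  ⟨h.left.add h'.left, h.right.add h'.right, by rw [add_sub_add_comm]; exact h.diff.add h'.diff⟩

lemma PB.smul {u u' : FD} {K d : ℝ} (h : P.PB a u u' K d) (z : ℂ) :
    P.PB a (z • u) (z • u') (‖z‖ * K) (‖z‖ * d) :=
  ⟨h.left.smul z, h.right.smul z, by rw [← smul_sub]; exact h.diff.smul z⟩

lemma Bil.pb {C : ℝ} {B : FD → FD → FD} (h : P.Bil a b c C B) {u u' v v' : FD} {K d L e : ℝ}
    (hu : P.PB a u u' K d) (hv : P.PB b v v' L e) :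
    P.PB c (B u v) (B u' v') (C * (K * L)) (C * (d * L + K * e)) :=
  ⟨h.bd _ _ _ _ hu.left hv.left, h.bd _ _ _ _ hu.right hv.right, by
    rw [h.sub u u' v v' K K L L hu.left hu.right hv.left hv.right]
    exact ((h.bd _ _ _ _ hu.diff hv.left).add (h.bd _ _ _ _ hu.right hv.diff)).mono
      (le_of_eq (by ring))⟩

lemma exists_pb_fcomm (P : DyadicPartition) (ha : a < 1) (hbc : b + c < 0) (habc : 0 < a + b + c) :
    ∃ C, 0 ≤ C ∧ ∀ (u u' v v' w w' : FD) (K d L e M r : ℝ), P.PB a u u' K d → P.PB b v v' L e →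
      P.PB c w w' M r → P.PB (a + b + c) (P.fcomm u v w) (P.fcomm u' v' w') (C * (K * L * M))
        (C * (d * L * M + K * e * M + K * L * r)) := by
  obtain ⟨C, hC, h⟩ := P.exists_bd_fcomm ha hbc habc
  refine ⟨C, hC, fun u u' v v' w w' K d L e M r hu hv hw =>
    ⟨h _ _ _ _ _ _ hu.left hv.left hw.left, h _ _ _ _ _ _ hu.right hv.right hw.right, ?_⟩⟩
  rw [fcomm_sub ha hbc habc hu.left hu.right hv.left hv.right hw.left hw.right]
  exact (((h _ _ _ _ _ _ hu.diff hv.left hw.left).add (h _ _ _ _ _ _ hu.right hv.diff hw.left)).add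
    (h _ _ _ _ _ _ hu.right hv.right hw.diff)).mono (le_of_eq (by ring))

/-! ### Continuous paths -/

variable (P) in
/-- `f` is a continuous path, defined on `J`, of elements of the Besov space of exponent `a`. -/
structure CB (J : Set ℝ) (a : ℝ) (f : ℝ → FD) : Prop where
  bd : ∀ t ∈ J, ∃ K, P.Bd a (f t) K
  cont : ∀ t ∈ J, ∀ ε > 0, ∀ᶠ s in 𝓝[J] t, P.Bd a (f s - f t) ε

variable {J J' : Set ℝ} {f g h : ℝ → FD}

lemma CB.mono_set (hf : P.CB J a f) (hJ : J' ⊆ J) : P.CB J' a f :=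
  ⟨fun t ht => hf.bd t (hJ ht), fun t ht ε hε =>
    (hf.cont t (hJ ht) ε hε).filter_mono (nhdsWithin_mono t hJ)⟩

lemma CB.exp_mono (hf : P.CB J a f) (hb : b ≤ a) : P.CB J b f :=
  ⟨fun t ht => (hf.bd t ht).imp fun _ h => h.exp_mono hb, fun t ht ε hε =>
    (hf.cont t ht ε hε).mono fun _ h => h.exp_mono hb⟩

lemma CB.congr (hf : P.CB J a f) (hfg : ∀ t ∈ J, g t = f t) : P.CB J a g := by
  refine ⟨fun t ht => by rw [hfg t ht]; exact hf.bd t ht, fun t ht ε hε => ?_⟩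
  filter_upwards [hf.cont t ht ε hε, self_mem_nhdsWithin] with s h1 h2
  rwa [hfg t ht, hfg s h2]

lemma CB.add (hf : P.CB J a f) (hg : P.CB J a g) : P.CB J a (fun t => f t + g t) := by
  refine ⟨fun t ht => ?_, fun t ht ε hε => ?_⟩
  · obtain ⟨K, hK⟩ := hf.bd t ht
    obtain ⟨L, hL⟩ := hg.bd t ht
    exact ⟨_, hK.add hL⟩
  · filter_upwards [hf.cont t ht (ε / 2) (by positivity), hg.cont t ht (ε / 2) (by positivity)]
      with s h1 h2
    rw [add_sub_add_comm]
    exact (h1.add h2).mono (by linarith)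

lemma CB.smul (hf : P.CB J a f) (z : ℂ) : P.CB J a (fun t => z • f t) := by
  refine ⟨fun t ht => ?_, fun t ht ε hε => ?_⟩
  · obtain ⟨K, hK⟩ := hf.bd t ht
    exact ⟨_, hK.smul z⟩
  · filter_upwards [hf.cont t ht (ε / (‖z‖ + 1)) (by positivity)] with s h1
    rw [← smul_sub]
    refine (h1.smul z).mono ?_
    rw [mul_div_assoc', div_le_iff₀ (by positivity)]
    nlinarith [norm_nonneg z]

lemma CB.sub (hf : P.CB J a f) (hg : P.CB J a g) : P.CB J a (fun t => f t - g t) := by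
  refine (hf.add (hg.smul (-1))).congr fun t _ => ?_
  simp [sub_eq_add_neg]

lemma CB.deriv (hf : P.CB J a f) : P.CB J (a - 1) (fun t => dsym * f t) := by
  obtain ⟨C, hC, h⟩ := P.exists_bd_deriv a
  refine ⟨fun t ht => ?_, fun t ht ε hε => ?_⟩
  · obtain ⟨K, hK⟩ := hf.bd t ht
    exact ⟨_, h _ _ hK⟩
  · filter_upwards [hf.cont t ht (ε / (C + 1)) (by positivity)] with s h1
    rw [← mul_sub]
    refine (h _ _ h1).mono ?_
    rw [mul_div_assoc', div_le_iff₀ (by positivity)]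
    nlinarith

lemma cb_const {u : FD} {K : ℝ} (hu : P.Bd a u K) : P.CB J a (fun _ => u) :=
  ⟨fun _ _ => ⟨K, hu⟩, fun t _ ε hε => Eventually.of_forall fun s => by
    rw [sub_self]; exact (Bd.zero _).mono hε.le⟩

lemma CB.eventually_bd (hf : P.CB J a f) {t : ℝ} (ht : t ∈ J) :
    ∃ K, 0 ≤ K ∧ P.Bd a (f t) K ∧ ∀ᶠ s in 𝓝[J] t, P.Bd a (f s) K := by
  obtain ⟨K, hK⟩ := hf.bd t ht
  refine ⟨K + 1, by linarith [hK.nonneg], hK.mono (by linarith), ?_⟩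
  filter_upwards [hf.cont t ht 1 one_pos] with s h1
  have := hK.add h1
  rwa [add_sub_cancel] at this

lemma CB.bilin {C : ℝ} {B : FD → FD → FD} (hB : P.Bil a b c C B) (hf : P.CB J a f)
    (hg : P.CB J b g) : P.CB J c (fun t => B (f t) (g t)) := by
  have hC := hB.nonneg
  refine ⟨fun t ht => ?_, fun t ht ε hε => ?_⟩
  · obtain ⟨K, hK⟩ := hf.bd t ht
    obtain ⟨L, hL⟩ := hg.bd t ht
    exact ⟨_, hB.bd _ _ _ _ hK hL⟩
  · obtain ⟨K, hK0, hK, hKe⟩ := hf.eventually_bd ht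
    obtain ⟨L, hL0, hL, hLe⟩ := hg.eventually_bd ht
    set δ := ε / (C * (L + K) + 1) with hδ
    have hd : 0 < δ := by positivity
    filter_upwards [hf.cont t ht δ hd, hg.cont t ht δ hd, hKe, hLe] with s h1 h2 h3 h4
    have := (hB.pb ⟨h3, hK, h1⟩ ⟨h4, hL, h2⟩).diff
    refine this.mono ?_
    calc C * (δ * L + K * δ) = C * (L + K) * ε / (C * (L + K) + 1) := by rw [hδ]; ring
      _ ≤ ε := by rw [div_le_iff₀ (by positivity)]; nlinarith

lemma CB.fcomm (ha : a < 1) (hbc : b + c < 0) (habc : 0 < a + b + c) (hf : P.CB J a f)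
    (hg : P.CB J b g) (hh : P.CB J c h) :
    P.CB J (a + b + c) (fun t => P.fcomm (f t) (g t) (h t)) := by
  obtain ⟨C, hC, hB⟩ := P.exists_pb_fcomm ha hbc habc
  refine ⟨fun t ht => ?_, fun t ht ε hε => ?_⟩
  · obtain ⟨K, hK0, hK, -⟩ := hf.eventually_bd ht
    obtain ⟨L, hL0, hL, -⟩ := hg.eventually_bd ht
    obtain ⟨M, hM0, hM, -⟩ := hh.eventually_bd ht
    exact ⟨_, (hB _ _ _ _ _ _ K (K + K) L (L + L) M (M + M) ⟨hK, hK, hK.sub hK⟩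
      ⟨hL, hL, hL.sub hL⟩ ⟨hM, hM, hM.sub hM⟩).left⟩
  · obtain ⟨K, hK0, hK, hKe⟩ := hf.eventually_bd ht
    obtain ⟨L, hL0, hL, hLe⟩ := hg.eventually_bd ht
    obtain ⟨M, hM0, hM, hMe⟩ := hh.eventually_bd ht
    set δ := ε / (C * (L * M + K * M + K * L) + 1) with hδ
    have hd : 0 < δ := by positivity
    filter_upwards [hf.cont t ht δ hd, hg.cont t ht δ hd, hh.cont t ht δ hd, hKe, hLe, hMe]
      with s h1 h2 h3 h4 h5 h6
    have := (hB _ _ _ _ _ _ K δ L δ M δ ⟨h4, hK, h1⟩ ⟨h5, hL, h2⟩ ⟨h6, hM, h3⟩).diff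
    refine this.mono ?_
    calc C * (δ * L * M + K * δ * M + K * L * δ)
        = C * (L * M + K * M + K * L) * ε / (C * (L * M + K * M + K * L) + 1) := by rw [hδ]; ring
      _ ≤ ε := by rw [div_le_iff₀ (by positivity)]; nlinarith

lemma CB.continuousOn_coef (hf : P.CB J a f) (k : ℤ) : ContinuousOn (fun t => f t k) J := by
  intro t ht
  rw [ContinuousWithinAt, Metric.tendsto_nhds]
  intro ε hε
  set A := dyS 1 * (3 * (1 + |(k : ℝ)|)) ^ ⌈1 + |a|⌉₊ with hA
  have hA0 : 0 ≤ A := by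
    have := dyS_nonneg 1
    positivity
  filter_upwards [hf.cont t ht (ε / (A + 1)) (by positivity)] with s h1
  rw [dist_eq_norm]
  have h2 := h1.norm_coef_le k
  rw [Pi.sub_apply] at h2
  refine h2.trans_lt ?_
  calc _ = A * ε / (A + 1) := by rw [hA]; ring
    _ < ε := by rw [div_lt_iff₀ (by positivity)]; nlinarith

/-- Continuity of the coefficients together with a local bound in a space of higher regularity
implies continuity. -/
lemma cb_of_bd {a' : ℝ} (haa' : a < a') (hc : ∀ k, ContinuousOn (fun t => f t k) J)
    (hb : ∀ t ∈ J, ∃ K, ∀ᶠ s in 𝓝[J] t, P.Bd a' (f s) K) : P.CB J a f := by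
  refine ⟨fun t ht => ?_, fun t ht ε hε => ?_⟩
  · obtain ⟨K, hK⟩ := hb t ht
    exact ⟨K, (hK.self_of_nhdsWithin ht).exp_mono haa'.le⟩
  · obtain ⟨K, hK⟩ := hb t ht
    have hKt := hK.self_of_nhdsWithin ht
    have hK0 := hKt.nonneg
    have hlim : Tendsto (fun j => (K + K) * dy (a' - a) j) atTop (𝓝 0) := by
      have := (summable_dy (by linarith : 0 < a' - a)).tendsto_atTop_zero.const_mul (K + K)
      simpa using this
    obtain ⟨n, hn⟩ := eventually_atTop.1 (hlim.eventually (ge_mem_nhds hε))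
    have hlow : ∀ j ∈ Finset.range n, ∀ᶠ s in 𝓝[J] t, ‖P.blk j (f s - f t)‖ ≤ ε * dy a j := by
      intro j _
      have h1 : Tendsto (fun s => ∑ k ∈ box (2 ^ j), ‖P.sym j k * (f s k - f t k)‖) (𝓝[J] t)
          (𝓝 (∑ k ∈ box (2 ^ j), ‖P.sym j k * (f t k - f t k)‖)) :=
        tendsto_finsetSum _ fun k _ => ((hc k t ht).sub_const _).const_mul _ |>.norm
      simp only [sub_self, mul_zero, norm_zero, Finset.sum_const_zero] at h1
      filter_upwards [h1.eventually (ge_mem_nhds (mul_pos hε (dy_pos a j)))] with s hs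
      refine le_trans ((CT.norm_le _ (by positivity)).2 fun x => ?_) hs
      rw [blk_def, poly_apply]
      refine (norm_sum_le _ _).trans (Finset.sum_le_sum fun k _ => ?_)
      rw [norm_mul, norm_chr_apply, mul_one]
      rfl
    filter_upwards [(Filter.eventually_all_finset _).2 hlow, hK] with s h1 h2 j
    by_cases hj : j < n
    · exact h1 j (Finset.mem_range.2 hj)
    · refine ((h2.sub hKt) j).trans ?_
      have h3 := hn j (by omega)
      have e : dy a' j = dy (a' - a) j * dy a j := by rw [← dy_add, sub_add_cancel]
      rw [e, ← mul_assoc]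
      exact mul_le_mul_of_nonneg_right h3 (dy_nonneg _ _)

lemma nhdsWithin_Icc_eq_Ioc {τ t : ℝ} (ht : 0 < t) : 𝓝[Icc 0 τ] t = 𝓝[Ioc 0 τ] t := by
  apply le_antisymm
  · rw [nhdsWithin_le_iff]
    filter_upwards [self_mem_nhdsWithin, mem_nhdsWithin_of_mem_nhds (Ioi_mem_nhds ht)] with s h1 h2
    exact ⟨h2, h1.2⟩
  · exact nhdsWithin_mono _ Ioc_subset_Icc_self

lemma CB.insert_zero {τ : ℝ} (hf : P.CB (Ioc 0 τ) a f) (h0 : ∃ K, P.Bd a (f 0) K)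
    (h : ∀ ε > 0, ∃ δ > 0, ∀ t, 0 < t → t ≤ τ → t < δ → P.Bd a (f t - f 0) ε) :
    P.CB (Icc 0 τ) a f := by
  refine ⟨fun t ht => ?_, fun t ht ε hε => ?_⟩
  · rcases ht.1.eq_or_lt with h1 | h1
    · rwa [← h1]
    · exact hf.bd t ⟨h1, ht.2⟩
  · rcases ht.1.eq_or_lt with h1 | h1
    · subst h1
      obtain ⟨δ, hδ, h2⟩ := h ε hε
      filter_upwards [self_mem_nhdsWithin, mem_nhdsWithin_of_mem_nhds (Iio_mem_nhds hδ)] with s h3 h4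
      rcases h3.1.eq_or_lt with h5 | h5
      · rw [← h5, sub_self]; exact (Bd.zero _).mono hε.le
      · exact h2 s h5 h3.2 h4
    · rw [nhdsWithin_Icc_eq_Ioc h1]
      exact hf.cont t ⟨h1, ht.2⟩ ε hε

lemma WL.continuousOn_coef {τ η K : ℝ} (hη : 0 ≤ η) (hf : P.WL τ η a K f) (k : ℤ) :
    ContinuousOn (fun t => f t k) (Ioc 0 τ) := by
  intro t ht
  have ht0 := ht.1
  set A := dyS 1 * (3 * (1 + |(k : ℝ)|)) ^ ⌈1 + |a - 1 / 2|⌉₊ with hA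
  have hA0 : 0 ≤ A := by
    have := dyS_nonneg 1
    positivity
  have hK0 : 0 ≤ K := (hf.low t ht0.le ht.2).nonneg
  have hlt : ∀ s s', t / 2 < s → s < s' → s' ≤ τ →
      ‖f s' k - f s k‖ ≤ A * (K * (t / 2) ^ (-η) * (s' - s) ^ (1 / 4 : ℝ)) := by
    intro s s' h1 h2 h3
    have h4 := (hf.hol s s' (by linarith) h2 h3).norm_coef_le k
    rw [Pi.sub_apply] at h4
    refine h4.trans ?_
    have h5 : s ^ (-η) ≤ (t / 2) ^ (-η) :=
      Real.rpow_le_rpow_of_nonpos (by linarith) h1.le (by linarith)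
    have h6 : 0 < s' - s := by linarith
    calc _ = A * (K * s ^ (-η) * (s' - s) ^ (1 / 4 : ℝ)) := by rw [hA]; ring
      _ ≤ _ := by gcongr
  have hle : ∀ᶠ s in 𝓝[Ioc 0 τ] t,
      dist (f s k) (f t k) ≤ A * (K * (t / 2) ^ (-η) * |s - t| ^ (1 / 4 : ℝ)) := by
    filter_upwards [self_mem_nhdsWithin,
      mem_nhdsWithin_of_mem_nhds (Ioi_mem_nhds (by linarith : t / 2 < t))] with s h1 h2
    rw [dist_eq_norm]
    rcases lt_trichotomy s t with h | h | h
    · rw [norm_sub_rev, abs_sub_comm, abs_of_pos (by linarith)]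
      exact hlt s t h2 h ht.2
    · rw [h, sub_self, norm_zero]; positivity
    · rw [abs_of_pos (by linarith)]
      exact hlt t s (by linarith) h h1.2
  have hlim : Tendsto (fun s => A * (K * (t / 2) ^ (-η) * |s - t| ^ (1 / 4 : ℝ))) (𝓝[Ioc 0 τ] t)
      (𝓝 0) := by
    have hcont : Continuous fun s : ℝ => A * (K * (t / 2) ^ (-η) * |s - t| ^ (1 / 4 : ℝ)) := by
      refine continuous_const.mul (continuous_const.mul (Continuous.rpow_const ?_ ?_))
      · fun_prop
      · intro _; right; norm_num
    have := (hcont.tendsto t).mono_left (nhdsWithin_le_nhds (s := Ioc 0 τ))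
    simpa using this
  exact tendsto_iff_dist_tendsto_zero.2
    (squeeze_zero' (Eventually.of_forall fun _ => dist_nonneg) hle hlim)

lemma WL.cb {τ η K a' : ℝ} (hη : 0 ≤ η) (hf : P.WL τ η a' K f) (ha : a < a') :
    P.CB (Ioc 0 τ) a f := by
  refine cb_of_bd ha (hf.continuousOn_coef hη) fun t ht => ⟨K * (t / 2) ^ (-η), ?_⟩
  have ht0 := ht.1
  have hK0 : 0 ≤ K := (hf.low t ht0.le ht.2).nonneg
  filter_upwards [self_mem_nhdsWithin,
    mem_nhdsWithin_of_mem_nhds (Ioi_mem_nhds (by linarith : t / 2 < t))] with s h1 h2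
  have h2' : t / 2 < s := h2
  refine (hf.sup s h1.1 h1.2).mono ?_
  have h5 : s ^ (-η) ≤ (t / 2) ^ (-η) :=
    Real.rpow_le_rpow_of_nonpos (by linarith) h2'.le (by linarith)
  gcongr

end DyadicPartition

namespace DyadicPartition

variable {P : DyadicPartition} {a b c : ℝ}

/-! ### Continuity of the heat flow and of Duhamel integrals -/

lemma cb_heat {T : ℝ} (hT : 0 ≤ T) {u : FD} {K : ℝ} (hu : P.Bd b u K) (hab : a < b + 4) :
    P.CB (Ioc 0 T) a (fun t => heat t * u) := by
  obtain ⟨C, -, h⟩ := P.exists_wl_heat hT (b + 4) (η := 2) (by norm_num) le_rfl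
  exact (h u K (by rwa [show b + 4 - 2 * 2 = b by ring])).cb (by norm_num) hab

lemma cb_heat_zero {T : ℝ} (hT : 0 ≤ T) {u : FD} (hu : P.Lit b u) :
    P.CB (Icc 0 T) b (fun t => heat t * u) := by
  obtain ⟨K, hK⟩ := hu.exists_bd
  refine (cb_heat hT hK (by linarith)).insert_zero ⟨K, by rwa [heat_zero, one_mul]⟩ fun ε hε => ?_
  obtain ⟨C, hC, h⟩ := P.exists_bd_heat_zero T hT
  obtain ⟨C', hC', h'⟩ := P.exists_bd_heat_sub T hT
  obtain ⟨n, hn⟩ := hu.exists_trunc (ε := ε / (3 * (C + 1))) (by positivity)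
  set v := P.trunc n u with hv
  obtain ⟨L, hL⟩ := (P.lit_trunc n u (b + 2)).exists_bd
  have hL0 := hL.nonneg
  refine ⟨ε / (3 * (C' * L + 1)), by positivity, fun t h0 ht htd => ?_⟩
  have b1 := h b t _ _ h0.le ht hn
  have b2 := h' (b + 2) 1 t v L zero_le_one le_rfl h0.le ht hL
  rw [show b + 2 - 2 * 1 = b by ring, Real.rpow_one] at b2
  have e : heat t * u - heat 0 * u = heat t * (u - v) + (heat t - 1) * v - (u - v) := by
    rw [heat_zero]; ring
  rw [e]
  refine ((b1.add b2).sub hn).mono ?_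
  have e1 : C * (ε / (3 * (C + 1))) ≤ ε / 3 := by
    rw [mul_div_assoc', div_le_div_iff₀ (by positivity) (by positivity)]; nlinarith
  have e2 : C' * t * L ≤ ε / 3 := by
    rw [lt_div_iff₀ (by positivity)] at htd
    nlinarith [mul_nonneg hC' hL0]
  have e3 : ε / (3 * (C + 1)) ≤ ε / 3 := by
    rw [div_le_div_iff₀ (by positivity) (by positivity)]; nlinarith
  linarith

lemma cb_duh {T τ σ w K : ℝ} {F : ℝ → FD} (hT : 0 ≤ T) (hw0 : 0 ≤ w) (hw : w < 1) (ha : a < σ + 2)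
    (hK : 0 ≤ K) (hτ0 : 0 ≤ τ) (hτ : τ ≤ T) (hc : ∀ k, ContinuousOn (fun r => F r k) (Ioc 0 τ))
    (hb : ∀ r, 0 < r → r ≤ τ → P.Bd σ (F r) (K * r ^ (-w))) : P.CB (Ioc 0 τ) a (duh F) := by
  set θ := max (1 / 2) (((a - σ) / 2 + 1) / 2) with hθ
  have h1 : 1 / 2 ≤ θ := le_max_left _ _
  have h2 : ((a - σ) / 2 + 1) / 2 ≤ θ := le_max_right _ _
  have h3 : θ < 1 := max_lt (by norm_num) (by linarith)
  have hη0 : 0 ≤ min w θ := le_min hw0 (by linarith)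
  obtain ⟨C, -, h⟩ := P.exists_wl_duh hT σ (θ := θ) (w := w) (η := min w θ) (by linarith) h3 hη0
    (min_le_right _ _) (min_le_left _ _) hw (by
      rcases le_total w θ with h4 | h4
      · rw [min_eq_left h4]; linarith
      · rw [min_eq_right h4]; linarith)
  exact (h F K τ 0 hK le_rfl hτ0 hτ hc hb (fun r h0 h4 => absurd h0 (not_lt.2 h4))).cb hη0
    (by linarith)

lemma cb_duh_zero {T τ σ θ w η K : ℝ} {F : ℝ → FD} (hT : 0 ≤ T) (h14 : 1 / 4 ≤ θ) (hθ : θ < 1)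
    (hη : 0 ≤ η) (hηθ : η ≤ θ) (hηw : η ≤ w) (hw : w < 1) (hκ : 0 < 1 - θ - w + η)
    (hK : 0 ≤ K) (hτ0 : 0 ≤ τ) (hτ : τ ≤ T) (hc : ∀ k, ContinuousOn (fun r => F r k) (Ioc 0 τ))
    (hb : ∀ r, 0 < r → r ≤ τ → P.Bd σ (F r) (K * r ^ (-w))) :
    P.CB (Icc 0 τ) (σ + 2 * θ - 2 * η) (duh F) := by
  have h1 : P.CB (Ioc 0 τ) (σ + 2 * θ - 2 * η) (duh F) :=
    cb_duh hT (hη.trans hηw) hw (by linarith) hK hτ0 hτ hc hb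
  refine h1.insert_zero ⟨0, by rw [duh_zero]; exact Bd.zero _⟩ fun ε hε => ?_
  obtain ⟨C, hC, h⟩ := P.exists_wl_duh hT σ h14 hθ hη hηθ hηw hw hκ.le
  have hlim : Tendsto (fun t : ℝ => C * K * (t - 0) ^ (1 - θ - w + η)) (𝓝 0) (𝓝 0) := by
    have hcont : Continuous fun t : ℝ => C * K * (t - 0) ^ (1 - θ - w + η) :=
      continuous_const.mul (Continuous.rpow_const (by fun_prop) fun _ => Or.inr hκ.le)
    have := hcont.tendsto 0
    rwa [sub_self, Real.zero_rpow hκ.ne', mul_zero] at this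
  obtain ⟨δ, hδ, h2⟩ := Metric.eventually_nhds_iff.1 (hlim.eventually (ge_mem_nhds hε))
  refine ⟨δ, hδ, fun t h0 ht htd => ?_⟩
  have h3 := (h F K t 0 hK le_rfl h0.le (ht.trans hτ)
    (fun k => (hc k).mono (Ioc_subset_Ioc_right ht)) (fun r h4 h5 => hb r h4 (h5.trans ht))
    (fun r h4 h5 => absurd h4 (not_lt.2 h5))).low t h0.le le_rfl
  rw [duh_zero, sub_zero]
  refine h3.mono (h2 ?_)
  rwa [Real.dist_eq, sub_zero, abs_of_pos h0]

lemma duh_integrable {T τ σ w K : ℝ} {F : ℝ → FD} (hT : 0 ≤ T) (hw0 : 0 ≤ w) (hw : w < 1)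
    (hK : 0 ≤ K) (hτ : τ ≤ T) (hc : ∀ k, ContinuousOn (fun r => F r k) (Ioc 0 τ))
    (hb : ∀ r, 0 < r → r ≤ τ → P.Bd σ (F r) (K * r ^ (-w))) {t : ℝ} (h0 : 0 < t) (ht : t ≤ τ)
    (k : ℤ) : IntervalIntegrable (fun r => heat (t - r) k * F r k) volume 0 t := by
  obtain ⟨C, -, h⟩ := P.exists_bd_heat_integral hT σ (θ := 0) (w := w) le_rfl le_rfl hw0
    zero_lt_one hw
  exact (h F K 0 t hK le_rfl h0.le h0 (ht.trans hτ)
    (fun k => (hc k).mono fun r hr => ⟨hr.1, hr.2.le.trans ht⟩)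
    fun r hr => hb r hr.1 (hr.2.le.trans ht)).1 k

lemma duh_sub {F F' : ℝ → FD} {t : ℝ}
    (h : ∀ k, IntervalIntegrable (fun r => heat (t - r) k * F r k) volume 0 t)
    (h' : ∀ k, IntervalIntegrable (fun r => heat (t - r) k * F' r k) volume 0 t) :
    duh (fun r => F r - F' r) t = duh F t - duh F' t := by
  ext k
  rw [Pi.sub_apply, duh, duh, duh, ← intervalIntegral.integral_sub (h k) (h' k)]
  simp only [Pi.sub_apply, mul_sub]

lemma duh_congr {F F' : ℝ → FD} {t : ℝ} (ht : 0 ≤ t) (h : ∀ r, 0 < r → r ≤ t → F r = F' r) :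
    duh F t = duh F' t := by
  ext k
  rw [duh, duh, intervalIntegral.integral_of_le ht, intervalIntegral.integral_of_le ht]
  exact setIntegral_congr_fun measurableSet_Ioc fun r hr => by rw [h r hr.1 hr.2]

/-! ### Paraproducts and integrals -/

lemma exists_fpara_eq_sum (P : DyadicPartition) (u : FD) (k : ℤ) :
    ∃ (S : Finset (Σ _ : ℕ, ℤ)) (c : (Σ _ : ℕ, ℤ) → ℂ), ∀ v : FD,
      P.fpara u v k = ∑ p ∈ S, c p * v p.2 := by
  obtain ⟨j, hj⟩ : ∃ j, P.sym j k ≠ 0 := by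
    by_contra hcon
    push Not at hcon
    have h1 := P.hasSum_sym_mul 1 k
    simp only [hcon, zero_mul] at h1
    exact one_ne_zero (h1.unique hasSum_zero)
  refine ⟨(ann j).sigma fun m => box (2 ^ m),
    fun p => P.sym p.1 p.2 * coef (P.low p.1 u * chr p.2) k, fun v => ?_⟩
  rw [fpara_apply, ser, tsum_eq_sum (s := ann j), Finset.sum_sigma]
  · refine Finset.sum_congr rfl fun m _ => ?_
    rw [paraT, blk_def, poly_def, Finset.mul_sum, map_sum, Finset.sum_apply]
    refine Finset.sum_congr rfl fun l _ => ?_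
    rw [mul_smul_comm, map_smul, Pi.smul_apply, smul_eq_mul, Pi.mul_apply]
    ring
  · intro m hm
    have h1 := P.annular_paraT u v j m (by rw [mem_ann] at hm; tauto)
    have h2 : coef (P.blk j (coef (P.paraT u v m))) k = 0 := by rw [h1, map_zero]; rfl
    rw [coef_blk, Pi.mul_apply] at h2
    exact (mul_eq_zero.1 h2).resolve_left hj

lemma fpara_integral (u : FD) {G : ℝ → FD} {s t : ℝ}
    (hG : ∀ k, IntervalIntegrable (fun r => G r k) volume s t) (k : ℤ) :
    IntervalIntegrable (fun r => P.fpara u (G r) k) volume s t ∧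
    P.fpara u (fun l => ∫ r in s..t, G r l) k = ∫ r in s..t, P.fpara u (G r) k := by
  obtain ⟨S, c, h⟩ := P.exists_fpara_eq_sum u k
  simp only [h]
  refine ⟨?_, ?_⟩
  · have := IntervalIntegrable.sum S (f := fun p r => c p * G r p.2) (μ := volume) (a := s) (b := t)
      fun p _ => (hG p.2).const_mul _
    simpa [Finset.sum_fn] using this
  · rw [intervalIntegral.integral_finsetSum fun p _ => (hG p.2).const_mul _]
    exact Finset.sum_congr rfl fun p _ => (intervalIntegral.integral_const_mul _ _).symm

lemma continuousOn_fpara_coef (u : FD) {G : ℝ → FD} {J : Set ℝ}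
    (hG : ∀ k, ContinuousOn (fun r => G r k) J) (k : ℤ) :
    ContinuousOn (fun r => P.fpara u (G r) k) J := by
  obtain ⟨S, c, h⟩ := P.exists_fpara_eq_sum u k
  simp only [h]
  exact continuousOn_finsetSum _ fun p _ => (hG p.2).const_mul _

end DyadicPartition

/-! ### The remainder -/

/-- The exponents of the para-KPZ equation. -/
structure Exps (α β γ : ℝ) : Prop where
  hβ : 1 / 3 < β
  hβα : β < α
  hα : α < 1 / 2
  hγ : -β < γ
  hγβ : γ ≤ β

namespace DyadicPartition

variable {P : DyadicPartition} {α β γ : ℝ}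

variable (P β γ) in
/-- The bounds on `u = ∂ₓ (X^W + f + g)`. -/
structure UB (τ K : ℝ) (u : ℝ → FD) : Prop where
  reg : ∀ t, 0 < t → t ≤ τ → P.Bd β (u t) (K * t ^ (-(β - γ)))
  low : ∀ t, 0 < t → t ≤ τ → P.Bd (min β (β + γ)) (u t) (K * t ^ (-((β - γ) / 2)))
  hol : ∀ s t, 0 < s → s < t → t ≤ τ →
    P.Bd (β - 1 / 2) (u t - u s) (K * s ^ (-(β - γ)) * (t - s) ^ (1 / 4 : ℝ))

lemma rpow_weight {T t p q : ℝ} (h0 : 0 < t) (ht : t ≤ T) (hpq : p ≤ q) :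
    t ^ (-p) ≤ T ^ (q - p) * t ^ (-q) := by
  have : t ^ (-p) = t ^ (q - p) * t ^ (-q) := by rw [← Real.rpow_add h0]; ring_nf
  rw [this]
  gcongr

lemma exists_ub (P : DyadicPartition) (E : Exps α β γ) {T : ℝ} (hT : 0 ≤ T) :
    ∃ C : ℝ, 0 ≤ C ∧ ∀ (τ : ℝ) (W f g : ℝ → FD) (Kw Kf Kg : ℝ), τ ≤ T →
      (∀ t, 0 < t → t ≤ τ → P.Bd (α + 1) (W t) Kw) →
      (∀ s t, 0 < s → s < t → t ≤ τ →
        P.Bd (α + 1 - 1 / 2) (W t - W s) (Kw * (t - s) ^ (1 / 4 : ℝ))) →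
      P.WL τ ((β - γ) / 2) (β + 1) Kf f → P.WL τ (β - γ) (2 * β + 1) Kg g →
      P.UB β γ τ (C * (Kw + Kf + Kg)) (fun t => dsym * (W t + f t + g t)) := by
  obtain ⟨h1, h2, h3, h4, h5⟩ := E
  obtain ⟨C1, hC1, d1⟩ := P.exists_bd_deriv (β + 1)
  obtain ⟨C2, hC2, d2⟩ := P.exists_bd_deriv (min β (β + γ) + 1)
  obtain ⟨C3, hC3, d3⟩ := P.exists_bd_deriv (β + 1 - 1 / 2)
  have hm1 : min β (β + γ) ≤ β := min_le_left _ _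
  have hm2 : min β (β + γ) ≤ β + γ := min_le_right _ _
  set A := 1 + T ^ (β - γ) + T ^ ((β - γ) / 2) with hA
  have hA0 : 0 ≤ A := by positivity
  have hp1 : 0 ≤ T ^ (β - γ) := by positivity
  have hp2 : 0 ≤ T ^ ((β - γ) / 2) := by positivity
  have w1 : ∀ t, 0 < t → t ≤ T → 1 ≤ A * t ^ (-(β - γ)) := fun t h0 ht => by
    have := rpow_weight (p := 0) (q := β - γ) h0 ht (by linarith)
    simp only [neg_zero, Real.rpow_zero, sub_zero] at this
    refine this.trans ?_
    gcongr; linarith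
  have w2 : ∀ t, 0 < t → t ≤ T → 1 ≤ A * t ^ (-((β - γ) / 2)) := fun t h0 ht => by
    have := rpow_weight (p := 0) (q := (β - γ) / 2) h0 ht (by linarith)
    simp only [neg_zero, Real.rpow_zero, sub_zero] at this
    refine this.trans ?_
    gcongr; linarith
  have w3 : ∀ t, 0 < t → t ≤ T → t ^ (-((β - γ) / 2)) ≤ A * t ^ (-(β - γ)) := fun t h0 ht => by
    have := rpow_weight (p := (β - γ) / 2) (q := β - γ) h0 ht (by linarith)
    rw [show β - γ - (β - γ) / 2 = (β - γ) / 2 by ring] at this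
    refine this.trans ?_
    gcongr; linarith
  have hA1 : 1 ≤ A := by linarith
  refine ⟨(C1 + C2 + C3) * A, by positivity, fun τ W f g Kw Kf Kg hτ hW hWh hf hg =>
    ⟨fun t h0 ht => ?_, fun t h0 ht => ?_, fun s t hs hst ht => ?_⟩⟩
  · have b1 := (hW t h0 ht).exp_mono (by linarith : β + 1 ≤ α + 1)
    have b2 := hf.sup t h0 ht
    have b3 := (hg.sup t h0 ht).exp_mono (by linarith : β + 1 ≤ 2 * β + 1)
    have b4 := d1 _ _ ((b1.add b2).add b3)
    rw [add_sub_cancel_right] at b4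
    refine b4.mono ?_
    have n1 := b1.nonneg
    have n2 := (hf.low t h0.le ht).nonneg
    have n3 := (hg.low t h0.le ht).nonneg
    have t1 := w1 t h0 (ht.trans hτ)
    have t3 := w3 t h0 (ht.trans hτ)
    have t4 : 0 ≤ t ^ (-(β - γ)) := by positivity
    calc C1 * (Kw + Kf * t ^ (-((β - γ) / 2)) + Kg * t ^ (-(β - γ)))
        ≤ C1 * (Kw * (A * t ^ (-(β - γ))) + Kf * (A * t ^ (-(β - γ)))
          + Kg * (A * t ^ (-(β - γ)))) := by
          gcongr
          · exact le_mul_of_one_le_right n1 t1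
          · exact le_mul_of_one_le_left t4 hA1
      _ = C1 * (A * (Kw + Kf + Kg) * t ^ (-(β - γ))) := by ring
      _ ≤ (C1 + C2 + C3) * (A * (Kw + Kf + Kg) * t ^ (-(β - γ))) := by gcongr; linarith
      _ = _ := by ring
  · have b1 := (hW t h0 ht).exp_mono (by linarith : min β (β + γ) + 1 ≤ α + 1)
    have b2 := (hf.sup t h0 ht).exp_mono (by linarith : min β (β + γ) + 1 ≤ β + 1)
    have b3 := ((hg.sup t h0 ht).interp (hg.low t h0.le ht) (θ := 1 / 2) (by norm_num)
      (by norm_num)).exp_mono (b := min β (β + γ) + 1) (by linarith)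
    have n1 := b1.nonneg
    have n2 := (hf.low t h0.le ht).nonneg
    have n3 := (hg.low t h0.le ht).nonneg
    have e : (Kg * t ^ (-(β - γ))) ^ (1 - 1 / 2 : ℝ) * Kg ^ (1 / 2 : ℝ)
        = Kg * t ^ (-((β - γ) / 2)) := by
      rw [Real.mul_rpow n3 (by positivity), ← Real.rpow_mul h0.le, mul_right_comm,
        ← Real.rpow_add_of_nonneg n3 (by norm_num) (by norm_num)]
      norm_num
      left; ring_nf
    rw [e] at b3
    have b4 := d2 _ _ ((b1.add b2).add b3)
    rw [add_sub_cancel_right] at b4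
    refine b4.mono ?_
    have t2 := w2 t h0 (ht.trans hτ)
    have t4 : 0 ≤ t ^ (-((β - γ) / 2)) := by positivity
    calc C2 * (Kw + Kf * t ^ (-((β - γ) / 2)) + Kg * t ^ (-((β - γ) / 2)))
        ≤ C2 * (Kw * (A * t ^ (-((β - γ) / 2))) + Kf * (A * t ^ (-((β - γ) / 2)))
          + Kg * (A * t ^ (-((β - γ) / 2)))) := by
          gcongr
          · exact le_mul_of_one_le_right n1 t2
          · exact le_mul_of_one_le_left t4 hA1
          · exact le_mul_of_one_le_left t4 hA1
      _ = C2 * (A * (Kw + Kf + Kg) * t ^ (-((β - γ) / 2))) := by ring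
      _ ≤ (C1 + C2 + C3) * (A * (Kw + Kf + Kg) * t ^ (-((β - γ) / 2))) := by gcongr; linarith
      _ = _ := by ring
  · have hts : 0 < t - s := by linarith
    have b1 := (hWh s t hs hst ht).exp_mono (by linarith : β + 1 - 1 / 2 ≤ α + 1 - 1 / 2)
    have b2 := hf.hol s t hs hst ht
    have b3 := (hg.hol s t hs hst ht).exp_mono (by linarith : β + 1 - 1 / 2 ≤ 2 * β + 1 - 1 / 2)
    have b4 := d3 _ _ ((b1.add b2).add b3)
    rw [show β + 1 - 1 / 2 - 1 = β - 1 / 2 by ring] at b4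
    have e : dsym * (W t + f t + g t) - dsym * (W s + f s + g s)
        = dsym * (W t - W s + (f t - f s) + (g t - g s)) := by ring
    rw [e]
    refine b4.mono ?_
    have n1 : 0 ≤ Kw := (hW t (hs.trans hst) ht).nonneg
    have n2 := (hf.low s hs.le (hst.le.trans ht)).nonneg
    have n3 := (hg.low s hs.le (hst.le.trans ht)).nonneg
    have t1 := w1 s hs (by linarith)
    have t3 := w3 s hs (by linarith)
    have t4 : 0 ≤ s ^ (-(β - γ)) := by positivity
    set q := (t - s) ^ (1 / 4 : ℝ) with hq
    have hq0 : 0 ≤ q := by positivity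
    calc C3 * (Kw * q + Kf * s ^ (-((β - γ) / 2)) * q + Kg * s ^ (-(β - γ)) * q)
        ≤ C3 * (Kw * (A * s ^ (-(β - γ))) * q + Kf * (A * s ^ (-(β - γ))) * q
          + Kg * (A * s ^ (-(β - γ))) * q) := by
          gcongr
          · exact le_mul_of_one_le_right n1 t1
          · exact le_mul_of_one_le_left t4 hA1
      _ = C3 * (A * (Kw + Kf + Kg) * s ^ (-(β - γ)) * q) := by ring
      _ ≤ (C1 + C2 + C3) * (A * (Kw + Kf + Kg) * s ^ (-(β - γ)) * q) := by gcongr; linarith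
      _ = _ := by ring

lemma UB.nonneg {τ K : ℝ} {u : ℝ → FD} (hu : P.UB β γ τ K u) (hτ : 0 < τ) : 0 ≤ K := by
  have h1 := (hu.reg τ hτ le_rfl).nonneg
  have h2 : 0 < τ ^ (-(β - γ)) := by positivity
  exact nonneg_of_mul_nonneg_left h1 h2

lemma UB.para_bd (P : DyadicPartition) (E : Exps α β γ) : ∃ C : ℝ, 0 ≤ C ∧
    ∀ (τ K L : ℝ) (u ξ : ℝ → FD), P.UB β γ τ K u →
      (∀ t, 0 < t → t ≤ τ → P.Bd (α - 1) (ξ t) L) →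
      ∀ r, 0 < r → r ≤ τ → P.Bd (α - 1) (P.fpara (u r) (ξ r))
        (C * K * L * r ^ (-((β - γ) / 2))) := by
  obtain ⟨h1, h2, h3, h4, h5⟩ := E
  have ha : 0 < min β (β + γ) := lt_min (by linarith) (by linarith)
  obtain ⟨C, hC, h⟩ := P.exists_bd_fpara_pos ha (α - 1)
  exact ⟨C, hC, fun τ K L u ξ hu hξ r h0 hr =>
    (h _ _ _ _ (hu.low r h0 hr) (hξ r h0 hr)).mono (le_of_eq (by ring))⟩

lemma continuousOn_para_coef (E : Exps α β γ) {J : Set ℝ} {u ξ : ℝ → FD} (hu : P.CB J β u)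
    (hξ : P.CB J (α - 1) ξ) (k : ℤ) : ContinuousOn (fun r => P.fpara (u r) (ξ r) k) J := by
  obtain ⟨C, hC⟩ := P.exists_bil_fpara_pos (by linarith [E.hβ] : 0 < β) (α - 1)
  exact (CB.bilin hC hu hξ).continuousOn_coef k

lemma UB.duh_para_integrable (E : Exps α β γ) {τ K L : ℝ} {u ξ : ℝ → FD} (hu : P.UB β γ τ K u)
    (hξ : ∀ t, 0 < t → t ≤ τ → P.Bd (α - 1) (ξ t) L) (hcu : P.CB (Ioc 0 τ) β u)
    (hcξ : P.CB (Ioc 0 τ) (α - 1) ξ) {t : ℝ} (h0 : 0 < t) (ht : t ≤ τ) (k : ℤ) :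
    IntervalIntegrable (fun r => heat (t - r) k * P.fpara (u r) (ξ r) k) volume 0 t := by
  obtain ⟨C, hC, hb⟩ := UB.para_bd P E
  have hK := hu.nonneg (h0.trans_le ht)
  have hL := (hξ t h0 ht).nonneg
  obtain ⟨h1, h2, h3, h4, h5⟩ := id E
  exact duh_integrable (F := fun r => P.fpara (u r) (ξ r)) (h0.trans_le ht).le
    (by linarith : 0 ≤ (β - γ) / 2) (by linarith) (by positivity : 0 ≤ C * K * L) le_rfl
    (fun k => continuousOn_para_coef E hcu hcξ k) (hb τ K L u ξ hu hξ) h0 ht k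

lemma duh_integrable_of_bd {τ L a : ℝ} {ξ : ℝ → FD} (hξ : ∀ t, 0 < t → t ≤ τ → P.Bd a (ξ t) L)
    (hc : ∀ k, ContinuousOn (fun r => ξ r k) (Ioc 0 τ)) {t : ℝ} (h0 : 0 < t) (ht : t ≤ τ) (k : ℤ) :
    IntervalIntegrable (fun r => heat (t - r) k * ξ r k) volume 0 t :=
  duh_integrable (h0.trans_le ht).le le_rfl zero_lt_one (hξ t h0 ht).nonneg le_rfl hc
    (fun r hr0 hr => (hξ r hr0 hr).mono (by simp)) h0 ht k

variable (P) in
/-- The commutator of the paraproduct by `u` with `ξ ↦ ∂ₓ (duh ξ)`. -/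
def bil (u ξ : ℝ → FD) (t : ℝ) : FD :=
  dsym * duh (fun r => P.fpara (u r) (ξ r)) t - P.fpara (u t) (dsym * duh ξ t)

lemma exists_bd_bil (P : DyadicPartition) (E : Exps α β γ) {T : ℝ} (hT : 0 ≤ T) :
    ∃ C : ℝ, 0 ≤ C ∧ ∀ (τ K L : ℝ) (u ξ : ℝ → FD), τ ≤ T → P.UB β γ τ K u →
      (∀ t, 0 < t → t ≤ τ → P.Bd (α - 1) (ξ t) L) → P.CB (Ioc 0 τ) β u →
      P.CB (Ioc 0 τ) (α - 1) ξ → ∀ t, 0 < t → t ≤ τ →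
      P.Bd (2 * β) (P.bil u ξ t) (C * (K * L) * t ^ (-(β - γ))) := by
  obtain ⟨h1, h2, h3, h4, h5⟩ := id E
  set κ := (α - β) / 2 with hκ
  obtain ⟨C1, hC1, hh⟩ := P.exists_bd_heat T hT
  obtain ⟨C2, hC2, hd⟩ := P.exists_bd_deriv (β - 1 / 2 + (α - 1))
  obtain ⟨C3, hC3, hp⟩ := P.exists_bd_fpara_neg (by linarith : β - 1 / 2 < 0) (α - 1)
  obtain ⟨C4, hC4, hcm⟩ := P.exists_bd_heat_comm T hT (by linarith : β < 1) (α - 1) (1 - κ)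
    (by linarith) (by linarith)
  obtain ⟨C5, hC5, hk⟩ := exists_kernel_bound (p := 1 - κ) (q := β - γ) (by linarith) (by linarith)
    (by linarith) (by linarith)
  have hTκ : 0 ≤ T ^ κ := by positivity
  refine ⟨(C1 * C2 * C3 + C4) * (C5 * T ^ κ), by positivity,
    fun τ K L u ξ hτ hu hξ hcu hcξ t h0 ht => ?_⟩
  have hK := hu.nonneg (h0.trans_le ht)
  have hL := (hξ t h0 ht).nonneg
  have i1 := fun k => hu.duh_para_integrable E hξ hcu hcξ h0 ht k
  have i2 := fun k => duh_integrable_of_bd hξ hcξ.continuousOn_coef h0 ht k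
  set G : ℝ → FD := fun r => dsym * (heat (t - r) * ξ r) with hG
  have iG : ∀ k, IntervalIntegrable (fun r => G r k) volume 0 t := fun k => (i2 k).const_mul _
  have iP := fun k => fpara_integral (P := P) (u t) iG k
  set H : ℝ → FD := fun r => dsym * (heat (t - r) * P.fpara (u r) (ξ r)) - P.fpara (u t) (G r)
    with hH
  have hrep : P.bil u ξ t = fun k => ∫ r in (0 : ℝ)..t, H r k := by
    ext k
    have e1 : dsym * duh ξ t = fun l => ∫ r in (0 : ℝ)..t, G r l := by
      ext l
      simp only [Pi.mul_apply, duh, hG, intervalIntegral.integral_const_mul]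
    rw [bil, e1, Pi.sub_apply, (iP k).2, Pi.mul_apply, duh,
      ← intervalIntegral.integral_const_mul, ← intervalIntegral.integral_sub
        ((i1 k).const_mul _) (iP k).1]
    rfl
  have hsub : ∀ r ∈ Ioo 0 t, r ∈ Ioc 0 τ := fun r hr => ⟨hr.1, hr.2.le.trans ht⟩
  have cheat : ∀ k, Continuous fun r => heat (t - r) k := fun k =>
    (continuous_heat k).comp (continuous_const.sub continuous_id)
  have hc : ∀ k, ContinuousOn (fun r => H r k) (Ioo 0 t) := by
    intro k
    refine ContinuousOn.sub ?_ ?_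
    · exact continuousOn_const.mul ((cheat k).continuousOn.mul
        ((continuousOn_para_coef E hcu hcξ k).mono hsub))
    · exact continuousOn_fpara_coef (u t) (fun l => continuousOn_const.mul
        ((cheat l).continuousOn.mul ((hcξ.continuousOn_coef l).mono hsub))) k
  obtain ⟨ik, bk⟩ := hk 0 t h0.le
  simp only [sub_zero] at ik bk
  have hbd : ∀ r ∈ Ioo 0 t, P.Bd (2 * β) (H r)
      ((C1 * C2 * C3 + C4) * (K * L) * ((t - r) ^ (-(1 - κ)) * r ^ (-(β - γ)))) := by
    intro r hr
    have hr0 := hr.1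
    have htr : 0 < t - r := by linarith [hr.2]
    have hrτ : r ≤ τ := hr.2.le.trans ht
    have e : H r = heat (t - r) * (dsym * P.fpara (u r - u t) (ξ r))
        + (dsym * heat (t - r) * P.fpara (u t) (ξ r)
          - P.fpara (u t) (dsym * heat (t - r) * ξ r)) := by
      simp only [hH, hG, map_sub, LinearMap.sub_apply, mul_assoc]
      ring
    have b0 : P.Bd (β - 1 / 2) (u r - u t) (K * r ^ (-(β - γ)) * (t - r) ^ (1 / 4 : ℝ)) := by
      rw [show u r - u t = -(u t - u r) by abel]
      exact (hu.hol r t hr0 hr.2 ht).neg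
    have b1 := hh _ (5 / 4 - κ) (t - r) _ _ (by linarith) (by linarith) htr (by linarith)
      (hd _ _ (hp _ _ _ _ b0 (hξ r hr0 hrτ)))
    rw [show β - 1 / 2 + (α - 1) - 1 + 2 * (5 / 4 - κ) = 2 * β by rw [hκ]; ring] at b1
    have b2 := hcm (t - r) (u t) (ξ r) _ _ htr (by linarith) (hu.reg t h0 ht) (hξ r hr0 hrτ)
    rw [show β + (α - 1) - 1 + 2 * (1 - κ) = 2 * β by rw [hκ]; ring] at b2
    rw [e]
    refine (b1.add b2).mono ?_
    have e1 : (t - r) ^ (-(5 / 4 - κ)) * (t - r) ^ (1 / 4 : ℝ) = (t - r) ^ (-(1 - κ)) := by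
      rw [← Real.rpow_add htr]; ring_nf
    have e2 : t ^ (-(β - γ)) ≤ r ^ (-(β - γ)) :=
      Real.rpow_le_rpow_of_nonpos hr0 hr.2.le (by linarith)
    have e3 : 0 ≤ (t - r) ^ (-(1 - κ)) := by positivity
    calc _ = C1 * C2 * C3 * (K * L) * (((t - r) ^ (-(5 / 4 - κ)) * (t - r) ^ (1 / 4 : ℝ))
            * r ^ (-(β - γ))) + C4 * (K * L) * ((t - r) ^ (-(1 - κ)) * t ^ (-(β - γ))) := by ring
      _ ≤ C1 * C2 * C3 * (K * L) * ((t - r) ^ (-(1 - κ)) * r ^ (-(β - γ)))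
          + C4 * (K * L) * ((t - r) ^ (-(1 - κ)) * r ^ (-(β - γ))) := by rw [e1]; gcongr
      _ = _ := by ring
  rw [hrep]
  refine (bd_integral h0.le (ik.const_mul _) hc hbd).mono ?_
  rw [intervalIntegral.integral_const_mul]
  have e3 : t ^ (1 - (1 - κ) - (β - γ)) ≤ T ^ κ * t ^ (-(β - γ)) := by
    rw [show 1 - (1 - κ) - (β - γ) = κ + -(β - γ) by ring, Real.rpow_add h0]
    have : t ^ κ ≤ T ^ κ := Real.rpow_le_rpow h0.le (ht.trans hτ) (by linarith)
    gcongr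
  calc _ ≤ (C1 * C2 * C3 + C4) * (K * L) * (C5 * (T ^ κ * t ^ (-(β - γ)))) := by
        gcongr
        exact bk.trans (by gcongr)
    _ = _ := by ring

lemma bil_sub (E : Exps α β γ) {τ K K' L L' : ℝ} {u u' ξ ξ' : ℝ → FD} (hu : P.UB β γ τ K u)
    (hu' : P.UB β γ τ K' u') (hξ : ∀ t, 0 < t → t ≤ τ → P.Bd (α - 1) (ξ t) L)
    (hξ' : ∀ t, 0 < t → t ≤ τ → P.Bd (α - 1) (ξ' t) L')
    (hcu : P.CB (Ioc 0 τ) β u) (hcu' : P.CB (Ioc 0 τ) β u') (hcξ : P.CB (Ioc 0 τ) (α - 1) ξ)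
    (hcξ' : P.CB (Ioc 0 τ) (α - 1) ξ') {t : ℝ} (h0 : 0 < t) (ht : t ≤ τ) :
    P.bil u ξ t - P.bil u' ξ' t
      = P.bil (fun r => u r - u' r) ξ t + P.bil u' (fun r => ξ r - ξ' r) t := by
  have i1 := fun k => hu.duh_para_integrable E hξ hcu hcξ h0 ht k
  have i2 := fun k => hu'.duh_para_integrable E hξ hcu' hcξ h0 ht k
  have i3 := fun k => hu'.duh_para_integrable E hξ' hcu' hcξ' h0 ht k
  have j1 := fun k => duh_integrable_of_bd hξ hcξ.continuousOn_coef h0 ht k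
  have j2 := fun k => duh_integrable_of_bd hξ' hcξ'.continuousOn_coef h0 ht k
  have e1 := duh_sub i1 i2
  have e2 := duh_sub i2 i3
  have e3 := duh_sub j1 j2
  simp only [bil, map_sub, LinearMap.sub_apply] at *
  rw [e1, e2, e3]
  simp only [mul_sub, map_sub]
  abel

variable (P) in
/-- The remainder `∂ₓ f - u ≺ ∂ₓ Y`, for `f` and `Y` given in mild form. -/
def rem (f₀ Y₀ : FD) (u ξ : ℝ → FD) (t : ℝ) : FD :=
  dsym * (heat t * f₀ + duh (fun r => P.fpara (u r) (ξ r)) t)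
    - P.fpara (u t) (dsym * (heat t * Y₀ + duh ξ t))

lemma rem_eq (f₀ Y₀ : FD) (u ξ : ℝ → FD) (t : ℝ) : P.rem f₀ Y₀ u ξ t
    = dsym * (heat t * f₀) + P.bil u ξ t - P.fpara (u t) (dsym * (heat t * Y₀)) := by
  simp only [rem, bil, mul_add, map_add]; abel

lemma exists_bd_rem_sub (P : DyadicPartition) (E : Exps α β γ) {T : ℝ} (hT : 0 ≤ T) :
    ∃ C : ℝ, 0 ≤ C ∧ ∀ (τ K d L e d₀ : ℝ) (f₀ f₀' Y₀ Y₀' : FD) (u u' ξ ξ' : ℝ → FD), τ ≤ T →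
      P.UB β γ τ K u → P.UB β γ τ K u' → P.UB β γ τ d (fun t => u t - u' t) →
      (∀ t, 0 < t → t ≤ τ → P.PB (α - 1) (ξ t) (ξ' t) L e) →
      P.CB (Ioc 0 τ) β u → P.CB (Ioc 0 τ) β u' →
      P.CB (Ioc 0 τ) (α - 1) ξ → P.CB (Ioc 0 τ) (α - 1) ξ' →
      P.Bd (γ + 1) (f₀ - f₀') d₀ → P.PB (α + 1) Y₀ Y₀' L e → ∀ t, 0 < t → t ≤ τ →
      P.Bd (2 * β) (P.rem f₀ Y₀ u ξ t - P.rem f₀' Y₀' u' ξ' t)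
        (C * (d₀ + d * L + K * e) * t ^ (-(min (3 * β / 2 - γ) (2 * β)))) := by
  obtain ⟨h1, h2, h3, h4, h5⟩ := id E
  set W := min (3 * β / 2 - γ) (2 * β) with hW
  obtain ⟨C1, hC1, hb⟩ := P.exists_bd_bil E hT
  obtain ⟨C2, hC2, hh⟩ := P.exists_bd_heat T hT
  obtain ⟨C3, hC3, hd⟩ := P.exists_bd_deriv (2 * β + 1)
  obtain ⟨C4, hP⟩ := P.exists_bil_fpara_pos (lt_min (by linarith) (by linarith) :
    0 < min β (β + γ)) (2 * β)
  have hC4 := hP.nonneg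
  have p1 : 0 ≤ T ^ (W - (β - γ / 2)) := by positivity
  have p2 : 0 ≤ T ^ (W - (β - γ)) := by positivity
  have p3 : 0 ≤ T ^ (W - ((β - γ) / 2 + (β - α / 2))) := by positivity
  have hW1 : β - γ / 2 ≤ W := le_min (by linarith) (by linarith)
  have hW2 : β - γ ≤ W := le_min (by linarith) (by linarith)
  have hW3 : (β - γ) / 2 + (β - α / 2) ≤ W := le_min (by linarith) (by linarith)
  refine ⟨C3 * C2 * T ^ (W - (β - γ / 2)) + C1 * T ^ (W - (β - γ))
    + C4 * (C3 * C2) * T ^ (W - ((β - γ) / 2 + (β - α / 2))), by positivity,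
    fun τ K d L e d₀ f₀ f₀' Y₀ Y₀' u u' ξ ξ' hτ hu hu' hud hξ hcu hcu' hcξ hcξ' hf hY t h0 ht => ?_⟩
  have hK := hu.nonneg (h0.trans_le ht)
  have hd0 := hud.nonneg (h0.trans_le ht)
  have hL := (hξ t h0 ht).left.nonneg
  have he := (hξ t h0 ht).diff.nonneg
  have hdf := hf.nonneg
  have htT := ht.trans hτ
  have b1 := hd _ _ (by
    have := hh _ (β - γ / 2) t _ _ (by linarith) (by linarith) h0 htT hf
    rwa [show γ + 1 + 2 * (β - γ / 2) = 2 * β + 1 by ring] at this)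
  have b2 := hb τ d L (fun r => u r - u' r) ξ hτ hud (fun t h0 ht => (hξ t h0 ht).left)
    (hcu.sub hcu') hcξ t h0 ht
  have b3 := hb τ K e u' (fun r => ξ r - ξ' r) hτ hu' (fun t h0 ht => (hξ t h0 ht).diff)
    hcu' (hcξ.sub hcξ') t h0 ht
  have hYh : P.PB (2 * β) (dsym * (heat t * Y₀)) (dsym * (heat t * Y₀'))
      (C3 * (C2 * t ^ (-(β - α / 2)) * L)) (C3 * (C2 * t ^ (-(β - α / 2)) * e)) := by
    have key : ∀ (Z : FD) (l : ℝ), P.Bd (α + 1) Z l →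
        P.Bd (2 * β) (dsym * (heat t * Z)) (C3 * (C2 * t ^ (-(β - α / 2)) * l)) := fun Z l hZ => by
      have := hh _ (β - α / 2) t _ _ (by linarith) (by linarith) h0 htT hZ
      rw [show α + 1 + 2 * (β - α / 2) = 2 * β + 1 by ring] at this
      have := hd _ _ this
      rwa [add_sub_cancel_right] at this
    refine ⟨key _ _ hY.left, key _ _ hY.right, ?_⟩
    rw [← mul_sub, ← mul_sub]
    exact key _ _ hY.diff
  have b4 := (hP.pb (⟨hu.low t h0 ht, hu'.low t h0 ht, hud.low t h0 ht⟩ : P.PB _ _ _ _ _) hYh).diff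
  rw [add_sub_cancel_right] at b1
  have eq : P.rem f₀ Y₀ u ξ t - P.rem f₀' Y₀' u' ξ' t
      = dsym * (heat t * (f₀ - f₀'))
        + (P.bil (fun r => u r - u' r) ξ t + P.bil u' (fun r => ξ r - ξ' r) t)
        - (P.fpara (u t) (dsym * (heat t * Y₀)) - P.fpara (u' t) (dsym * (heat t * Y₀'))) := by
    rw [← bil_sub E hu hu' (fun t h0 ht => (hξ t h0 ht).left) (fun t h0 ht => (hξ t h0 ht).right)
      hcu hcu' hcξ hcξ' h0 ht, rem_eq, rem_eq]
    simp only [mul_sub]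
    abel
  rw [eq]
  refine ((b1.add (b2.add b3)).sub b4).mono ?_
  have t1 := rpow_weight h0 htT hW1
  have t2 := rpow_weight h0 htT hW2
  have t3 : t ^ (-((β - γ) / 2)) * t ^ (-(β - α / 2))
      ≤ T ^ (W - ((β - γ) / 2 + (β - α / 2))) * t ^ (-W) := by
    rw [← Real.rpow_add h0]
    have := rpow_weight h0 htT hW3
    rwa [neg_add] at this
  have t4 : 0 ≤ t ^ (-W) := by positivity
  calc _ = C3 * C2 * d₀ * t ^ (-(β - γ / 2)) + C1 * (d * L + K * e) * t ^ (-(β - γ))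
        + C4 * (C3 * C2) * (d * L + K * e) * (t ^ (-((β - γ) / 2)) * t ^ (-(β - α / 2))) := by ring
    _ ≤ C3 * C2 * d₀ * (T ^ (W - (β - γ / 2)) * t ^ (-W))
        + C1 * (d * L + K * e) * (T ^ (W - (β - γ)) * t ^ (-W))
        + C4 * (C3 * C2) * (d * L + K * e)
          * (T ^ (W - ((β - γ) / 2 + (β - α / 2))) * t ^ (-W)) := by gcongr
    _ = (C3 * C2 * T ^ (W - (β - γ / 2)) * d₀ + (C1 * T ^ (W - (β - γ))
        + C4 * (C3 * C2) * T ^ (W - ((β - γ) / 2 + (β - α / 2)))) * (d * L + K * e)) * t ^ (-W) := by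
        ring
    _ ≤ ((C3 * C2 * T ^ (W - (β - γ / 2)) + C1 * T ^ (W - (β - γ))
    + C4 * (C3 * C2) * T ^ (W - ((β - γ) / 2 + (β - α / 2)))) * d₀
        + (C3 * C2 * T ^ (W - (β - γ / 2)) + C1 * T ^ (W - (β - γ))
    + C4 * (C3 * C2) * T ^ (W - ((β - γ) / 2 + (β - α / 2)))) * (d * L + K * e)) * t ^ (-W) := by
        have q1 : 0 ≤ C3 * C2 * T ^ (W - (β - γ / 2)) := by positivity
        have q2 : 0 ≤ C1 * T ^ (W - (β - γ)) := by positivity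
        have q3 : 0 ≤ C4 * (C3 * C2) * T ^ (W - ((β - γ) / 2 + (β - α / 2))) := by positivity
        gcongr <;> linarith
    _ = _ := by ring

variable (P) in
/-- The terms of the right-hand side of the equation for `g` that do not involve the remainder. -/
def src (D C k ξ q B Y u : FD) : FD :=
  D + P.fmul u C + P.fcomm u k ξ + P.fres q ξ + P.fpara ξ u + B + P.fmul u Y
    + (1 / 2 : ℂ) • P.fmul u u

lemma exists_pb_src (P : DyadicPartition) (E : Exps α β γ) {T : ℝ} (hT : 0 ≤ T) :
    ∃ Q : ℝ, 0 ≤ Q ∧ ∀ (t m e K d : ℝ) (D D' C C' k k' ξ ξ' q q' B B' Y Y' u u' : FD),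
      0 < t → t ≤ T → 1 ≤ m → 0 ≤ K → 0 ≤ d → P.PB (2 * α - 1) D D' m e →
      P.PB (2 * α - 1) C C' m e → P.PB α k k' m e → P.PB (α - 1) ξ ξ' m e →
      P.PB (2 * β) q q' (K * t ^ (-(β - γ))) (d * t ^ (-(β - γ))) →
      P.PB (2 * α - 1) B B' m e → P.PB (2 * α - 1) Y Y' m e →
      P.PB β u u' (K * t ^ (-(β - γ))) (d * t ^ (-(β - γ))) →
      P.PB (min β (β + γ)) u u' (K * t ^ (-((β - γ) / 2))) (d * t ^ (-((β - γ) / 2))) →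
      P.PB (α + β - 1) (P.src D C k ξ q B Y u) (P.src D' C' k' ξ' q' B' Y' u')
        (Q * ((m + K * m ^ 2 + K ^ 2) * t ^ (-(β - γ))))
        (Q * ((e + d * m ^ 2 + K * m * e + d * K) * t ^ (-(β - γ)))) := by
  obtain ⟨h1, h2, h3, h4, h5⟩ := id E
  obtain ⟨C1, hb1⟩ := P.exists_bil_fmul_neg (by linarith : 0 < β) (by linarith : 2 * α - 1 < 0)
    (by linarith)
  obtain ⟨C2, hC2, hb2⟩ := P.exists_pb_fcomm (by linarith : β < 1)
    (by linarith : α + (α - 1) < 0) (by linarith)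
  obtain ⟨C3, hb3⟩ := P.exists_bil_fres (by linarith : 0 < 2 * β + (α - 1))
  obtain ⟨C4, hb4⟩ := P.exists_bil_fpara_neg (by linarith : α - 1 < 0) β
  obtain ⟨C5, hb5⟩ := P.exists_bil_fmul_pos (lt_min (by linarith) (by linarith) :
    0 < min β (β + γ))
  have ha0 : 0 < min β (β + γ) := lt_min (by linarith) (by linarith)
  have hC1 := hb1.nonneg
  have hC3 := hb3.nonneg
  have hC4 := hb4.nonneg
  have hC5 := hb5.nonneg
  set A := T ^ (β - γ) with hA
  have hA0 : 0 ≤ A := by positivity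
  refine ⟨A + C1 + 2 * C2 + C3 + C4 + A + C1 + C5, by positivity,
    fun t m e K d D D' C C' k k' ξ ξ' q q' B B' Y Y' u u' h0 ht hm hK hd hD hC hk hξ hq hB hY hu hu0
      => ?_⟩
  have he := hD.diff.nonneg
  have hl : 1 ≤ A * t ^ (-(β - γ)) := by
    have := rpow_weight (p := 0) (q := β - γ) h0 ht (by linarith)
    simpa using this
  have hll : t ^ (-((β - γ) / 2)) * t ^ (-((β - γ) / 2)) = t ^ (-(β - γ)) := by
    rw [← Real.rpow_add h0]; ring_nf
  set l := t ^ (-(β - γ)) with hldef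
  have hl0 : 0 ≤ l := by positivity
  have hm0 : 0 ≤ m := by linarith
  have hmm : m ≤ m ^ 2 := by nlinarith
  set S := (m + K * m ^ 2 + K ^ 2) * l with hS
  set Z := (e + d * m ^ 2 + K * m * e + d * K) * l with hZ
  have s1 : m * l ≤ S := by rw [hS]; gcongr; linarith [mul_nonneg hK (sq_nonneg m), sq_nonneg K]
  have s2 : K * m ^ 2 * l ≤ S := by rw [hS]; gcongr; linarith [sq_nonneg K]
  have s3 : K ^ 2 * l ≤ S := by rw [hS]; gcongr; linarith [mul_nonneg hK (sq_nonneg m)]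
  have s4 : K * m * l ≤ S := le_trans (by gcongr) s2
  have q1 := mul_nonneg hd (sq_nonneg m)
  have q2 := mul_nonneg (mul_nonneg hK hm0) he
  have q3 := mul_nonneg hd hK
  have z1 : e * l ≤ Z := by rw [hZ]; gcongr; linarith
  have z2 : (d * m ^ 2 + K * m * e) * l ≤ Z := mul_le_mul_of_nonneg_right (by linarith) hl0
  have z3 : d * K * l ≤ Z := by rw [hZ]; gcongr; linarith
  have z4 : (d * m + K * e) * l ≤ Z := by
    refine le_trans ?_ z2
    gcongr
    exact le_mul_of_one_le_right hK hm
  have z5 : (d * m ^ 2 + 2 * (K * m * e)) * l ≤ 2 * Z := by nlinarith [mul_nonneg q1 hl0]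
  have z6 : 2 * (d * K * l) * (1 / 2) ≤ Z := by linarith
  have bD : ∀ {D D' : FD}, P.PB (2 * α - 1) D D' m e → P.PB (α + β - 1) D D' (A * S) (A * Z) :=
    fun hD => (hD.exp_mono (by linarith)).mono
      (by
        calc m ≤ m * (A * l) := le_mul_of_one_le_right hm0 hl
          _ = A * (m * l) := by ring
          _ ≤ A * S := by gcongr)
      (by
        calc e ≤ e * (A * l) := le_mul_of_one_le_right he hl
          _ = A * (e * l) := by ring
          _ ≤ A * Z := by gcongr)
  have bC : ∀ {C C' : FD}, P.PB (2 * α - 1) C C' m e →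
      P.PB (α + β - 1) (P.fmul u C) (P.fmul u' C') (C1 * S) (C1 * Z) :=
    fun hC => ((hb1.pb hu hC).exp_mono (by linarith)).mono
      (by
        calc _ = C1 * (K * m * l) := by ring
          _ ≤ C1 * S := by gcongr)
      (by
        calc _ = C1 * ((d * m + K * e) * l) := by ring
          _ ≤ C1 * Z := by gcongr)
  have bR := ((hb2 _ _ _ _ _ _ _ _ _ _ _ _ hu hk hξ).exp_mono
    (by linarith : α + β - 1 ≤ β + α + (α - 1))).mono
      (by
        calc _ = C2 * (K * m ^ 2 * l) := by ring
          _ ≤ C2 * S := by gcongr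
          _ ≤ 2 * C2 * S := by
            have : 0 ≤ S := le_trans (by positivity) s1
            nlinarith [mul_nonneg hC2 this])
      (by
        calc _ = C2 * ((d * m ^ 2 + 2 * (K * m * e)) * l) := by ring
          _ ≤ C2 * (2 * Z) := by gcongr
          _ = 2 * C2 * Z := by ring)
  have bQ := ((hb3.pb hq hξ).exp_mono (by linarith : α + β - 1 ≤ 2 * β + (α - 1))).mono
      (by
        calc _ = C3 * (K * m * l) := by ring
          _ ≤ C3 * S := by gcongr)
      (by
        calc _ = C3 * ((d * m + K * e) * l) := by ring
          _ ≤ C3 * Z := by gcongr)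
  have bP := ((hb4.pb hξ hu).exp_mono (by linarith : α + β - 1 ≤ α - 1 + β)).mono
      (by
        calc _ = C4 * (K * m * l) := by ring
          _ ≤ C4 * S := by gcongr)
      (by
        calc _ = C4 * ((d * m + K * e) * l) := by ring
          _ ≤ C4 * Z := by gcongr)
  have n12 : ‖(1 / 2 : ℂ)‖ = 1 / 2 := by norm_num
  have bU : P.PB (α + β - 1) ((1 / 2 : ℂ) • P.fmul u u) ((1 / 2 : ℂ) • P.fmul u' u') (C5 * S)
      (C5 * Z) := by
    refine (((hb5.pb hu0 hu0).smul (1 / 2 : ℂ)).exp_mono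
      (by linarith : α + β - 1 ≤ min β (β + γ))).mono ?_ ?_
    · rw [n12]
      calc _ = 1 / 2 * (C5 * (K ^ 2 * (t ^ (-((β - γ) / 2)) * t ^ (-((β - γ) / 2))))) := by ring
        _ ≤ 1 * (C5 * S) := by rw [hll]; gcongr; norm_num
        _ = C5 * S := one_mul _
    · rw [n12]
      calc _ = C5 * (2 * (d * K * (t ^ (-((β - γ) / 2)) * t ^ (-((β - γ) / 2)))) * (1 / 2)) := by
            ring
        _ ≤ C5 * Z := by rw [hll]; gcongr
  exact (((((((bD hD).add (bC hC)).add bR).add bQ).add bP).add (bD hB)).add (bC hY)).add bU |>.mono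
    (le_of_eq (by ring)) (le_of_eq (by ring))

end DyadicPartition

/-- The components of a driving term, as families of Fourier coefficients. -/
structure FDriv where
  XI : ℝ → FD
  XY : ℝ → FD
  XW : ℝ → FD
  XB : ℝ → FD
  XD : ℝ → FD
  XK : ℝ → FD
  XC : ℝ → FD

/-- `u = ∂ₓ (X^W + f + g)`. -/
def fU (X : FDriv) (f g : ℝ → FD) (t : ℝ) : FD := dsym * (X.XW t + f t + g t)

/-- The driving term whose components all vanish. -/
def FDriv.zero : FDriv := ⟨0, 0, 0, 0, 0, 0, 0⟩

namespace DyadicPartition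

variable (P : DyadicPartition)

/-- The right-hand side of the equation for `f`. -/
def fF (X : FDriv) (f g : ℝ → FD) (t : ℝ) : FD := P.fpara (fU X f g t) (dsym * X.XI t)

/-- The part of the right-hand side of the equation for `g` that does not involve the remainder. -/
def fG₁ (X : FDriv) (f g : ℝ → FD) (t : ℝ) : FD :=
  P.src (X.XD t) (X.XC t) (dsym * X.XK t) (dsym * X.XI t) (dsym * g t) (X.XB t) (dsym * X.XY t)
    (fU X f g t)

/-- The resonant product of the remainder `∂ₓ h - u ≺ ∂ₓ X^K` and `∂ₓ X^I`. -/
def fG₂ (X : FDriv) (h f g : ℝ → FD) (t : ℝ) : FD :=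
  P.fres (dsym * h t - P.fpara (fU X f g t) (dsym * X.XK t)) (dsym * X.XI t)

/-- The first component of the fixed point map. -/
def Φ₁ (X : FDriv) (f₀ : FD) (f g : ℝ → FD) (t : ℝ) : FD := heat t * f₀ + duh (P.fF X f g) t

/-- The second component of the fixed point map. -/
def Φ₂ (X : FDriv) (f₀ g₀ : FD) (f g : ℝ → FD) (t : ℝ) : FD :=
  heat t * g₀ + duh (fun r => P.fG₁ X f g r + P.fG₂ X (P.Φ₁ X f₀ f g) f g r) t

/-- Bounds on two driving terms and on their difference. -/
structure DrP (α τ m e : ℝ) (X X' : FDriv) : Prop where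
  XI : ∀ t ∈ Icc 0 τ, P.PB α (X.XI t) (X'.XI t) m e
  XY : ∀ t ∈ Icc 0 τ, P.PB (2 * α) (X.XY t) (X'.XY t) m e
  XW : ∀ t ∈ Icc 0 τ, P.PB (α + 1) (X.XW t) (X'.XW t) m e
  XWh : ∀ s t, 0 ≤ s → s < t → t ≤ τ → P.PB (α + 1 - 1 / 2) (X.XW t - X.XW s) (X'.XW t - X'.XW s)
    (m * (t - s) ^ (1 / 4 : ℝ)) (e * (t - s) ^ (1 / 4 : ℝ))
  XB : ∀ t ∈ Icc 0 τ, P.PB (2 * α - 1) (X.XB t) (X'.XB t) m e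
  XD : ∀ t ∈ Icc 0 τ, P.PB (2 * α - 1) (X.XD t) (X'.XD t) m e
  XK : ∀ t ∈ Icc 0 τ, P.PB (α + 1) (X.XK t) (X'.XK t) m e
  XC : ∀ t ∈ Icc 0 τ, P.PB (2 * α - 1) (X.XC t) (X'.XC t) m e

/-- Continuity of the components of a driving term, and the equation for `X^K`. -/
structure DrC (α τ : ℝ) (X : FDriv) : Prop where
  XI : P.CB (Icc 0 τ) α X.XI
  XY : P.CB (Icc 0 τ) (2 * α) X.XY
  XW : P.CB (Icc 0 τ) (α + 1) X.XW
  XB : P.CB (Icc 0 τ) (2 * α - 1) X.XB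
  XD : P.CB (Icc 0 τ) (2 * α - 1) X.XD
  XK : P.CB (Icc 0 τ) (α + 1) X.XK
  XC : P.CB (Icc 0 τ) (2 * α - 1) X.XC
  mild : ∀ t ∈ Icc 0 τ, X.XK t = heat t * X.XK 0 + duh (fun r => dsym * X.XI r) t

/-- Continuity of a pair of paths at positive times. -/
structure Adm (β τ : ℝ) (f g : ℝ → FD) : Prop where
  cf : P.CB (Ioc 0 τ) (β + 1) f
  cg : P.CB (Ioc 0 τ) (2 * β + 1) g

/-- The bounds defining the norm of the solution space. -/
structure SB (β γ τ K : ℝ) (f g : ℝ → FD) : Prop where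
  wf : P.WL τ ((β - γ) / 2) (β + 1) K f
  wg : P.WL τ (β - γ) (2 * β + 1) K g

end DyadicPartition

namespace DyadicPartition

variable {P : DyadicPartition} {α β γ : ℝ}

lemma cb_of_weighted {a a' w K τ : ℝ} {f : ℝ → FD} (haa' : a < a') (hw : 0 ≤ w)
    (hc : ∀ k, ContinuousOn (fun r => f r k) (Ioc 0 τ))
    (hb : ∀ r, 0 < r → r ≤ τ → P.Bd a' (f r) (K * r ^ (-w))) : P.CB (Ioc 0 τ) a f := by
  refine cb_of_bd haa' hc fun t ht => ⟨|K| * (t / 2) ^ (-w), ?_⟩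
  have ht0 := ht.1
  filter_upwards [self_mem_nhdsWithin,
    mem_nhdsWithin_of_mem_nhds (Ioi_mem_nhds (by linarith : t / 2 < t))] with s h1 h2
  have h2' : t / 2 < s := h2
  refine (hb s h1.1 h1.2).mono ?_
  have h5 : s ^ (-w) ≤ (t / 2) ^ (-w) :=
    Real.rpow_le_rpow_of_nonpos (by linarith) h2'.le (by linarith)
  have h6 : 0 ≤ s ^ (-w) := Real.rpow_nonneg h1.1.le _
  have := le_abs_self K
  gcongr

lemma UB.zero {τ K : ℝ} (hK : 0 ≤ K) : P.UB β γ τ K (fun _ => 0) where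
  reg t h0 _ := (Bd.zero _).mono (by positivity)
  low t h0 _ := (Bd.zero _).mono (by positivity)
  hol s t hs hst _ := by
    have : 0 < t - s := by linarith
    rw [sub_self]; exact (Bd.zero _).mono (by positivity)

lemma SB.nonneg {τ K : ℝ} {f g : ℝ → FD} (h : P.SB β γ τ K f g) (hτ : 0 ≤ τ) : 0 ≤ K :=
  (h.wf.low 0 le_rfl hτ).nonneg

lemma DrP.nonneg {τ m e : ℝ} {X X' : FDriv} (h : P.DrP α τ m e X X') (hτ : 0 ≤ τ) :
    0 ≤ m ∧ 0 ≤ e :=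
  ⟨(h.XI 0 ⟨le_rfl, hτ⟩).left.nonneg, (h.XI 0 ⟨le_rfl, hτ⟩).diff.nonneg⟩

lemma exists_pb_deriv (P : DyadicPartition) (a : ℝ) : ∃ C : ℝ, 0 ≤ C ∧ ∀ (u u' : FD) (K d : ℝ),
    P.PB a u u' K d → P.PB (a - 1) (dsym * u) (dsym * u') (C * K) (C * d) := by
  obtain ⟨C, hC, h⟩ := P.exists_bd_deriv a
  exact ⟨C, hC, fun u u' K d hu => ⟨h _ _ hu.left, h _ _ hu.right, by
    rw [← mul_sub]; exact h _ _ hu.diff⟩⟩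

variable (P α β γ) in
/-- Bounds on the quantities derived from two driving terms and two pairs of paths. -/
structure Der (Q τ m e K d : ℝ) (X X' : FDriv) (f g f' g' : ℝ → FD) : Prop where
  ul : P.UB β γ τ (Q * (m + K)) (fU X f g)
  ur : P.UB β γ τ (Q * (m + K)) (fU X' f' g')
  ud : P.UB β γ τ (Q * (e + d)) (fun t => fU X f g t - fU X' f' g' t)
  dI : ∀ t, 0 < t → t ≤ τ → P.PB (α - 1) (dsym * X.XI t) (dsym * X'.XI t) (Q * m) (Q * e)
  dY : ∀ t, 0 < t → t ≤ τ → P.PB (2 * α - 1) (dsym * X.XY t) (dsym * X'.XY t) (Q * m) (Q * e)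
  dK : ∀ t, 0 < t → t ≤ τ → P.PB α (dsym * X.XK t) (dsym * X'.XK t) (Q * m) (Q * e)
  dg : ∀ t, 0 < t → t ≤ τ → P.PB (2 * β) (dsym * g t) (dsym * g' t)
    (Q * K * t ^ (-(β - γ))) (Q * d * t ^ (-(β - γ)))

lemma exists_der (P : DyadicPartition) (E : Exps α β γ) {T : ℝ} (hT : 0 ≤ T) :
    ∃ Q : ℝ, 1 ≤ Q ∧ ∀ (τ m e K d : ℝ) (X X' : FDriv) (f g f' g' : ℝ → FD), 0 ≤ τ → τ ≤ T →
      P.DrP α τ m e X X' → P.SB β γ τ K f g → P.SB β γ τ K f' g' →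
      P.SB β γ τ d (fun t => f t - f' t) (fun t => g t - g' t) →
      P.Der α β γ Q τ m e K d X X' f g f' g' := by
  obtain ⟨C0, hC0, h0⟩ := P.exists_ub E hT
  obtain ⟨C1, hC1, h1⟩ := P.exists_pb_deriv α
  obtain ⟨C2, hC2, h2⟩ := P.exists_pb_deriv (2 * α)
  obtain ⟨C3, hC3, h3⟩ := P.exists_pb_deriv (α + 1)
  obtain ⟨C4, hC4, h4⟩ := P.exists_pb_deriv (2 * β + 1)
  rw [add_sub_cancel_right] at h3 h4
  refine ⟨1 + 2 * C0 + C1 + C2 + C3 + C4, by linarith,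
    fun τ m e K d X X' f g f' g' hτ0 hτ hX hf hf' hd => ?_⟩
  obtain ⟨hm, he⟩ := hX.nonneg hτ0
  have hK := hf.nonneg hτ0
  have hd0 := hd.nonneg hτ0
  set Q := 1 + 2 * C0 + C1 + C2 + C3 + C4 with hQ
  have ubm : ∀ {x y : ℝ} {u : ℝ → FD}, 0 ≤ x → 0 ≤ y → P.UB β γ τ (C0 * (x + y + y)) u →
      P.UB β γ τ (Q * (x + y)) u := by
    intro x y u hx hy hu
    have hle : C0 * (x + y + y) ≤ Q * (x + y) := by
      have : 0 ≤ (C1 + C2 + C3 + C4) * (x + y) := by positivity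
      rw [hQ]; nlinarith [mul_nonneg hC0 hx]
    exact ⟨fun t ht0 ht => (hu.reg t ht0 ht).mono (by gcongr),
      fun t ht0 ht => (hu.low t ht0 ht).mono (by gcongr),
      fun s t hs hst ht => (hu.hol s t hs hst ht).mono (by
        have : 0 < t - s := by linarith
        gcongr)⟩
  have hI : ∀ {t : ℝ}, 0 < t → t ≤ τ → t ∈ Icc 0 τ := fun h h' => ⟨h.le, h'⟩
  have e1 : C1 ≤ Q := by linarith
  have e2 : C2 ≤ Q := by linarith
  have e3 : C3 ≤ Q := by linarith
  have e4 : C4 ≤ Q := by linarith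
  refine ⟨ubm hm hK ?_, ubm hm hK ?_, ubm he hd0 ?_, fun t ht0 ht => ?_, fun t ht0 ht => ?_,
    fun t ht0 ht => ?_, fun t ht0 ht => ?_⟩
  · exact h0 τ X.XW f g m K K hτ (fun t ht0 ht => (hX.XW t (hI ht0 ht)).left)
      (fun s t hs hst ht => (hX.XWh s t hs.le hst ht).left) hf.wf hf.wg
  · exact h0 τ X'.XW f' g' m K K hτ (fun t ht0 ht => (hX.XW t (hI ht0 ht)).right)
      (fun s t hs hst ht => (hX.XWh s t hs.le hst ht).right) hf'.wf hf'.wg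
  · have := h0 τ (fun t => X.XW t - X'.XW t) _ _ e d d hτ
      (fun t ht0 ht => (hX.XW t (hI ht0 ht)).diff)
      (fun s t hs hst ht => by
        have := (hX.XWh s t hs.le hst ht).diff
        rwa [show X.XW t - X.XW s - (X'.XW t - X'.XW s)
          = X.XW t - X'.XW t - (X.XW s - X'.XW s) by abel] at this) hd.wf hd.wg
    convert this using 2 with t
    simp only [fU, ← mul_sub]
    congr 1; abel
  · exact (h1 _ _ _ _ (hX.XI t (hI ht0 ht))).mono (by gcongr) (by gcongr)
  · exact (h2 _ _ _ _ (hX.XY t (hI ht0 ht))).mono (by gcongr) (by gcongr)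
  · exact (h3 _ _ _ _ (hX.XK t (hI ht0 ht))).mono (by gcongr) (by gcongr)
  · have := h4 _ _ _ _ (⟨hf.wg.sup t ht0 ht, hf'.wg.sup t ht0 ht, hd.wg.sup t ht0 ht⟩ :
      P.PB (2 * β + 1) (g t) (g' t) _ _)
    exact this.mono (by rw [← mul_assoc]; gcongr) (by rw [← mul_assoc]; gcongr)

/-! ### Continuity in time of the right-hand sides -/

lemma Adm.cb_u {E : Exps α β γ} {τ : ℝ} {X : FDriv} {f g : ℝ → FD} (hX : P.DrC α τ X)
    (h : P.Adm β τ f g) : P.CB (Ioc 0 τ) β (fU X f g) := by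
  obtain ⟨h1, h2, h3, h4, h5⟩ := E
  have c1 := (hX.XW.mono_set Ioc_subset_Icc_self).exp_mono (by linarith : β + 1 ≤ α + 1)
  have := ((c1.add h.cf).add (h.cg.exp_mono (by linarith : β + 1 ≤ 2 * β + 1))).deriv
  rwa [add_sub_cancel_right] at this

lemma DrC.cb_I {τ : ℝ} {X : FDriv} (hX : P.DrC α τ X) :
    P.CB (Ioc 0 τ) (α - 1) (fun t => dsym * X.XI t) := (hX.XI.mono_set Ioc_subset_Icc_self).deriv

lemma DrC.cb_K {τ : ℝ} {X : FDriv} (hX : P.DrC α τ X) :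
    P.CB (Ioc 0 τ) α (fun t => dsym * X.XK t) := by
  have := (hX.XK.mono_set Ioc_subset_Icc_self).deriv
  rwa [add_sub_cancel_right] at this

lemma cb_F (E : Exps α β γ) {τ : ℝ} {X : FDriv} {f g : ℝ → FD} (hX : P.DrC α τ X)
    (h : P.Adm β τ f g) : P.CB (Ioc 0 τ) (α - 1) (P.fF X f g) := by
  obtain ⟨C, hC⟩ := P.exists_bil_fpara_pos (by linarith [E.hβ] : 0 < β) (α - 1)
  exact CB.bilin hC (Adm.cb_u (E := E) hX h) hX.cb_I

lemma cb_G₁ (E : Exps α β γ) {τ : ℝ} {X : FDriv} {f g : ℝ → FD} (hX : P.DrC α τ X)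
    (h : P.Adm β τ f g) : P.CB (Ioc 0 τ) (α + β - 1) (P.fG₁ X f g) := by
  have cu := Adm.cb_u (E := E) hX h
  have cI := hX.cb_I
  have cK := hX.cb_K
  obtain ⟨h1, h2, h3, h4, h5⟩ := E
  obtain ⟨C1, hb1⟩ := P.exists_bil_fmul_neg (by linarith : 0 < β) (by linarith : 2 * α - 1 < 0)
    (by linarith)
  obtain ⟨C3, hb3⟩ := P.exists_bil_fres (by linarith : 0 < 2 * β + (α - 1))
  obtain ⟨C4, hb4⟩ := P.exists_bil_fpara_neg (by linarith : α - 1 < 0) β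
  obtain ⟨C5, hb5⟩ := P.exists_bil_fmul_pos (by linarith : 0 < β)
  have cg := h.cg.deriv
  rw [add_sub_cancel_right] at cg
  have cY := (hX.XY.mono_set Ioc_subset_Icc_self).deriv
  have cC := hX.XC.mono_set Ioc_subset_Icc_self
  have r1 : α + β - 1 ≤ 2 * α - 1 := by linarith
  have r2 : α + β - 1 ≤ β + α + (α - 1) := by linarith
  have r3 : α + β - 1 ≤ 2 * β + (α - 1) := by linarith
  have r4 : α + β - 1 ≤ α - 1 + β := by linarith
  have r5 : α + β - 1 ≤ β := by linarith
  exact (((((((((hX.XD.mono_set Ioc_subset_Icc_self).exp_mono r1).add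
    ((CB.bilin hb1 cu cC).exp_mono r1)).add
    ((CB.fcomm (by linarith) (by linarith) (by linarith) cu cK cI).exp_mono r2)).add
    ((CB.bilin hb3 cg cI).exp_mono r3)).add ((CB.bilin hb4 cI cu).exp_mono r4)).add
    ((hX.XB.mono_set Ioc_subset_Icc_self).exp_mono r1)).add
    ((CB.bilin hb1 cu cY).exp_mono r1)).add
    (((CB.bilin hb5 cu cu).smul (1 / 2)).exp_mono r5))

lemma remainder_eq {τ : ℝ} {X : FDriv} {f g : ℝ → FD} (hX : P.DrC α τ X) (f₀ : FD) {t : ℝ}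
    (h0 : 0 ≤ t) (ht : t ≤ τ) :
    dsym * P.Φ₁ X f₀ f g t - P.fpara (fU X f g t) (dsym * X.XK t)
      = P.rem f₀ (X.XK 0) (fU X f g) (fun r => dsym * X.XI r) t := by rw [hX.mild t ⟨h0, ht⟩]; rfl

lemma cb_Φ₁ (E : Exps α β γ) {T τ K L M : ℝ} {X : FDriv} {f g : ℝ → FD} {f₀ : FD} (hT : 0 ≤ T)
    (hτ0 : 0 ≤ τ) (hτ : τ ≤ T) (hX : P.DrC α τ X) (h : P.Adm β τ f g)
    (hu : P.UB β γ τ K (fU X f g)) (hK : 0 ≤ K) (hL : 0 ≤ L)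
    (hξ : ∀ t, 0 < t → t ≤ τ → P.Bd (α - 1) (dsym * X.XI t) L)
    (hf : P.Bd (γ + 1) f₀ M) : P.CB (Ioc 0 τ) (β + 1) (P.Φ₁ X f₀ f g) := by
  obtain ⟨C, hC, hb⟩ := UB.para_bd P E
  have hF := cb_F E hX h
  obtain ⟨h1, h2, h3, h4, h5⟩ := id E
  refine (cb_heat hτ0 hf (by linarith)).add ?_
  exact cb_duh (w := (β - γ) / 2) (σ := α - 1) hT (by linarith) (by linarith) (by linarith)
    (by positivity : 0 ≤ C * K * L) hτ0 hτ hF.continuousOn_coef (hb τ K L _ _ hu hξ)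

lemma cb_G₂ (E : Exps α β γ) {T τ K L M R : ℝ} {X : FDriv} {f g : ℝ → FD} {f₀ : FD} (hT : 0 ≤ T)
    (hτ0 : 0 ≤ τ) (hτ : τ ≤ T) (hX : P.DrC α τ X) (h : P.Adm β τ f g)
    (hu : P.UB β γ τ K (fU X f g)) (hK : 0 ≤ K) (hL : 0 ≤ L)
    (hξ : ∀ t, 0 < t → t ≤ τ → P.Bd (α - 1) (dsym * X.XI t) L)
    (hf : P.Bd (γ + 1) f₀ M) {W : ℝ} (hW : 0 ≤ W)
    (hrem : ∀ t, 0 < t → t ≤ τ → P.Bd (2 * β) (dsym * P.Φ₁ X f₀ f g t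
      - P.fpara (fU X f g t) (dsym * X.XK t)) (R * t ^ (-W))) :
    ∃ b, P.CB (Ioc 0 τ) b (P.fG₂ X (P.Φ₁ X f₀ f g) f g) := by
  have cΦ := (cb_Φ₁ E hT hτ0 hτ hX h hu hK hL hξ hf).deriv
  have cu := Adm.cb_u (E := E) hX h
  have cI := hX.cb_I
  have cK := hX.cb_K
  obtain ⟨h1, h2, h3, h4, h5⟩ := id E
  obtain ⟨C, hC⟩ := P.exists_bil_fpara_pos (by linarith : 0 < β) α
  have cp := CB.bilin hC cu cK
  have cr : P.CB (Ioc 0 τ) (2 * β - (2 * β + (α - 1)) / 2) (fun t => dsym * P.Φ₁ X f₀ f g t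
      - P.fpara (fU X f g t) (dsym * X.XK t)) := by
    refine cb_of_weighted (a' := 2 * β) (by linarith) hW (fun k => ?_) hrem
    exact (cΦ.continuousOn_coef k).sub (cp.continuousOn_coef k)
  obtain ⟨C', hC'⟩ := P.exists_bil_fres
    (by linarith : 0 < 2 * β - (2 * β + (α - 1)) / 2 + (α - 1))
  exact ⟨_, CB.bilin hC' cr cI⟩

/-! ### Bounds on the right-hand sides -/

/-- The weight of the resonant product with the remainder. -/
def wR (β γ : ℝ) : ℝ := min (3 * β / 2 - γ) (2 * β)

variable (P α β γ) in
/-- Bounds on the right-hand sides of two equations. -/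
structure SrcB (Q τ m e K d M d₀ : ℝ) (X X' : FDriv) (f₀ f₀' : FD) (f g f' g' : ℝ → FD) :
    Prop where
  F : ∀ t, 0 < t → t ≤ τ → P.PB (α - 1) (P.fF X f g t) (P.fF X' f' g' t)
    (Q * ((m + K) * m) * t ^ (-((β - γ) / 2)))
    (Q * ((e + d) * m + (m + K) * e) * t ^ (-((β - γ) / 2)))
  G₁ : ∀ t, 0 < t → t ≤ τ → P.PB (α + β - 1) (P.fG₁ X f g t) (P.fG₁ X' f' g' t)
    (Q * (m + (m + K) * m ^ 2 + (m + K) ^ 2) * t ^ (-(β - γ)))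
    (Q * (e + (e + d) * m ^ 2 + (m + K) * m * e + (e + d) * (m + K)) * t ^ (-(β - γ)))
  R : ∀ t, 0 < t → t ≤ τ → P.PB (2 * β)
    (dsym * P.Φ₁ X f₀ f g t - P.fpara (fU X f g t) (dsym * X.XK t))
    (dsym * P.Φ₁ X' f₀' f' g' t - P.fpara (fU X' f' g' t) (dsym * X'.XK t))
    (Q * (M + (m + K) * m) * t ^ (-(wR β γ)))
    (Q * (d₀ + (e + d) * m + (m + K) * e) * t ^ (-(wR β γ)))
  G₂ : ∀ t, 0 < t → t ≤ τ → P.PB (2 * β + (α - 1)) (P.fG₂ X (P.Φ₁ X f₀ f g) f g t)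
    (P.fG₂ X' (P.Φ₁ X' f₀' f' g') f' g' t) (Q * ((M + (m + K) * m) * m) * t ^ (-(wR β γ)))
    (Q * ((d₀ + (e + d) * m + (m + K) * e) * m + (M + (m + K) * m) * e) * t ^ (-(wR β γ)))

lemma rem_zero (t : ℝ) : P.rem 0 0 (fun _ => 0) (fun _ => 0) t = 0 := by
  have h : duh (fun _ => 0) t = 0 := by ext k; simp [duh]
  simp [rem, h]

lemma exists_srcB (P : DyadicPartition) (E : Exps α β γ) {T : ℝ} (hT : 0 ≤ T) :
    ∃ Q : ℝ, 0 ≤ Q ∧ ∀ (τ m e K d M d₀ : ℝ) (X X' : FDriv) (f₀ f₀' : FD) (f g f' g' : ℝ → FD),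
      0 ≤ τ → τ ≤ T → 1 ≤ m → P.DrP α τ m e X X' → P.DrC α τ X → P.DrC α τ X' →
      P.SB β γ τ K f g → P.SB β γ τ K f' g' →
      P.SB β γ τ d (fun t => f t - f' t) (fun t => g t - g' t) → P.Adm β τ f g → P.Adm β τ f' g' →
      P.PB (γ + 1) f₀ f₀' M d₀ → P.SrcB α β γ Q τ m e K d M d₀ X X' f₀ f₀' f g f' g' := by
  obtain ⟨D, hD, hder⟩ := P.exists_der E hT
  obtain ⟨C1, hb1⟩ := P.exists_bil_fpara_pos (lt_min (by linarith [E.hβ]) (by linarith [E.hγ]) :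
    0 < min β (β + γ)) (α - 1)
  obtain ⟨C2, hC2, hb2⟩ := P.exists_pb_src E hT
  obtain ⟨C3, hC3, hb3⟩ := P.exists_bd_rem_sub E hT
  obtain ⟨C4, hb4⟩ := P.exists_bil_fres (by linarith [E.hβ, E.hβα] : 0 < 2 * β + (α - 1))
  have hC1 := hb1.nonneg
  have hC4 := hb4.nonneg
  have hD0 : 0 ≤ D := by linarith
  have hD2 : D ≤ D ^ 2 := by nlinarith
  have hD3 : D ^ 2 ≤ D ^ 3 := by nlinarith [sq_nonneg D]
  have hD12 : (1 : ℝ) ≤ D ^ 2 := by linarith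
  set Q1 := C1 * D ^ 2 + C2 * D ^ 3 + 2 * (C3 * D ^ 2) with hQ1
  have hQ10 : 0 ≤ Q1 := by positivity
  refine ⟨Q1 + C4 * (Q1 * D), by positivity,
    fun τ m e K d M d₀ X X' f₀ f₀' f g f' g' hτ0 hτ hm hX hcX hcX' hf hf' hd ha ha' h0 => ?_⟩
  have hder := hder τ m e K d X X' f g f' g' hτ0 hτ hX hf hf' hd
  obtain ⟨hm0, he⟩ := hX.nonneg hτ0
  have hK := hf.nonneg hτ0
  have hd0 := hd.nonneg hτ0
  have hM := h0.left.nonneg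
  have hdd := h0.diff.nonneg
  have hcI := hcX.cb_I
  have hcI' := hcX'.cb_I
  have hcu := Adm.cb_u (E := E) hcX ha
  have hcu' := Adm.cb_u (E := E) hcX' ha'
  have i1 : C1 * D ^ 2 ≤ Q1 := by
    rw [hQ1]; linarith [mul_nonneg hC2 (pow_nonneg hD0 3), mul_nonneg hC3 (pow_nonneg hD0 2)]
  have i2 : C2 * D ^ 3 ≤ Q1 := by
    rw [hQ1]; linarith [mul_nonneg hC1 (pow_nonneg hD0 2), mul_nonneg hC3 (pow_nonneg hD0 2)]
  have i3 : 2 * (C3 * D ^ 2) ≤ Q1 := by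
    rw [hQ1]; linarith [mul_nonneg hC1 (pow_nonneg hD0 2), mul_nonneg hC2 (pow_nonneg hD0 3)]
  have i3' : C3 * D ^ 2 ≤ Q1 := by linarith [mul_nonneg hC3 (pow_nonneg hD0 2)]
  have i4 : Q1 ≤ Q1 + C4 * (Q1 * D) := by linarith [mul_nonneg hC4 (mul_nonneg hQ10 hD0)]
  have i5 : C4 * (Q1 * D) ≤ Q1 + C4 * (Q1 * D) := by linarith
  have up : ∀ {x y w : ℝ}, x ≤ Q1 + C4 * (Q1 * D) → 0 ≤ y → 0 ≤ w →
      x * y * w ≤ (Q1 + C4 * (Q1 * D)) * y * w := fun _ _ _ => by gcongr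
  set U := m + K with hU
  set V := e + d with hV
  have hU0 : 0 ≤ U := by positivity
  have hV0 : 0 ≤ V := by positivity
  have hR : ∀ t, 0 < t → t ≤ τ → P.PB (2 * β)
      (dsym * P.Φ₁ X f₀ f g t - P.fpara (fU X f g t) (dsym * X.XK t))
      (dsym * P.Φ₁ X' f₀' f' g' t - P.fpara (fU X' f' g' t) (dsym * X'.XK t))
      (Q1 * (M + U * m) * t ^ (-(wR β γ))) (Q1 * (d₀ + V * m + U * e) * t ^ (-(wR β γ))) := by
    intro t ht0 ht
    have h00 : (0 : ℝ) ∈ Icc 0 τ := ⟨le_rfl, hτ0⟩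
    rw [remainder_eq hcX f₀ ht0.le ht, remainder_eq hcX' f₀' ht0.le ht]
    have hw : 0 ≤ t ^ (-(wR β γ)) := by positivity
    have hm' : m ≤ D * m := by nlinarith
    have he' : e ≤ D * e := by nlinarith
    have key : ∀ (Z : FD) (v ξ : ℝ → FD) (f₁ : FD), P.UB β γ τ (D * U) v →
        (∀ t, 0 < t → t ≤ τ → P.Bd (α - 1) (ξ t) (D * m)) → P.CB (Ioc 0 τ) β v →
        P.CB (Ioc 0 τ) (α - 1) ξ → P.Bd (γ + 1) f₁ M → P.Bd (α + 1) Z m →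
        P.Bd (2 * β) (P.rem f₁ Z v ξ t) (Q1 * (M + U * m) * t ^ (-(wR β γ))) := by
      intro Z v ξ f₁ hv hξ hcv hcξ hf₁ hZ
      have hz : ∀ {a k : ℝ}, 0 ≤ k → P.Bd a 0 k := fun hk => (Bd.zero _).mono hk
      have := hb3 τ (D * U) (D * U) (D * m) (D * m) M f₁ 0 Z 0 v (fun _ => 0) ξ (fun _ => 0) hτ hv
        (UB.zero (by positivity)) (by simpa using hv)
        (fun t h0 ht => ⟨hξ t h0 ht, hz (by positivity), by simpa using hξ t h0 ht⟩)
        hcv (cb_const (Bd.zero _)) hcξ (cb_const (Bd.zero _)) (by simpa using hf₁)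
        ⟨hZ.mono hm', hz (by positivity), by simpa using hZ.mono hm'⟩ t ht0 ht
      rw [rem_zero, sub_zero] at this
      refine this.mono (mul_le_mul_of_nonneg_right ?_ hw)
      calc C3 * (M + D * U * (D * m) + D * U * (D * m))
          = C3 * 1 * M + 2 * (C3 * D ^ 2) * (U * m) := by ring
        _ ≤ C3 * D ^ 2 * M + 2 * (C3 * D ^ 2) * (U * m) := by gcongr
        _ ≤ Q1 * M + Q1 * (U * m) := by gcongr
        _ = Q1 * (M + U * m) := by ring
    refine ⟨key _ _ _ _ hder.ul (fun t h0 ht => (hder.dI t h0 ht).left) hcu hcI h0.left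
      (hX.XK 0 h00).left, key _ _ _ _ hder.ur (fun t h0 ht => (hder.dI t h0 ht).right) hcu' hcI'
      h0.right (hX.XK 0 h00).right, ?_⟩
    refine (hb3 τ (D * U) (D * V) (D * m) (D * e) d₀ f₀ f₀' _ _ _ _ _ _ hτ hder.ul hder.ur hder.ud
      hder.dI hcu hcu' hcI hcI' h0.diff ((hX.XK 0 h00).mono hm' he') t ht0 ht).mono
      (mul_le_mul_of_nonneg_right ?_ hw)
    calc C3 * (d₀ + D * V * (D * m) + D * U * (D * e))
        = C3 * 1 * d₀ + C3 * D ^ 2 * (V * m + U * e) := by ring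
      _ ≤ C3 * D ^ 2 * d₀ + C3 * D ^ 2 * (V * m + U * e) := by gcongr
      _ ≤ Q1 * d₀ + Q1 * (V * m + U * e) := by gcongr
      _ = _ := by ring
  refine ⟨fun t ht0 ht => ?_, fun t ht0 ht => ?_, fun t ht0 ht => (hR t ht0 ht).mono ?_ ?_,
    fun t ht0 ht => ?_⟩
  · have hw : 0 ≤ t ^ (-((β - γ) / 2)) := by positivity
    refine (hb1.pb (⟨hder.ul.low t ht0 ht, hder.ur.low t ht0 ht, hder.ud.low t ht0 ht⟩ :
      P.PB _ _ _ _ _) (hder.dI t ht0 ht)).mono ?_ ?_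
    · calc _ = C1 * D ^ 2 * (U * m) * t ^ (-((β - γ) / 2)) := by ring
        _ ≤ _ := up (i1.trans i4) (by positivity) hw
    · calc _ = C1 * D ^ 2 * (V * m + U * e) * t ^ (-((β - γ) / 2)) := by ring
        _ ≤ _ := up (i1.trans i4) (by positivity) hw
  · have hw : 0 ≤ t ^ (-(β - γ)) := by positivity
    have hI : t ∈ Icc 0 τ := ⟨ht0.le, ht⟩
    have hm' : m ≤ D * m := by nlinarith
    have he' : e ≤ D * e := by nlinarith
    have hKU : K ≤ U := by linarith
    have hdV : d ≤ V := by linarith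
    refine (hb2 t (D * m) (D * e) (D * U) (D * V) _ _ _ _ _ _ _ _ _ _ _ _ _ _ _ _ ht0
      (ht.trans hτ) (by nlinarith) (by positivity) (by positivity) ((hX.XD t hI).mono hm' he')
      ((hX.XC t hI).mono hm' he') (hder.dK t ht0 ht) (hder.dI t ht0 ht)
      ((hder.dg t ht0 ht).mono (by gcongr) (by gcongr)) ((hX.XB t hI).mono hm' he')
      (hder.dY t ht0 ht) ⟨hder.ul.reg t ht0 ht, hder.ur.reg t ht0 ht, hder.ud.reg t ht0 ht⟩
      ⟨hder.ul.low t ht0 ht, hder.ur.low t ht0 ht, hder.ud.low t ht0 ht⟩).mono ?_ ?_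
    · rw [← mul_assoc]
      refine mul_le_mul_of_nonneg_right ?_ hw
      calc C2 * (D * m + D * U * (D * m) ^ 2 + (D * U) ^ 2)
          = C2 * (D * m + D ^ 3 * (U * m ^ 2) + D ^ 2 * U ^ 2) := by ring
        _ ≤ C2 * (D ^ 3 * m + D ^ 3 * (U * m ^ 2) + D ^ 3 * U ^ 2) := by gcongr; linarith
        _ = C2 * D ^ 3 * (m + U * m ^ 2 + U ^ 2) := by ring
        _ ≤ _ := mul_le_mul_of_nonneg_right (i2.trans i4) (by positivity)
    · rw [← mul_assoc]
      refine mul_le_mul_of_nonneg_right ?_ hw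
      calc C2 * (D * e + D * V * (D * m) ^ 2 + D * U * (D * m) * (D * e) + D * V * (D * U))
          = C2 * (D * e + D ^ 3 * (V * m ^ 2) + D ^ 3 * (U * m * e) + D ^ 2 * (V * U)) := by ring
        _ ≤ C2 * (D ^ 3 * e + D ^ 3 * (V * m ^ 2) + D ^ 3 * (U * m * e) + D ^ 3 * (V * U)) := by
            gcongr; linarith
        _ = C2 * D ^ 3 * (e + V * m ^ 2 + U * m * e + V * U) := by ring
        _ ≤ _ := mul_le_mul_of_nonneg_right (i2.trans i4) (by positivity)
  · exact up i4 (by positivity) (by positivity)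
  · exact up i4 (by positivity) (by positivity)
  · have hw : 0 ≤ t ^ (-(wR β γ)) := by positivity
    refine (hb4.pb (hR t ht0 ht) (hder.dI t ht0 ht)).mono ?_ ?_
    · calc _ = C4 * (Q1 * D) * ((M + U * m) * m) * t ^ (-(wR β γ)) := by ring
        _ ≤ _ := up i5 (by positivity) hw
    · calc _ = C4 * (Q1 * D) * ((d₀ + V * m + U * e) * m + (M + U * m) * e)
            * t ^ (-(wR β γ)) := by ring
        _ ≤ _ := up i5 (by positivity) hw

lemma wR_nonneg (E : Exps α β γ) : 0 ≤ wR β γ :=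
  le_min (by linarith [E.hβ, E.hγβ]) (by linarith [E.hβ])

lemma wR_lt_one (E : Exps α β γ) : wR β γ < 1 :=
  (min_le_right _ _).trans_lt (by linarith [E.hβα, E.hα])

lemma PB.refl {a K : ℝ} {u : FD} (h : P.Bd a u K) : P.PB a u u K 0 :=
  ⟨h, h, by rw [sub_self]; exact Bd.zero _⟩

lemma WL.zero {τ η a K : ℝ} (hK : 0 ≤ K) : P.WL τ η a K (fun _ => 0) where
  sup t h0 _ := (Bd.zero _).mono (by positivity)
  low t h0 _ := (Bd.zero _).mono hK
  hol s t hs hst _ := by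
    have : 0 < t - s := by linarith
    rw [sub_self]; exact (Bd.zero _).mono (by positivity)

lemma SB.sub_self {τ : ℝ} (f g : ℝ → FD) :
    P.SB β γ τ 0 (fun t => f t - f t) (fun t => g t - g t) := by
  simp only [_root_.sub_self]
  exact ⟨WL.zero le_rfl, WL.zero le_rfl⟩

variable (P α β γ) in
/-- Integrability of the three sources. -/
structure SrcC (τ : ℝ) (X : FDriv) (f₀ : FD) (f g : ℝ → FD) : Prop where
  F : ∀ k, ContinuousOn (fun r => P.fF X f g r k) (Ioc 0 τ)
  G₁ : ∀ k, ContinuousOn (fun r => P.fG₁ X f g r k) (Ioc 0 τ)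
  G₂ : ∀ k, ContinuousOn (fun r => P.fG₂ X (P.Φ₁ X f₀ f g) f g r k) (Ioc 0 τ)
  iF : ∀ t, 0 ≤ t → t ≤ τ → ∀ k,
    IntervalIntegrable (fun r => heat (t - r) k * P.fF X f g r k) volume 0 t
  iG₁ : ∀ t, 0 ≤ t → t ≤ τ → ∀ k,
    IntervalIntegrable (fun r => heat (t - r) k * P.fG₁ X f g r k) volume 0 t
  iG₂ : ∀ t, 0 ≤ t → t ≤ τ → ∀ k,
    IntervalIntegrable (fun r => heat (t - r) k * P.fG₂ X (P.Φ₁ X f₀ f g) f g r k) volume 0 t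

lemma srcC_of_bd (E : Exps α β γ) {T τ K L R A B C M : ℝ} {X : FDriv} {f g : ℝ → FD} {f₀ : FD}
    (hT : 0 ≤ T) (hτ0 : 0 ≤ τ) (hτ : τ ≤ T) (hX : P.DrC α τ X) (h : P.Adm β τ f g)
    (hu : P.UB β γ τ K (fU X f g)) (hK : 0 ≤ K) (hL : 0 ≤ L)
    (hξ : ∀ t, 0 < t → t ≤ τ → P.Bd (α - 1) (dsym * X.XI t) L) (hf : P.Bd (γ + 1) f₀ M)
    (hR : ∀ t, 0 < t → t ≤ τ → P.Bd (2 * β) (dsym * P.Φ₁ X f₀ f g t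
      - P.fpara (fU X f g t) (dsym * X.XK t)) (R * t ^ (-(wR β γ))))
    (hA : ∀ t, 0 < t → t ≤ τ → P.Bd (α - 1) (P.fF X f g t) (A * t ^ (-((β - γ) / 2))))
    (hB : ∀ t, 0 < t → t ≤ τ → P.Bd (α + β - 1) (P.fG₁ X f g t) (B * t ^ (-(β - γ))))
    (hC : ∀ t, 0 < t → t ≤ τ → P.Bd (2 * β + (α - 1)) (P.fG₂ X (P.Φ₁ X f₀ f g) f g t)
      (C * t ^ (-(wR β γ)))) (hA0 : 0 ≤ A) (hB0 : 0 ≤ B) (hC0 : 0 ≤ C) :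
    P.SrcC τ X f₀ f g := by
  have cF := (cb_F E hX h).continuousOn_coef
  have c1 := (cb_G₁ E hX h).continuousOn_coef
  obtain ⟨b, c2⟩ := cb_G₂ E hT hτ0 hτ hX h hu hK hL hξ hf (wR_nonneg E) hR
  have c2 := c2.continuousOn_coef
  have hw0 := wR_nonneg E
  have hw1 := wR_lt_one E
  obtain ⟨h1, h2, h3, h4, h5⟩ := id E
  refine ⟨cF, c1, c2, fun t ht0 ht k => ?_, fun t ht0 ht k => ?_, fun t ht0 ht k => ?_⟩
  all_goals
    rcases ht0.eq_or_lt with h0 | h0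
    · rw [← h0]
  · exact duh_integrable hT (by linarith) (by linarith) hA0 hτ cF hA h0 ht k
  · exact duh_integrable hT (by linarith) (by linarith) hB0 hτ c1 hB h0 ht k
  · exact duh_integrable hT hw0 hw1 hC0 hτ c2 hC h0 ht k

lemma exists_srcBC (P : DyadicPartition) (E : Exps α β γ) {T : ℝ} (hT : 0 ≤ T) :
    ∃ Q : ℝ, 0 ≤ Q ∧ ∀ (τ m e K d M d₀ : ℝ) (X X' : FDriv) (f₀ f₀' : FD) (f g f' g' : ℝ → FD),
      0 ≤ τ → τ ≤ T → 1 ≤ m → P.DrP α τ m e X X' → P.DrC α τ X → P.DrC α τ X' →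
      P.SB β γ τ K f g → P.SB β γ τ K f' g' →
      P.SB β γ τ d (fun t => f t - f' t) (fun t => g t - g' t) → P.Adm β τ f g → P.Adm β τ f' g' →
      P.PB (γ + 1) f₀ f₀' M d₀ → P.SrcB α β γ Q τ m e K d M d₀ X X' f₀ f₀' f g f' g' ∧
        P.SrcC τ X f₀ f g ∧ P.SrcC τ X' f₀' f' g' := by
  obtain ⟨D, hD, hder⟩ := P.exists_der E hT
  obtain ⟨Q, hQ, hs⟩ := P.exists_srcB E hT
  refine ⟨Q, hQ, fun τ m e K d M d₀ X X' f₀ f₀' f g f' g' hτ0 hτ hm hX hcX hcX' hf hf' hd ha ha' h0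
    => ?_⟩
  have s := hs τ m e K d M d₀ X X' f₀ f₀' f g f' g' hτ0 hτ hm hX hcX hcX' hf hf' hd ha ha' h0
  have r := hder τ m e K d X X' f g f' g' hτ0 hτ hX hf hf' hd
  obtain ⟨hm0, he⟩ := hX.nonneg hτ0
  have hK := hf.nonneg hτ0
  have hM := h0.left.nonneg
  refine ⟨s, srcC_of_bd E hT hτ0 hτ hcX ha r.ul (by positivity) (by positivity)
    (fun t h0 ht => (r.dI t h0 ht).left) h0.left (fun t h0 ht => (s.R t h0 ht).left)
    (fun t h0 ht => (s.F t h0 ht).left) (fun t h0 ht => (s.G₁ t h0 ht).left)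
    (fun t h0 ht => (s.G₂ t h0 ht).left) (by positivity) (by positivity) (by positivity),
    srcC_of_bd E hT hτ0 hτ hcX' ha' r.ur (by positivity) (by positivity)
    (fun t h0 ht => (r.dI t h0 ht).right) h0.right (fun t h0 ht => (s.R t h0 ht).right)
    (fun t h0 ht => (s.F t h0 ht).right) (fun t h0 ht => (s.G₁ t h0 ht).right)
    (fun t h0 ht => (s.G₂ t h0 ht).right) (by positivity) (by positivity) (by positivity)⟩

lemma duh_add {F F' : ℝ → FD} {t : ℝ}
    (h : ∀ k, IntervalIntegrable (fun r => heat (t - r) k * F r k) volume 0 t)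
    (h' : ∀ k, IntervalIntegrable (fun r => heat (t - r) k * F' r k) volume 0 t) :
    duh (fun r => F r + F' r) t = duh F t + duh F' t := by
  ext k
  rw [Pi.add_apply, duh, duh, duh, ← intervalIntegral.integral_add (h k) (h' k)]
  simp only [Pi.add_apply, mul_add]

lemma SrcC.Φ₂_eq {τ t : ℝ} {X : FDriv} {f₀ g₀ : FD} {f g : ℝ → FD} (h : P.SrcC τ X f₀ f g)
    (h0 : 0 ≤ t) (ht : t ≤ τ) : P.Φ₂ X f₀ g₀ f g t
      = heat t * g₀ + (duh (P.fG₁ X f g) t + duh (P.fG₂ X (P.Φ₁ X f₀ f g) f g) t) := by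
  rw [Φ₂, ← duh_add (h.iG₁ t h0 ht) (h.iG₂ t h0 ht)]

/-- The exponent with respect to which the resonant product with the remainder is estimated. -/
lemma exists_sigma (E : Exps α β γ) : ∃ σ θ : ℝ, σ ≤ 2 * β + (α - 1) ∧ σ + 2 * θ = 2 * β + 1 ∧
    1 / 4 ≤ θ ∧ θ < 1 ∧ β - γ ≤ θ ∧ β - γ ≤ wR β γ ∧ 1 - θ - wR β γ + (β - γ) = (α - β) / 2 := by
  obtain ⟨h1, h2, h3, h4, h5⟩ := E
  have w1 : wR β γ ≤ 3 * β / 2 - γ := min_le_left _ _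
  have w2 : wR β γ ≤ 2 * β := min_le_right _ _
  have w3 : β - γ ≤ wR β γ := le_min (by linarith) (by linarith)
  have w4 : β - γ < wR β γ + (α - β) / 2 := by
    have : β - γ - (α - β) / 2 < wR β γ := lt_min (by linarith) (by linarith)
    linarith
  exact ⟨α - β - 1 + 2 * wR β γ + 2 * γ, 1 + β - (α - β) / 2 - wR β γ - γ, by linarith,
    by ring, by linarith, by linarith, by linarith, w3, by ring⟩

set_option maxHeartbeats 1000000 in
/-- The fixed point map is Lipschitz, with a small constant on short time intervals. -/
lemma exists_diff (P : DyadicPartition) (E : Exps α β γ) {T : ℝ} (hT : 0 ≤ T) :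
    ∃ C₀ : ℝ, 0 ≤ C₀ ∧ ∀ A : ℝ, 0 ≤ A → ∃ Q : ℝ, 0 ≤ Q ∧
    ∀ (τ t₀ m M e d d₀ : ℝ) (X X' : FDriv) (f₀ f₀' g₀ g₀' : FD) (f g f' g' : ℝ → FD),
      0 ≤ t₀ → t₀ ≤ τ → τ ≤ T → 1 ≤ m → m ^ 3 ≤ M → P.DrP α τ m e X X' → P.DrC α τ X →
      P.DrC α τ X' → P.SB β γ τ (A * M) f g → P.SB β γ τ (A * M) f' g' →
      P.SB β γ τ d (fun t => f t - f' t) (fun t => g t - g' t) → P.Adm β τ f g → P.Adm β τ f' g' →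
      P.PB (γ + 1) f₀ f₀' M d₀ → P.PB (2 * γ + 1) g₀ g₀' M d₀ →
      (∀ r, 0 < r → r ≤ t₀ → P.fF X f g r = P.fF X' f' g' r ∧ P.fG₁ X f g r = P.fG₁ X' f' g' r ∧
        P.fG₂ X (P.Φ₁ X f₀ f g) f g r = P.fG₂ X' (P.Φ₁ X' f₀' f' g') f' g' r) →
      P.SB β γ τ (C₀ * d₀ + Q * (τ - t₀) ^ ((α - β) / 2) * M * (d₀ + d + m * e))
        (fun t => P.Φ₁ X f₀ f g t - P.Φ₁ X' f₀' f' g' t)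
        (fun t => P.Φ₂ X f₀ g₀ f g t - P.Φ₂ X' f₀' g₀' f' g' t) := by
  obtain ⟨Q, hQ, hs⟩ := P.exists_srcBC E hT
  obtain ⟨σ, θ, hσ, hσθ, hθ4, hθ1, hθη, hηw, hθκ⟩ := exists_sigma E
  have hw1 := wR_lt_one E
  obtain ⟨h1, h2, h3, h4, h5⟩ := id E
  obtain ⟨Cf, hCf, hhf⟩ := P.exists_wl_heat hT (β + 1) (η := (β - γ) / 2) (by linarith)
    (by linarith)
  obtain ⟨Cg, hCg, hhg⟩ := P.exists_wl_heat hT (2 * β + 1) (η := β - γ) (by linarith) (by linarith)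
  obtain ⟨S1, hS1, hd1⟩ := P.exists_wl_duh hT (α - 1) (θ := 1 - (α - β) / 2) (w := (β - γ) / 2)
    (η := (β - γ) / 2) (by linarith) (by linarith) (by linarith) (by linarith) le_rfl (by linarith)
    (by linarith)
  obtain ⟨S2, hS2, hd2⟩ := P.exists_wl_duh hT (α + β - 1) (θ := 1 - (α - β) / 2) (w := β - γ)
    (η := β - γ) (by linarith) (by linarith) (by linarith) (by linarith) le_rfl (by linarith)
    (by linarith)
  obtain ⟨S3, hS3, hd3⟩ := P.exists_wl_duh hT σ (θ := θ) (w := wR β γ)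
    (η := β - γ) hθ4 hθ1 (by linarith) hθη hηw hw1 (by linarith)
  refine ⟨Cf + Cg, by positivity, fun A hA => ⟨(S1 * (2 + A) + S2 * (5 + 2 * A) + S3 * (5 + 2 * A)) * Q,
    by positivity, ?_⟩⟩
  intro τ t₀ m M e d d₀ X X' f₀ f₀' g₀ g₀' f g f' g' ht0 htτ hτ hm hM hX hcX hcX' hf hf' hd ha ha'
    hf0 hg0 hz
  have hτ0 : 0 ≤ τ := ht0.trans htτ
  obtain ⟨s, c, c'⟩ := hs τ m e (A * M) d M d₀ X X' f₀ f₀' f g f' g' hτ0 hτ hm hX hcX hcX' hf hf'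
    hd ha ha' hf0
  obtain ⟨hm0, he⟩ := hX.nonneg hτ0
  have hd0 := hd.nonneg hτ0
  have hM0 := hf0.left.nonneg
  have hdd := hf0.diff.nonneg
  set x := (τ - t₀) ^ ((α - β) / 2) with hx
  have hx0 : 0 ≤ x := Real.rpow_nonneg (by linarith) _
  have hmM : m ≤ M := le_trans (by nlinarith [sq_nonneg m]) hM
  have hm2M : m ^ 2 ≤ M := le_trans (by nlinarith [sq_nonneg m]) hM
  have hme : 0 ≤ m * e := by positivity
  have heme : e ≤ m * e := le_mul_of_one_le_left he hm
  have k1 : m * (m * e) ≤ M * (m * e) := by gcongr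
  have k2 : m * d ≤ M * d := by gcongr
  have k3 : m ^ 2 * d ≤ M * d := by gcongr
  have k4 : m * e ≤ M * (m * e) := by nlinarith
  have k5 : e ≤ M * (m * e) := by linarith
  have k6 : m ^ 2 * e ≤ M * (m * e) := by nlinarith
  have k7 : A * M * e ≤ A * (M * (m * e)) := by rw [mul_assoc]; gcongr
  have k8 : m * d₀ ≤ M * d₀ := by gcongr
  have k9 : M * e ≤ M * (m * e) := by gcongr
  have kd : 0 ≤ M * d := by positivity
  have kd0 : 0 ≤ M * d₀ := by positivity
  have kme : 0 ≤ M * (m * e) := by positivity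
  have kAd : 0 ≤ A * (M * d) := by positivity
  have kAd0 : 0 ≤ A * (M * d₀) := by positivity
  have kAme : 0 ≤ A * (M * (m * e)) := by positivity
  set Y := M * (d₀ + d + m * e) with hY
  have hY0 : 0 ≤ Y := by positivity
  have nF : Q * ((e + d) * m + (m + A * M) * e) ≤ Q * ((2 + A) * Y) := by
    gcongr
    have : (2 + A) * Y = 2 * (M * d₀) + 2 * (M * d) + 2 * (M * (m * e)) + A * (M * d₀)
      + A * (M * d) + A * (M * (m * e)) := by rw [hY]; ring
    rw [this]
    linarith
  have eY : (5 + 2 * A) * Y = 5 * (M * d₀) + 5 * (M * d) + 5 * (M * (m * e)) + 2 * (A * (M * d₀))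
      + 2 * (A * (M * d)) + 2 * (A * (M * (m * e))) := by rw [hY]; ring
  have nG1 : Q * (e + (e + d) * m ^ 2 + (m + A * M) * m * e + (e + d) * (m + A * M))
      ≤ Q * ((5 + 2 * A) * Y) := by
    gcongr
    rw [eY]
    linarith
  have nG2 : Q * ((d₀ + (e + d) * m + (m + A * M) * e) * m + (M + (m + A * M) * m) * e)
      ≤ Q * ((5 + 2 * A) * Y) := by
    gcongr
    rw [eY]
    linarith
  have wF := hd1 (fun r => P.fF X f g r - P.fF X' f' g' r) _ τ t₀
    (by positivity : 0 ≤ Q * ((2 + A) * Y)) ht0 htτ hτ (fun k => (c.F k).sub (c'.F k))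
    (fun r hr0 hr => (s.F r hr0 hr).diff.mono
      (mul_le_mul_of_nonneg_right nF (Real.rpow_nonneg hr0.le _)))
    (fun r hr0 hr => sub_eq_zero.2 (hz r hr0 hr).1)
  have wG1 := hd2 (fun r => P.fG₁ X f g r - P.fG₁ X' f' g' r) _ τ t₀
    (by positivity : 0 ≤ Q * ((5 + 2 * A) * Y)) ht0 htτ hτ (fun k => (c.G₁ k).sub (c'.G₁ k))
    (fun r hr0 hr => (s.G₁ r hr0 hr).diff.mono
      (mul_le_mul_of_nonneg_right nG1 (Real.rpow_nonneg hr0.le _)))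
    (fun r hr0 hr => sub_eq_zero.2 (hz r hr0 hr).2.1)
  have wG2 := hd3 (fun r => P.fG₂ X (P.Φ₁ X f₀ f g) f g r
    - P.fG₂ X' (P.Φ₁ X' f₀' f' g') f' g' r) _ τ t₀
    (by positivity : 0 ≤ Q * ((5 + 2 * A) * Y)) ht0 htτ hτ (fun k => (c.G₂ k).sub (c'.G₂ k))
    (fun r hr0 hr => ((s.G₂ r hr0 hr).diff.exp_mono hσ).mono
      (mul_le_mul_of_nonneg_right nG2 (Real.rpow_nonneg hr0.le _)))
    (fun r hr0 hr => sub_eq_zero.2 (hz r hr0 hr).2.2)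
  rw [show α - 1 + 2 * (1 - (α - β) / 2) = β + 1 by ring,
    show 1 - (1 - (α - β) / 2) - (β - γ) / 2 + (β - γ) / 2 = (α - β) / 2 by ring, ← hx] at wF
  rw [show α + β - 1 + 2 * (1 - (α - β) / 2) = 2 * β + 1 by ring,
    show 1 - (1 - (α - β) / 2) - (β - γ) + (β - γ) = (α - β) / 2 by ring, ← hx] at wG1
  rw [hσθ, hθκ, ← hx] at wG2
  have wf0 := (hhf _ d₀ (by
    rw [show β + 1 - 2 * ((β - γ) / 2) = γ + 1 by ring]; exact hf0.diff)).time_mono hτ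
  have wg0 := (hhg _ d₀ (by
    rw [show 2 * β + 1 - 2 * (β - γ) = 2 * γ + 1 by ring]; exact hg0.diff)).time_mono hτ
  have n1 : 0 ≤ S1 * (2 + A) * Q * x * Y := by positivity
  have n2 : 0 ≤ S2 * (5 + 2 * A) * Q * x * Y := by positivity
  have n3 : 0 ≤ S3 * (5 + 2 * A) * Q * x * Y := by positivity
  have n4 : 0 ≤ Cf * d₀ := by positivity
  have n5 : 0 ≤ Cg * d₀ := by positivity
  have eT : (Cf + Cg) * d₀ + (S1 * (2 + A) + S2 * (5 + 2 * A) + S3 * (5 + 2 * A)) * Q * x * M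
      * (d₀ + d + m * e) = Cf * d₀ + Cg * d₀ + S1 * (2 + A) * Q * x * Y
        + S2 * (5 + 2 * A) * Q * x * Y + S3 * (5 + 2 * A) * Q * x * Y := by rw [hY]; ring
  refine ⟨((wf0.add wF).mono ?_).congr fun t h0 ht => ?_,
    (((wg0.add wG1).add wG2).mono ?_).congr fun t h0 ht => ?_⟩
  · rw [eT]; linarith
  · rw [duh_sub (c.iF t h0 ht) (c'.iF t h0 ht), Φ₁, Φ₁]; ring
  · rw [eT]; linarith
  · rw [duh_sub (c.iG₁ t h0 ht) (c'.iG₁ t h0 ht), duh_sub (c.iG₂ t h0 ht) (c'.iG₂ t h0 ht),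
      c.Φ₂_eq h0 ht, c'.Φ₂_eq h0 ht]
    ring

lemma DrP.self {τ m e : ℝ} {X X' : FDriv} (h : P.DrP α τ m e X X') : P.DrP α τ m 0 X X where
  XI t ht := .refl (h.XI t ht).left
  XY t ht := .refl (h.XY t ht).left
  XW t ht := .refl (h.XW t ht).left
  XWh s t hs hst ht := by rw [zero_mul]; exact .refl (h.XWh s t hs hst ht).left
  XB t ht := .refl (h.XB t ht).left
  XD t ht := .refl (h.XD t ht).left
  XK t ht := .refl (h.XK t ht).left
  XC t ht := .refl (h.XC t ht).left

/-- The fixed point map preserves continuity. -/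
lemma adm_Φ (E : Exps α β γ) {T τ m K M : ℝ} {X : FDriv} {f₀ g₀ : FD} {f g : ℝ → FD} (hT : 0 ≤ T)
    (hτ0 : 0 ≤ τ) (hτ : τ ≤ T) (hm : 1 ≤ m) (hX : P.DrP α τ m 0 X X) (hcX : P.DrC α τ X)
    (hf : P.SB β γ τ K f g) (ha : P.Adm β τ f g) (hf0 : P.Bd (γ + 1) f₀ M)
    (hg0 : P.Bd (2 * γ + 1) g₀ M) :
    P.Adm β τ (P.Φ₁ X f₀ f g) (P.Φ₂ X f₀ g₀ f g) ∧ P.SrcC τ X f₀ f g ∧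
    (P.Lit (γ + 1) f₀ → P.CB (Icc 0 τ) (γ + 1) (P.Φ₁ X f₀ f g)) ∧
    (P.Lit (2 * γ + 1) g₀ → P.CB (Icc 0 τ) (2 * γ + 1) (P.Φ₂ X f₀ g₀ f g)) := by
  obtain ⟨Q, hQ, hs⟩ := P.exists_srcBC E hT
  obtain ⟨s, c, -⟩ := hs τ m 0 K 0 M 0 X X f₀ f₀ f g f g hτ0 hτ hm hX hcX hcX hf hf
    (SB.sub_self f g) ha ha (.refl hf0)
  obtain ⟨σ, θ, hσ, hσθ, hθ4, hθ1, hθη, hηw, hθκ⟩ := exists_sigma E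
  have hw1 := wR_lt_one E
  have hw0 := wR_nonneg E
  obtain ⟨h1, h2, h3, h4, h5⟩ := id E
  have hK := hf.nonneg hτ0
  have hM := hf0.nonneg
  have hm0 : 0 ≤ m := by linarith
  have bF := fun t h0 ht => (s.F t h0 ht).left
  have b1 := fun t h0 ht => (s.G₁ t h0 ht).left
  have b2 := fun t h0 ht => (s.G₂ t h0 ht).left
  have n1 : 0 ≤ Q * ((m + K) * m) := by positivity
  have n2 : 0 ≤ Q * (m + (m + K) * m ^ 2 + (m + K) ^ 2) := by positivity
  have n3 : 0 ≤ Q * ((M + (m + K) * m) * m) := by positivity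
  refine ⟨⟨?_, ?_⟩, c, fun hl => ?_, fun hl => ?_⟩
  · exact (cb_heat hτ0 hf0 (by linarith)).add
      (cb_duh hT (by linarith) (by linarith) (by linarith) n1 hτ0 hτ c.F bF)
  · exact ((cb_heat hτ0 hg0 (by linarith)).add
      ((cb_duh hT (by linarith) (by linarith) (by linarith) n2 hτ0 hτ c.G₁ b1).add
      (cb_duh hT hw0 hw1 (by linarith) n3 hτ0 hτ c.G₂ b2))).congr
        fun t ht => c.Φ₂_eq ht.1.le ht.2
  · have d1 := cb_duh_zero hT (σ := α - 1) (θ := 1 - (α - β) / 2) (w := (β - γ) / 2)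
      (η := (β - γ) / 2) (by linarith) (by linarith) (by linarith) (by linarith) le_rfl
      (by linarith) (by linarith) n1 hτ0 hτ c.F bF
    rw [show α - 1 + 2 * (1 - (α - β) / 2) - 2 * ((β - γ) / 2) = γ + 1 by ring] at d1
    exact (cb_heat_zero hτ0 hl).add d1
  · have d1 := cb_duh_zero hT (σ := α + β - 1) (θ := 1 - (α - β) / 2) (w := β - γ)
      (η := β - γ) (by linarith) (by linarith) (by linarith) (by linarith) le_rfl
      (by linarith) (by linarith) n2 hτ0 hτ c.G₁ b1
    rw [show α + β - 1 + 2 * (1 - (α - β) / 2) - 2 * (β - γ) = 2 * γ + 1 by ring] at d1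
    have d2 := cb_duh_zero hT (σ := σ) (θ := θ) (w := wR β γ)
      (η := β - γ) hθ4 hθ1 (by linarith) hθη hηw hw1 (by linarith) n3 hτ0 hτ c.G₂
      (fun t h0 ht => (b2 t h0 ht).exp_mono hσ)
    rw [show σ + 2 * θ - 2 * (β - γ) = 2 * γ + 1 by rw [hσθ]; ring] at d2
    exact ((cb_heat_zero hτ0 hl).add (d1.add d2)).congr fun t ht => c.Φ₂_eq ht.1 ht.2

/-! ### The zero system -/

lemma fres_zero_left (v : FD) : P.fres 0 v = 0 := by
  have : P.resT 0 v = 0 := by funext m; cases m <;> simp [resT]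
  ext k; simp [fres, this, ser]

lemma fmul_zero_left (v : FD) : P.fmul 0 v = 0 := by simp [fmul, fres_zero_left]

lemma fcomm_zero : P.fcomm 0 0 0 = 0 := by
  refine eq_zero_of_bd (P := P) (a := 1 / 2) fun ε hε => ?_
  obtain ⟨C, hC, h⟩ := P.exists_bd_fcomm (a := 3 / 4) (b := 0) (c := -(1 / 4)) (by norm_num)
    (by norm_num) (by norm_num)
  have := h 0 0 0 0 0 0 (Bd.zero _) (Bd.zero _) (Bd.zero _)
  rw [show (3 / 4 + 0 + -(1 / 4) : ℝ) = 1 / 2 by norm_num] at this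
  exact this.mono (by simpa using hε.le)

lemma src_zero : P.src 0 0 0 0 0 0 0 0 = 0 := by
  simp [src, fmul_zero_left, fcomm_zero, fres_zero_left]

lemma duh_zero_fun (t : ℝ) : duh 0 t = 0 := by ext k; simp [duh]

lemma fU_zero : fU FDriv.zero 0 0 = 0 := by ext t; simp [fU, FDriv.zero]

lemma fF_zero : P.fF FDriv.zero 0 0 = 0 := by ext t; simp [fF, fU_zero]

lemma Φ₁_zero : P.Φ₁ FDriv.zero 0 0 0 = 0 := by ext t; simp [Φ₁, fF_zero, duh_zero_fun]

lemma fG₁_zero : P.fG₁ FDriv.zero 0 0 = 0 := by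
  funext t
  rw [fG₁, fU_zero]
  simp [FDriv.zero, src_zero]

lemma fG₂_zero : P.fG₂ FDriv.zero 0 0 0 = 0 := by
  funext t
  simp [fG₂, fU_zero, fres_zero_left]

lemma Φ₂_zero : P.Φ₂ FDriv.zero 0 0 0 0 = 0 := by
  funext t
  have : (fun r => P.fG₁ FDriv.zero 0 0 r + P.fG₂ FDriv.zero (P.Φ₁ FDriv.zero 0 0 0) 0 0 r)
      = (0 : ℝ → FD) := by rw [Φ₁_zero, fG₁_zero, fG₂_zero]; funext r; simp
  rw [Φ₂, this, duh_zero_fun]; simp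

lemma drC_zero {τ : ℝ} : P.DrC α τ FDriv.zero where
  XI := cb_const (Bd.zero _)
  XY := cb_const (Bd.zero _)
  XW := cb_const (Bd.zero _)
  XB := cb_const (Bd.zero _)
  XD := cb_const (Bd.zero _)
  XK := cb_const (Bd.zero _)
  XC := cb_const (Bd.zero _)
  mild t _ := by
    have : (fun r => dsym * FDriv.zero.XI r) = 0 := by funext r; simp [FDriv.zero]
    rw [this, duh_zero_fun]; simp [FDriv.zero]

lemma PB.zero_right {a K : ℝ} {u : FD} (h : P.Bd a u K) : P.PB a u 0 K K :=
  ⟨h, (Bd.zero _).mono h.nonneg, by rwa [sub_zero]⟩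

lemma DrP.zero_right {τ m e : ℝ} {X X' : FDriv} (h : P.DrP α τ m e X X') :
    P.DrP α τ m m X FDriv.zero where
  XI t ht := .zero_right (h.XI t ht).left
  XY t ht := .zero_right (h.XY t ht).left
  XW t ht := .zero_right (h.XW t ht).left
  XWh s t hs hst ht := by
    have := PB.zero_right (h.XWh s t hs hst ht).left
    simpa [FDriv.zero] using this
  XB t ht := .zero_right (h.XB t ht).left
  XD t ht := .zero_right (h.XD t ht).left
  XK t ht := .zero_right (h.XK t ht).left
  XC t ht := .zero_right (h.XC t ht).left

lemma SB.zero {τ K : ℝ} (hK : 0 ≤ K) : P.SB β γ τ K 0 0 := ⟨WL.zero hK, WL.zero hK⟩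

lemma Adm.zero {τ : ℝ} : P.Adm β τ 0 0 := ⟨cb_const (Bd.zero _), cb_const (Bd.zero _)⟩

lemma SB.mono {τ K L : ℝ} {f g : ℝ → FD} (h : P.SB β γ τ K f g) (hKL : K ≤ L) :
    P.SB β γ τ L f g := ⟨h.wf.mono hKL, h.wg.mono hKL⟩

lemma SB.add {τ K L : ℝ} {f g f' g' : ℝ → FD} (h : P.SB β γ τ K f g) (h' : P.SB β γ τ L f' g') :
    P.SB β γ τ (K + L) (fun t => f t + f' t) (fun t => g t + g' t) :=
  ⟨h.wf.add h'.wf, h.wg.add h'.wg⟩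

lemma SB.congr {τ K : ℝ} {f g f' g' : ℝ → FD} (h : P.SB β γ τ K f g)
    (hf : ∀ t, 0 ≤ t → t ≤ τ → f' t = f t ∧ g' t = g t) : P.SB β γ τ K f' g' :=
  ⟨h.wf.congr fun t h0 ht => (hf t h0 ht).1, h.wg.congr fun t h0 ht => (hf t h0 ht).2⟩

lemma SB.time_mono {τ τ' K : ℝ} {f g : ℝ → FD} (h : P.SB β γ τ K f g) (hτ : τ' ≤ τ) :
    P.SB β γ τ' K f g := ⟨h.wf.time_mono hτ, h.wg.time_mono hτ⟩

lemma WL.neg {τ η a K : ℝ} {f : ℝ → FD} (h : P.WL τ η a K f) : P.WL τ η a K (fun t => -f t) where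
  sup t h0 ht := (h.sup t h0 ht).neg
  low t h0 ht := (h.low t h0 ht).neg
  hol s t hs hst ht := by
    rw [show -f t - -f s = -(f t - f s) by abel]; exact (h.hol s t hs hst ht).neg

lemma SB.sub {τ K L : ℝ} {f g f' g' : ℝ → FD} (h : P.SB β γ τ K f g) (h' : P.SB β γ τ L f' g') :
    P.SB β γ τ (K + L) (fun t => f t - f' t) (fun t => g t - g' t) :=
  ⟨(h.wf.add h'.wf.neg).congr fun _ _ _ => sub_eq_add_neg _ _,
    (h.wg.add h'.wg.neg).congr fun _ _ _ => sub_eq_add_neg _ _⟩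

/-! ### Limits of paths -/

lemma WL.of_tendsto {τ η a K : ℝ} {f : ℝ → FD} {F : ℕ → ℝ → FD}
    (hF : ∀ t, 0 ≤ t → t ≤ τ → ∀ k, Tendsto (fun n => F n t k) atTop (𝓝 (f t k)))
    (h : ∀ᶠ n in atTop, P.WL τ η a K (F n)) : P.WL τ η a K f where
  sup t h0 ht := Bd.of_tendsto (hF t h0.le ht) (h.mono fun _ h => h.sup t h0 ht)
  low t h0 ht := Bd.of_tendsto (hF t h0 ht) (h.mono fun _ h => h.low t h0 ht)
  hol s t hs hst ht := Bd.of_tendsto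
    (fun k => (hF t (hs.trans hst).le ht k).sub (hF s hs.le (hst.le.trans ht) k))
    (h.mono fun _ h => h.hol s t hs hst ht)

lemma CB.of_approx {J : Set ℝ} {a : ℝ} {f : ℝ → FD} (h : ∀ t ∈ J, ∀ ε > 0, ∃ g, P.CB J a g ∧
    ∀ᶠ s in 𝓝[J] t, P.Bd a (f s - g s) ε) : P.CB J a f := by
  refine ⟨fun t ht => ?_, fun t ht ε hε => ?_⟩
  · obtain ⟨g, hg, h1⟩ := h t ht 1 one_pos
    obtain ⟨K, hK⟩ := hg.bd t ht
    have := (h1.self_of_nhdsWithin ht).add hK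
    rw [sub_add_cancel] at this
    exact ⟨_, this⟩
  · obtain ⟨g, hg, h1⟩ := h t ht (ε / 3) (by positivity)
    have h2 := (h1.self_of_nhdsWithin ht).neg
    filter_upwards [h1, hg.cont t ht (ε / 3) (by positivity)] with s h3 h4
    rw [show f s - f t = f s - g s + (g s - g t) + -(f t - g t) by abel]
    exact ((h3.add h4).add h2).mono (by linarith)

lemma CB.of_wl {τ η a : ℝ} {f : ℝ → FD} {F : ℕ → ℝ → FD} {K : ℕ → ℝ} (hη : 0 ≤ η)
    (hK : Tendsto K atTop (𝓝 0)) (hF : ∀ n, P.CB (Ioc 0 τ) a (F n))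
    (h : ∀ n, P.WL τ η a (K n) (fun t => f t - F n t)) : P.CB (Ioc 0 τ) a f := by
  refine CB.of_approx fun t ht ε hε => ?_
  have ht0 := ht.1
  have hlim : Tendsto (fun n => K n * (t / 2) ^ (-η)) atTop (𝓝 0) := by
    simpa using hK.mul_const ((t / 2) ^ (-η))
  obtain ⟨n, hn⟩ := (hlim.eventually (ge_mem_nhds hε)).exists
  refine ⟨F n, hF n, ?_⟩
  have hK0 : 0 ≤ K n := ((h n).low t ht0.le ht.2).nonneg
  filter_upwards [self_mem_nhdsWithin,
    mem_nhdsWithin_of_mem_nhds (Ioi_mem_nhds (by linarith : t / 2 < t))] with s h1 h2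
  have h2' : t / 2 < s := h2
  refine ((h n).sup s h1.1 h1.2).mono (le_trans ?_ hn)
  have h5 : s ^ (-η) ≤ (t / 2) ^ (-η) :=
    Real.rpow_le_rpow_of_nonpos (by linarith) h2'.le (by linarith)
  gcongr

lemma SB.eq_of_small {τ : ℝ} {f g f' g' : ℝ → FD}
    (h : ∀ ε > 0, P.SB β γ τ ε (fun t => f t - f' t) (fun t => g t - g' t)) :
    ∀ t, 0 ≤ t → t ≤ τ → f t = f' t ∧ g t = g' t := fun t h0 ht =>
  ⟨sub_eq_zero.1 (eq_zero_of_bd fun ε hε => (h ε hε).wf.low t h0 ht),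
    sub_eq_zero.1 (eq_zero_of_bd fun ε hε => (h ε hε).wg.low t h0 ht)⟩

/-! ### Solutions -/

variable (P β γ) in
/-- Mild solutions of the para-KPZ equation. -/
structure FSol (τ : ℝ) (X : FDriv) (f₀ g₀ : FD) (f g : ℝ → FD) : Prop where
  adm : P.Adm β τ f g
  bd : ∃ K, P.SB β γ τ K f g
  eq : ∀ t, 0 ≤ t → t ≤ τ → f t = P.Φ₁ X f₀ f g t ∧ g t = P.Φ₂ X f₀ g₀ f g t

lemma Adm.mono {τ τ' : ℝ} {f g : ℝ → FD} (h : P.Adm β τ f g) (hτ : τ' ≤ τ) : P.Adm β τ' f g :=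
  ⟨h.cf.mono_set (Ioc_subset_Ioc_right hτ), h.cg.mono_set (Ioc_subset_Ioc_right hτ)⟩

lemma FSol.mono {τ τ' : ℝ} {X : FDriv} {f₀ g₀ : FD} {f g : ℝ → FD}
    (h : P.FSol β γ τ X f₀ g₀ f g) (hτ : τ' ≤ τ) : P.FSol β γ τ' X f₀ g₀ f g :=
  ⟨h.adm.mono hτ, h.bd.imp fun _ h => h.time_mono hτ, fun t h0 ht => h.eq t h0 (ht.trans hτ)⟩

lemma DrP.mono_time {τ τ' m e : ℝ} {X X' : FDriv} (h : P.DrP α τ m e X X') (hτ : τ' ≤ τ) :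
    P.DrP α τ' m e X X' where
  XI t ht := h.XI t ⟨ht.1, ht.2.trans hτ⟩
  XY t ht := h.XY t ⟨ht.1, ht.2.trans hτ⟩
  XW t ht := h.XW t ⟨ht.1, ht.2.trans hτ⟩
  XWh s t hs hst ht := h.XWh s t hs hst (ht.trans hτ)
  XB t ht := h.XB t ⟨ht.1, ht.2.trans hτ⟩
  XD t ht := h.XD t ⟨ht.1, ht.2.trans hτ⟩
  XK t ht := h.XK t ⟨ht.1, ht.2.trans hτ⟩
  XC t ht := h.XC t ⟨ht.1, ht.2.trans hτ⟩

lemma DrC.mono_time {τ τ' : ℝ} {X : FDriv} (h : P.DrC α τ X) (hτ : τ' ≤ τ) : P.DrC α τ' X where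
  XI := h.XI.mono_set (Icc_subset_Icc_right hτ)
  XY := h.XY.mono_set (Icc_subset_Icc_right hτ)
  XW := h.XW.mono_set (Icc_subset_Icc_right hτ)
  XB := h.XB.mono_set (Icc_subset_Icc_right hτ)
  XD := h.XD.mono_set (Icc_subset_Icc_right hτ)
  XK := h.XK.mono_set (Icc_subset_Icc_right hτ)
  XC := h.XC.mono_set (Icc_subset_Icc_right hτ)
  mild t ht := h.mild t ⟨ht.1, ht.2.trans hτ⟩

variable (P) in
/-- The Picard iterates. -/
def picard (X : FDriv) (f₀ g₀ : FD) : ℕ → (ℝ → FD) × (ℝ → FD)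
  | 0 => (0, 0)
  | n + 1 => (P.Φ₁ X f₀ (picard X f₀ g₀ n).1 (picard X f₀ g₀ n).2,
      P.Φ₂ X f₀ g₀ (picard X f₀ g₀ n).1 (picard X f₀ g₀ n).2)

lemma exists_tendsto_picard {τ B : ℝ} {F : ℕ → ℝ → FD} {a : ℝ}
    (h : ∀ n t, 0 ≤ t → t ≤ τ → P.Bd a (F (n + 1) t - F n t) (B * (1 / 2) ^ n)) :
    ∃ f : ℝ → FD, ∀ t, 0 ≤ t → t ≤ τ → ∀ k, Tendsto (fun n => F n t k) atTop (𝓝 (f t k)) := by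
  have : ∀ (t : ℝ) (k : ℤ), ∃ z : ℂ, 0 ≤ t → t ≤ τ → Tendsto (fun n => F n t k) atTop (𝓝 z) := by
    intro t k
    by_cases ht : 0 ≤ t ∧ t ≤ τ
    · have hc : CauchySeq fun n => F n t k := by
        refine cauchySeq_of_le_geometric (1 / 2)
          (B * (dyS 1 * (3 * (1 + |(k : ℝ)|)) ^ ⌈1 + |a|⌉₊)) (by norm_num) fun n => ?_
        rw [dist_comm, dist_eq_norm]
        exact ((h n t ht.1 ht.2).norm_coef_le k).trans (le_of_eq (by ring))
      obtain ⟨z, hz⟩ := cauchySeq_tendsto_of_complete hc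
      exact ⟨z, fun _ _ => hz⟩
    · exact ⟨0, fun h0 h1 => absurd ⟨h0, h1⟩ ht⟩
  choose f hf using this
  exact ⟨f, fun t h0 ht k => hf t k h0 ht⟩

/-- Existence of solutions on a short time interval, and the a priori bound. -/
lemma exists_fsol (P : DyadicPartition) (E : Exps α β γ) {T : ℝ} (hT : 0 ≤ T) :
    ∃ A c : ℝ, 0 < A ∧ 0 < c ∧ ∀ (τ m M : ℝ) (X : FDriv) (f₀ g₀ : FD), 0 ≤ τ → τ ≤ T → 1 ≤ m →
      m ^ 3 ≤ M → τ ^ ((α - β) / 2) * M ≤ c → P.DrP α τ m 0 X X → P.DrC α τ X →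
      P.Bd (γ + 1) f₀ M → P.Bd (2 * γ + 1) g₀ M →
      ∃ f g, P.FSol β γ τ X f₀ g₀ f g ∧ P.SB β γ τ (A * M) f g := by
  obtain ⟨C₀, hC₀, hdiff⟩ := P.exists_diff E hT
  obtain ⟨Q, hQ, hd⟩ := hdiff (C₀ + 1) (by linarith)
  set A := C₀ + 1 with hA
  refine ⟨A, 1 / (Q * (2 + A) + 1), by linarith, by positivity,
    fun τ m M X f₀ g₀ hτ0 hτ hm hM hc hX hcX hf0 hg0 => ?_⟩
  have hm0 : 0 ≤ m := by linarith
  have hM1 : 1 ≤ M := le_trans (one_le_pow₀ hm) hM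
  have hmM : m ^ 2 ≤ M := le_trans (by nlinarith [sq_nonneg m]) hM
  have hA0 : 0 ≤ A := by linarith
  set x := τ ^ ((α - β) / 2) with hx
  have hx0 : 0 ≤ x := by positivity
  have hsmall : Q * x * M * (2 + A) ≤ 1 := by
    calc Q * x * M * (2 + A) = Q * (2 + A) * (x * M) := by ring
      _ ≤ Q * (2 + A) * (1 / (Q * (2 + A) + 1)) := by gcongr
      _ ≤ 1 := by rw [mul_one_div, div_le_one (by positivity)]; linarith
  have hsmall2 : Q * x * M ≤ 1 / 2 := by
    have : 0 ≤ Q * x * M := by positivity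
    nlinarith
  have hz0 : ∀ r : ℝ, 0 < r → r ≤ 0 → False := fun r h h' => absurd h (not_lt.2 h')
  set z := P.picard X f₀ g₀ with hz
  have hzs : ∀ n, z (n + 1) = (P.Φ₁ X f₀ (z n).1 (z n).2, P.Φ₂ X f₀ g₀ (z n).1 (z n).2) :=
    fun n => rfl
  have hbd : ∀ n, P.SB β γ τ (A * M) (z n).1 (z n).2 ∧ P.Adm β τ (z n).1 (z n).2 := by
    intro n
    induction n with
    | zero => exact ⟨SB.zero (by positivity), Adm.zero⟩
    | succ n ih =>
      obtain ⟨i1, i2⟩ := ih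
      have h1 := hd τ 0 m M m (A * M) M X FDriv.zero f₀ 0 g₀ 0 (z n).1 (z n).2 0 0 le_rfl hτ0 hτ hm
        hM hX.zero_right hcX drC_zero i1 (SB.zero (by positivity))
        (i1.congr fun t _ _ => ⟨sub_zero _, sub_zero _⟩) i2 Adm.zero (.zero_right hf0)
        (.zero_right hg0) fun r h h' => (hz0 r h h').elim
      rw [Φ₁_zero, Φ₂_zero, sub_zero] at h1
      refine ⟨(h1.mono ?_).congr fun t _ _ => ⟨(sub_zero _).symm, (sub_zero _).symm⟩,
        (adm_Φ E hT hτ0 hτ hm hX hcX i1 i2 hf0 hg0).1⟩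
      rw [← hx]
      calc C₀ * M + Q * x * M * (M + A * M + m * m)
          ≤ C₀ * M + Q * x * M * (M + A * M + M) := by gcongr; nlinarith
        _ = C₀ * M + Q * x * M * (2 + A) * M := by ring
        _ ≤ C₀ * M + 1 * M := by gcongr
        _ = A * M := by rw [hA]; ring
  have hstep : ∀ (f g f' g' : ℝ → FD) (d : ℝ), P.SB β γ τ (A * M) f g → P.SB β γ τ (A * M) f' g' →
      P.Adm β τ f g → P.Adm β τ f' g' → P.SB β γ τ d (fun t => f t - f' t) (fun t => g t - g' t) →
      P.SB β γ τ (d * (1 / 2)) (fun t => P.Φ₁ X f₀ f g t - P.Φ₁ X f₀ f' g' t)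
        (fun t => P.Φ₂ X f₀ g₀ f g t - P.Φ₂ X f₀ g₀ f' g' t) := by
    intro f g f' g' d s s' a a' h
    have h1 := hd τ 0 m M 0 d 0 X X f₀ f₀ g₀ g₀ f g f' g' le_rfl hτ0 hτ hm hM hX hcX hcX s s' h a a'
      (.refl hf0) (.refl hg0) fun r h h' => (hz0 r h h').elim
    rw [sub_zero, ← hx] at h1
    refine h1.mono ?_
    have hd0 := h.nonneg hτ0
    calc C₀ * 0 + Q * x * M * (0 + d + m * 0) = Q * x * M * d := by ring
      _ ≤ 1 / 2 * d := by gcongr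
      _ = _ := by ring
  have hinc : ∀ n, P.SB β γ τ (A * M * (1 / 2) ^ n) (fun t => (z (n + 1)).1 t - (z n).1 t)
      (fun t => (z (n + 1)).2 t - (z n).2 t) := by
    intro n
    induction n with
    | zero =>
      rw [pow_zero, mul_one]
      exact (hbd 1).1.congr fun t _ _ => ⟨sub_zero _, sub_zero _⟩
    | succ n ih =>
      rw [pow_succ, ← mul_assoc]
      exact hstep _ _ _ _ _ (hbd _).1 (hbd _).1 (hbd _).2 (hbd _).2 ih
  obtain ⟨f, hf⟩ := exists_tendsto_picard (F := fun n => (z n).1) fun n t h0 ht =>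
    (hinc n).wf.low t h0 ht
  obtain ⟨g, hg⟩ := exists_tendsto_picard (F := fun n => (z n).2) fun n t h0 ht =>
    (hinc n).wg.low t h0 ht
  have hSB : P.SB β γ τ (A * M) f g :=
    ⟨WL.of_tendsto hf (Eventually.of_forall fun n => (hbd n).1.wf),
      WL.of_tendsto hg (Eventually.of_forall fun n => (hbd n).1.wg)⟩
  have hmn : ∀ n p, P.SB β γ τ (2 * (A * M) * (1 / 2) ^ n * (1 - (1 / 2) ^ p))
      (fun t => (z (n + p)).1 t - (z n).1 t) (fun t => (z (n + p)).2 t - (z n).2 t) := by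
    intro n p
    induction p with
    | zero =>
      rw [pow_zero, _root_.sub_self, mul_zero, add_zero]
      exact SB.sub_self _ _
    | succ p ih =>
      refine ((ih.add (hinc (n + p))).mono (le_of_eq ?_)).congr fun t _ _ => ⟨?_, ?_⟩
      · rw [pow_add, pow_succ]; ring
      · rw [← add_assoc]; abel
      · rw [← add_assoc]; abel
  have hconv : ∀ n, P.SB β γ τ (2 * (A * M) * (1 / 2) ^ n) (fun t => f t - (z n).1 t)
      (fun t => g t - (z n).2 t) := by
    intro n
    have hle : ∀ p : ℕ, 2 * (A * M) * (1 / 2) ^ n * (1 - (1 / 2) ^ p)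
        ≤ 2 * (A * M) * (1 / 2) ^ n := fun p =>
      mul_le_of_le_one_right (by positivity) (by
        have : (0 : ℝ) ≤ (1 / 2) ^ p := by positivity
        linarith)
    refine ⟨WL.of_tendsto (F := fun p t => (z (n + p)).1 t - (z n).1 t) (fun t h0 ht k => ?_)
      (Eventually.of_forall fun p => ((hmn n p).mono (hle p)).wf),
      WL.of_tendsto (F := fun p t => (z (n + p)).2 t - (z n).2 t) (fun t h0 ht k => ?_)
      (Eventually.of_forall fun p => ((hmn n p).mono (hle p)).wg)⟩
    · have := (hf t h0 ht k).comp (tendsto_add_atTop_nat n)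
      simp only [Function.comp_def, add_comm _ n] at this
      exact this.sub_const _
    · have := (hg t h0 ht k).comp (tendsto_add_atTop_nat n)
      simp only [Function.comp_def, add_comm _ n] at this
      exact this.sub_const _
  have hlim : Tendsto (fun n : ℕ => 2 * (A * M) * (1 / 2 : ℝ) ^ n) atTop (𝓝 0) := by
    have := (tendsto_pow_atTop_nhds_zero_of_lt_one (by norm_num : (0 : ℝ) ≤ 1 / 2)
      (by norm_num)).const_mul (2 * (A * M))
    simpa using this
  have hη : 0 ≤ β - γ := by linarith [E.hγβ]
  have hAdm : P.Adm β τ f g :=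
    ⟨CB.of_wl (by linarith) hlim (fun n => (hbd n).2.cf) fun n => (hconv n).wf,
      CB.of_wl hη hlim (fun n => (hbd n).2.cg) fun n => (hconv n).wg⟩
  refine ⟨f, g, ⟨hAdm, ⟨_, hSB⟩, SB.eq_of_small (P := P) (β := β) (γ := γ) fun ε hε => ?_⟩, hSB⟩
  obtain ⟨n, hn⟩ := (hlim.eventually (ge_mem_nhds (half_pos hε))).exists
  have s1 := hconv (n + 1)
  have s2 := hstep _ _ _ _ _ hSB (hbd n).1 hAdm (hbd n).2 (hconv n)
  refine ((s1.sub s2).mono ?_).congr fun t _ _ => ⟨?_, ?_⟩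
  · rw [pow_succ]; linarith
  · rw [hzs]; abel
  · rw [hzs]; abel

/-- Solutions are unique. -/
lemma FSol.unique (E : Exps α β γ) {T τ m : ℝ} {X : FDriv} {f₀ g₀ : FD} {f g f' g' : ℝ → FD}
    (hT : 0 ≤ T) (hτ0 : 0 ≤ τ) (hτ : τ ≤ T) (hm : 1 ≤ m) (hX : P.DrP α τ m 0 X X)
    (hcX : P.DrC α τ X) (h : P.FSol β γ τ X f₀ g₀ f g) (h' : P.FSol β γ τ X f₀ g₀ f' g')
    {M₀ : ℝ} (hf0 : P.Bd (γ + 1) f₀ M₀) (hg0 : P.Bd (2 * γ + 1) g₀ M₀) :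
    ∀ t, 0 ≤ t → t ≤ τ → f t = f' t ∧ g t = g' t := by
  obtain ⟨C₀, hC₀, hdiff⟩ := P.exists_diff E hT
  obtain ⟨Q, hQ, hd⟩ := hdiff 1 zero_le_one
  obtain ⟨K, hK⟩ := h.bd
  obtain ⟨K', hK'⟩ := h'.bd
  have hκ : 0 < (α - β) / 2 := by linarith [E.hβα]
  have hm0 : 0 ≤ m := by linarith
  have hM0 := hf0.nonneg
  have hK0 := hK.nonneg hτ0
  have hK0' := hK'.nonneg hτ0
  set M := m ^ 3 + M₀ + K + K' with hM
  have hm3 : 0 ≤ m ^ 3 := by positivity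
  have hMm : m ^ 3 ≤ M := by linarith
  have hMM : M₀ ≤ M := by linarith
  have hKM : K ≤ 1 * M := by linarith
  have hKM' : K' ≤ 1 * M := by linarith
  have hMp : 0 ≤ M := by linarith
  obtain ⟨δ, hδ, hδs⟩ : ∃ δ : ℝ, 0 < δ ∧ Q * δ ^ ((α - β) / 2) * M ≤ 1 / 2 := by
    have hcont : Tendsto (fun x : ℝ => Q * x ^ ((α - β) / 2) * M) (𝓝[>] 0) (𝓝 0) := by
      have h1 : Continuous fun x : ℝ => Q * x ^ ((α - β) / 2) * M :=
        (continuous_const.mul (continuous_id.rpow_const fun _ => Or.inr hκ.le)).mul continuous_const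
      have := (h1.tendsto 0).mono_left (nhdsWithin_le_nhds (s := Ioi 0))
      simpa [Real.zero_rpow hκ.ne'] using this
    have := (hcont.eventually (ge_mem_nhds (by norm_num : (0 : ℝ) < 1 / 2))).and
      self_mem_nhdsWithin
    obtain ⟨δ, h1, h2⟩ := this.exists
    exact ⟨δ, h2, h1⟩
  have hstep : ∀ n : ℕ, ∀ t, 0 ≤ t → t ≤ min (n * δ) τ → f t = f' t ∧ g t = g' t := by
    intro n
    induction n with
    | zero =>
      intro t h0 ht
      have ht0 : t = 0 := le_antisymm (ht.trans ((min_le_left _ _).trans (by simp))) h0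
      subst ht0
      rw [(h.eq 0 le_rfl hτ0).1, (h.eq 0 le_rfl hτ0).2, (h'.eq 0 le_rfl hτ0).1,
        (h'.eq 0 le_rfl hτ0).2]
      simp [Φ₁, Φ₂, duh_zero]
    | succ n ih =>
      set t₀ := min (n * δ) τ with ht₀
      set τ₁ := min (((n + 1 : ℕ) : ℝ) * δ) τ with hτ₁
      have hnδ : (0 : ℝ) ≤ n * δ := by positivity
      have h00 : 0 ≤ t₀ := le_min hnδ hτ0
      have h01 : t₀ ≤ τ₁ := min_le_min_right _ (by push_cast; nlinarith)
      have h1τ : τ₁ ≤ τ := min_le_right _ _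
      have hdt : τ₁ - t₀ ≤ δ := by
        have : τ₁ ≤ t₀ + δ := by
          rw [ht₀, hτ₁, min_add_add_right (n * δ) τ δ |>.symm]
          exact min_le_min (by push_cast; linarith) (by linarith)
        linarith
      have hx : Q * (τ₁ - t₀) ^ ((α - β) / 2) * M ≤ 1 / 2 := by
        refine le_trans ?_ hδs
        have : 0 ≤ τ₁ - t₀ := by linarith
        gcongr
      have hx0 : 0 ≤ Q * (τ₁ - t₀) ^ ((α - β) / 2) * M := by
        have : 0 ≤ τ₁ - t₀ := by linarith
        positivity
      have hK1 := (hK.mono hKM).time_mono h1τ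
      have hK1' := (hK'.mono hKM').time_mono h1τ
      have hloop : ∀ i : ℕ, P.SB β γ τ₁ ((1 * M + 1 * M) * (1 / 2) ^ i) (fun t => f t - f' t)
          (fun t => g t - g' t) := by
        intro i
        induction i with
        | zero => rw [pow_zero, mul_one]; exact hK1.sub hK1'
        | succ i ihi =>
          have h1 := hd τ₁ t₀ m M 0 _ 0 X X f₀ f₀ g₀ g₀ f g f' g' h00 h01 (h1τ.trans hτ) hm hMm
            (hX.mono_time h1τ) (hcX.mono_time h1τ) (hcX.mono_time h1τ) hK1 hK1' ihi
            (h.adm.mono h1τ) (h'.adm.mono h1τ) (.refl (hf0.mono hMM)) (.refl (hg0.mono hMM))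
            (fun r h0 hr => by
              have hrτ : r ≤ τ := hr.trans (min_le_right _ _)
              obtain ⟨e1, e2⟩ := ih r h0.le hr
              have e3 := (h.eq r h0.le hrτ).1
              have e4 := (h'.eq r h0.le hrτ).1
              have eU : fU X f g r = fU X f' g' r := by rw [fU, fU, e1, e2]
              refine ⟨by rw [fF, fF, eU], by rw [fG₁, fG₁, eU, e2], ?_⟩
              rw [fG₂, fG₂, eU, ← e3, ← e4, e1])
          refine (h1.mono ?_).congr fun t h0 ht => ?_
          · calc _ = Q * (τ₁ - t₀) ^ ((α - β) / 2) * M * ((1 * M + 1 * M) * (1 / 2) ^ i) := by ring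
              _ ≤ 1 / 2 * ((1 * M + 1 * M) * (1 / 2) ^ i) := by gcongr
              _ = _ := by rw [pow_succ]; ring
          · obtain ⟨e1, e2⟩ := h.eq t h0 (ht.trans h1τ)
            obtain ⟨e3, e4⟩ := h'.eq t h0 (ht.trans h1τ)
            exact ⟨by rw [← e1, ← e3], by rw [← e2, ← e4]⟩
      refine SB.eq_of_small (P := P) (β := β) (γ := γ) fun ε hε => ?_
      have hlim : Tendsto (fun n : ℕ => (1 * M + 1 * M) * (1 / 2 : ℝ) ^ n) atTop (𝓝 0) := by
        have := (tendsto_pow_atTop_nhds_zero_of_lt_one (by norm_num : (0 : ℝ) ≤ 1 / 2)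
          (by norm_num)).const_mul (1 * M + 1 * M)
        simpa using this
      obtain ⟨i, hi⟩ := (hlim.eventually (ge_mem_nhds hε)).exists
      exact (hloop i).mono hi
  intro t h0 ht
  obtain ⟨n, hn⟩ := exists_nat_ge (τ / δ)
  rw [div_le_iff₀ hδ] at hn
  exact hstep n t h0 (le_min (ht.trans hn) ht)

/-- Continuous dependence on the data. -/
lemma exists_fsol_diff (P : DyadicPartition) (E : Exps α β γ) {T : ℝ} (hT : 0 ≤ T) (A : ℝ)
    (hA : 0 ≤ A) : ∃ C c : ℝ, 0 ≤ C ∧ 0 < c ∧ ∀ (τ m M e d₀ : ℝ) (X X' : FDriv)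
      (f₀ f₀' g₀ g₀' : FD) (f g f' g' : ℝ → FD), 0 ≤ τ → τ ≤ T → 1 ≤ m → m ^ 3 ≤ M →
      τ ^ ((α - β) / 2) * M ≤ c → P.DrP α τ m e X X' → P.DrC α τ X → P.DrC α τ X' →
      P.PB (γ + 1) f₀ f₀' M d₀ → P.PB (2 * γ + 1) g₀ g₀' M d₀ →
      P.FSol β γ τ X f₀ g₀ f g → P.FSol β γ τ X' f₀' g₀' f' g' →
      P.SB β γ τ (A * M) f g → P.SB β γ τ (A * M) f' g' → ∀ ε > 0,
      P.SB β γ τ (C * (d₀ + m * e) + ε) (fun t => f t - f' t) (fun t => g t - g' t) := by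
  obtain ⟨C₀, hC₀, hdiff⟩ := P.exists_diff E hT
  obtain ⟨Q, hQ, hd⟩ := hdiff A hA
  refine ⟨2 * C₀ + 1, 1 / (2 * Q + 1), by positivity, by positivity,
    fun τ m M e d₀ X X' f₀ f₀' g₀ g₀' f g f' g' hτ0 hτ hm hM hc hX hcX hcX' hf0 hg0 h h' hs hs'
      ε hε => ?_⟩
  obtain ⟨hm0, he⟩ := hX.nonneg hτ0
  have hM1 : 1 ≤ M := le_trans (one_le_pow₀ hm) hM
  have hd0 := hf0.diff.nonneg
  set x := τ ^ ((α - β) / 2) with hx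
  have hx0 : 0 ≤ x := by positivity
  have hx1 : Q * x * M ≤ 1 / 2 := by
    calc Q * x * M = Q * (x * M) := by ring
      _ ≤ Q * (1 / (2 * Q + 1)) := by gcongr
      _ ≤ 1 / 2 := by rw [mul_one_div, div_le_div_iff₀ (by positivity) (by positivity)]; linarith
  have hQx : 0 ≤ Q * x * M := by positivity
  set B := (2 * C₀ + 1) * (d₀ + m * e) with hB
  have hme : 0 ≤ m * e := by positivity
  have hloop : ∀ i : ℕ, P.SB β γ τ (B + (A * M + A * M) * (1 / 2) ^ i) (fun t => f t - f' t)
      (fun t => g t - g' t) := by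
    intro i
    induction i with
    | zero =>
      rw [pow_zero, mul_one]
      refine (hs.sub hs').mono ?_
      have : 0 ≤ B := by positivity
      linarith
    | succ i ih =>
      have h1 := hd τ 0 m M e _ d₀ X X' f₀ f₀' g₀ g₀' f g f' g' le_rfl hτ0 hτ hm hM hX hcX hcX'
        hs hs' ih h.adm h'.adm hf0 hg0 fun r h h' => absurd h (not_lt.2 h')
      rw [sub_zero, ← hx] at h1
      refine (h1.mono ?_).congr fun t h0 ht => ?_
      · set y := (A * M + A * M) * (1 / 2 : ℝ) ^ i with hy
        have hy0 : 0 ≤ y := by positivity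
        have hB0 : 0 ≤ B := by positivity
        calc C₀ * d₀ + Q * x * M * (d₀ + (B + y) + m * e)
            ≤ C₀ * d₀ + 1 / 2 * (d₀ + (B + y) + m * e) := by gcongr
          _ ≤ B + y * (1 / 2) := by
            have : 0 ≤ C₀ * (m * e) := by positivity
            rw [hB]; nlinarith
          _ = _ := by rw [hy, pow_succ]; ring
      · obtain ⟨e1, e2⟩ := h.eq t h0 ht
        obtain ⟨e3, e4⟩ := h'.eq t h0 ht
        exact ⟨by rw [← e1, ← e3], by rw [← e2, ← e4]⟩
  have hlim : Tendsto (fun n : ℕ => (A * M + A * M) * (1 / 2 : ℝ) ^ n) atTop (𝓝 0) := by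
    have := (tendsto_pow_atTop_nhds_zero_of_lt_one (by norm_num : (0 : ℝ) ≤ 1 / 2)
      (by norm_num)).const_mul (A * M + A * M)
    simpa using this
  obtain ⟨i, hi⟩ := (hlim.eventually (ge_mem_nhds hε)).exists
  exact (hloop i).mono (by linarith)

end DyadicPartition

/-! ### Fourier series of test functions and distributions -/

lemma character_apply (k : ℤ) (x : ℝ) : (character k).1 x = chr k (x : UnitAddCircle) := by
  rw [chr_apply, fourier_coe_apply]
  simp [character]

/-- A test function as a function on the circle. -/
def tcirc : TestFn →ₗ[ℂ] CT where
  toFun φ := (⟨φ.2.2.lift, by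
    exact continuous_coinduced_dom.2 φ.2.1.continuous⟩ : C(UnitAddCircle, ℂ))
  map_add' φ ψ := by ext x; induction x using QuotientAddGroup.induction_on; rfl
  map_smul' c φ := by ext x; induction x using QuotientAddGroup.induction_on; rfl

lemma tcirc_coe (φ : TestFn) (x : ℝ) : tcirc φ (x : UnitAddCircle) = φ.1 x := rfl

lemma integral_mul_test (A : CT) (φ : TestFn) :
    ∫ x in (0 : ℝ)..1, A (x : UnitAddCircle) * φ.1 x = coef (A * tcirc φ) 0 := by
  have := fourierCoeff_eq_intervalIntegral (T := 1) (A * tcirc φ : CT) 0 0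
  rw [show coef (A * tcirc φ) 0 = fourierCoeff (A * tcirc φ : CT) 0 from rfl, this]
  simp only [zero_add, div_one, one_smul, neg_zero, fourier_zero]
  rfl

/-- The Fourier coefficients of a test function. -/
def tc : TestFn →ₗ[ℂ] FD := coef.comp tcirc

lemma tcirc_character (k : ℤ) : tcirc (character k) = chr k := by
  ext x
  induction x using QuotientAddGroup.induction_on with
  | H z => exact character_apply k z

lemma tc_character (m k : ℤ) : tc (character m) k = if k = m then 1 else 0 := by
  rw [tc, LinearMap.comp_apply, tcirc_character, coef_chr]

lemma coef_mul_chr (A : CT) (m k : ℤ) : coef (A * chr m) k = coef A (k - m) := by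
  rw [coef_eq_integral, coef_eq_integral]
  congr 1
  ext x
  rw [neg_sub, sub_eq_add_neg, ← chr_mul]
  simp only [CT.mul_apply]; ring

lemma tc_eq_integral (φ : TestFn) (k : ℤ) :
    tc φ k = ∫ x in (0 : ℝ)..1, φ.1 x * (character (-k)).1 x := by
  have := integral_mul_test (tcirc φ) (character (-k))
  simp only [tcirc_coe] at this
  rw [this, tcirc_character, coef_mul_chr]
  simp [tc]

lemma testDeriv_character (k : ℤ) : testDeriv (character k) = dsym k • character k := by
  ext x
  show deriv (fun y : ℝ => Complex.exp (2 * Real.pi * Complex.I * k * y)) x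
    = dsym k * Complex.exp (2 * Real.pi * Complex.I * k * x)
  have h : HasDerivAt (fun y : ℝ => 2 * Real.pi * Complex.I * k * (y : ℂ))
      (2 * Real.pi * Complex.I * k * 1) x := (Complex.ofRealCLM.hasDerivAt (x := x)).const_mul _
  rw [h.cexp.deriv, dsym]; ring

lemma tc_testDeriv (φ : TestFn) (k : ℤ) : tc (testDeriv φ) k = dsym k * tc φ k := by
  have hφ : ∀ x, HasDerivAt φ.1 ((testDeriv φ).1 x) x := fun x =>
    ((φ.2.1.differentiable (by simp)) x).hasDerivAt
  have hχ : ∀ x, HasDerivAt (character (-k)).1 ((testDeriv (character (-k))).1 x) x := fun x =>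
    (((character (-k)).2.1.differentiable (by simp)) x).hasDerivAt
  have hi : ∀ ψ : TestFn, IntervalIntegrable ψ.1 volume 0 1 := fun ψ =>
    ψ.2.1.continuous.intervalIntegrable _ _
  have key := intervalIntegral.integral_deriv_mul_eq_sub (a := 0) (b := 1) (u := φ.1)
    (v := (character (-k)).1) (fun x _ => hφ x) (fun x _ => hχ x) (hi _) (hi _)
  have hp : ∀ ψ : TestFn, ψ.1 1 = ψ.1 0 := fun ψ => by simpa using ψ.2.2 0
  rw [hp, hp, sub_self, intervalIntegral.integral_add] at key
  · rw [tc_eq_integral, tc_eq_integral, eq_neg_of_add_eq_zero_left key,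
      ← intervalIntegral.integral_neg, ← intervalIntegral.integral_const_mul]
    congr 1
    ext x
    rw [testDeriv_character]
    show -(φ.1 x * (dsym (-k) * (character (-k)).1 x)) = _
    simp only [dsym]; push_cast; ring
  · exact ((testDeriv φ).2.1.continuous.mul (character (-k)).2.1.continuous).intervalIntegrable _ _
  · exact (φ.2.1.continuous.mul (testDeriv (character (-k))).2.1.continuous).intervalIntegrable _ _

lemma iteratedDeriv_test (φ : TestFn) (m : ℕ) : iteratedDeriv m φ.1 = ((testDeriv^[m]) φ).1 := by
  induction m generalizing φ with
  | zero => simp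
  | succ m ih => rw [iteratedDeriv_succ', Function.iterate_succ_apply, ← ih]; rfl

lemma tc_iterate (φ : TestFn) (m : ℕ) (k : ℤ) :
    tc ((testDeriv^[m]) φ) k = dsym k ^ m * tc φ k := by
  induction m with
  | zero => simp
  | succ m ih => rw [Function.iterate_succ_apply', tc_testDeriv, ih, pow_succ']; ring

lemma norm_dsym (k : ℤ) : ‖dsym k‖ = 2 * Real.pi * |(k : ℝ)| := by
  simp [dsym, abs_of_pos Real.pi_pos]

/-- Rapid decay of the Fourier coefficients of test functions. -/
lemma norm_tc_le {φ : TestFn} {N : ℕ} {B : ℝ} (h : ∀ m ≤ N, ∀ x : ℝ, ‖iteratedDeriv m φ.1 x‖ ≤ B)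
    (k : ℤ) : (1 + |(k : ℝ)|) ^ N * ‖tc φ k‖ ≤ B := by
  have hB : 0 ≤ B := (norm_nonneg _).trans (h 0 (Nat.zero_le _) 0)
  have hm : ∀ m ≤ N, ‖tc ((testDeriv^[m]) φ) k‖ ≤ B := fun m hm => by
    refine (norm_coef_le _ _).trans ((CT.norm_le _ hB).2 fun x => ?_)
    induction x using QuotientAddGroup.induction_on with
    | H z => exact (congrArg (fun f : ℝ → ℂ => ‖f z‖) (iteratedDeriv_test φ m)).symm.trans_le (h m hm z)
  by_cases hk : k = 0
  · simpa [hk] using hm 0 (Nat.zero_le _)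
  · have := hm N le_rfl
    rw [tc_iterate, norm_mul, norm_pow, norm_dsym] at this
    refine le_trans ?_ this
    have h1 : (1 : ℝ) ≤ |(k : ℝ)| := by exact_mod_cast Int.one_le_abs hk
    gcongr
    nlinarith [Real.pi_gt_three]

lemma exists_norm_tc_le (φ : TestFn) (N : ℕ) :
    ∃ B : ℝ, 0 ≤ B ∧ ∀ k : ℤ, (1 + |(k : ℝ)|) ^ N * ‖tc φ k‖ ≤ B := by
  refine ⟨∑ m ∈ Finset.range (N + 1), ‖tcirc ((testDeriv^[m]) φ)‖,
    Finset.sum_nonneg fun _ _ => norm_nonneg _, norm_tc_le fun m hm x => ?_⟩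
  rw [iteratedDeriv_test, ← tcirc_coe]
  refine (CT.norm_coe_le_norm _ _).trans ?_
  exact Finset.single_le_sum (f := fun m => ‖tcirc ((testDeriv^[m]) φ)‖)
    (fun _ _ => norm_nonneg _) (Finset.mem_range.2 (by omega))

lemma summable_inv_sq_int : Summable fun k : ℤ => ((1 + |(k : ℝ)|) ^ 2)⁻¹ := by
  refine Summable.of_nat_of_neg_add_one ?_ ?_
  · refine ((summable_nat_add_iff 1).2 (Real.summable_nat_pow_inv.2 one_lt_two)).congr fun n => ?_
    push_cast; rw [abs_of_nonneg (Nat.cast_nonneg n), add_comm]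
  · refine ((summable_nat_add_iff 2).2 (Real.summable_nat_pow_inv.2 one_lt_two)).congr fun n => ?_
    push_cast
    rw [abs_neg, abs_of_nonneg (by positivity)]
    ring_nf

lemma summable_tc (φ : TestFn) (p : ℕ) : Summable fun k : ℤ => (1 + |(k : ℝ)|) ^ p * ‖tc φ k‖ := by
  obtain ⟨B, hB, h⟩ := exists_norm_tc_le φ (p + 2)
  refine Summable.of_nonneg_of_le (fun k => by positivity) (fun k => ?_)
    (summable_inv_sq_int.mul_left B)
  rw [← div_eq_mul_inv, le_div_iff₀ (by positivity)]
  refine le_trans (le_of_eq ?_) (h k)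
  rw [pow_add]; ring

lemma summable_norm_tc (φ : TestFn) : Summable fun k : ℤ => ‖tc φ k‖ := by
  simpa using summable_tc φ 0

lemma hasSum_tcirc (φ : TestFn) : HasSum (fun k => tc φ k • chr k) (tcirc φ) :=
  hasSum_fourier_series_of_summable (f := (tcirc φ : C(AddCircle (1 : ℝ), ℂ)))
    (summable_norm_tc φ).of_norm

/-- Parseval's formula for the pairing with a test function. -/
lemma hasSum_integral_mul (A : CT) (φ : TestFn) :
    HasSum (fun k => tc φ k * coef A (-k)) (∫ x in (0 : ℝ)..1, A (x : UnitAddCircle) * φ.1 x) := by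
  rw [integral_mul_test]
  have h := ((coefL 0).hasSum ((hasSum_tcirc φ).mul_left A))
  refine h.congr_fun fun k => ?_
  rw [mul_smul_comm, map_smul, ← coef_apply, coef_mul_chr, zero_sub, smul_eq_mul]

/-- Distributions are the sums of their Fourier series. -/
lemma hasSum_dist (u : TDist) (φ : TestFn) :
    HasSum (fun k => tc φ k * fourier u (-k)) (u.1 φ) := by
  obtain ⟨N, C, h⟩ := u.2
  have hb : ∀ s : Finset ℤ, ‖u.1 φ - ∑ k ∈ s, tc φ k * fourier u (-k)‖
      ≤ C * ∑' k : ((s : Set ℤ)ᶜ : Set ℤ), ((2 * Real.pi) ^ N * ((1 + |(k : ℝ)|) ^ N * ‖tc φ k‖)) := by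
    intro s
    have e : u.1 φ - ∑ k ∈ s, tc φ k * fourier u (-k)
        = u.1 (φ - ∑ k ∈ s, tc φ k • character k) := by
      rw [map_sub, map_sum]
      congr 1
      refine Finset.sum_congr rfl fun k _ => ?_
      rw [map_smul, fourier, neg_neg]; rfl
    rw [e]
    refine h _ _ fun m hm x => ?_
    set ψ := φ - ∑ k ∈ s, tc φ k • character k with hψ
    have hψc : ∀ k, tc ψ k = if k ∈ s then 0 else tc φ k := by
      intro k
      rw [hψ, map_sub, map_sum]
      simp only [map_smul, Pi.sub_apply, Finset.sum_apply, Pi.smul_apply, tc_character, smul_eq_mul,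
        mul_ite, mul_one, mul_zero]
      rw [Finset.sum_ite_eq]
      split_ifs <;> simp
    rw [iteratedDeriv_test, ← tcirc_coe]
    refine (CT.norm_coe_le_norm _ _).trans ?_
    have hs := hasSum_tcirc ((testDeriv^[m]) ψ)
    have hn := (summable_norm_tc ((testDeriv^[m]) ψ))
    have hchr : ∀ k, ‖tc ((testDeriv^[m]) ψ) k • chr k‖ = ‖tc ((testDeriv^[m]) ψ) k‖ := fun k => by
      rw [norm_smul, show ‖chr k‖ = 1 from ?_, mul_one]
      refine le_antisymm ((CT.norm_le _ zero_le_one).2 fun x => (norm_chr_apply k x).le) ?_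
      rw [← norm_chr_apply k 0]; exact CT.norm_coe_le_norm _ _
    rw [← hs.tsum_eq]
    refine (norm_tsum_le_tsum_norm (by simpa only [hchr] using hn)).trans ?_
    simp only [hchr]
    have hS := (summable_tc φ N).mul_left ((2 * Real.pi) ^ N)
    rw [tsum_subtype ((s : Set ℤ)ᶜ) fun k : ℤ => (2 * Real.pi) ^ N * ((1 + |(k : ℝ)|) ^ N * ‖tc φ k‖)]
    refine hn.tsum_le_tsum (fun k => ?_) (hS.indicator _)
    rw [tc_iterate, hψc]
    by_cases hk : k ∈ s
    · rw [if_pos hk, mul_zero, norm_zero]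
      exact indicator_nonneg (fun _ _ => by positivity) _
    · rw [if_neg hk, indicator_of_mem (by simpa using hk), norm_mul, norm_pow, norm_dsym, ← mul_assoc,
        ← mul_pow]
      have h2 : 1 ≤ 2 * Real.pi * (1 + |(k : ℝ)|) := by
        nlinarith [Real.pi_gt_three, abs_nonneg (k : ℝ)]
      gcongr
      calc (2 * Real.pi * |(k : ℝ)|) ^ m ≤ (2 * Real.pi * (1 + |(k : ℝ)|)) ^ m := by
            gcongr; linarith
        _ ≤ _ := pow_le_pow_right₀ h2 hm
  have hlim := (tendsto_tsum_compl_atTop_zero fun k : ℤ =>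
    (2 * Real.pi) ^ N * ((1 + |(k : ℝ)|) ^ N * ‖tc φ k‖)).const_mul C
  rw [mul_zero] at hlim
  rw [HasSum, tendsto_iff_norm_sub_tendsto_zero]
  refine squeeze_zero (fun _ => norm_nonneg _) (fun s => ?_) hlim
  rw [norm_sub_rev]; exact hb s

lemma dist_ext {u v : TDist} (h : fourier u = fourier v) : u = v := by
  refine Subtype.ext (LinearMap.ext fun φ => ?_)
  have := hasSum_dist u φ
  rw [h] at this
  exact this.unique (hasSum_dist v φ)

lemma fourier_add (u v : TDist) : fourier (u + v) = fourier u + fourier v := rfl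
lemma fourier_sub (u v : TDist) : fourier (u - v) = fourier u - fourier v := rfl
lemma fourier_smul (c : ℂ) (u : TDist) : fourier (c • u) = c • fourier u := rfl

lemma fourier_dx (u : TDist) : fourier (dx u) = dsym * fourier u := by
  ext k
  show -(u.1 (testDeriv (character (-k)))) = dsym k * u.1 (character (-k))
  rw [testDeriv_character, map_smul, smul_eq_mul, ← neg_mul]
  congr 1
  simp [dsym]

/-- At most polynomial growth. -/
def Slow (c : FD) : Prop := ∃ (C : ℝ) (p : ℕ), ∀ k, ‖c k‖ ≤ C * (1 + |(k : ℝ)|) ^ p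

lemma summable_tc_mul (φ : TestFn) {c : FD} {C : ℝ} {p : ℕ}
    (h : ∀ k, ‖c k‖ ≤ C * (1 + |(k : ℝ)|) ^ p) : Summable fun k => tc φ k * c (-k) := by
  refine ((summable_tc φ p).mul_left C).of_norm_bounded fun k => ?_
  have := h (-k)
  push_cast at this
  rw [abs_neg] at this
  rw [norm_mul]
  calc _ ≤ ‖tc φ k‖ * (C * (1 + |(k : ℝ)|) ^ p) := by gcongr
    _ = _ := by ring

open Classical in
/-- The distribution with given Fourier coefficients. -/
def toDist (c : FD) : TDist :=
  if h : Slow c then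
    ⟨{  toFun := fun φ => ∑' k, tc φ k * c (-k)
        map_add' := fun φ ψ => by
          obtain ⟨C, p, hc⟩ := h
          rw [← (summable_tc_mul φ hc).tsum_add (summable_tc_mul ψ hc)]
          simp only [map_add, Pi.add_apply, add_mul]
        map_smul' := fun a φ => by
          simp only [map_smul, Pi.smul_apply, smul_eq_mul, mul_assoc, tsum_mul_left,
            RingHom.id_apply] }, by
      obtain ⟨C, p, hc⟩ := h
      refine ⟨p + 2, C * ∑' k : ℤ, ((1 + |(k : ℝ)|) ^ 2)⁻¹, fun φ B hB => ?_⟩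
      have hC : 0 ≤ C := by simpa using (norm_nonneg _).trans (hc 0)
      have hs := (summable_inv_sq_int.mul_left (C * B))
      rw [show C * (∑' k : ℤ, ((1 + |(k : ℝ)|) ^ 2)⁻¹) * B
        = ∑' k : ℤ, C * B * ((1 + |(k : ℝ)|) ^ 2)⁻¹ by rw [tsum_mul_left]; ring]
      refine tsum_of_norm_bounded hs.hasSum fun k => ?_
      have h1 := norm_tc_le hB k
      have h2 := hc (-k)
      push_cast at h2
      rw [abs_neg] at h2
      have hk : 0 < 1 + |(k : ℝ)| := by positivity
      rw [norm_mul, ← div_eq_mul_inv, le_div_iff₀ (by positivity)]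
      calc ‖tc φ k‖ * ‖c (-k)‖ * (1 + |(k : ℝ)|) ^ 2
          ≤ ‖tc φ k‖ * (C * (1 + |(k : ℝ)|) ^ p) * (1 + |(k : ℝ)|) ^ 2 := by gcongr
        _ = C * ((1 + |(k : ℝ)|) ^ (p + 2) * ‖tc φ k‖) := by rw [pow_add]; ring
        _ ≤ C * B := by gcongr⟩
  else 0

lemma fourier_toDist {c : FD} (h : Slow c) : fourier (toDist c) = c := by
  ext k
  rw [fourier, toDist, dif_pos h]
  show ∑' l, tc (character (-k)) l * c (-l) = c k
  rw [tsum_eq_single (-k) fun l hl => by rw [tc_character, if_neg hl, zero_mul], tc_character,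
    if_pos rfl, one_mul, neg_neg]

lemma isDistLimit_iff_unique {a : ℕ → ℝ → ℂ} {w : TDist} (h : IsDistLimit a w) :
    distLimit a = w := by
  have hex : ∃ w, IsDistLimit a w := ⟨w, h⟩
  rw [distLimit, dif_pos hex]
  exact Subtype.ext (LinearMap.ext fun φ => tendsto_nhds_unique (hex.choose_spec φ) (h φ))

/-- Convergence of the Fourier coefficients and polynomial bounds imply convergence in the sense of
distributions. -/
lemma isDistLimit_of_coef {S : ℕ → CT} {w : TDist} {C : ℝ} {p : ℕ}
    (h : ∀ k, Tendsto (fun n => coef (S n) k) atTop (𝓝 (fourier w k)))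
    (hb : ∀ n k, ‖coef (S n) k‖ ≤ C * (1 + |(k : ℝ)|) ^ p) :
    IsDistLimit (fun n x => S n (x : UnitAddCircle)) w := by
  intro φ
  rw [← (hasSum_dist w φ).tsum_eq]
  simp only [← (hasSum_integral_mul _ φ).tsum_eq]
  refine tendsto_tsum_of_dominated_convergence ((summable_tc φ p).mul_left C)
    (fun k => (h (-k)).const_mul _) (Eventually.of_forall fun n k => ?_)
  have := hb n (-k)
  push_cast at this
  rw [abs_neg] at this
  rw [norm_mul]
  calc _ ≤ ‖tc φ k‖ * (C * (1 + |(k : ℝ)|) ^ p) := by gcongr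
    _ = _ := by ring

lemma isSmooth_of_tc {w : TDist} {a : TestFn} (h : fourier w = tc a) : IsSmooth w := by
  refine ⟨a, fun φ => ?_⟩
  have h1 := hasSum_integral_mul (tcirc a) φ
  have h2 := hasSum_dist w φ
  rw [h] at h2
  exact h2.unique h1

lemma IsSmooth.exists_tc {w : TDist} (h : IsSmooth w) : ∃ a : TestFn, fourier w = tc a := by
  obtain ⟨a, ha⟩ := h
  exact ⟨a, funext fun k => by rw [fourier, ha, tc_eq_integral]⟩

/-- The Fourier coefficients of a path of distributions. -/
notation "𝔉" f:max => fun t => fourier (f t)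

namespace DyadicPartition

variable {P : DyadicPartition} {a b c : ℝ} {u v w : TDist}

/-! ### Norms of distributions in terms of their Fourier coefficients -/

lemma block_eq (j : ℕ) (u : TDist) (x : ℝ) :
    P.block j u x = P.blk j (fourier u) (x : UnitAddCircle) := by
  rw [block, blk_def, poly_apply, tsum_eq_sum (s := box (2 ^ j))]
  · refine Finset.sum_congr rfl fun k _ => ?_
    rw [character_apply]; rfl
  · intro k hk
    have : ((P.symbol j k : ℝ) : ℂ) = 0 := P.sym_eq_zero_of_not_mem hk
    rw [this, zero_mul, zero_mul]

lemma iSup_block (j : ℕ) (u : TDist) :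
    ⨆ x : ℝ, ‖P.block j u x‖ₑ = ENNReal.ofReal ‖P.blk j (fourier u)‖ := by
  refine le_antisymm (iSup_le fun x => ?_) ?_
  · rw [block_eq, ← ofReal_norm]
    exact ENNReal.ofReal_le_ofReal (CT.norm_coe_le_norm _ _)
  · refine ENNReal.le_of_forall_pos_le_add fun ε hε hfin => ?_
    set S := ⨆ x : ℝ, ‖P.block j u x‖ₑ with hS
    have hS' : S ≠ ⊤ := hfin.ne
    refine le_trans ?_ (le_self_add (a := S))
    rw [← ENNReal.ofReal_toReal hS']
    refine ENNReal.ofReal_le_ofReal ((CT.norm_le _ ENNReal.toReal_nonneg).2 fun x => ?_)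
    induction x using QuotientAddGroup.induction_on with
    | H z =>
      have h1 : ‖P.block j u z‖ₑ ≤ S := le_iSup (fun x : ℝ => ‖P.block j u x‖ₑ) z
      rw [block_eq, ← ofReal_norm] at h1
      exact (ENNReal.ofReal_le_iff_le_toReal hS').1 h1

lemma besovTerm_eq (a : ℝ) (u : TDist) (j : ℕ) :
    P.besovTerm a u j = ENNReal.ofReal (((2 : ℝ) ^ a * dy a j)⁻¹ * ‖P.blk j (fourier u)‖) := by
  rw [besovTerm, iSup_block, ← ENNReal.ofReal_mul (by positivity)]
  congr 2
  rw [dy_eq, ← Real.rpow_add two_pos, ← Real.rpow_neg two_pos.le]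
  congr 1; ring

lemma besovTerm_le_iff {K : ℝ} (hK : 0 ≤ K) (j : ℕ) :
    P.besovTerm a u j ≤ ENNReal.ofReal K ↔ ‖P.blk j (fourier u)‖ ≤ (2 : ℝ) ^ a * K * dy a j := by
  have := dy_pos a j
  rw [besovTerm_eq, ENNReal.ofReal_le_ofReal_iff hK, inv_mul_le_iff₀ (by positivity)]
  constructor <;> intro h <;> linarith

lemma cnorm_le_iff {K : ℝ} (hK : 0 ≤ K) :
    P.cnorm a u ≤ ENNReal.ofReal K ↔ P.Bd a (fourier u) ((2 : ℝ) ^ a * K) := by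
  rw [cnorm, iSup_le_iff]
  exact forall_congr' fun j => besovTerm_le_iff hK j

lemma memC_iff : P.MemC a u ↔ P.Lit a (fourier u) := by
  have h2 : (0 : ℝ) < 2 ^ a := by positivity
  rw [MemC, ENNReal.tendsto_nhds_zero]
  constructor
  · intro h ε hε
    obtain ⟨n, hn⟩ := eventually_atTop.1 (h (ENNReal.ofReal (ε / 2 ^ a)) (by simp; positivity))
    refine ⟨n, fun j hj => ?_⟩
    have := (besovTerm_le_iff (by positivity) j).1 (hn j hj)
    rwa [mul_div_cancel₀ _ h2.ne'] at this
  · intro h ε hε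
    by_cases ht : ε = ⊤
    · simp [ht]
    have hε' := ENNReal.toReal_pos hε.ne' ht
    obtain ⟨n, hn⟩ := h ((2 : ℝ) ^ a * ε.toReal) (by positivity)
    refine eventually_atTop.2 ⟨n, fun j hj => ?_⟩
    rw [← ENNReal.ofReal_toReal ht]
    exact (besovTerm_le_iff hε'.le j).2 (hn j hj)

lemma _root_.ParaKPZ.two_rpow_le (ha : |a| ≤ 2) : (2 : ℝ) ^ a ≤ 4 := by
  calc (2 : ℝ) ^ a ≤ 2 ^ (2 : ℝ) := Real.rpow_le_rpow_of_exponent_le one_le_two (abs_le.1 ha).2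
    _ = 4 := by norm_num

lemma bd_of_cnorm_le (ha : |a| ≤ 2) {K : ℝ} (hK : 0 ≤ K) (h : P.cnorm a u ≤ ENNReal.ofReal K) :
    P.Bd a (fourier u) (4 * K) :=
  ((cnorm_le_iff hK).1 h).mono (mul_le_mul_of_nonneg_right (two_rpow_le ha) hK)

lemma Bd.cnorm_le (ha : |a| ≤ 2) {K : ℝ} (h : P.Bd a (fourier u) K) :
    P.cnorm a u ≤ ENNReal.ofReal (4 * K) := by
  have hK := h.nonneg
  refine (cnorm_le_iff (by positivity)).2 (h.mono ?_)
  have h1 : (2 : ℝ) ^ (-a) ≤ 4 := two_rpow_le (by rwa [abs_neg])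
  have h2 : (0 : ℝ) < 2 ^ a := by positivity
  rw [Real.rpow_neg two_pos.le, inv_le_iff_one_le_mul₀ h2] at h1
  nlinarith

lemma MemC.exists_bd (h : P.MemC a u) : ∃ K, P.Bd a (fourier u) K := (memC_iff.1 h).exists_bd

lemma cnorm_lt_top {K : ℝ} (h : P.Bd a (fourier u) K) : P.cnorm a u < ⊤ := by
  refine lt_of_le_of_lt ((cnorm_le_iff (K := K / 2 ^ a) ?_).2 ?_) ENNReal.ofReal_lt_top
  · have := h.nonneg; positivity
  · rwa [mul_div_cancel₀ _ (by positivity)]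

lemma Bd.slow {f : FD} {K : ℝ} (h : P.Bd a f K) : Slow f := by
  refine ⟨dyS 1 * K * 3 ^ ⌈1 + |a|⌉₊, ⌈1 + |a|⌉₊, fun k => ?_⟩
  refine (h.norm_coef_le k).trans (le_of_eq ?_)
  rw [mul_pow]; ring

lemma Lit.slow {f : FD} (h : P.Lit a f) : Slow f := by
  obtain ⟨K, hK⟩ := h.exists_bd
  exact hK.slow

/-! ### Products -/

lemma ser_ite (g : ℕ → CT) (n : ℕ) :
    ser (fun m => if m < n then g m else 0) = coef (∑ m ∈ Finset.range n, g m) := by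
  ext k
  rw [map_sum, Finset.sum_apply, ser, tsum_eq_sum (s := Finset.range n)]
  · exact Finset.sum_congr rfl fun m hm => by rw [if_pos (Finset.mem_range.1 hm)]
  · intro m hm
    rw [if_neg (by simpa using hm)]; simp

lemma isDistLimit_ser {s K C : ℝ} {g : ℕ → CT} {w : TDist} (hg : SerSummable g)
    (hn : ∀ m, ‖g m‖ ≤ K * dy s m) (hC : ∀ n, P.Bd s (ser fun m => if m < n then g m else 0) C)
    (hw : fourier w = ser g) :
    IsDistLimit (fun n x => (∑ m ∈ Finset.range n, g m : CT) (x : UnitAddCircle)) w := by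
  refine isDistLimit_of_coef (C := dyS 1 * C * 3 ^ ⌈1 + |s|⌉₊) (p := ⌈1 + |s|⌉₊) (fun k => ?_)
    fun n k => ?_
  · rw [hw]
    simp only [map_sum, Finset.sum_apply]
    exact (hg k).hasSum.tendsto_sum_nat
  · rw [← ser_ite]
    refine ((hC n).norm_coef_le k).trans (le_of_eq ?_)
    rw [mul_pow]; ring

lemma norm_ite_le {s K : ℝ} {g : ℕ → CT} (hn : ∀ m, ‖g m‖ ≤ K * dy s m) (n m : ℕ) :
    ‖if m < n then g m else 0‖ ≤ K * dy s m := by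
  split_ifs
  · exact hn m
  · rw [norm_zero]; exact (norm_nonneg _).trans (hn m)

lemma paraSum_eq (u v : TDist) (n : ℕ) (x : ℝ) : P.paraSum u v n x
    = (∑ m ∈ Finset.range n, P.paraT (fourier u) (fourier v) m : CT) (x : UnitAddCircle) := by
  rw [CT.sum_apply, paraSum]
  refine Finset.sum_congr rfl fun j hj => ?_
  rw [paraT, CT.mul_apply, low_apply, CT.sum_apply, ← Finset.sum_filter, Finset.sum_mul]
  refine Finset.sum_congr ?_ fun i _ => by rw [block_eq, block_eq]
  ext i
  rw [Finset.mem_range] at hj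
  simp only [Finset.mem_filter, Finset.mem_range]
  omega

lemma resSum_eq (u v : TDist) (n : ℕ) (x : ℝ) : P.resSum u v n x
    = (∑ m ∈ Finset.range n, P.resT (fourier u) (fourier v) m : CT) (x : UnitAddCircle) := by
  induction n with
  | zero => simp [resSum]
  | succ n ih =>
    rw [Finset.sum_range_succ, CT.add_apply, ← ih, resSum, resSum]
    rw [Finset.sum_range_succ]
    simp only [Finset.sum_range_succ _ n]
    rw [Finset.sum_add_distrib, add_assoc]
    congr 1
    have e1 : ∀ j ∈ Finset.range n, (if n ≤ j + 1 ∧ j ≤ n + 1 then P.block n u x * P.block j v x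
        else 0) = if j + 1 = n then P.block n u x * P.block j v x else 0 := fun j hj => by
      rw [Finset.mem_range] at hj
      exact if_congr (by omega) rfl rfl
    have e2 : ∀ i ∈ Finset.range n, (if i ≤ n + 1 ∧ n ≤ i + 1 then P.block i u x * P.block n v x
        else 0) = if i + 1 = n then P.block i u x * P.block n v x else 0 := fun i hi => by
      rw [Finset.mem_range] at hi
      exact if_congr (by omega) rfl rfl
    rw [Finset.sum_congr rfl e1, Finset.sum_congr rfl e2, if_pos (by omega)]
    cases n with
    | zero => simp [resT, block_eq]
    | succ n =>
      have e3 : ∀ F : ℕ → ℂ, ∑ i ∈ Finset.range (n + 1), (if i + 1 = n + 1 then F i else 0) = F n :=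
        fun F => by
          simp only [add_left_inj]
          rw [Finset.sum_ite_eq' (Finset.range (n + 1)) n F, if_pos (by simp)]
      rw [e3 fun j => P.block (n + 1) u x * P.block j v x,
        e3 fun i => P.block i u x * P.block (n + 1) v x]
      simp only [resT, block_eq, CT.add_apply, CT.mul_apply]
      ring

lemma fourier_para {K L : ℝ} (hu : P.Bd a (fourier u) K) (hv : P.Bd b (fourier v) L) :
    fourier (P.para u v) = P.fpara (fourier u) (fourier v) := by
  have ha : min a (-1) < 0 := lt_of_le_of_lt (min_le_right _ _) (by norm_num)
  have hu' := hu.exp_mono (min_le_left a (-1))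
  obtain ⟨C, -, hC⟩ := P.exists_bd_fpara_neg ha b
  have hw := fourier_toDist (hC _ _ _ _ hu' hv).slow
  obtain ⟨C', -, hC'⟩ := P.exists_bd_ser_annular (min a (-1) + b)
  have hn : ∀ m, ‖P.paraT (fourier u) (fourier v) m‖
      ≤ K * dyS (-(min a (-1))) * L * dy (min a (-1) + b) m := fun m => by
    have h1 := norm_low_le_neg ha hu' m
    have h2 := hv m
    have := (norm_nonneg _).trans h1
    refine (norm_mul_le _ _).trans ?_
    calc _ ≤ K * (dyS (-(min a (-1))) * dy (min a (-1)) m) * (L * dy b m) := by gcongr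
      _ = _ := by rw [dy_add]; ring
  have han := P.annular_paraT (fourier u) (fourier v)
  rw [← hw, para, isDistLimit_iff_unique]
  rw [show P.paraSum u v = _ from funext fun n => funext fun x => paraSum_eq u v n x]
  refine isDistLimit_ser han.serSummable hn (fun n => hC' _ _ ?_ (norm_ite_le hn n)) hw
  intro j m hjm
  dsimp only
  split_ifs
  · exact han j m hjm
  · simp

lemma isDistLimit_res (hab : 0 < a + b) {K L : ℝ} (hu : P.Bd a (fourier u) K)
    (hv : P.Bd b (fourier v) L) :
    IsDistLimit (P.resSum u v) (toDist (P.fres (fourier u) (fourier v))) ∧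
      fourier (toDist (P.fres (fourier u) (fourier v))) = P.fres (fourier u) (fourier v) := by
  obtain ⟨C, -, hC⟩ := P.exists_bd_fres hab
  have hw := fourier_toDist (hC _ _ _ _ hu hv).slow
  refine ⟨?_, hw⟩
  obtain ⟨C', -, hC'⟩ := P.exists_bd_ser_ball hab 3
  have hn := norm_resT_le hu hv
  rw [show P.resSum u v = _ from funext fun n => funext fun x => resSum_eq u v n x]
  have hball := P.ballLike_of_specIn 1 (P.specIn_resT (fourier u) (fourier v))
  refine isDistLimit_ser (serSummable_of_summable (summable_resT hab hu hv)) hn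
    (fun n => hC' _ _ ?_ (norm_ite_le hn n)) hw
  refine P.ballLike_of_specIn 1 fun m => ?_
  split_ifs
  · exact P.specIn_resT _ _ m
  · exact SpecIn.zero _

lemma fourier_res (hab : 0 < a + b) {K L : ℝ} (hu : P.Bd a (fourier u) K)
    (hv : P.Bd b (fourier v) L) : fourier (P.res u v) = P.fres (fourier u) (fourier v) := by
  obtain ⟨h1, h2⟩ := isDistLimit_res hab hu hv
  rw [res, isDistLimit_iff_unique h1, h2]

lemma fourier_mul (hab : 0 < a + b) {K L : ℝ} (hu : P.Bd a (fourier u) K)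
    (hv : P.Bd b (fourier v) L) : fourier (P.mul u v) = P.fmul (fourier u) (fourier v) := by
  rw [mul, fourier_add, fourier_add, fourier_para hu hv, fourier_para hv hu, fourier_res hab hu hv,
    fmul]

/-! ### The commutator -/

lemma bd_tc (φ : TestFn) : ∃ K, P.Bd 2 (tc φ) K := by
  obtain ⟨B, hB, h⟩ := exists_norm_tc_le φ 4
  have hS := summable_inv_sq_int
  set S := ∑' k : ℤ, ((1 + |(k : ℝ)|) ^ 2)⁻¹
  refine ⟨B * 8 * S, fun j => ?_⟩
  rw [blk_def, poly_def]
  refine (norm_sum_le _ _).trans ?_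
  have hk : ∀ k ∈ box (2 ^ j), ‖(P.sym j * tc φ) k • chr k‖
      ≤ B * 8 * dy 2 j * ((1 + |(k : ℝ)|) ^ 2)⁻¹ := by
    intro k _
    have hd := dy_nonneg 2 j
    have h1 : ‖(P.sym j * tc φ) k • chr k‖ ≤ ‖(P.sym j * tc φ) k‖ := by
      rw [norm_smul]
      refine mul_le_of_le_one_right (norm_nonneg _) ((CT.norm_le _ zero_le_one).2 fun x => ?_)
      exact (norm_chr_apply k x).le
    refine h1.trans ?_
    by_cases h0 : P.sym j k = 0
    · rw [Pi.mul_apply, h0, zero_mul, norm_zero]; positivity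
    have hsk : (3 / 8 : ℝ) * 2 ^ j ≤ 1 + |(k : ℝ)| := by
      by_contra! hlt
      cases j with
      | zero => rw [pow_zero] at hlt; linarith [abs_nonneg (k : ℝ)]
      | succ j =>
        refine h0 ?_
        rw [sym, P.symbol_eq_zero_of_gt (by linarith), Complex.ofReal_zero]
    have hd2 : dy 2 j = ((2 ^ j : ℝ) ^ 2)⁻¹ := by
      rw [show (2 : ℝ) = 1 + 1 by norm_num, dy_add, dy_one]
      norm_num; ring
    rw [Pi.mul_apply, norm_mul, sym, Complex.norm_real, Real.norm_eq_abs,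
      abs_of_nonneg (P.symbol_nonneg _ _)]
    refine (mul_le_of_le_one_left (norm_nonneg _) (P.symbol_le_one _ _)).trans ?_
    rw [← div_eq_mul_inv, le_div_iff₀ (by positivity), hd2, ← div_eq_mul_inv,
      le_div_iff₀ (by positivity)]
    have h2 : (2 ^ j : ℝ) ^ 2 ≤ 8 * (1 + |(k : ℝ)|) ^ 2 := by
      have : (0 : ℝ) < 2 ^ j := by positivity
      nlinarith
    calc _ ≤ ‖tc φ k‖ * (1 + |(k : ℝ)|) ^ 2 * (8 * (1 + |(k : ℝ)|) ^ 2) := by gcongr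
      _ = 8 * ((1 + |(k : ℝ)|) ^ 4 * ‖tc φ k‖) := by ring
      _ ≤ B * 8 := by linarith [h k]
  refine (Finset.sum_le_sum hk).trans ?_
  rw [← Finset.mul_sum]
  have h3 : ∑ k ∈ box (2 ^ j), ((1 + |(k : ℝ)|) ^ 2)⁻¹ ≤ S :=
    hS.sum_le_tsum _ fun k _ => by positivity
  have := dy_nonneg 2 j
  calc _ ≤ B * 8 * dy 2 j * S := by gcongr
    _ = _ := by ring

lemma isSmooth_trunc (n : ℕ) (c : FD) : IsSmooth (toDist (P.trunc n c)) ∧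
    fourier (toDist (P.trunc n c)) = P.trunc n c := by
  have hf := fourier_toDist (P.lit_trunc n c 1).slow
  obtain ⟨d, hd⟩ := P.specIn_low (n + 1) c
  refine ⟨isSmooth_of_tc (a := ∑ k ∈ box (2 ^ (n + 1)), d k • character k) ?_, hf⟩
  rw [hf, trunc, hd, tc, LinearMap.comp_apply, map_sum, poly_def]
  simp only [map_smul, tcirc_character]

lemma MemC.exists_smooth (ha : |a| ≤ 2) (h : P.MemC a u) {δ : ℝ≥0∞} (hδ : 0 < δ) :
    ∃ u', IsSmooth u' ∧ P.cnorm a (u' - u) < δ := by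
  obtain ⟨ε, hε, hεδ⟩ : ∃ ε : ℝ, 0 < ε ∧ ENNReal.ofReal (4 * ε) < δ := by
    obtain ⟨r, hr0, hr⟩ := ENNReal.lt_iff_exists_real_btwn.1 hδ
    exact ⟨r / 4, by have := ENNReal.ofReal_pos.1 hr.1; linarith,
      by rw [mul_div_cancel₀ _ (by norm_num)]; exact hr.2⟩
  obtain ⟨n, hn⟩ := (memC_iff.1 h).exists_trunc hε
  obtain ⟨h1, h2⟩ := P.isSmooth_trunc n (fourier u)
  refine ⟨_, h1, lt_of_le_of_lt (Bd.cnorm_le ha ?_) hεδ⟩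
  rw [fourier_sub, h2, ← neg_sub]
  exact hn.neg

lemma fourier_smoothCommutator (hu : IsSmooth u) (hv : IsSmooth v) (hw : IsSmooth w) :
    fourier (P.smoothCommutator u v w) = P.fcomm (fourier u) (fourier v) (fourier w) := by
  obtain ⟨φ, hφ⟩ := hu.exists_tc
  obtain ⟨ψ, hψ⟩ := hv.exists_tc
  obtain ⟨θ, hθ⟩ := hw.exists_tc
  obtain ⟨K, hu⟩ := P.bd_tc φ
  obtain ⟨L, hv⟩ := P.bd_tc ψ
  obtain ⟨M, hw⟩ := P.bd_tc θ
  rw [← hφ] at hu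
  rw [← hψ] at hv
  rw [← hθ] at hw
  obtain ⟨C1, -, hp⟩ := P.exists_bd_fpara_pos two_pos 2
  obtain ⟨C2, -, hr⟩ := P.exists_bd_fres (a := 2) (b := 2) (by norm_num)
  have hp := hp _ _ K L hu hv
  have hr := hr _ _ L M hv hw
  have e1 := fourier_para hu hv
  have e2 := fourier_res (by norm_num) hv hw
  rw [← e1] at hp
  rw [← e2] at hr
  rw [smoothCommutator, fourier_sub, fourier_res (by norm_num) hp hw, fourier_mul (by norm_num) hu hr,
    e1, e2, fcomm_eq_of_regular hu hv hw]

lemma isCommutator_toDist (ha : a < 1) (hbc : b + c < 0) (habc : 0 < a + b + c) (ha2 : |a| ≤ 2)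
    (hb2 : |b| ≤ 2) (hc2 : |c| ≤ 2) (hs2 : |a + b + c| ≤ 2) (hu : P.MemC a u) (hv : P.MemC b v)
    (hw : P.MemC c w) :
    fourier (toDist (P.fcomm (fourier u) (fourier v) (fourier w)))
        = P.fcomm (fourier u) (fourier v) (fourier w) ∧
      P.IsCommutator a b c u v w (toDist (P.fcomm (fourier u) (fourier v) (fourier w))) := by
  obtain ⟨K, hK⟩ := hu.exists_bd
  obtain ⟨L, hL⟩ := hv.exists_bd
  obtain ⟨M, hM⟩ := hw.exists_bd
  have hlit := lit_fcomm ha hbc habc hK (memC_iff.1 hv) hM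
  have hf := fourier_toDist hlit.slow
  refine ⟨hf, memC_iff.2 (by rwa [hf]), fun ε hε => ?_⟩
  obtain ⟨C, hC, hpb⟩ := exists_pb_fcomm P ha hbc habc
  have hK0 := hK.nonneg
  have hL0 := hL.nonneg
  have hM0 := hM.nonneg
  set K' := K + 4
  set L' := L + 4
  set M' := M + 4
  set Q := 4 * (C * (4 * L' * M' + K' * 4 * M' + K' * L' * 4)) + 1 with hQ
  have hQ0 : 0 < Q := by positivity
  obtain ⟨r, hr0, hr⟩ := ENNReal.lt_iff_exists_real_btwn.1 hε
  have hr0' : 0 < r := ENNReal.ofReal_pos.1 hr.1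
  set d := min 1 (r / Q) with hd
  have hd0 : 0 < d := lt_min one_pos (by positivity)
  have hd1 : d ≤ 1 := min_le_left _ _
  refine ⟨ENNReal.ofReal d, by simpa using hd0, fun u' v' w' su sv sw du dv dw => ?_⟩
  have pb : ∀ {e : ℝ} {x x' : TDist} {N : ℝ}, |e| ≤ 2 → P.Bd e (fourier x) N →
      P.cnorm e (x' - x) < ENNReal.ofReal d → P.PB e (fourier x') (fourier x) (N + 4) (4 * d) := by
    intro e x x' N he hx hdx
    have h1 := bd_of_cnorm_le he hd0.le hdx.le
    rw [fourier_sub] at h1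
    have h2 := h1.add hx
    rw [sub_add_cancel] at h2
    exact ⟨h2.mono (by linarith), hx.mono (by linarith), h1⟩
  have h := (hpb _ _ _ _ _ _ _ _ _ _ _ _ (pb ha2 hK du) (pb hb2 hL dv) (pb hc2 hM dw)).diff
  rw [← fourier_smoothCommutator su sv sw, ← hf, ← fourier_sub] at h
  refine lt_of_le_of_lt (Bd.cnorm_le hs2 h) (lt_of_le_of_lt (ENNReal.ofReal_le_ofReal ?_) hr.2)
  calc _ = (Q - 1) * d := by rw [hQ]; ring
    _ ≤ Q * (r / Q) := mul_le_mul (by linarith) (min_le_right _ _) hd0.le hQ0.le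
    _ = r := mul_div_cancel₀ _ hQ0.ne'

lemma IsCommutator.unique (ha2 : |a| ≤ 2) (hb2 : |b| ≤ 2) (hc2 : |c| ≤ 2) (hs2 : |a + b + c| ≤ 2)
    (hu : P.MemC a u) (hv : P.MemC b v) (hw : P.MemC c w) {r s : TDist}
    (hr : P.IsCommutator a b c u v w r) (hs : P.IsCommutator a b c u v w s) : r = s := by
  refine dist_ext (sub_eq_zero.1 (eq_zero_of_bd (P := P) (a := a + b + c) fun ε hε => ?_))
  have hε' : 0 < ENNReal.ofReal (ε / 8) := by simpa using hε
  obtain ⟨δ, hδ, h1⟩ := hr.2 _ hε'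
  obtain ⟨δ', hδ', h2⟩ := hs.2 _ hε'
  obtain ⟨u', su, du⟩ := hu.exists_smooth ha2 (lt_min hδ hδ')
  obtain ⟨v', sv, dv⟩ := hv.exists_smooth hb2 (lt_min hδ hδ')
  obtain ⟨w', sw, dw⟩ := hw.exists_smooth hc2 (lt_min hδ hδ')
  have h3 := bd_of_cnorm_le hs2 (by positivity) (h1 u' v' w' su sv sw
    (du.trans_le (min_le_left _ _)) (dv.trans_le (min_le_left _ _)) (dw.trans_le (min_le_left _ _))).le
  have h4 := bd_of_cnorm_le hs2 (by positivity) (h2 u' v' w' su sv sw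
    (du.trans_le (min_le_right _ _)) (dv.trans_le (min_le_right _ _))
    (dw.trans_le (min_le_right _ _))).le
  rw [fourier_sub] at h3 h4
  have := h4.sub h3
  rw [sub_sub_sub_cancel_left] at this
  exact this.mono (by linarith)

lemma fourier_commutator (ha : a < 1) (hbc : b + c < 0) (habc : 0 < a + b + c) (ha2 : |a| ≤ 2)
    (hb2 : |b| ≤ 2) (hc2 : |c| ≤ 2) (hs2 : |a + b + c| ≤ 2) (hu : P.MemC a u) (hv : P.MemC b v)
    (hw : P.MemC c w) :
    fourier (P.commutator a b c u v w) = P.fcomm (fourier u) (fourier v) (fourier w) := by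
  obtain ⟨hf, h⟩ := isCommutator_toDist ha hbc habc ha2 hb2 hc2 hs2 hu hv hw
  have hex : ∃ r, P.IsCommutator a b c u v w r := ⟨_, h⟩
  rw [commutator, dif_pos hex,
    IsCommutator.unique ha2 hb2 hc2 hs2 hu hv hw hex.choose_spec h, hf]

end DyadicPartition

/-! ### Continuous paths of distributions -/

namespace DyadicPartition

variable {P : DyadicPartition} {a b : ℝ}

lemma CB.exists_bd_Icc {s t : ℝ} {f : ℝ → FD} (h : P.CB (Icc s t) a f) :
    ∃ K, 0 ≤ K ∧ ∀ r ∈ Icc s t, P.Bd a (f r) K := by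
  refine isCompact_Icc.induction_on (p := fun S => ∃ K, 0 ≤ K ∧ ∀ r ∈ S, P.Bd a (f r) K)
    ⟨0, le_rfl, fun _ h => h.elim⟩ (fun _ _ hst ⟨K, h0, hK⟩ => ⟨K, h0, fun r hr => hK r (hst hr)⟩)
    (fun S S' ⟨K, h0, hK⟩ ⟨K', h0', hK'⟩ => ⟨K + K', by positivity, fun r hr => ?_⟩) fun r hr => ?_
  · rcases hr with hr | hr
    · exact (hK r hr).mono (by linarith)
    · exact (hK' r hr).mono (by linarith)
  · obtain ⟨K, hK0, -, hK⟩ := h.eventually_bd hr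
    exact ⟨_, hK, K, hK0, fun _ h => h⟩

lemma contC_iff {J : Set ℝ} {u : ℝ → TDist} : P.ContC J a u ↔
    P.CB J a (𝔉 u) ∧ ∀ t ∈ J, P.Lit a (fourier (u t)) := by
  have h2 : (0 : ℝ) < 2 ^ a := by positivity
  constructor
  · rintro ⟨h, hc⟩
    refine ⟨⟨fun t ht => (h t ht).exists_bd, fun t ht ε hε => ?_⟩, fun t ht => memC_iff.1 (h t ht)⟩
    have := ENNReal.tendsto_nhds_zero.1 (hc t ht) (ENNReal.ofReal (ε / 2 ^ a))
      (by simpa using by positivity)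
    filter_upwards [this] with s hs
    have := (cnorm_le_iff (by positivity)).1 hs
    rwa [mul_div_cancel₀ _ h2.ne', fourier_sub] at this
  · rintro ⟨h, hl⟩
    refine ⟨fun t ht => memC_iff.2 (hl t ht), fun t ht => ENNReal.tendsto_nhds_zero.2 fun ε hε => ?_⟩
    by_cases hε' : ε = ⊤
    · simp [hε']
    have hp := ENNReal.toReal_pos hε.ne' hε'
    filter_upwards [h.cont t ht ((2 : ℝ) ^ a * ε.toReal) (by positivity)] with s hs
    rw [← ENNReal.ofReal_toReal hε', cnorm_le_iff hp.le, fourier_sub]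
    exact hs

lemma exists_norm_apply_le (P : DyadicPartition) (b : ℝ) (φ : TestFn) : ∃ A : ℝ, 0 ≤ A ∧
    ∀ (w : TDist) (K : ℝ), P.Bd b (fourier w) K → ‖w.1 φ‖ ≤ A * K := by
  have hs := (summable_tc φ ⌈1 + |b|⌉₊).mul_left (dyS 1 * 3 ^ ⌈1 + |b|⌉₊)
  have hd := dyS_nonneg 1
  refine ⟨∑' k : ℤ, dyS 1 * 3 ^ ⌈1 + |b|⌉₊ * ((1 + |(k : ℝ)|) ^ ⌈1 + |b|⌉₊ * ‖tc φ k‖),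
    tsum_nonneg fun k => by positivity, fun w K h => ?_⟩
  rw [← (hasSum_dist w φ).tsum_eq, mul_comm, ← tsum_mul_left]
  refine tsum_of_norm_bounded (hs.mul_left K).hasSum fun k => ?_
  have := h.norm_coef_le (-k)
  push_cast at this
  rw [abs_neg, mul_pow] at this
  rw [norm_mul]
  calc _ ≤ ‖tc φ k‖ * (dyS 1 * K * (3 ^ ⌈1 + |b|⌉₊ * (1 + |(k : ℝ)|) ^ ⌈1 + |b|⌉₊)) := by gcongr
    _ = _ := by ring

lemma CB.continuousOn_apply {J : Set ℝ} {u : ℝ → TDist}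
    (h : P.CB J b (𝔉 u)) (φ : TestFn) : ContinuousOn (fun t => (u t).1 φ) J := by
  obtain ⟨A, hA, hb⟩ := P.exists_norm_apply_le b φ
  intro t ht
  rw [ContinuousWithinAt, Metric.tendsto_nhds]
  intro ε hε
  filter_upwards [h.cont t ht (ε / (A + 1)) (by positivity)] with s h1
  rw [dist_eq_norm]
  rw [← fourier_sub] at h1
  have h2 := hb _ _ h1
  rw [show (u s).1 φ - (u t).1 φ = (u s - u t).1 φ from rfl]
  refine h2.trans_lt ?_
  rw [mul_div_assoc', div_lt_iff₀ (by positivity)]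
  nlinarith

end DyadicPartition

/-! ### The heat equation -/

lemma heat_mul_neg (t : ℝ) (k : ℤ) : heat t k * heat (-t) k = 1 := by
  have := congrFun (heat_add t (-t)) k
  rw [add_neg_cancel, heat_zero] at this
  exact this.symm

lemma continuous_heat_coef (k : ℤ) : Continuous fun t => heat t k :=
  continuous_iff_continuousAt.2 fun t => (DyadicPartition.hasDerivAt_heat k t).continuousAt

/-- Variation of constants, for a single Fourier coefficient. -/
lemma eq_duh_of_hasDerivAt {t : ℝ} (ht : 0 ≤ t) {y F : ℝ → ℂ} {k : ℤ}
    (hy : ContinuousOn y (Icc 0 t))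
    (hd : ∀ r ∈ Ioo 0 t, HasDerivAt y (1 / 2 * (dsym k * dsym k) * y r + F r) r)
    (hi : IntervalIntegrable (fun r => heat (t - r) k * F r) volume 0 t) :
    y t = heat t k * y 0 + ∫ r in (0 : ℝ)..t, heat (t - r) k * F r := by
  have hc : Continuous fun r => heat (t - r) k := (continuous_heat_coef k).comp (by fun_prop)
  have := intervalIntegral.integral_eq_sub_of_hasDerivAt_of_le ht
    (f := fun r => heat (t - r) k * y r) (hc.continuousOn.mul hy) (fun r hr => ?_) hi
  · rw [this, sub_self, sub_zero, heat_zero, Pi.one_apply, one_mul]; ring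
  · have h1 : HasDerivAt (fun r => heat (t - r) k)
        (-(1 / 2 * (dsym k * dsym k) * heat (t - r) k)) r :=
      (DyadicPartition.hasDerivAt_heat k (t - r)).comp_const_sub t r
    exact (h1.mul (hd r hr)).congr_deriv (by ring)

lemma hasDerivAt_of_eq_duh {τ : ℝ} {y F : ℝ → ℂ} {k : ℤ} (hF : ContinuousOn F (Ioc 0 τ))
    (hi : ∀ t, 0 ≤ t → t ≤ τ → IntervalIntegrable (fun r => heat (t - r) k * F r) volume 0 t)
    (h : ∀ t, 0 ≤ t → t ≤ τ → y t = heat t k * y 0 + ∫ r in (0 : ℝ)..t, heat (t - r) k * F r)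
    {t : ℝ} (h0 : 0 < t) (ht : t < τ) :
    HasDerivAt y (1 / 2 * (dsym k * dsym k) * y t + F t) t := by
  have hsplit : ∀ t r, heat (t - r) k * F r = heat t k * (heat (-r) k * F r) := fun t r => by
    rw [sub_eq_add_neg, heat_add, Pi.mul_apply]; ring
  have hint : IntervalIntegrable (fun r => heat (-r) k * F r) volume 0 t := by
    have := (hi t h0.le ht.le).const_mul (heat (-t) k)
    refine this.congr fun r _ => ?_
    rw [hsplit, ← mul_assoc, mul_comm (heat (-t) k), heat_mul_neg, one_mul]
  have hFc : ContinuousAt (fun r => heat (-r) k * F r) t :=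
    ((continuous_heat_coef k).comp continuous_neg).continuousAt.mul
      (hF.continuousAt (Ioc_mem_nhds h0 ht))
  have hsm : StronglyMeasurableAtFilter (fun r => heat (-r) k * F r) (𝓝 t) := by
    refine ContinuousOn.stronglyMeasurableAtFilter (s := Ioo 0 τ) isOpen_Ioo ?_ t ⟨h0, ht⟩
    exact ((continuous_heat_coef k).comp continuous_neg).continuousOn.mul
      (hF.mono Ioo_subset_Ioc_self)
  have hd := (DyadicPartition.hasDerivAt_heat k t).mul
    ((intervalIntegral.integral_hasDerivAt_right hint hsm hFc).const_add (y 0))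
  have hy : ∀ᶠ r in 𝓝 t, y r
      = heat r k * (y 0 + ∫ s in (0 : ℝ)..r, heat (-s) k * F s) := by
    filter_upwards [Ioo_mem_nhds h0 ht] with r hr
    rw [h r hr.1.le hr.2.le, mul_add, ← intervalIntegral.integral_const_mul]
    simp only [hsplit]
  refine (hd.congr_of_eventuallyEq hy).congr_deriv ?_
  rw [hy.self_of_nhds, ← mul_assoc (heat t k), heat_mul_neg]
  ring

lemma half_dx_dx_add (f F : TDist) (φ : TestFn) :
    (1 / 2 : ℂ) * (dx (dx f)).1 φ + F.1 φ = ((1 / 2 : ℂ) • dx (dx f) + F).1 φ := rfl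

lemma fourier_half_dx_dx_add (f F : TDist) (k : ℤ) :
    fourier ((1 / 2 : ℂ) • dx (dx f) + F) k
      = 1 / 2 * (dsym k * dsym k) * fourier f k + fourier F k := by
  rw [fourier_add, fourier_smul, fourier_dx, fourier_dx]
  simp only [Pi.add_apply, Pi.smul_apply, Pi.mul_apply, smul_eq_mul]
  ring

/-- Distributional solutions of the heat equation are mild solutions. -/
lemma SolvesHeat.eq_duh {τ : ℝ} {f F : ℝ → TDist} (h : SolvesHeat τ f F)
    (hf : ∀ k, ContinuousOn (fun t => fourier (f t) k) (Icc 0 τ))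
    (hF : ∀ k, ContinuousOn (fun t => fourier (F t) k) (Ioc 0 τ))
    (hi : ∀ t, 0 ≤ t → t ≤ τ → ∀ k,
      IntervalIntegrable (fun r => heat (t - r) k * fourier (F r) k) volume 0 t)
    {t : ℝ} (h0 : 0 ≤ t) (ht : t ≤ τ) :
    fourier (f t) = heat t * fourier (f 0) + duh (𝔉 F) t := by
  ext k
  refine eq_duh_of_hasDerivAt (y := fun t => fourier (f t) k) (F := fun t => fourier (F t) k) h0
    ((hf k).mono (Icc_subset_Icc_right ht)) (fun r hr => ?_) (hi t h0 ht k)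
  set H := fun r => 1 / 2 * (dsym k * dsym k) * fourier (f r) k + fourier (F r) k with hH
  have hHc : ContinuousOn H (Ioc 0 τ) := (((hf k).mono Ioc_subset_Icc_self).const_mul _).add (hF k)
  have hfk : ∀ s t, 0 < s → s ≤ t → t ≤ τ →
      IntervalIntegrable H volume s t ∧ fourier (f t) k - fourier (f s) k = ∫ r in s..t, H r := by
    intro s t h0 hst ht
    obtain ⟨h1, h2⟩ := h (character (-k)) s t h0 hst ht
    have e : (fun r => (1 / 2 : ℂ) * (dx (dx (f r))).1 (character (-k)) + (F r).1 (character (-k)))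
        = H := funext fun r => by rw [half_dx_dx_add]; exact fourier_half_dx_dx_add _ _ _
    rw [e] at h1 h2
    exact ⟨h1, h2⟩
  have hr2 : r < τ := hr.2.trans_le ht
  have hr0 : 0 < r / 2 := by linarith [hr.1]
  have hrr : r / 2 < r := by linarith [hr.1]
  have hsm : StronglyMeasurableAtFilter H (𝓝 r) :=
    ContinuousOn.stronglyMeasurableAtFilter (s := Ioo 0 τ) isOpen_Ioo
      (hHc.mono Ioo_subset_Ioc_self) r ⟨hr.1, hr2⟩
  have hd := (intervalIntegral.integral_hasDerivAt_right (hfk (r / 2) r hr0 hrr.le hr2.le).1 hsm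
    (hHc.continuousAt (Ioc_mem_nhds hr.1 hr2))).const_add (fourier (f (r / 2)) k)
  refine hd.congr_of_eventuallyEq ?_
  filter_upwards [Ioo_mem_nhds hrr hr2] with s hs
  rw [← (hfk (r / 2) s hr0 hs.1.le hs.2.le).2]; ring

namespace DyadicPartition

variable {P : DyadicPartition} {a b : ℝ}

/-- Mild solutions of the heat equation are distributional solutions. -/
lemma solvesHeat_of_eq_duh {τ : ℝ} {f F : ℝ → TDist}
    (hf : P.CB (Ioc 0 τ) a (𝔉 f))
    (hF : P.CB (Ioc 0 τ) b (𝔉 F))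
    (hi : ∀ t, 0 ≤ t → t ≤ τ → ∀ k,
      IntervalIntegrable (fun r => heat (t - r) k * fourier (F r) k) volume 0 t)
    (h : ∀ t, 0 ≤ t → t ≤ τ →
      fourier (f t) = heat t * fourier (f 0) + duh (𝔉 F) t) :
    SolvesHeat τ f F := by
  intro φ s t h0 hst ht
  set H : ℝ → TDist := fun r => (1 / 2 : ℂ) • dx (dx (f r)) + F r with hH
  have hsub : Icc s t ⊆ Ioc 0 τ := fun r hr => ⟨h0.trans_le hr.1, hr.2.trans ht⟩
  have hHcb : P.CB (Icc s t) (min (a - 1 - 1) b) (𝔉 H) := by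
    refine ((((hf.deriv.deriv.smul (1 / 2 : ℂ)).exp_mono (min_le_left _ b)).add
      (hF.exp_mono (min_le_right (a - 1 - 1) b))).congr fun r _ => ?_).mono_set hsub
    rw [hH, fourier_add, fourier_smul, fourier_dx, fourier_dx]
  have hHφ : ContinuousOn (fun r => (H r).1 φ) (uIcc s t) := by
    rw [uIcc_of_le hst]; exact hHcb.continuousOn_apply φ
  refine ⟨hHφ.intervalIntegrable, ?_⟩
  have hk : ∀ k, fourier (f t) k - fourier (f s) k = ∫ r in s..t, fourier (H r) k := by
    intro k
    refine (intervalIntegral.integral_eq_sub_of_hasDerivAt_of_le hst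
      (f := fun t => fourier (f t) k) ((hf.continuousOn_coef k).mono hsub) (fun r hr => ?_) ?_).symm
    · rw [fourier_half_dx_dx_add]
      exact hasDerivAt_of_eq_duh (y := fun t => fourier (f t) k) (F := fun t => fourier (F t) k)
        (hF.continuousOn_coef k) (fun t h0 ht => hi t h0 ht k)
        (fun t h0 ht => congrFun (h t h0 ht) k) (h0.trans hr.1) (hr.2.trans_le ht)
    · refine ContinuousOn.intervalIntegrable ?_
      rw [uIcc_of_le hst]; exact hHcb.continuousOn_coef k
  obtain ⟨K, hK0, hK⟩ := hHcb.exists_bd_Icc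
  set p := ⌈1 + |min (a - 1 - 1) b|⌉₊ with hp
  have hbound : ∀ k : ℤ, ∀ r ∈ Icc s t, ‖tc φ k * fourier (H r) (-k)‖
      ≤ K * (dyS 1 * 3 ^ p * ((1 + |(k : ℝ)|) ^ p * ‖tc φ k‖)) := by
    intro k r hr
    have := (hK r hr).norm_coef_le (-k)
    push_cast at this
    rw [abs_neg, mul_pow, ← hp] at this
    rw [norm_mul]
    calc _ ≤ ‖tc φ k‖ * (dyS 1 * K * (3 ^ p * (1 + |(k : ℝ)|) ^ p)) := by gcongr
      _ = _ := by ring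
  have hsum := ((summable_tc φ p).mul_left (dyS 1 * 3 ^ p)).mul_left K
  have h1 := intervalIntegral.hasSum_integral_of_dominated_convergence (μ := volume) (a := s) (b := t)
    (F := fun (k : ℤ) r => tc φ k * fourier (H r) (-k)) (f := fun r => (H r).1 φ)
    (fun k _ => K * (dyS 1 * 3 ^ p * ((1 + |(k : ℝ)|) ^ p * ‖tc φ k‖)))
    (fun k => by
      rw [uIoc_of_le hst]
      exact (((hHcb.continuousOn_coef (-k)).const_mul _).mono Ioc_subset_Icc_self).aestronglyMeasurable
        measurableSet_Ioc)
    (fun k => Eventually.of_forall fun r hr => hbound k r (by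
      rw [uIoc_of_le hst] at hr; exact Ioc_subset_Icc_self hr))
    (Eventually.of_forall fun r _ => hsum) (by simp)
    (Eventually.of_forall fun r _ => hasSum_dist (H r) φ)
  have h2 := (hasSum_dist (f t) φ).sub (hasSum_dist (f s) φ)
  refine h2.unique (h1.congr_fun fun k => ?_)
  rw [intervalIntegral.integral_const_mul, ← hk]; ring

end DyadicPartition

/-- The Fourier coefficients of the components of a driving term. -/
def DrivingTerm.coefs (X : DrivingTerm) : FDriv where
  XI t := fourier (X.XI t)
  XY t := fourier (X.XY t)
  XW t := fourier (X.XW t)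
  XB t := fourier (X.XB t)
  XD t := fourier (X.XD t)
  XK t := fourier (X.XK t)
  XC t := fourier (X.XC t)

namespace DyadicPartition

variable {P : DyadicPartition} {α β γ a T : ℝ}

/-! ### Norms of paths of distributions -/

lemma supNorm_lt_top {u : ℝ → TDist} (h : P.ContC (Icc 0 T) a u) : P.supNorm T a u < ⊤ := by
  obtain ⟨K, hK0, hK⟩ := (contC_iff.1 h).1.exists_bd_Icc
  refine lt_of_le_of_lt (iSup₂_le fun t ht => (cnorm_le_iff (K := K / 2 ^ a) (by positivity)).2 ?_)
    ENNReal.ofReal_lt_top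
  rw [mul_div_cancel₀ _ (by positivity)]
  exact hK t ht

lemma supNorm_le_iff {u : ℝ → TDist} {x : ℝ≥0∞} :
    P.supNorm T a u ≤ x ↔ ∀ t ∈ Icc 0 T, P.cnorm a (u t) ≤ x := iSup₂_le_iff

lemma holderNorm_le_iff {δ : ℝ} {u : ℝ → TDist} {x : ℝ≥0∞} : P.holderNorm T δ a u ≤ x ↔
    ∀ s t, 0 ≤ s → s < t → t ≤ T → P.cnorm a (u t - u s) ≤ x * ENNReal.ofReal ((t - s) ^ δ) := by
  simp only [holderNorm, iSup_le_iff]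
  refine forall_congr' fun s => forall_congr' fun t => ⟨fun h h0 hst ht => ?_, fun h hst => ?_⟩
  · have hp : 0 < (t - s) ^ δ := Real.rpow_pos_of_pos (by linarith) _
    exact (ENNReal.div_le_iff (by simpa using hp) ENNReal.ofReal_ne_top).1 (h ⟨h0, hst, ht⟩)
  · have hp : 0 < (t - s) ^ δ := Real.rpow_pos_of_pos (by linarith [hst.2.1]) _
    exact (ENNReal.div_le_iff (by simpa using hp) ENNReal.ofReal_ne_top).2 (h hst.1 hst.2.1 hst.2.2)

lemma wSupNorm_le_iff {η : ℝ} {u : ℝ → TDist} {K : ℝ} (hK : 0 ≤ K) :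
    P.wSupNorm T η a u ≤ ENNReal.ofReal K ↔
      ∀ t, 0 < t → t ≤ T → P.cnorm a (u t) ≤ ENNReal.ofReal (K * t ^ (-η)) := by
  simp only [wSupNorm, iSup_le_iff]
  refine forall_congr' fun t => ⟨fun h h0 ht => ?_, fun h ht => ?_⟩
  · have hp : 0 < t ^ η := Real.rpow_pos_of_pos h0 _
    have := h ⟨h0, ht⟩
    rw [Real.rpow_neg h0.le, ENNReal.ofReal_mul hK, ENNReal.ofReal_inv_of_pos hp, ← div_eq_mul_inv]
    refine (ENNReal.le_div_iff_mul_le (Or.inl (by simpa using hp))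
      (Or.inl ENNReal.ofReal_ne_top)).2 ?_
    rwa [mul_comm]
  · have hp : 0 < t ^ η := Real.rpow_pos_of_pos ht.1 _
    have := h ht.1 ht.2
    rw [Real.rpow_neg ht.1.le, ENNReal.ofReal_mul hK, ENNReal.ofReal_inv_of_pos hp,
      ← div_eq_mul_inv] at this
    rw [mul_comm]
    exact (ENNReal.le_div_iff_mul_le (Or.inl (by simpa using hp))
      (Or.inl ENNReal.ofReal_ne_top)).1 this

lemma wHolderNorm_le_iff {η δ : ℝ} {u : ℝ → TDist} {K : ℝ} (hK : 0 ≤ K) :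
    P.wHolderNorm T η δ a u ≤ ENNReal.ofReal K ↔ ∀ s t, 0 < s → s < t → t ≤ T →
      P.cnorm a (u t - u s) ≤ ENNReal.ofReal (K * s ^ (-η) * (t - s) ^ δ) := by
  simp only [wHolderNorm, iSup_le_iff]
  have key : ∀ s t, 0 < s ∧ s < t ∧ t ≤ T → (ENNReal.ofReal (s ^ η) *
      (P.cnorm a (u t - u s) / ENNReal.ofReal ((t - s) ^ δ)) ≤ ENNReal.ofReal K ↔
      P.cnorm a (u t - u s) ≤ ENNReal.ofReal (K * s ^ (-η) * (t - s) ^ δ)) := by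
    intro s t h
    have hp : 0 < s ^ η := Real.rpow_pos_of_pos h.1 _
    have hq : 0 < (t - s) ^ δ := Real.rpow_pos_of_pos (by linarith [h.2.1]) _
    rw [Real.rpow_neg h.1.le, ENNReal.ofReal_mul (by positivity), ENNReal.ofReal_mul hK,
      ENNReal.ofReal_inv_of_pos hp, ← div_eq_mul_inv, mul_comm,
      ← ENNReal.le_div_iff_mul_le (Or.inl (by simpa using hp)) (Or.inl ENNReal.ofReal_ne_top),
      ENNReal.div_le_iff (by simpa using hq) ENNReal.ofReal_ne_top]
  exact forall_congr' fun s => forall_congr' fun t =>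
    ⟨fun h h0 hst ht => (key s t ⟨h0, hst, ht⟩).1 (h ⟨h0, hst, ht⟩),
      fun h hst => (key s t hst).2 (h hst.1 hst.2.1 hst.2.2)⟩

lemma WL.wlNorm_le {η K : ℝ} {u : ℝ → TDist} (h1 : |a| ≤ 2) (h2 : |a - 2 * η| ≤ 2)
    (h3 : |a - 1 / 2| ≤ 2) (hK : 0 ≤ K) (h : P.WL T η a K (𝔉 u)) :
    P.wlNorm T η a (1 / 4) u ≤ ENNReal.ofReal (12 * K) := by
  have e : a - 2 * (1 / 4) = a - 1 / 2 := by ring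
  rw [wlNorm, e, show 12 * K = 4 * K + 4 * K + 4 * K by ring,
    ENNReal.ofReal_add (by positivity) (by positivity), ENNReal.ofReal_add (by positivity) (by positivity)]
  refine add_le_add (add_le_add ?_ ?_) ?_
  · refine (wSupNorm_le_iff (by positivity)).2 fun t h0 ht => ?_
    rw [mul_assoc]; exact (h.sup t h0 ht).cnorm_le h1
  · exact supNorm_le_iff.2 fun t ht => (h.low t ht.1 ht.2).cnorm_le h2
  · refine (wHolderNorm_le_iff (by positivity)).2 fun s t hs hst ht => ?_
    rw [mul_assoc 4, mul_assoc 4]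
    exact Bd.cnorm_le h3 (u := u t - u s) (h.hol s t hs hst ht)

lemma exists_wl {η : ℝ} {u : ℝ → TDist} (h1 : |a| ≤ 2) (h2 : |a - 2 * η| ≤ 2)
    (h3 : |a - 1 / 2| ≤ 2) (h : P.MemWL T η a (1 / 4) u) :
    ∃ K, P.WL T η a K (𝔉 u) := by
  obtain ⟨⟨-, hs⟩, hc, -, hh⟩ := h
  have hl := supNorm_lt_top hc
  have e : a - 2 * (1 / 4) = a - 1 / 2 := by ring
  rw [e] at hh
  set x := (P.wSupNorm T η a u).toReal + (P.supNorm T (a - 2 * η) u).toReal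
    + (P.wHolderNorm T η (1 / 4) (a - 1 / 2) u).toReal with hx
  have p1 : 0 ≤ (P.wSupNorm T η a u).toReal := ENNReal.toReal_nonneg
  have p2 : 0 ≤ (P.supNorm T (a - 2 * η) u).toReal := ENNReal.toReal_nonneg
  have p3 : 0 ≤ (P.wHolderNorm T η (1 / 4) (a - 1 / 2) u).toReal := ENNReal.toReal_nonneg
  have hx0 : 0 ≤ x := by positivity
  have b1 := (wSupNorm_le_iff hx0).1 (ENNReal.le_ofReal_iff_toReal_le hs.ne hx0 |>.2 (by linarith))
  have b2 := supNorm_le_iff.1 (ENNReal.le_ofReal_iff_toReal_le hl.ne hx0 |>.2 (by linarith))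
  have b3 := (wHolderNorm_le_iff hx0).1 (ENNReal.le_ofReal_iff_toReal_le hh.ne hx0 |>.2 (by linarith))
  refine ⟨4 * x, fun t h0 ht => ?_, fun t h0 ht => bd_of_cnorm_le h2 hx0 (b2 t ⟨h0, ht⟩),
    fun s t hs hst ht => ?_⟩
  · rw [mul_assoc]; exact bd_of_cnorm_le h1 (by positivity) (b1 t h0 ht)
  · rw [mul_assoc 4, mul_assoc 4]
    have : 0 ≤ t - s := by linarith
    exact bd_of_cnorm_le (u := u t - u s) h3 (by positivity) (b3 s t hs hst ht)

/-! ### Driving terms -/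

lemma IsDriving.norm_lt_top {X : DrivingTerm} (h : P.IsDriving α T X) :
    P.drivingNorm α T X < ⊤ := by
  obtain ⟨h1, h2, h3, h4, h5, h6, h7, -⟩ := h
  simp only [drivingNorm, lNorm, ENNReal.add_lt_top]
  exact ⟨⟨⟨⟨⟨⟨supNorm_lt_top h1, supNorm_lt_top h2⟩, supNorm_lt_top h3.1, h3.2.2⟩,
    supNorm_lt_top h4⟩, supNorm_lt_top h5⟩, supNorm_lt_top h6⟩, supNorm_lt_top h7⟩

lemma drP_zero_of_le (h0 : 0 < α) (h1 : α < 1 / 2) {X : DrivingTerm} {m : ℝ} (hm : 0 ≤ m)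
    (h : P.drivingNorm α T X ≤ ENNReal.ofReal m) :
    P.DrP α T (4 * m) (4 * m) X.coefs FDriv.zero := by
  rw [drivingNorm, lNorm] at h
  have e : α + 1 - 2 * (1 / 4) = α + 1 - 1 / 2 := by ring
  rw [e] at h
  have h6 := le_self_add.trans h
  have h5 := le_self_add.trans h6
  have h4 := le_self_add.trans h5
  have h3 := le_self_add.trans h4
  have h2 := le_self_add.trans h3
  have hW := le_add_self.trans h3
  have s : ∀ {a : ℝ} {u : ℝ → TDist}, |a| ≤ 2 → P.supNorm T a u ≤ ENNReal.ofReal m →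
      ∀ t ∈ Icc 0 T, P.PB a (fourier (u t)) 0 (4 * m) (4 * m) := fun ha hu t ht =>
    .zero_right (bd_of_cnorm_le ha hm (supNorm_le_iff.1 hu t ht))
  have r : ∀ {x : ℝ}, -2 ≤ x → x ≤ 2 → |x| ≤ 2 := fun h h' => abs_le.2 ⟨h, h'⟩
  exact
  { XI := s (r (by linarith) (by linarith)) (le_self_add.trans h2)
    XY := s (r (by linarith) (by linarith)) (le_add_self.trans h2)
    XW := s (r (by linarith) (by linarith)) (le_self_add.trans hW)
    XWh := fun s t hs hst ht => by
      have h8 := holderNorm_le_iff.1 (le_add_self.trans hW) s t hs hst ht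
      have hp : 0 ≤ (t - s) ^ (1 / 4 : ℝ) := Real.rpow_nonneg (by linarith) _
      rw [← ENNReal.ofReal_mul hm] at h8
      have := PB.zero_right (bd_of_cnorm_le (r (by linarith) (by linarith)) (by positivity) h8)
      rw [fourier_sub, ← mul_assoc] at this
      rw [show FDriv.zero.XW t - FDriv.zero.XW s = 0 from sub_self _]
      exact this
    XB := s (r (by linarith) (by linarith)) (le_add_self.trans h4)
    XD := s (r (by linarith) (by linarith)) (le_add_self.trans h5)
    XK := s (r (by linarith) (by linarith)) (le_add_self.trans h6)
    XC := s (r (by linarith) (by linarith)) (le_add_self.trans h) }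

lemma PB.of_sub_left {K d : ℝ} {u v : FD} (h : P.Bd a u K) (h' : P.Bd a (v - u) d) :
    P.PB a v u (K + d) d :=
  ⟨by have := h.add h'; rwa [add_sub_cancel] at this, h.mono (by linarith [h'.nonneg]), h'⟩

lemma drP_of_le (h0 : 0 < α) (h1 : α < 1 / 2) {X X' : DrivingTerm} {m e : ℝ} (hm : 0 ≤ m)
    (he : 0 ≤ e) (h : P.drivingNorm α T X ≤ ENNReal.ofReal m)
    (h' : P.drivingNorm α T (X'.diff X) ≤ ENNReal.ofReal e) :
    P.DrP α T (4 * m + 4 * e) (4 * e) X'.coefs X.coefs := by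
  have b := drP_zero_of_le h0 h1 hm h
  have b' := drP_zero_of_le h0 h1 he h'
  exact
  { XI := fun t ht => .of_sub_left (b.XI t ht).left (b'.XI t ht).left
    XY := fun t ht => .of_sub_left (b.XY t ht).left (b'.XY t ht).left
    XW := fun t ht => .of_sub_left (b.XW t ht).left (b'.XW t ht).left
    XWh := fun s t hs hst ht => by
      rw [add_mul]
      refine .of_sub_left (b.XWh s t hs hst ht).left ?_
      have := (b'.XWh s t hs hst ht).left
      rw [sub_sub_sub_comm]
      exact this
    XB := fun t ht => .of_sub_left (b.XB t ht).left (b'.XB t ht).left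
    XD := fun t ht => .of_sub_left (b.XD t ht).left (b'.XD t ht).left
    XK := fun t ht => .of_sub_left (b.XK t ht).left (b'.XK t ht).left
    XC := fun t ht => .of_sub_left (b.XC t ht).left (b'.XC t ht).left }

lemma IsDriving.drC {X : DrivingTerm} (h : P.IsDriving α T X) : P.DrC α T X.coefs := by
  obtain ⟨h1, h2, h3, h4, h5, h6, h7, h8⟩ := h
  have c1 := (contC_iff.1 h1).1
  have c6 := (contC_iff.1 h6).1
  refine ⟨c1, (contC_iff.1 h2).1, (contC_iff.1 h3.1).1, (contC_iff.1 h4).1, (contC_iff.1 h5).1, c6,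
    (contC_iff.1 h7).1, fun t ht => ?_⟩
  have cd := c1.deriv
  obtain ⟨K, hK0, hK⟩ := cd.exists_bd_Icc
  have := SolvesHeat.eq_duh h8 (fun k => c6.continuousOn_coef k)
    (fun k => by
      simp only [fourier_dx]
      exact (cd.continuousOn_coef k).mono Ioc_subset_Icc_self)
    (fun t h0 ht k => by
      simp only [fourier_dx]
      rcases h0.eq_or_lt with rfl | h0
      · exact IntervalIntegrable.refl
      · exact duh_integrable_of_bd (fun r hr0 hr => hK r ⟨hr0.le, hr⟩)
          (fun k => (cd.continuousOn_coef k).mono Ioc_subset_Icc_self) h0 ht k) ht.1 ht.2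
  simp only [fourier_dx] at this
  exact this

/-! ### The solution space -/

lemma memWL_of_wl {η K : ℝ} {u : ℝ → TDist} (h1 : |a| ≤ 2) (h2 : |a - 2 * η| ≤ 2)
    (h3 : |a - 1 / 2| ≤ 2) (hη : 0 ≤ η) (hK : 0 ≤ K) (h : P.WL T η a K (𝔉 u))
    (hc : P.CB (Ioc 0 T) a (𝔉 u)) (hl : ∀ t ∈ Ioc 0 T, P.Lit a (fourier (u t)))
    (hc0 : P.CB (Icc 0 T) (a - 2 * η) (𝔉 u))
    (hl0 : P.Lit (a - 2 * η) (fourier (u 0))) : P.MemWL T η a (1 / 4) u := by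
  have hn := (h.wlNorm_le h1 h2 h3 hK).trans_lt ENNReal.ofReal_lt_top
  have h12 : a - 2 * (1 / 4) ≤ a := by linarith
  simp only [wlNorm, ENNReal.add_lt_top] at hn
  refine ⟨⟨contC_iff.2 ⟨hc, hl⟩, hn.1.1⟩, contC_iff.2 ⟨hc0, fun t ht => ?_⟩,
    contC_iff.2 ⟨hc.exp_mono h12, fun t ht => (hl t ht).exp_mono h12⟩, hn.2⟩
  rcases ht.1.eq_or_lt with rfl | h0
  · exact hl0
  · exact (hl t ⟨h0, ht.2⟩).exp_mono (by linarith)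

lemma _root_.ParaKPZ.Exps.abs_le (E : Exps α β γ) : (|β + 1| ≤ 2 ∧ |β + 1 - 2 * ((β - γ) / 2)| ≤ 2 ∧
    |β + 1 - 1 / 2| ≤ 2) ∧ |2 * β + 1| ≤ 2 ∧ |2 * β + 1 - 2 * (β - γ)| ≤ 2 ∧
    |2 * β + 1 - 1 / 2| ≤ 2 := by
  obtain ⟨h1, h2, h3, h4, h5⟩ := E
  refine ⟨⟨?_, ?_, ?_⟩, ?_, ?_, ?_⟩ <;> rw [_root_.abs_le] <;> constructor <;> linarith

lemma SB.dNorm_le (E : Exps α β γ) {K : ℝ} {f g : ℝ → TDist} (hK : 0 ≤ K)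
    (h : P.SB β γ T K (𝔉 f) (𝔉 g)) :
    P.dNorm β γ T f g ≤ ENNReal.ofReal (24 * K) := by
  obtain ⟨⟨a1, a2, a3⟩, b1, b2, b3⟩ := E.abs_le
  rw [dNorm, show 24 * K = 12 * K + 12 * K by ring, ENNReal.ofReal_add (by positivity) (by positivity)]
  exact add_le_add (h.wf.wlNorm_le a1 a2 a3 hK) (h.wg.wlNorm_le b1 b2 b3 hK)

lemma MemD.exists_sb (E : Exps α β γ) {f g : ℝ → TDist} (h : P.MemD β γ T f g) :
    ∃ K, P.SB β γ T K (𝔉 f) (𝔉 g) := by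
  obtain ⟨⟨a1, a2, a3⟩, b1, b2, b3⟩ := E.abs_le
  obtain ⟨K, hK⟩ := exists_wl a1 a2 a3 h.1
  obtain ⟨L, hL⟩ := exists_wl b1 b2 b3 h.2
  exact ⟨max K L, hK.mono (le_max_left _ _), hL.mono (le_max_right _ _)⟩

/-! ### The right-hand sides -/

lemma fourier_rhsF {X : DrivingTerm} {f g : ℝ → TDist} {t b K L : ℝ}
    (hu : P.Bd a (fU X.coefs (𝔉 f) (𝔉 g) t) K)
    (hI : P.Bd b (X.coefs.XI t) L) : fourier (P.rhsF X f g t)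
      = P.fF X.coefs (𝔉 f) (𝔉 g) t := by
  obtain ⟨C, -, hC⟩ := P.exists_bd_deriv b
  have hI' := hC _ _ hI
  have e : fourier (dx (X.XI t)) = dsym * X.coefs.XI t := fourier_dx _
  have eu : fourier (uTerm X f g t)
      = fU X.coefs (𝔉 f) (𝔉 g) t := fourier_dx _
  rw [← e] at hI'
  rw [← eu] at hu
  rw [rhsF, fourier_para hu hI', e, eu, fF]

lemma fourier_rhsG (E : Exps α β γ) {X : DrivingTerm} {f g : ℝ → TDist} {t R : ℝ}
    (hX : P.IsDriving α T X) (ht : t ∈ Icc 0 T) (hf : P.Lit (β + 1) (fourier (f t)))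
    (hg : P.Lit (2 * β + 1) (fourier (g t)))
    (hR : P.Bd (2 * β) (dsym * fourier (f t) - P.fpara
      (fU X.coefs (𝔉 f) (𝔉 g) t) (dsym * X.coefs.XK t)) R) :
    P.ResConverges (P.remainder X f g t) (dx (X.XI t)) ∧ fourier (P.rhsG α β X f g t)
      = P.fG₁ X.coefs (𝔉 f) (𝔉 g) t
        + P.fG₂ X.coefs (𝔉 f) (𝔉 f)
            (𝔉 g) t := by
  obtain ⟨h1, h2, h3, h4, h5⟩ := id E
  obtain ⟨x1, x2, x3, x4, x5, x6, x7, -⟩ := hX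
  have lI := lit_deriv (P := P) (memC_iff.1 (x1.1 t ht))
  have lK := lit_deriv (P := P) (memC_iff.1 (x6.1 t ht))
  have lY := lit_deriv (P := P) (memC_iff.1 (x2.1 t ht))
  have lW := memC_iff.1 (x3.1.1 t ht)
  have lg := lit_deriv (P := P) hg
  have lu : P.Lit β (fU X.coefs (𝔉 f) (𝔉 g) t) := by
    have := lit_deriv (P := P) (((lW.exp_mono (by linarith : β + 1 ≤ α + 1)).add hf).add
      (hg.exp_mono (by linarith : β + 1 ≤ 2 * β + 1)))
    rwa [add_sub_cancel_right] at this
  have eu : fourier (uTerm X f g t)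
      = fU X.coefs (𝔉 f) (𝔉 g) t := fourier_dx _
  rw [add_sub_cancel_right] at lK lg
  rw [← eu] at lu hR
  rw [← fourier_dx] at lI lK lY lg
  obtain ⟨Ku, bu⟩ := lu.exists_bd
  obtain ⟨KI, bI⟩ := lI.exists_bd
  obtain ⟨KK, bK⟩ := lK.exists_bd
  obtain ⟨KY, bY⟩ := lY.exists_bd
  obtain ⟨Kg, bg⟩ := lg.exists_bd
  obtain ⟨KC, bC⟩ := (x7.1 t ht).exists_bd
  have er : fourier (P.remainder X f g t)
      = dsym * fourier (f t) - P.fpara (fourier (uTerm X f g t)) (dsym * X.coefs.XK t) := by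
    rw [remainder, fourier_sub, fourier_dx, fourier_para bu bK]
    congr 2
    exact fourier_dx _
  rw [← er] at hR
  have hpos : 0 < 2 * β + (α - 1) := by linarith
  refine ⟨⟨_, (isDistLimit_res hpos hR bI).1⟩, ?_⟩
  have r : ∀ {x : ℝ}, -2 ≤ x → x ≤ 2 → |x| ≤ 2 := fun h h' => _root_.abs_le.2 ⟨h, h'⟩
  have ec := fourier_commutator (P := P) (a := β) (b := α) (c := α - 1) (by linarith) (by linarith)
    (by linarith) (r (by linarith) (by linarith)) (r (by linarith) (by linarith))
    (r (by linarith) (by linarith)) (r (by linarith) (by linarith)) (memC_iff.2 lu) (memC_iff.2 lK)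
    (memC_iff.2 lI)
  have eI : dsym * X.coefs.XI t = fourier (dx (X.XI t)) := (fourier_dx _).symm
  have eK : dsym * X.coefs.XK t = fourier (dx (X.XK t)) := (fourier_dx _).symm
  have eY : dsym * X.coefs.XY t = fourier (dx (X.XY t)) := (fourier_dx _).symm
  simp only [rhsG, fourier_add, fourier_smul]
  rw [ec, fourier_mul (by linarith) bu bC, fourier_res hpos hR bI, fourier_res hpos bg bI,
    fourier_para bI bu, fourier_mul (by linarith) bu bY, fourier_mul (by linarith) bu bu, er, fG₁, fG₂,
    src, ← eu, ← fourier_dx (g t), eI, eK, eY]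
  simp only [DrivingTerm.coefs]
  abel

/-! ### Distributional and mild solutions -/

lemma FSol.congr {τ : ℝ} {X : FDriv} {f₀ g₀ : FD} {f g f' g' : ℝ → FD}
    (h : P.FSol β γ τ X f₀ g₀ f g) (hf : ∀ t, 0 ≤ t → t ≤ τ → f' t = f t ∧ g' t = g t) :
    P.FSol β γ τ X f₀ g₀ f' g' := by
  have hU : ∀ t, 0 ≤ t → t ≤ τ → fU X f' g' t = fU X f g t := fun t h0 ht => by
    rw [fU, fU, (hf t h0 ht).1, (hf t h0 ht).2]
  have hΦ : ∀ t, 0 ≤ t → t ≤ τ → P.Φ₁ X f₀ f' g' t = P.Φ₁ X f₀ f g t := fun t h0 ht => by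
    rw [Φ₁, Φ₁]
    congr 1
    exact duh_congr h0 fun r hr0 hr => by rw [fF, fF, hU r hr0.le (hr.trans ht)]
  refine ⟨⟨h.adm.cf.congr fun t ht => (hf t ht.1.le ht.2).1,
    h.adm.cg.congr fun t ht => (hf t ht.1.le ht.2).2⟩, h.bd.imp fun K hK => hK.congr hf,
    fun t h0 ht => ⟨by rw [(hf t h0 ht).1, (h.eq t h0 ht).1, hΦ t h0 ht], ?_⟩⟩
  rw [(hf t h0 ht).2, (h.eq t h0 ht).2, Φ₂, Φ₂]
  congr 1
  refine (duh_congr h0 fun r hr0 hr => ?_).symm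
  have h0' := hr0.le
  have h1' := hr.trans ht
  rw [fG₁, fG₁, fG₂, fG₂, hU r h0' h1', hΦ r h0' h1', (hf r h0' h1').2]

lemma lit_Φ (E : Exps α β γ) {τ m K M : ℝ} {X : FDriv} {f₀ g₀ : FD} {f g : ℝ → FD}
    (hT : 0 ≤ T) (hτ0 : 0 ≤ τ) (hτ : τ ≤ T) (hm : 1 ≤ m) (hX : P.DrP α τ m 0 X X)
    (hcX : P.DrC α τ X) (hf : P.SB β γ τ K f g) (ha : P.Adm β τ f g) (hf0 : P.Bd (γ + 1) f₀ M)
    (hg0 : P.Bd (2 * γ + 1) g₀ M) : ∀ t ∈ Ioc 0 τ,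
      P.Lit (β + 1) (P.Φ₁ X f₀ f g t) ∧ P.Lit (2 * β + 1) (P.Φ₂ X f₀ g₀ f g t) := by
  obtain ⟨Q, hQ, hs⟩ := P.exists_srcBC E hT
  obtain ⟨s, c, -⟩ := hs τ m 0 K 0 M 0 X X f₀ f₀ f g f g hτ0 hτ hm hX hcX hcX hf hf
    (SB.sub_self f g) ha ha (.refl hf0)
  have hw1 := wR_lt_one E
  have hw0 := wR_nonneg E
  obtain ⟨h1, h2, h3, h4, h5⟩ := id E
  have hK := hf.nonneg hτ0
  have hM := hf0.nonneg
  have hm0 : 0 ≤ m := by linarith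
  have n1 : 0 ≤ Q * ((m + K) * m) := by positivity
  have n2 : 0 ≤ Q * (m + (m + K) * m ^ 2 + (m + K) ^ 2) := by positivity
  have n3 : 0 ≤ Q * ((M + (m + K) * m) * m) := by positivity
  have c1 := (cb_heat (a := β + 1 + (α - β) / 2) hτ0 hf0 (by linarith)).add
      (cb_duh hT (by linarith) (by linarith) (by linarith) n1 hτ0 hτ c.F
        fun t h0 ht => (s.F t h0 ht).left)
  have c2 := (cb_heat (a := 2 * β + 1 + (α - β) / 2) hτ0 hg0 (by linarith)).add
      ((cb_duh hT (by linarith) (by linarith) (by linarith) n2 hτ0 hτ c.G₁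
        fun t h0 ht => (s.G₁ t h0 ht).left).add
      (cb_duh hT hw0 hw1 (by linarith) n3 hτ0 hτ c.G₂ fun t h0 ht => (s.G₂ t h0 ht).left))
  intro t ht
  obtain ⟨L1, b1⟩ := c1.bd t ht
  obtain ⟨L2, b2⟩ := c2.bd t ht
  refine ⟨b1.lit (by linarith), ?_⟩
  rw [c.Φ₂_eq ht.1.le ht.2]
  exact b2.lit (by linarith)

lemma IsDriving.exists_drP (E : Exps α β γ) {X : DrivingTerm} (hX : P.IsDriving α T X) :
    ∃ m, 1 ≤ m ∧ P.DrP α T m 0 X.coefs X.coefs := by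
  have h := drP_zero_of_le (m := 1 + (P.drivingNorm α T X).toReal) (by linarith [E.hβ, E.hβα]) E.hα
    (by have : 0 ≤ (P.drivingNorm α T X).toReal := ENNReal.toReal_nonneg
        positivity)
    ((ENNReal.ofReal_toReal hX.norm_lt_top.ne).symm.le.trans
      (ENNReal.ofReal_le_ofReal (le_add_of_nonneg_left zero_le_one)))
  have : 0 ≤ (P.drivingNorm α T X).toReal := ENNReal.toReal_nonneg
  exact ⟨_, by linarith, h.self⟩

lemma DrP.fourier_rhsF (E : Exps α β γ) {τ m : ℝ} {X : DrivingTerm} {f g : ℝ → TDist}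
    (hP : P.DrP α τ m 0 X.coefs X.coefs) (hC : P.DrC α τ X.coefs) (hA : P.Adm β τ (𝔉 f) (𝔉 g))
    (t : ℝ) (h0 : 0 < t) (ht : t ≤ τ) :
    fourier (P.rhsF X f g t) = P.fF X.coefs (𝔉 f) (𝔉 g) t := by
  obtain ⟨L, hL⟩ := (hA.cb_u (E := E) hC).bd t ⟨h0, ht⟩
  exact _root_.ParaKPZ.DyadicPartition.fourier_rhsF hL (hP.XI t ⟨h0.le, ht⟩).left

/-- Distributional solutions are mild solutions. -/
lemma IsSolution.fsol (E : Exps α β γ) {τ : ℝ} {X : DrivingTerm} {f₀ g₀ : TDist}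
    {f g : ℝ → TDist} (hT : 0 ≤ T) (hτ0 : 0 ≤ τ) (hτ : τ ≤ T) (hX : P.IsDriving α T X)
    (hf0 : P.MemC (γ + 1) f₀) (h : P.IsSolution α β γ τ X f₀ g₀ f g) :
    P.FSol β γ τ X.coefs (fourier f₀) (fourier g₀) (𝔉 f)
      (𝔉 g) := by
  obtain ⟨hD, rfl, rfl, -, hF, hG⟩ := h
  obtain ⟨K, hK⟩ := hD.exists_sb E
  obtain ⟨⟨⟨hcf, -⟩, hcf0, -⟩, ⟨hcg, -⟩, hcg0, -⟩ := hD
  have hA : P.Adm β τ (𝔉 f) (𝔉 g) :=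
    ⟨(contC_iff.1 hcf).1, (contC_iff.1 hcg).1⟩
  obtain ⟨m, hm, hP⟩ := hX.exists_drP E
  have hP := hP.mono_time hτ
  have hC := hX.drC.mono_time hτ
  obtain ⟨M, hM⟩ := hf0.exists_bd
  obtain ⟨Q, hQ, hs⟩ := P.exists_srcBC E hT
  obtain ⟨s, c, -⟩ := hs τ m 0 K 0 M 0 _ _ _ _ _ _ _ _ hτ0 hτ hm hP hC hC hK hK
    (SB.sub_self _ _) hA hA (.refl hM)
  have eF := hP.fourier_rhsF E hC hA
  have ef : ∀ t, 0 ≤ t → t ≤ τ → fourier (f t) = P.Φ₁ X.coefs (fourier (f 0))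
      (𝔉 f) (𝔉 g) t := fun t h0 ht => by
    rw [SolvesHeat.eq_duh hF (fun k => (contC_iff.1 hcf0).1.continuousOn_coef k)
      (fun k => (c.F k).congr fun r hr => congrFun (eF r hr.1 hr.2) k)
      (fun t h0 ht k => (c.iF t h0 ht k).congr fun r hr => ?_) h0 ht, Φ₁]
    · congr 1
      exact duh_congr h0 fun r hr0 hr => eF r hr0 (hr.trans ht)
    · rw [uIoc_of_le h0] at hr
      rw [eF r hr.1 (hr.2.trans ht)]
  have eG : ∀ t, 0 < t → t ≤ τ → fourier (P.rhsG α β X f g t)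
      = P.fG₁ X.coefs (𝔉 f) (𝔉 g) t
      + P.fG₂ X.coefs (P.Φ₁ X.coefs (fourier (f 0)) (𝔉 f)
        (𝔉 g)) (𝔉 f) (𝔉 g) t :=
      fun t h0 ht => by
    have hR := (s.R t h0 ht).left
    rw [← ef t h0.le ht] at hR
    rw [(fourier_rhsG E hX ⟨h0.le, ht.trans hτ⟩ ((contC_iff.1 hcf).2 t ⟨h0, ht⟩)
      ((contC_iff.1 hcg).2 t ⟨h0, ht⟩) hR).2, fG₂, fG₂, ef t h0.le ht]
  refine ⟨hA, ⟨K, hK⟩, fun t h0 ht => ⟨ef t h0 ht, ?_⟩⟩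
  rw [SolvesHeat.eq_duh hG (fun k => (contC_iff.1 hcg0).1.continuousOn_coef k)
    (fun k => ((c.G₁ k).add (c.G₂ k)).congr fun r hr => congrFun (eG r hr.1 hr.2) k)
    (fun t h0 ht k => ((c.iG₁ t h0 ht k).add (c.iG₂ t h0 ht k)).congr fun r hr => ?_) h0 ht, Φ₂]
  · congr 1
    exact duh_congr h0 fun r hr0 hr => eG r hr0 (hr.trans ht)
  · rw [uIoc_of_le h0] at hr
    rw [eG r hr.1 (hr.2.trans ht), Pi.add_apply, mul_add]

/-- Mild solutions are distributional solutions. -/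
lemma FSol.isSolution (E : Exps α β γ) {τ : ℝ} {X : DrivingTerm} {f₀ g₀ : TDist}
    {f g : ℝ → TDist} (hT : 0 ≤ T) (hτ0 : 0 ≤ τ) (hτ : τ ≤ T) (hX : P.IsDriving α T X)
    (hf0 : P.MemC (γ + 1) f₀) (hg0 : P.MemC (2 * γ + 1) g₀)
    (h : P.FSol β γ τ X.coefs (fourier f₀) (fourier g₀) (𝔉 f)
      (𝔉 g)) : P.IsSolution α β γ τ X f₀ g₀ f g := by
  obtain ⟨K, hK⟩ := h.bd
  have hK0 := hK.nonneg hτ0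
  have hA := h.adm
  obtain ⟨m, hm, hP⟩ := hX.exists_drP E
  have hP := hP.mono_time hτ
  have hC := hX.drC.mono_time hτ
  obtain ⟨M₁, hM₁⟩ := hf0.exists_bd
  obtain ⟨M₂, hM₂⟩ := hg0.exists_bd
  have hM := hM₁.mono (le_max_left M₁ M₂)
  have hM' := hM₂.mono (le_max_right M₁ M₂)
  obtain ⟨Q, hQ, hs⟩ := P.exists_srcBC E hT
  obtain ⟨s, c, -⟩ := hs τ m 0 K 0 _ 0 _ _ _ _ _ _ _ _ hτ0 hτ hm hP hC hC hK hK
    (SB.sub_self _ _) hA hA (.refl hM)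
  obtain ⟨-, -, cf, cg⟩ := adm_Φ E hT hτ0 hτ hm hP hC hK hA hM hM'
  have hl := lit_Φ E hT hτ0 hτ hm hP hC hK hA hM hM'
  have e0 : f 0 = f₀ := dist_ext (by rw [(h.eq 0 le_rfl hτ0).1]; simp [Φ₁, heat_zero, duh_zero])
  have e0' : g 0 = g₀ := dist_ext (by rw [(h.eq 0 le_rfl hτ0).2]; simp [Φ₂, heat_zero, duh_zero])
  have lf : ∀ t ∈ Ioc 0 τ, P.Lit (β + 1) (fourier (f t)) := fun t ht => by
    rw [(h.eq t ht.1.le ht.2).1]; exact (hl t ht).1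
  have lg : ∀ t ∈ Ioc 0 τ, P.Lit (2 * β + 1) (fourier (g t)) := fun t ht => by
    rw [(h.eq t ht.1.le ht.2).2]; exact (hl t ht).2
  have eF := hP.fourier_rhsF E hC hA
  have eG : ∀ t, 0 < t → t ≤ τ → P.ResConverges (P.remainder X f g t) (dx (X.XI t)) ∧
      fourier (P.rhsG α β X f g t)
      = P.fG₁ X.coefs (𝔉 f) (𝔉 g) t
      + P.fG₂ X.coefs (P.Φ₁ X.coefs (fourier f₀) (𝔉 f)
        (𝔉 g)) (𝔉 f) (𝔉 g) t :=
      fun t h0 ht => by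
    have hR := (s.R t h0 ht).left
    rw [← (h.eq t h0.le ht).1] at hR
    obtain ⟨r1, r2⟩ := fourier_rhsG E hX ⟨h0.le, ht.trans hτ⟩ (lf t ⟨h0, ht⟩) (lg t ⟨h0, ht⟩) hR
    refine ⟨r1, ?_⟩
    rw [r2, fG₂, fG₂, ← (h.eq t h0.le ht).1]
  obtain ⟨⟨a1, a2, a3⟩, b1, b2, b3⟩ := E.abs_le
  have hγβ := E.hγβ
  have i1 : β + 1 - 2 * ((β - γ) / 2) = γ + 1 := by ring
  have i2 : 2 * β + 1 - 2 * (β - γ) = 2 * γ + 1 := by ring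
  refine ⟨⟨memWL_of_wl a1 a2 a3 (by linarith) hK0 hK.wf hA.cf lf ?_ ?_,
    memWL_of_wl b1 b2 b3 (by linarith) hK0 hK.wg hA.cg lg ?_ ?_⟩, e0, e0',
    fun t ht => (eG t ht.1 ht.2).1, ?_, ?_⟩
  · rw [i1]; exact (cf (memC_iff.1 hf0)).congr fun t ht => (h.eq t ht.1 ht.2).1
  · rw [i1, e0]; exact memC_iff.1 hf0
  · rw [i2]; exact (cg (memC_iff.1 hg0)).congr fun t ht => (h.eq t ht.1 ht.2).2
  · rw [i2, e0']; exact memC_iff.1 hg0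
  · refine solvesHeat_of_eq_duh hA.cf ((cb_F E hC hA).congr fun t ht => eF t ht.1 ht.2)
      (fun t h0 ht k => (c.iF t h0 ht k).congr fun r hr => ?_) fun t h0 ht => ?_
    · rw [uIoc_of_le h0] at hr
      rw [eF r hr.1 (hr.2.trans ht)]
    · rw [(h.eq t h0 ht).1, e0, Φ₁]
      congr 1
      exact duh_congr h0 fun r hr0 hr => (eF r hr0 (hr.trans ht)).symm
  · have d1 := cb_G₁ E hC hA
    have d2 := cb_of_weighted (a := 2 * β + (α - 1) - 1) (by linarith) (wR_nonneg E) c.G₂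
      fun r h0 hr => (s.G₂ r h0 hr).left
    refine solvesHeat_of_eq_duh (b := min (α + β - 1) (2 * β + (α - 1) - 1)) hA.cg
      (((d1.exp_mono (min_le_left _ _)).add (d2.exp_mono (min_le_right _ _))).congr
        fun t ht => (eG t ht.1 ht.2).2)
      (fun t h0 ht k => ((c.iG₁ t h0 ht k).add (c.iG₂ t h0 ht k)).congr fun r hr => ?_)
      fun t h0 ht => ?_
    · rw [uIoc_of_le h0] at hr
      rw [(eG r hr.1 (hr.2.trans ht)).2, Pi.add_apply, mul_add]
    · rw [(h.eq t h0 ht).2, e0', Φ₂]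
      congr 1
      exact duh_congr h0 fun r hr0 hr => (eG r hr0 (hr.trans ht)).2.symm

end DyadicPartition

namespace DyadicPartition

variable {P : DyadicPartition} {α β γ T : ℝ}

/-! ### The local existence time -/

lemma one_le_dataSize (X : DrivingTerm) (f₀ g₀ : TDist) : 1 ≤ P.dataSize α γ T X f₀ g₀ := by
  have h1 : 0 ≤ (P.cnorm (γ + 1) f₀).toReal := ENNReal.toReal_nonneg
  have h2 : 0 ≤ (P.cnorm (2 * γ + 1) g₀).toReal := ENNReal.toReal_nonneg
  have h3 : 0 ≤ (P.drivingNorm α T X).toReal ^ 3 := pow_nonneg ENNReal.toReal_nonneg 3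
  rw [dataSize]; linarith

lemma localTime_spec (hβα : β < α) (hT : 0 < T) {c : ℝ} (hc : 0 < c) (X : DrivingTerm)
    (f₀ g₀ : TDist) {τ : ℝ}
    (hτ : τ = P.localTime ((c / 2048) ^ (2 / (α - β))) α β γ T X f₀ g₀) :
    0 < τ ∧ τ ≤ T ∧ τ ^ ((α - β) / 2) * (2048 * P.dataSize α γ T X f₀ g₀) ≤ c := by
  have hD := one_le_dataSize (P := P) (α := α) (γ := γ) (T := T) X f₀ g₀
  set D := P.dataSize α γ T X f₀ g₀ with hDdef
  have hab : 0 < α - β := by linarith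
  have hp : 0 < (c / 2048) ^ (2 / (α - β)) * D ^ (-(2 / (α - β))) := by positivity
  have hτ0 : 0 < τ := by rw [hτ, localTime]; exact lt_min hp hT
  refine ⟨hτ0, by rw [hτ, localTime]; exact min_le_right _ _, ?_⟩
  have h1 : τ ^ ((α - β) / 2) ≤ c / 2048 * D⁻¹ := by
    have hle : τ ≤ (c / 2048) ^ (2 / (α - β)) * D ^ (-(2 / (α - β))) := by
      rw [hτ, localTime]; exact min_le_left _ _
    refine (Real.rpow_le_rpow hτ0.le hle (by positivity)).trans (le_of_eq ?_)
    rw [Real.mul_rpow (by positivity) (by positivity), ← Real.rpow_mul (by positivity),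
      ← Real.rpow_mul (by positivity), show 2 / (α - β) * ((α - β) / 2) = 1 by field_simp,
      show -(2 / (α - β)) * ((α - β) / 2) = -1 by field_simp, Real.rpow_one, Real.rpow_neg_one]
  calc _ ≤ c / 2048 * D⁻¹ * (2048 * D) := by gcongr
    _ = c := by field_simp

lemma cube_le_dataSize (X : DrivingTerm) (f₀ g₀ : TDist) :
    (4 * (2 * (1 + (P.drivingNorm α T X).toReal))) ^ 3 ≤ 2048 * P.dataSize α γ T X f₀ g₀ := by
  have h1 : 0 ≤ (P.cnorm (γ + 1) f₀).toReal := ENNReal.toReal_nonneg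
  have h2 : 0 ≤ (P.cnorm (2 * γ + 1) g₀).toReal := ENNReal.toReal_nonneg
  have h3 : 0 ≤ (P.drivingNorm α T X).toReal := ENNReal.toReal_nonneg
  rw [dataSize]
  nlinarith [mul_nonneg h3 (sq_nonneg ((P.drivingNorm α T X).toReal - 1)),
    sq_nonneg ((P.drivingNorm α T X).toReal - 1)]

lemma bd_initial (E : Exps α β γ) (X : DrivingTerm) {f₀ g₀ : TDist} (hf : P.MemC (γ + 1) f₀)
    (hg : P.MemC (2 * γ + 1) g₀) :
    P.Bd (γ + 1) (fourier f₀) (2048 * P.dataSize α γ T X f₀ g₀) ∧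
      P.Bd (2 * γ + 1) (fourier g₀) (2048 * P.dataSize α γ T X f₀ g₀) := by
  obtain ⟨h1, h2, h3, h4, h5⟩ := E
  have x1 : 0 ≤ (P.cnorm (γ + 1) f₀).toReal := ENNReal.toReal_nonneg
  have x2 : 0 ≤ (P.cnorm (2 * γ + 1) g₀).toReal := ENNReal.toReal_nonneg
  have x3 : 0 ≤ (P.drivingNorm α T X).toReal ^ 3 := pow_nonneg ENNReal.toReal_nonneg 3
  obtain ⟨K, hK⟩ := hf.exists_bd
  obtain ⟨L, hL⟩ := hg.exists_bd
  refine ⟨(bd_of_cnorm_le (abs_le.2 ⟨by linarith, by linarith⟩) x1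
    (ENNReal.ofReal_toReal (cnorm_lt_top hK).ne).symm.le).mono ?_,
    (bd_of_cnorm_le (abs_le.2 ⟨by linarith, by linarith⟩) x2
    (ENNReal.ofReal_toReal (cnorm_lt_top hL).ne).symm.le).mono ?_⟩ <;> rw [dataSize] <;> linarith

lemma IsDriving.drP_self (E : Exps α β γ) {X : DrivingTerm} (hX : P.IsDriving α T X) :
    P.DrP α T (4 * (2 * (1 + (P.drivingNorm α T X).toReal))) 0 X.coefs X.coefs := by
  have h3 : 0 ≤ (P.drivingNorm α T X).toReal := ENNReal.toReal_nonneg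
  exact (drP_zero_of_le (by linarith [E.hβ, E.hβα]) E.hα (by positivity)
    ((ENNReal.ofReal_toReal hX.norm_lt_top.ne).symm.le.trans
      (ENNReal.ofReal_le_ofReal (by linarith)))).self

lemma four_mul_le {N : ℝ} (hN : 0 ≤ N) : 1 ≤ 4 * (2 * (1 + N)) := by linarith

lemma tendsto_ofReal_modulus {x y e : ℝ → ℝ≥0∞} (C m : ℝ) (hx : Tendsto x (𝓝[>] 0) (𝓝 0))
    (hy : Tendsto y (𝓝[>] 0) (𝓝 0)) (he : Tendsto e (𝓝[>] 0) (𝓝 0)) :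
    Tendsto (fun ε : ℝ => ENNReal.ofReal (24 * (C * (4 * (x ε).toReal + 4 * (y ε).toReal
      + m * (4 * (e ε).toReal)) + ε))) (𝓝[>] 0) (𝓝 0) := by
  have t : ∀ {z : ℝ → ℝ≥0∞}, Tendsto z (𝓝[>] 0) (𝓝 0) →
      Tendsto (fun ε => (z ε).toReal) (𝓝[>] 0) (𝓝 0) := fun hz =>
    (ENNReal.tendsto_toReal ENNReal.zero_ne_top).comp hz
  have hid : Tendsto (fun ε : ℝ => ε) (𝓝[>] 0) (𝓝 0) := nhdsWithin_le_nhds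
  have := ((((((t hx).const_mul 4).add ((t hy).const_mul 4)).add
    (((t he).const_mul 4).const_mul m)).const_mul C).add hid).const_mul 24
  simpa using ENNReal.tendsto_ofReal this

end DyadicPartition

end ParaKPZ

end

theorem theorem3 (P : DyadicPartition) (α β γ T : ℝ) (hβ : 1 / 3 < β) (hβα : β < α)
    (hα : α < 1 / 2) (hγ : -β < γ) (hγβ : γ ≤ β) (hT : 0 < T) :
    ∃ C₁ C₂ : ℝ, 0 < C₁ ∧ 0 < C₂ ∧
      ∀ (f₀ g₀ : TDist) (X : DrivingTerm),
        P.MemC (γ + 1) f₀ → P.MemC (2 * γ + 1) g₀ → P.IsDriving α T X →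
        -- existence on `[0, T_*]`, with the bound
        (∃ f g : ℝ → TDist,
          P.IsSolution α β γ (P.localTime C₂ α β γ T X f₀ g₀) X f₀ g₀ f g ∧
          P.dNorm β γ (P.localTime C₂ α β γ T X f₀ g₀) f g
            ≤ ENNReal.ofReal (C₁ * P.dataSize α γ T X f₀ g₀)) ∧
        -- uniqueness on `[0, T_*]`
        (∀ f g f' g' : ℝ → TDist,
          P.IsSolution α β γ (P.localTime C₂ α β γ T X f₀ g₀) X f₀ g₀ f g →
          P.IsSolution α β γ (P.localTime C₂ α β γ T X f₀ g₀) X f₀ g₀ f' g' →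
          ∀ t ∈ Set.Icc 0 (P.localTime C₂ α β γ T X f₀ g₀), f t = f' t ∧ g t = g' t) ∧
        -- continuous dependence on the initial value and the driving term
        (∀ (f₀' g₀' : ℝ → TDist) (X' : ℝ → DrivingTerm),
          (∀ ε : ℝ, 0 < ε → P.MemC (γ + 1) (f₀' ε) ∧ P.MemC (2 * γ + 1) (g₀' ε) ∧
            P.IsDriving α T (X' ε)) →
          Filter.Tendsto (fun ε => P.cnorm (γ + 1) (f₀' ε - f₀)) (𝓝[>] 0) (𝓝 0) →
          Filter.Tendsto (fun ε => P.cnorm (2 * γ + 1) (g₀' ε - g₀)) (𝓝[>] 0) (𝓝 0) →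
          Filter.Tendsto (fun ε => P.drivingNorm α T ((X' ε).diff X)) (𝓝[>] 0) (𝓝 0) →
          ∀ (f g : ℝ → TDist) (f' g' : ℝ → ℝ → TDist),
            P.IsSolution α β γ (P.localTime C₂ α β γ T X f₀ g₀) X f₀ g₀ f g →
            (∀ ε : ℝ, 0 < ε →
              P.IsSolution α β γ (P.localTime C₂ α β γ T (X' ε) (f₀' ε) (g₀' ε))
                (X' ε) (f₀' ε) (g₀' ε) (f' ε) (g' ε)) →
            Filter.Tendsto (fun ε => P.dNorm β γ
              (min (P.localTime C₂ α β γ T (X' ε) (f₀' ε) (g₀' ε))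
                (P.localTime C₂ α β γ T X f₀ g₀))
              (f' ε - f) (g' ε - g)) (𝓝[>] 0) (𝓝 0)) := by
  have E : Exps α β γ := ⟨hβ, hβα, hα, hγ, hγβ⟩
  obtain ⟨A, c₁, hA, hc₁, hex⟩ := P.exists_fsol E hT.le
  obtain ⟨C, c₂, hC, hc₂, hdf⟩ := P.exists_fsol_diff E hT.le A hA.le
  have hc : 0 < min c₁ c₂ := lt_min hc₁ hc₂
  refine ⟨24 * (A * 2048), (min c₁ c₂ / 2048) ^ (2 / (α - β)), by positivity, by positivity,
    fun f₀ g₀ X hf₀ hg₀ hX => ?_⟩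
  have hmain : ∀ (f₀ g₀ : TDist) (X : DrivingTerm) (τ : ℝ), P.MemC (γ + 1) f₀ →
      P.MemC (2 * γ + 1) g₀ → P.IsDriving α T X →
      τ = P.localTime ((min c₁ c₂ / 2048) ^ (2 / (α - β))) α β γ T X f₀ g₀ →
      (∃ f g, P.FSol β γ τ X.coefs (fourier f₀) (fourier g₀) f g ∧
        P.SB β γ τ (A * (2048 * P.dataSize α γ T X f₀ g₀)) f g) ∧
      ∀ f g f' g', P.FSol β γ τ X.coefs (fourier f₀) (fourier g₀) f g →
        P.FSol β γ τ X.coefs (fourier f₀) (fourier g₀) f' g' →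
        ∀ t, 0 ≤ t → t ≤ τ → f t = f' t ∧ g t = g' t := by
    intro f₀ g₀ X τ hf₀ hg₀ hX hτ
    obtain ⟨t1, t2, t3⟩ := DyadicPartition.localTime_spec hβα hT hc X f₀ g₀ hτ
    obtain ⟨b1, b2⟩ := DyadicPartition.bd_initial (T := T) E X hf₀ hg₀
    have hm := DyadicPartition.four_mul_le (ENNReal.toReal_nonneg (a := P.drivingNorm α T X))
    have hP := (hX.drP_self E).mono_time t2
    have hC := hX.drC.mono_time t2
    exact ⟨hex τ _ _ X.coefs _ _ t1.le t2 hm (DyadicPartition.cube_le_dataSize X f₀ g₀)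
      (t3.trans (min_le_left _ _)) hP hC b1 b2,
      fun f g f' g' h h' => h.unique E hT.le t1.le t2 hm hP hC h' b1 b2⟩
  have hsol : ∀ (f₀ g₀ : TDist) (X : DrivingTerm) (τ : ℝ), P.MemC (γ + 1) f₀ →
      P.MemC (2 * γ + 1) g₀ → P.IsDriving α T X →
      τ = P.localTime ((min c₁ c₂ / 2048) ^ (2 / (α - β))) α β γ T X f₀ g₀ →
      ∀ f g, P.IsSolution α β γ τ X f₀ g₀ f g →
        P.FSol β γ τ X.coefs (fourier f₀) (fourier g₀) (𝔉 f) (𝔉 g) ∧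
        P.SB β γ τ (A * (2048 * P.dataSize α γ T X f₀ g₀)) (𝔉 f) (𝔉 g) := by
    intro f₀ g₀ X τ hf₀ hg₀ hX hτ f g h
    obtain ⟨t1, t2, -⟩ := DyadicPartition.localTime_spec hβα hT hc X f₀ g₀ hτ
    have h1 := h.fsol E hT.le t1.le t2 hX hf₀
    obtain ⟨⟨f', g', h2, h3⟩, hu⟩ := hmain f₀ g₀ X τ hf₀ hg₀ hX hτ
    exact ⟨h1, h3.congr (hu _ _ _ _ h1 h2)⟩
  obtain ⟨τ, hτ⟩ : ∃ τ, τ = P.localTime ((min c₁ c₂ / 2048) ^ (2 / (α - β))) α β γ T X f₀ g₀ :=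
    ⟨_, rfl⟩
  have hD := DyadicPartition.one_le_dataSize (P := P) (α := α) (γ := γ) (T := T) X f₀ g₀
  obtain ⟨t1, t2, t3⟩ := DyadicPartition.localTime_spec hβα hT hc X f₀ g₀ hτ
  rw [← hτ]
  refine ⟨?_, fun f g f' g' h h' t ht => ?_, fun f₀' g₀' X' hdata hlf hlg hlX f g f' g' h h' => ?_⟩
  · obtain ⟨f, g, h, hs⟩ := (hmain f₀ g₀ X τ hf₀ hg₀ hX hτ).1
    have e : ∀ t, 0 ≤ t → t ≤ τ → fourier (toDist (f t)) = f t ∧ fourier (toDist (g t)) = g t :=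
      fun t h0 ht => ⟨fourier_toDist (hs.wf.low t h0 ht).slow,
        fourier_toDist (hs.wg.low t h0 ht).slow⟩
    refine ⟨fun t => toDist (f t), fun t => toDist (g t),
      (h.congr e).isSolution E hT.le t1.le t2 hX hf₀ hg₀,
      ((hs.congr e).dNorm_le E (by positivity)).trans (ENNReal.ofReal_le_ofReal (le_of_eq (by ring)))⟩
  · obtain ⟨e1, e2⟩ := (hmain f₀ g₀ X τ hf₀ hg₀ hX hτ).2 _ _ _ _ (hsol f₀ g₀ X τ hf₀ hg₀ hX hτ f g h).1
      (hsol f₀ g₀ X τ hf₀ hg₀ hX hτ f' g' h').1 t ht.1 ht.2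
    exact ⟨dist_ext e1, dist_ext e2⟩
  · refine tendsto_of_tendsto_of_tendsto_of_le_of_le' tendsto_const_nhds
      (DyadicPartition.tendsto_ofReal_modulus C (4 * (2 * (1 + (P.drivingNorm α T X).toReal)))
        hlf hlg hlX) (Eventually.of_forall fun _ => zero_le) ?_
    filter_upwards [self_mem_nhdsWithin, hlf.eventually (gt_mem_nhds ENNReal.zero_lt_top),
      hlg.eventually (gt_mem_nhds ENNReal.zero_lt_top),
      hlX.eventually (ge_mem_nhds one_pos)] with ε hε hxf hxg hxX
    have hε : 0 < ε := hε
    obtain ⟨hf', hg', hX'⟩ := hdata ε hε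
    obtain ⟨τ', hτ'⟩ : ∃ τ', τ' = P.localTime ((min c₁ c₂ / 2048) ^ (2 / (α - β))) α β γ T (X' ε)
      (f₀' ε) (g₀' ε) := ⟨_, rfl⟩
    have h'ε := h' ε hε
    rw [← hτ'] at h'ε ⊢
    have hD' := DyadicPartition.one_le_dataSize (P := P) (α := α) (γ := γ) (T := T) (X' ε) (f₀' ε)
      (g₀' ε)
    have hcube := DyadicPartition.cube_le_dataSize (P := P) (α := α) (γ := γ) (T := T) X f₀ g₀
    obtain ⟨b1, b2⟩ := DyadicPartition.bd_initial (T := T) E X hf₀ hg₀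
    obtain ⟨b1', b2'⟩ := DyadicPartition.bd_initial (T := T) E (X' ε) hf' hg'
    obtain ⟨t1', t2', t3'⟩ := DyadicPartition.localTime_spec hβα hT hc (X' ε) (f₀' ε) (g₀' ε) hτ'
    obtain ⟨s1, s2⟩ := hsol f₀ g₀ X τ hf₀ hg₀ hX hτ f g h
    obtain ⟨s1', s2'⟩ := hsol _ _ _ τ' hf' hg' hX' hτ' _ _ h'ε
    set D := P.dataSize α γ T X f₀ g₀
    set D' := P.dataSize α γ T (X' ε) (f₀' ε) (g₀' ε)
    set N := (P.drivingNorm α T X).toReal with hN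
    have hN0 : 0 ≤ N := ENNReal.toReal_nonneg
    have m1 : D ≤ max D' D := le_max_right _ _
    have m2 : D' ≤ max D' D := le_max_left _ _
    have hσ0 : 0 < min τ' τ := lt_min t1' t1
    have hκ : 0 ≤ (α - β) / 2 := by linarith
    have hsmall : min τ' τ ^ ((α - β) / 2) * (2048 * max D' D) ≤ c₂ := by
      rcases max_cases D' D with ⟨h, -⟩ | ⟨h, -⟩ <;> rw [h]
      · exact le_trans (mul_le_mul_of_nonneg_right
          (Real.rpow_le_rpow hσ0.le (min_le_left _ _) hκ) (by positivity))
          (t3'.trans (min_le_right _ _))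
      · exact le_trans (mul_le_mul_of_nonneg_right
          (Real.rpow_le_rpow hσ0.le (min_le_right _ _) hκ) (by positivity))
          (t3.trans (min_le_right _ _))
    have hxX' := (hxX.trans_lt ENNReal.one_lt_top).ne
    set e := (P.drivingNorm α T ((X' ε).diff X)).toReal with he
    have he0 : 0 ≤ e := ENNReal.toReal_nonneg
    have he1 : e ≤ 1 := by
      have := (ENNReal.toReal_le_toReal hxX' ENNReal.one_ne_top).2 hxX
      rwa [ENNReal.toReal_one] at this
    have hP := DyadicPartition.drP_of_le (X := X) (X' := X' ε) (m := 2 * (1 + N) - e)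
      (by linarith) hα (by linarith) he0
      ((ENNReal.ofReal_toReal hX.norm_lt_top.ne).symm.le.trans
        (ENNReal.ofReal_le_ofReal (by rw [← hN]; linarith)))
      (ENNReal.ofReal_toReal hxX').symm.le
    rw [show 4 * (2 * (1 + N) - e) + 4 * e = 4 * (2 * (1 + N)) by ring] at hP
    have hσT : min τ' τ ≤ T := (min_le_right _ _).trans t2
    have d1 := DyadicPartition.bd_of_cnorm_le (abs_le.2 ⟨by linarith, by linarith⟩)
      ENNReal.toReal_nonneg (ENNReal.ofReal_toReal hxf.ne).symm.le
    have d2 := DyadicPartition.bd_of_cnorm_le (abs_le.2 ⟨by linarith, by linarith⟩)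
      ENNReal.toReal_nonneg (ENNReal.ofReal_toReal hxg.ne).symm.le
    set x := (P.cnorm (γ + 1) (f₀' ε - f₀)).toReal
    set y := (P.cnorm (2 * γ + 1) (g₀' ε - g₀)).toReal
    have hx0 : 0 ≤ x := ENNReal.toReal_nonneg
    have hy0 : 0 ≤ y := ENNReal.toReal_nonneg
    have hfin := hdf (min τ' τ) (4 * (2 * (1 + N))) (2048 * max D' D) (4 * e) (4 * x + 4 * y)
      (X' ε).coefs X.coefs _ _ _ _ _ _ _ _ hσ0.le hσT (DyadicPartition.four_mul_le hN0)
      (hcube.trans (by linarith)) hsmall (hP.mono_time hσT) (hX'.drC.mono_time hσT)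
      (hX.drC.mono_time hσT)
      ⟨b1'.mono (by linarith), b1.mono (by linarith), d1.mono (by linarith)⟩
      ⟨b2'.mono (by linarith), b2.mono (by linarith), d2.mono (by linarith)⟩
      (s1'.mono (min_le_left _ _)) (s1.mono (min_le_right _ _))
      ((s2'.time_mono (min_le_left _ _)).mono (by gcongr))
      ((s2.time_mono (min_le_right _ _)).mono (by gcongr)) ε hε
    have hK0 : 0 ≤ C * (4 * x + 4 * y + 4 * (2 * (1 + N)) * (4 * e)) + ε := by
      clear_value x y e N
      exact add_nonneg (mul_nonneg hC (by positivity)) hε.le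
    clear_value x y e N
    have hfin' : P.SB β γ (min τ' τ) (C * (4 * x + 4 * y + 4 * (2 * (1 + N)) * (4 * e)) + ε)
        (fun t => fourier ((f' ε - f) t)) (fun t => fourier ((g' ε - g) t)) :=
      hfin.congr fun t _ _ => ⟨fourier_sub _ _, fourier_sub _ _⟩
    have hres := hfin'.dNorm_le E hK0
    exact hres
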